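/- Let $n\ge 3$, $\gamma>0$ and let $\nu\in\mathbb R^n$ be a unit vector. Write $D=-i\partial_w$, $\Delta=D\cdot D$, $\langle w\rangle=(1+|w|^2)^{1/2}$, and let $a\cdot b=\sum_j a_jb_j$ also for complex vectors. Identify $\mathbb R^{n-1}$ with $\{x\in\mathbb R^n: x\cdot\nu=0\}$ and $\mathbb C^{n-1}$ with $\{\zeta\in\mathbb C^n:\zeta\cdot\nu=0\}$. For a real weight $W$ on $\mathbb R^n$ let $e^{W}L^2=L^2(\mathbb R^n;e^{-2W(w)}\,dw)$ and let $e^{W}H^2$ be the space of $u\in e^{W}L^2$ with weak derivatives $D^\alpha u\in e^{W}L^2$ for $|\alpha|\le 2$, normed by the $e^WL^2$ norms of these derivatives. For $\rho=z\nu+\rho_\perp$ with $z\in\mathbb C\setminus\mathbb R$ and $\rho_\perp\in\mathbb R^{n-1}\setminus\{0\}$ let $G_0(\rho)=\mathcal F^{-1}(|\xi|^2+2\rho\cdot\xi)^{-1}\mathcal F$ be the Fourier multiplier which inverts $\Delta+2\rho\cdot D$ (the inverse Fourier transform being taken in the sense of tempered distributions). (1) There are an open set $U\subset\mathbb C^{n-1}$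 containing $\mathbb R^{n-1}\setminus\{0\}$ and a family of bounded operators $$\mathcal G_0(z,\rho_\perp):e^{-\gamma\langle w\rangle}L^2(\mathbb R^n)\to e^{\gamma\langle w\rangle}H^2(\mathbb R^n),\qquad (z,\rho_\perp)\in(\mathbb C\setminus\mathbb R)\times U,$$ which is (jointly) complex-analytic on $(\mathbb C\setminus\mathbb R)\times U$ in the operator norm, and such that $\mathcal G_0(z,\rho_\perp)=G_0(z\nu+\rho_\perp)$ on $e^{-\gamma\langle w\rangle}L^2$ for all $z\in\mathbb C\setminus\mathbb R$ and $\rho_\perp\in\mathbb R^{n-1}\setminus\{0\}$. (2) For $z\in\mathbb C\setminus\mathbb R$ and $\rho_\perp\in\mathbb R^{n-1}\setminus\{0\}$ the operator $G_0(z\nu+\rho_\perp)$ is bounded from $e^{-\gamma|w|}L^2$ to $e^{\gamma|w|}L^2$, and with values in the bounded operators between these spaces it is complex-analytic in $z$ (for fixed $\rho_\perp$) and real-analytic in $\rho_\perp$ (for fixed $z$). (3) As a bounded operator $e^{-\gamma|w|}L^2\to e^{\gamma|w|}L^2$, $G_0(\rho)\to 0$ in norm as $|\rho|\to\infty$, $\rho=z\nu+\rho_\perp$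 with $z\in\mathbb C\setminus\mathbb R$ and $\rho_\perp\in\mathbb R^{n-1}\setminus\{0\}$. -/

import Mathlib

open MeasureTheory
open scoped FourierTransform SchwartzMap ContDiff

noncomputable section

/-- `ℝⁿ` with its Euclidean norm and Lebesgue measure. -/
abbrev RSp (n : ℕ) := EuclideanSpace ℝ (Fin n)

/-- `ℂⁿ` with its Hermitian norm. -/
abbrev CSp (n : ℕ) := EuclideanSpace ℂ (Fin n)

/-- The inclusion `ℝⁿ ⊆ ℂⁿ`. -/
def toC {n : ℕ} (x : RSp n) : CSp n := WithLp.toLp 2 fun i => (x i : ℂ)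

/-- The complex bilinear (not Hermitian) dot product `ζ · η = ∑ ζᵢ ηᵢ` on `ℂⁿ`. -/
def cdot {n : ℕ} (ζ η : CSp n) : ℂ := ∑ i, ζ i * η i

/-! ### Exponentially weighted `L²` and Sobolev spaces -/

/-- The weight exponent `w ↦ γ ⟨w⟩`, where `⟨w⟩ = (1 + |w|²)^{1/2}`. -/
def bracketWeight (n : ℕ) (γ : ℝ) : C(RSp n, ℝ) where
  toFun w := γ * Real.sqrt (1 + ‖w‖ ^ 2)
  continuous_toFun := by fun_prop

/-- The weight exponent `w ↦ γ |w|`. -/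
def normWeight (n : ℕ) (γ : ℝ) : C(RSp n, ℝ) where
  toFun w := γ * ‖w‖
  continuous_toFun := by fun_prop

/-- The measure `e^{-2 W(w)} dw` on `ℝⁿ`. -/
def expMeasure {n : ℕ} (W : C(RSp n, ℝ)) : Measure (RSp n) :=
  volume.withDensity fun w => ENNReal.ofReal (Real.exp (-2 * W w))

/-- The space `e^{W} L²(ℝⁿ) = L²(ℝⁿ; e^{-2 W(w)} dw)` of complex valued functions. -/
abbrev ExpL2 {n : ℕ} (W : C(RSp n, ℝ)) := Lp ℂ 2 (expMeasure W)

/-- Elements of `e^{W} L²` are locally integrable for Lebesgue measure: they can be paired with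
continuous functions of compact support. -/
theorem ExpL2_integrable_mul {n : ℕ} {W : C(RSp n, ℝ)} (u : ExpL2 W) {g : RSp n → ℂ}
    (hg : Continuous g) (hc : HasCompactSupport g) :
    Integrable (fun x => u x * g x) (volume : Measure (RSp n)) := by
  have hd : Continuous fun w : RSp n => Real.toNNReal (Real.exp (-2 * W w)) := by fun_prop
  have hμ : expMeasure W
      = volume.withDensity fun w => ((Real.toNNReal (Real.exp (-2 * W w)) : NNReal) : ENNReal) :=
    rfl
  have : IsLocallyFiniteMeasure (expMeasure W) := by
    rw [hμ]
    exact IsLocallyFiniteMeasure.withDensity_coe hd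
  have hloc : LocallyIntegrable (u : RSp n → ℂ) (expMeasure W) :=
    (Lp.memLp u).locallyIntegrable (by norm_num)
  have hg' : Continuous fun x => ((Real.exp (2 * W x) : ℝ) : ℂ) * g x := by fun_prop
  have h := hloc.integrable_smul_right_of_hasCompactSupport hg'
    (HasCompactSupport.mul_left (f := fun x => ((Real.exp (2 * W x) : ℝ) : ℂ)) hc)
  refine ((integrable_withDensity_iff_integrable_smul hd.measurable).1 h).congr (Filter.Eventually.of_forall fun x => ?_)
  have e : ((Real.exp (-2 * W x) : ℝ) : ℂ) * ((Real.exp (2 * W x) : ℝ) : ℂ) = 1 := by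
    rw [← Complex.ofReal_mul, ← Real.exp_add]
    simp
  simp only [NNReal.smul_def, Real.coe_toNNReal _ (Real.exp_pos _).le, smul_eq_mul,
    Complex.real_smul]
  linear_combination (u x * g x) * e

/-- The classical iterated partial derivative `∂_{I 0} ⋯ ∂_{I (k-1)} φ` at `x`. -/
def partialDeriv {n : ℕ} (k : ℕ) (I : Fin k → Fin n) (φ : RSp n → ℂ) (x : RSp n) : ℂ :=
  iteratedFDeriv ℝ k φ x fun j => EuclideanSpace.single (I j) (1 : ℝ)

theorem continuous_partialDeriv {n k : ℕ} (I : Fin k → Fin n) {φ : RSp n → ℂ}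
    (hφ : ContDiff ℝ ∞ φ) : Continuous (partialDeriv k I φ) := by
  have h : Continuous (iteratedFDeriv ℝ k φ) :=
    hφ.continuous_iteratedFDeriv (by exact_mod_cast le_top)
  unfold partialDeriv
  fun_prop

theorem hasCompactSupport_partialDeriv {n k : ℕ} (I : Fin k → Fin n) {φ : RSp n → ℂ}
    (hφ : HasCompactSupport φ) : HasCompactSupport (partialDeriv k I φ) := by
  refine (hφ.iteratedFDeriv (𝕜 := ℝ) k).mono' ?_
  refine (Function.support_subset_iff'.2 fun x hx => ?_).trans subset_closure
  simp [partialDeriv, Function.notMem_support.1 hx]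

/-- Indices of the partial derivatives of order at most `m`: an order `k ≤ m` together with the
`k` coordinates in which one differentiates. -/
abbrev JetIndex (n m : ℕ) := Σ k : Fin (m + 1), (Fin (k : ℕ) → Fin n)

/-- The index of the function itself (the derivative of order `0`). -/
def jetZero (n m : ℕ) : JetIndex n m := ⟨0, Fin.elim0⟩

/-- The weighted Sobolev space `e^{W} H^m(ℝⁿ)`: the functions `u ∈ e^{W} L²` all of whose weak
derivatives of order at most `m` lie in `e^{W} L²`. An element is stored as the family of the
weak derivatives of `u` (which `u` determines), `u` itself being the entry at `jetZero`; the norm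
is the square root of the sum of the squared `e^{W} L²` norms of all entries. -/
def ExpSobolev {n : ℕ} (W : C(RSp n, ℝ)) (m : ℕ) :
    Submodule ℂ (PiLp 2 fun _ : JetIndex n m => ExpL2 W) where
  carrier := {v | ∀ (J : JetIndex n m) (φ : RSp n → ℂ), ContDiff ℝ ∞ φ → HasCompactSupport φ →
    ∫ x, v (jetZero n m) x * partialDeriv J.1 J.2 φ x = (-1) ^ (J.1 : ℕ) * ∫ x, v J x * φ x}
  zero_mem' := by
    intro J φ _ _
    have h0 : ∀ᵐ x ∂(volume : Measure (RSp n)), (0 : ExpL2 W) x = 0 :=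
      (withDensity_absolutelyContinuous' (by fun_prop)
        (Filter.Eventually.of_forall fun x => by simp [Real.exp_pos])).ae_le
        (Lp.coeFn_zero ℂ 2 (expMeasure W))
    have h1 : ∀ g : RSp n → ℂ, ∫ x, (0 : ExpL2 W) x * g x = 0 := fun g => by
      rw [integral_congr_ae (g := fun _ => (0 : ℂ)) (h0.mono fun x hx => by beta_reduce; rw [hx, zero_mul])]
      simp
    simp only [PiLp.zero_apply, h1, mul_zero]
  add_mem' := by
    intro u v hu hv J φ hφ hc
    have hadd : ∀ (K : JetIndex n m) {g : RSp n → ℂ}, Continuous g → HasCompactSupport g →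
        ∫ x, (u + v) K x * g x = (∫ x, u K x * g x) + ∫ x, v K x * g x := by
      intro K g hg hgc
      rw [← integral_add (ExpL2_integrable_mul (u K) hg hgc) (ExpL2_integrable_mul (v K) hg hgc)]
      have h : ∀ᵐ x ∂(volume : Measure (RSp n)), (u K + v K : ExpL2 W) x = u K x + v K x :=
        (withDensity_absolutelyContinuous' (by fun_prop)
          (Filter.Eventually.of_forall fun x => by simp [Real.exp_pos])).ae_le
          (Lp.coeFn_add (u K) (v K))
      refine integral_congr_ae (h.mono fun x hx => ?_)
      simp only [PiLp.add_apply, hx]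
      ring
    rw [hadd _ (continuous_partialDeriv _ hφ) (hasCompactSupport_partialDeriv _ hc),
      hadd _ hφ.continuous hc, hu J φ hφ hc, hv J φ hφ hc]
    ring
  smul_mem' := by
    intro c u hu J φ hφ hc
    have hsmul : ∀ (K : JetIndex n m) (g : RSp n → ℂ),
        ∫ x, (c • u) K x * g x = c * ∫ x, u K x * g x := by
      intro K g
      rw [← integral_const_mul]
      have h : ∀ᵐ x ∂(volume : Measure (RSp n)), (c • u K : ExpL2 W) x = c * u K x :=
        (withDensity_absolutelyContinuous' (by fun_prop)
          (Filter.Eventually.of_forall fun x => by simp [Real.exp_pos])).ae_le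
          (Lp.coeFn_smul c (u K))
      refine integral_congr_ae (h.mono fun x hx => ?_)
      simp only [PiLp.smul_apply, hx]
      ring
    rw [hsmul, hsmul, hu J φ hφ hc]
    ring

/-- The function `u ∈ e^{W} L²` underlying an element of `e^{W} H^m`. -/
def expSobolevFn {n m : ℕ} {W : C(RSp n, ℝ)} (v : ExpSobolev W m) : ExpL2 W :=
  v.1 (jetZero n m)

/-! ### The operator `G₀(ρ)` -/

/-- The symbol `|ξ|² + 2 ρ · ξ` of `P₀(ρ) = Δ + 2 ρ · D`, `D = -i∂`, `Δ = D · D`. -/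
def faddeevSymbol {n : ℕ} (ρ : CSp n) (ξ : RSp n) : ℂ :=
  ((‖ξ‖ ^ 2 : ℝ) : ℂ) + 2 * cdot ρ (toC ξ)

/-- `u = G₀(ρ) f`, where `G₀(ρ)` is the Fourier multiplier by `(|ξ|² + 2 ρ · ξ)⁻¹`: the function
`u` is the inverse Fourier transform, as a tempered distribution, of the product of
`(|ξ|² + 2 ρ · ξ)⁻¹` with the Fourier transform of `f`. With the Fourier transform
`𝓕 f ξ = ∫ e^{-2πi w·ξ} f w dw`, the operator `D` corresponds to multiplication by `2πξ`, hence
the argument `2πξ` of the symbol. Both integrals are required to converge absolutely. -/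
def IsFaddeevInverse {n : ℕ} (ρ : CSp n) (f u : RSp n → ℂ) : Prop :=
  ∀ φ : 𝓢(RSp n, ℂ),
    Integrable (fun w => u w * φ w) ∧
    Integrable (fun ξ => (faddeevSymbol ρ ((2 * Real.pi) • ξ))⁻¹ * 𝓕 f ξ * (𝓕⁻ φ) ξ) ∧
    ∫ w, u w * φ w = ∫ ξ, (faddeevSymbol ρ ((2 * Real.pi) • ξ))⁻¹ * 𝓕 f ξ * (𝓕⁻ φ) ξ

/-! ### The parameters `(z, ρ_⊥)` -/

/-- The real orthogonal complement `Span{ν}^⊥ ≅ ℝ^{n-1}`. -/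
abbrev PerpR {n : ℕ} (ν : RSp n) : Submodule ℝ (RSp n) := (Submodule.span ℝ {ν})ᗮ

/-- The complexification `{ζ ∈ ℂⁿ : ζ · ν = 0} ≅ ℂ^{n-1}` of `Span{ν}^⊥`. -/
def PerpC {n : ℕ} (ν : RSp n) : Submodule ℂ (CSp n) where
  carrier := {ζ | cdot ζ (toC ν) = 0}
  zero_mem' := by simp [cdot]
  add_mem' := by
    intro a b ha hb
    simp only [Set.mem_ofPred_eq, cdot, PiLp.add_apply, add_mul, Finset.sum_add_distrib] at *
    rw [ha, hb, add_zero]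
  smul_mem' := by
    intro c a ha
    simp only [Set.mem_ofPred_eq, cdot, PiLp.smul_apply, smul_eq_mul, mul_assoc,
      ← Finset.mul_sum] at *
    rw [ha, mul_zero]

/-- The inclusion of the real points, `ℝ^{n-1} ⊆ ℂ^{n-1}`. -/
def perpToC {n : ℕ} {ν : RSp n} (x : PerpR ν) : PerpC ν :=
  ⟨toC x.1, by
    have h : ∑ i, x.1 i * ν i = 0 := by
      have := Submodule.mem_orthogonal_singleton_iff_inner_right.1 x.2
      simpa [PiLp.inner_apply] using this
    change ∑ i, ((x.1 i : ℝ) : ℂ) * ((ν i : ℝ) : ℂ) = 0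
    exact_mod_cast h⟩

/-- The vector `ρ = z ν + ρ_⊥ ∈ ℂⁿ` for real `ρ_⊥`. -/
def rhoVec {n : ℕ} {ν : RSp n} (z : ℂ) (x : PerpR ν) : CSp n := z • toC ν + toC x.1

end

/-! Write `p(ζ) = ζ·ζ + 2ρ·ζ` for the symbol and `L = ρ_⊥·ρ_⊥`. Exponential weights buy holomorphy:
for `|Im ζ| < γ` the function `e^{iζ·w}` lies in `e^{γ⟨w⟩}L²` and pairs with `e^{-γ⟨w⟩}L²`, so the
rank one operators `modeOp γ ζ : f ↦ f̂(ζ) e^{iζ·w}` depend holomorphically on `ζ` in this tube. The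
resolvent is a multiple of the integral of `p⁻¹ modeOp` over real frequencies, and the contour may
be deformed inside the tube.

Convergence at infinity is obtained by subtraction. With the elliptic reference symbol `p₁ = ζ·ζ +
2γ² + 1` and `q = 1 - p/p₁ = O(1/|ζ|)`, the finite geometric identity `1/p = p₁⁻¹ ∑_{k<N} q^k +
q^N/p` splits off bounded `L²` multipliers which are polynomial in `ρ` (`neumannOp`). The remainder
`q^N/p` decays as fast as desired, even after two derivatives, and only it needs contours.

In the coordinates `ζ = tν + By - ρ_⊥` the symbol is `t² + 2zt + |y|² - L`. For real `ρ_⊥` it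
vanishes exactly on `t = 0, |y| = |ρ_⊥|`, of codimension two, where `1/p` is integrable. This set
moves with `ρ_⊥`, so the integrand cannot be continued as it stands. Inside the sphere both roots in
`t` lie on the side opposite to `Im z`; after scaling `y` by `√L` the line of integration in `t` is
moved by `iγ/4` towards the side of `Im z`, and the symbol stays away from zero also for complex `L`
(`inner_symbol_lower`). Outside the sphere the roots are on both sides and no such shift is
possible; instead the radial substitution `By ↦ √(L + |y|² - 1) By/|y|` turns the symbol into `t² +
2zt + |y|² - 1`, which no longer contains `ρ_⊥`. Its singularity is now fixed and integrable, and
`Im √(L + |y|² - 1)` is bounded by `√|Im L|` uniformly in `y`, so the contour remains in the tube.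
Both pieces are dominated integrals of holomorphic functions (`analyticOnNhd_integral`, resting on
Osgood's lemma), and at real `ρ_⊥` they give back the original integral
(`integral_lineFun_eq_contourOp`). Parts (1) and (2) follow, since `|w|` and `⟨w⟩` differ by at most
1.

For (3), duality and density reduce the norm to `∫ p⁻¹ f̂ φ̌` with test functions `f, φ`. For fixed
`y` the `t`-integral is pushed to the lines `Im t = ±γ/2`, with partial fractions when the roots are
on different sides. This gains `1/|Q|` or `1/|Im z|`, where `Q² = z² - (|y|² - |ρ_⊥|²)`
(`norm_integral_div_symbol_le`). If `|Im z|` is comparable to `|ρ|`, this is enough. Otherwise `|Q|²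
≥ |R² - |y|²|` with `R` comparable to `|ρ|`, and the singular weight `|R² - |y|²|^{-1/2}` is traded
for `R^{-1/2}` and one derivative in `L¹` (`exists_lintegral_sphere_kernel_le`). Plancherel bounds
the function and its derivative by the weighted norms, so `‖G₀(ρ)‖ = O(|ρ|^{-1/2})`. -/

noncomputable section

/-! ### Cauchy's formula on a torus and Osgood's lemma. -/

-- Induction on the number of variables: on each slice the inner torus integral is the induction
-- hypothesis, and the remaining circle integral is the one-variable Cauchy formula. Joint
-- continuity is what makes the torus integral an iterated one.
open Metric in
theorem torusIntegral_cauchy {F : Type*} [NormedAddCommGroup F] [NormedSpace ℂ F]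
    [CompleteSpace F] {R : ℝ} (hR : 0 < R) : ∀ (d : ℕ) (f : (Fin d → ℂ) → F) (c w : Fin d → ℂ),
    w ∈ ball c R → ContinuousOn f (closedBall c R) →
    (∀ x ∈ closedBall c R, ∀ i,
      DifferentiableOn ℂ (fun t => f (Function.update x i t)) (closedBall (c i) R)) →
    (∯ x in T(c, fun _ => R), (∏ i, (x i - w i)⁻¹) • f x) = (2 * Real.pi * Complex.I) ^ d • f w := by
  intro d
  induction d with
  | zero =>
    intro f c w _ _ _
    rw [torusIntegral_dim0]
    simp [Subsingleton.elim c w]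
  | succ d ih =>
    intro f c w hw hf hd
    have hw' : ∀ i, w i ∈ ball (c i) R := fun i => (ball_pi c hR ▸ hw : w ∈ Set.pi Set.univ _) i trivial
    have hmem : ∀ x ∈ sphere (c 0) R, ∀ y ∈ closedBall (c ∘ Fin.succ) R,
        (Fin.cons x y : Fin (d + 1) → ℂ) ∈ closedBall c R := by
      intro x hx y hy
      rw [closedBall_pi _ hR.le] at hy ⊢
      intro i _
      refine Fin.cases ?_ (fun j => ?_) i
      · simpa using (sphere_subset_closedBall hx)
      · simpa using hy j trivial
    have hint : TorusIntegrable (fun x => (∏ i, (x i - w i)⁻¹) • f x) c (fun _ => R) := by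
      refine ContinuousOn.integrableOn_compact isCompact_Icc ?_
      have hmap : ∀ θ, torusMap c (fun _ => R) θ ∈ closedBall c R := by
        intro θ
        rw [closedBall_pi _ hR.le]
        intro i _
        simp [torusMap, dist_eq_norm, abs_of_pos hR]
      have hcont : Continuous (torusMap c (fun _ => R)) := by unfold torusMap; fun_prop
      refine ContinuousOn.smul (continuousOn_finsetProd _ fun i _ => ?_)
        (hf.comp hcont.continuousOn fun θ _ => hmap θ)
      refine ContinuousOn.inv₀ (by fun_prop) fun θ _ h => ?_
      have h1 := hw' i
      rw [← sub_eq_zero.1 h] at h1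
      simp [torusMap, dist_eq_norm, abs_of_pos hR] at h1
    rw [torusIntegral_succ hint]
    have hinner : ∀ x ∈ sphere (c 0) R,
        (∯ y in T(c ∘ Fin.succ, (fun _ => R) ∘ Fin.succ),
          (∏ i, ((Fin.cons x y : Fin (d + 1) → ℂ) i - w i)⁻¹) • f (Fin.cons x y)) =
        (x - w 0)⁻¹ • (2 * Real.pi * Complex.I) ^ d • f (Fin.cons x (fun i => w i.succ)) := by
      intro x hx
      have h1 := ih (fun y => f (Fin.cons x y)) (c ∘ Fin.succ) (fun i => w i.succ) ?_ ?_ ?_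
      · rw [← h1, ← torusIntegral_smul]
        refine congrArg (fun g => torusIntegral g _ _) ?_
        funext y
        rw [Fin.prod_univ_succ, smul_smul]
        simp
      · rw [ball_pi _ hR]
        exact fun i _ => hw' i.succ
      · refine hf.comp (Continuous.continuousOn ?_) (fun y hy => hmem x hx y hy)
        exact Continuous.finCons continuous_const continuous_id
      · intro y hy i
        have := hd (Fin.cons x y) (hmem x hx y hy) i.succ
        simpa [Fin.cons_update] using this
    rw [circleIntegral.integral_congr hR.le hinner]
    have hline : DifferentiableOn ℂ (fun t => (2 * Real.pi * Complex.I) ^ d •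
        f (Fin.cons t (fun i => w i.succ))) (closedBall (c 0) R) := by
      have := hd w (ball_subset_closedBall hw) 0
      have e : ∀ t, Function.update w 0 t = Fin.cons t (fun i => w i.succ) := by
        intro t
        funext i
        refine Fin.cases ?_ (fun j => ?_) i <;> simp
      simp only [e] at this
      exact this.const_smul _
    rw [hline.circleIntegral_sub_inv_smul (hw' 0), smul_smul, pow_succ', mul_comm]
    congr 2
    funext i
    refine Fin.cases ?_ (fun j => ?_) i <;> simp

/-- The kernel `θ ↦ ∏ (T θ i - w i)⁻¹` as a function of `w` is analytic into continuous
functions on a compact space. -/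
theorem analyticAt_prod_ringInverse {K : Type*} [TopologicalSpace K] [CompactSpace K] {d : ℕ}
    (T : Fin d → C(K, ℂ)) {w : Fin d → ℂ} (hw : ∀ i θ, T i θ ≠ w i) :
    AnalyticAt ℂ (fun w : Fin d → ℂ =>
      ∏ i, Ring.inverse (T i - algebraMap ℂ C(K, ℂ) (w i))) w := by
  refine Finset.analyticAt_fun_prod _ fun i _ => ?_
  have hu : IsUnit (T i - algebraMap ℂ C(K, ℂ) (w i)) := by
    rw [ContinuousMap.isUnit_iff_forall_ne_zero]
    intro θ h
    exact hw i θ (sub_eq_zero.1 (by simpa using h))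
  obtain ⟨u, hu⟩ := hu
  have h1 : AnalyticAt ℂ (Ring.inverse : C(K, ℂ) → C(K, ℂ)) (T i - algebraMap ℂ C(K, ℂ) (w i)) := by
    rw [← hu]
    exact analyticAt_inverse u
  have h2 : AnalyticAt ℂ (fun w : Fin d → ℂ => T i - algebraMap ℂ C(K, ℂ) (w i)) w := by
    refine analyticAt_const.sub ?_
    exact ((Algebra.linearMap ℂ C(K, ℂ)).toContinuousLinearMap.comp
      (ContinuousLinearMap.proj (R := ℂ) (φ := fun _ : Fin d => ℂ) i)).analyticAt w
  exact AnalyticAt.comp (g := Ring.inverse) (f := fun w : Fin d → ℂ => T i - algebraMap ℂ C(K, ℂ) (w i)) h1 h2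

-- In Cauchy's formula the kernel is an analytic function of `w` with values in `C(Q, ℂ)`, inversion
-- in a Banach algebra being analytic. Integration of a kernel against `f` over the torus is a
-- continuous linear map into `F`, so analyticity passes to `f` without handling power series in
-- several variables.
open Metric in
theorem analyticAt_of_separately {F : Type*} [NormedAddCommGroup F] [NormedSpace ℂ F]
    [CompleteSpace F] {R : ℝ} (hR : 0 < R) {d : ℕ} {f : (Fin d → ℂ) → F} {c : Fin d → ℂ}
    (hf : ContinuousOn f (closedBall c R))
    (hd : ∀ x ∈ closedBall c R, ∀ i,
      DifferentiableOn ℂ (fun t => f (Function.update x i t)) (closedBall (c i) R)) :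
    AnalyticAt ℂ f c := by
  let Q : Set (Fin d → ℝ) := Set.Icc 0 fun _ => 2 * Real.pi
  have : CompactSpace Q := isCompact_iff_compactSpace.1 isCompact_Icc
  have hcont : Continuous (torusMap c (fun _ => R)) := by unfold torusMap; fun_prop
  have hmap : ∀ θ, torusMap c (fun _ => R) θ ∈ closedBall c R := by
    intro θ
    rw [closedBall_pi _ hR.le]
    intro i _
    simp [torusMap, dist_eq_norm, abs_of_pos hR]
  let T : Fin d → C(Q, ℂ) := fun i => ⟨fun θ => torusMap c (fun _ => R) θ i, by fun_prop⟩
  let g : C(Q, F) := ⟨fun θ => (∏ i, (R * Complex.exp (θ.1 i * Complex.I) * Complex.I)) •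
    -- The density `g` carries the Jacobian of the torus parametrization together with `f`, so that
    -- `Λ` applied to the Cauchy kernel is the torus integral.
    f (torusMap c (fun _ => R) θ), by
      refine Continuous.smul (continuous_finsetProd _ fun i _ => by
        have hi : Continuous fun θ : Q => ((θ.1 i : ℝ) : ℂ) :=
          Complex.continuous_ofReal.comp ((continuous_apply i).comp continuous_subtype_val)
        exact (continuous_const.mul (Complex.continuous_exp.comp (hi.mul continuous_const))).mul
          continuous_const) ?_
      exact hf.comp_continuous (hcont.comp continuous_subtype_val) fun θ => hmap θ⟩
  let μ : Measure Q := Measure.comap Subtype.val volume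
  have hμ : IsFiniteMeasure μ := by
    refine ⟨?_⟩
    rw [Measure.comap_apply _ Subtype.val_injective
      (fun s hs => MeasurableSet.subtype_image measurableSet_Icc hs) _ MeasurableSet.univ]
    simp only [Set.image_univ, Subtype.range_coe_subtype, Set.ofPred_mem_eq]
    exact isCompact_Icc.measure_lt_top
  have hint : ∀ h : C(Q, F), Integrable h μ := fun h =>
    (integrable_const (‖h‖)).mono' h.continuous.aestronglyMeasurable
      (Filter.Eventually.of_forall fun x => h.norm_coe_le_norm x)
  let Λ : C(Q, ℂ) →L[ℂ] F := LinearMap.mkContinuous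
    { toFun := fun k => ∫ θ, k θ • g θ ∂μ
      map_add' := fun k l => by
        refine Eq.trans ?_ (integral_add (hint (k • g)) (hint (l • g)))
        simp [add_smul]
      map_smul' := fun a k => by
        rw [← integral_smul]
        simp [smul_smul] } (‖g‖ * μ.real Set.univ) fun k => by
          refine (norm_integral_le_of_norm_le_const (C := ‖g‖ * ‖k‖) (Filter.Eventually.of_forall fun θ => ?_)).trans (le_of_eq (by ring))
          rw [norm_smul, mul_comm]
          gcongr
          · exact g.norm_coe_le_norm θ
          · exact k.norm_coe_le_norm θ
  have hne : ∀ w ∈ ball c R, ∀ (i : Fin d) (θ : Q), T i θ ≠ w i := by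
    intro w hw i θ h
    have h1 : w i ∈ ball (c i) R := (ball_pi c hR ▸ hw : w ∈ Set.pi Set.univ _) i trivial
    rw [← h] at h1
    simp [T, torusMap, dist_eq_norm, abs_of_pos hR] at h1
  have hA := AnalyticAt.comp (g := Λ) (f := fun w : Fin d → ℂ =>
    ∏ i, Ring.inverse (T i - algebraMap ℂ C(Q, ℂ) (w i)))
    (Λ.analyticAt _) (analyticAt_prod_ringInverse T (hne c (mem_ball_self hR)))
  have hA2 : AnalyticAt ℂ (fun w => ((2 * Real.pi * Complex.I) ^ d)⁻¹ •
      Λ (∏ i, Ring.inverse (T i - algebraMap ℂ C(Q, ℂ) (w i)))) c :=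
    (analyticAt_const (v := ((2 * Real.pi * Complex.I) ^ d)⁻¹)).smul hA
  refine hA2.congr ?_
  filter_upwards [isOpen_ball.mem_nhds (mem_ball_self hR)] with w hw
  have hc := torusIntegral_cauchy hR d f c w hw hf hd
  have h0 : (2 * Real.pi * Complex.I) ^ d ≠ 0 :=
    pow_ne_zero _ (by simp [Real.pi_ne_zero])
  rw [inv_smul_eq_iff₀ h0, ← hc]
  change ∫ θ, (∏ i, Ring.inverse (T i - algebraMap ℂ C(Q, ℂ) (w i))) θ • g θ ∂μ = _
  have hval : ∀ θ : Q, (∏ i, Ring.inverse (T i - algebraMap ℂ C(Q, ℂ) (w i))) θ =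
      ∏ i, (torusMap c (fun _ => R) θ i - w i)⁻¹ := by
    intro θ
    rw [ContinuousMap.coe_prod, Finset.prod_apply]
    refine Finset.prod_congr rfl fun i _ => ?_
    have hu : IsUnit (T i - algebraMap ℂ C(Q, ℂ) (w i)) := by
      rw [ContinuousMap.isUnit_iff_forall_ne_zero]
      intro θ h
      exact hne w hw i θ (sub_eq_zero.1 (by simpa using h))
    have h2 := congrArg (fun k : C(Q, ℂ) => k θ) (Ring.inverse_mul_cancel _ hu)
    simp only [ContinuousMap.mul_apply, ContinuousMap.one_apply] at h2
    exact eq_inv_of_mul_eq_one_left (by simpa [T] using h2)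
  simp only [hval]
  unfold torusIntegral
  have := integral_subtype_comap (μ := volume) (s := Q) measurableSet_Icc
    (fun θ => (∏ i, (torusMap c (fun _ => R) θ i - w i)⁻¹) •
      (∏ i, (R * Complex.exp (θ i * Complex.I) * Complex.I)) • f (torusMap c (fun _ => R) θ))
  refine this.trans (setIntegral_congr_fun measurableSet_Icc fun θ _ => ?_)
  exact smul_comm _ _ _

/-- Osgood's lemma: a continuous function which is holomorphic along complex lines is analytic. -/
theorem analyticOnNhd_of_continuousOn_of_lines {E F : Type*} [NormedAddCommGroup E]
    [NormedSpace ℂ E] [FiniteDimensional ℂ E] [NormedAddCommGroup F] [NormedSpace ℂ F]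
    [CompleteSpace F] {U : Set E} (hU : IsOpen U) {f : E → F} (hf : ContinuousOn f U)
    (hd : ∀ x ∈ U, ∀ v, DifferentiableAt ℂ (fun t : ℂ => f (x + t • v)) 0) :
    AnalyticOnNhd ℂ f U := by
  intro x hx
  let e : E ≃L[ℂ] (Fin (Module.finrank ℂ E) → ℂ) :=
    ContinuousLinearEquiv.ofFinrankEq (by simp)
  have hU' : IsOpen (e.symm ⁻¹' U) := hU.preimage e.symm.continuous
  obtain ⟨R, hR, hRU⟩ := Metric.nhds_basis_closedBall.mem_iff.1
    (hU'.mem_nhds (show e x ∈ e.symm ⁻¹' U by simpa using hx))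
  have key : AnalyticAt ℂ (f ∘ e.symm) (e x) := by
    refine analyticAt_of_separately hR (hf.comp e.symm.continuous.continuousOn hRU) ?_
    intro y hy i t ht
    have hmem : Function.update y i t ∈ Metric.closedBall (e x) R := by
      rw [closedBall_pi _ hR.le] at hy ⊢
      intro j _
      by_cases h : j = i
      · subst h; simpa using ht
      · simpa [h] using hy j trivial
    have h1 := hd _ (hRU hmem) (e.symm (Pi.single i 1))
    have h2 : DifferentiableAt ℂ (fun s : ℂ => f (e.symm (Function.update y i t) +
        (s - t) • e.symm (Pi.single i 1))) t := by
      have h3 : DifferentiableAt ℂ (fun s : ℂ => s - t) t := by fun_prop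
      have h1' : DifferentiableAt ℂ (fun s : ℂ => f (e.symm (Function.update y i t) +
        s • e.symm (Pi.single i 1))) (t - t) := by simpa using h1
      exact DifferentiableAt.comp (g := fun s : ℂ => f (e.symm (Function.update y i t) +
        s • e.symm (Pi.single i 1))) (f := fun s : ℂ => s - t) t h1' h3
    refine (h2.congr_of_eventuallyEq (Filter.Eventually.of_forall fun s => ?_)).differentiableWithinAt
    simp only [Function.comp]
    rw [← map_smul, ← map_add]
    congr 2
    funext j
    by_cases h : j = i
    · subst h; simp
    · simp [h]
  have h2 := AnalyticAt.comp (g := f ∘ e.symm) (f := e) (x := x) key (e.toContinuousLinearMap.analyticAt x)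
  refine h2.congr (Filter.Eventually.of_forall fun y => ?_)
  simp

/-! ### Integrals of holomorphic families. -/

/-- By Cauchy's estimate on circles of radius `r / 4` a majorant of the functions also majorizes
their derivatives on the half ball, so dominated differentiation needs no hypothesis on the
derivative. -/
theorem differentiableAt_integral_of_holomorphic {Y F : Type*} [MeasurableSpace Y] {μ : Measure Y}
    [NormedAddCommGroup F] [NormedSpace ℂ F] [CompleteSpace F] {Φ : ℂ → Y → F} {r : ℝ} (hr : 0 < r)
    (hmeas : ∀ t ∈ Metric.ball (0 : ℂ) r, AEStronglyMeasurable (Φ t) μ)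
    (hdiff : ∀ᵐ y ∂μ, DifferentiableOn ℂ (fun t => Φ t y) (Metric.ball 0 r)) {g : Y → ℝ}
    (hg : Integrable g μ) (hbd : ∀ᵐ y ∂μ, ∀ t ∈ Metric.ball (0 : ℂ) r, ‖Φ t y‖ ≤ g y) :
    DifferentiableAt ℂ (fun t => ∫ y, Φ t y ∂μ) 0 := by
  have h0 : (0 : ℂ) ∈ Metric.ball (0 : ℂ) r := Metric.mem_ball_self hr
  have hint : Integrable (Φ 0) μ :=
    hg.mono' (hmeas 0 h0) (hbd.mono fun y hy => hy 0 h0)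
  refine (hasDerivAt_integral_of_dominated_loc_of_deriv_le (s := Metric.ball 0 (r / 2))
    (F' := fun t y => deriv (fun t => Φ t y) t) (bound := fun y => g y / (r / 4))
    (Metric.ball_mem_nhds _ (by positivity))
    (Filter.eventually_of_mem (Metric.ball_mem_nhds _ hr) hmeas) hint ?_ ?_ (hg.div_const _)
    ?_).2.differentiableAt
  -- The derivative is measurable in `y` as a pointwise limit of difference quotients along `r / (k
  -- + 2)`, a null sequence inside the ball which avoids 0.
  · let u : ℕ → ℂ := fun k => ((r / (k + 2) : ℝ) : ℂ)
    have hu : ∀ k, u k ∈ Metric.ball (0 : ℂ) r := by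
      intro k
      have h2 : r / (k + 2 : ℝ) < r := div_lt_self hr (by have : (0 : ℝ) ≤ k := k.cast_nonneg; linarith)
      simp only [u, mem_ball_zero_iff, Complex.norm_real]
      rwa [Real.norm_of_nonneg (by positivity)]
    have hu0 : ∀ k, u k ≠ 0 := fun k => by
      simp only [u]
      exact_mod_cast (by positivity : r / (k + 2 : ℝ) ≠ 0)
    have hlim : Filter.Tendsto u Filter.atTop (nhdsWithin 0 {0}ᶜ) := by
      refine tendsto_nhdsWithin_iff.2 ⟨?_, Filter.Eventually.of_forall hu0⟩
      have h1 : Filter.Tendsto (fun k : ℕ => r / ((k : ℝ) + 2)) Filter.atTop (nhds 0) :=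
        Filter.Tendsto.div_atTop tendsto_const_nhds
          (Filter.tendsto_atTop_add_const_right _ _ tendsto_natCast_atTop_atTop)
      have := (Complex.continuous_ofReal.tendsto 0).comp h1
      simpa [u, Function.comp_def] using this
    refine aestronglyMeasurable_of_tendsto_ae (u := Filter.atTop)
      (f := fun (k : ℕ) y => (u k)⁻¹ • (Φ (u k) y - Φ 0 y))
      (fun k => ((hmeas _ (hu k)).sub (hmeas 0 h0)).const_smul _) ?_
    filter_upwards [hdiff] with y hy
    have hd := (hy.differentiableAt (Metric.ball_mem_nhds _ hr)).hasDerivAt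
    have := (hasDerivAt_iff_tendsto_slope.1 hd).comp hlim
    refine this.congr fun k => ?_
    simp [slope, Function.comp]
  · filter_upwards [hdiff, hbd] with y hy hby t ht
    have ht' : ‖t‖ < r / 2 := by simpa using ht
    have hsub : Metric.closedBall t (r / 4) ⊆ Metric.ball 0 r := fun w hw => by
      have h1 : ‖w - t‖ ≤ r / 4 := by simpa [dist_eq_norm] using hw
      have h2 : ‖w‖ ≤ ‖w - t‖ + ‖t‖ := by simpa using norm_add_le (w - t) t
      rw [mem_ball_zero_iff]; linarith
    refine Complex.norm_deriv_le_of_forall_mem_sphere_norm_le (by positivity) ?_ fun w hw =>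
      hby w (hsub (Metric.sphere_subset_closedBall hw))
    refine (hy.mono ?_).diffContOnCl
    rw [closure_ball _ (by positivity)]
    exact hsub
  · filter_upwards [hdiff] with y hy t ht
    refine (hy.differentiableAt (Metric.isOpen_ball.mem_nhds ?_)).hasDerivAt
    have ht' : ‖t‖ < r / 2 := by simpa using ht
    rw [mem_ball_zero_iff]; linarith

/-- A locally dominated integral of holomorphic functions is analytic. -/
theorem analyticOnNhd_integral {E F Y : Type*} [NormedAddCommGroup E]
    [NormedSpace ℂ E] [FiniteDimensional ℂ E] [NormedAddCommGroup F] [NormedSpace ℂ F]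
    [CompleteSpace F] [MeasurableSpace Y] {μ : Measure Y} {U : Set E} (hU : IsOpen U)
    {Φ : E → Y → F} (hmeas : ∀ p ∈ U, AEStronglyMeasurable (Φ p) μ)
    (hdiff : ∀ᵐ y ∂μ, DifferentiableOn ℂ (fun p => Φ p y) U)
    (hdom : ∀ p ∈ U, ∃ V ∈ nhds p, ∃ g : Y → ℝ, Integrable g μ ∧
      ∀ᵐ y ∂μ, ∀ q ∈ V, ‖Φ q y‖ ≤ g y) :
    AnalyticOnNhd ℂ (fun p => ∫ y, Φ p y ∂μ) U := by
  refine analyticOnNhd_of_continuousOn_of_lines hU ?_ ?_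
  · intro p hp
    obtain ⟨V, hV, g, hg, hbd⟩ := hdom p hp
    refine (continuousAt_of_dominated (bound := g) ?_ ?_ hg ?_).continuousWithinAt
    · exact Filter.eventually_of_mem (hU.mem_nhds hp) hmeas
    · exact Filter.eventually_of_mem hV fun q hq => hbd.mono fun y hy => hy q hq
    · exact hdiff.mono fun y hy => (hy.differentiableAt (hU.mem_nhds hp)).continuousAt
  · intro p hp v
    obtain ⟨V, hV, g, hg, hbd⟩ := hdom p hp
    have hlc : ContinuousAt (fun t : ℂ => p + t • v) 0 := by fun_prop
    have hn : U ∩ V ∈ nhds (p + (0 : ℂ) • v) := by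
      simpa using Filter.inter_mem (hU.mem_nhds hp) hV
    obtain ⟨r, hr, hrs⟩ := Metric.mem_nhds_iff.1 (hlc hn)
    refine differentiableAt_integral_of_holomorphic (Φ := fun t y => Φ (p + t • v) y) hr
      (fun t ht => hmeas _ (hrs ht).1) ?_ hg ?_
    · filter_upwards [hdiff] with y hy
      exact hy.comp (by fun_prop) fun t ht => (hrs ht).1
    · filter_upwards [hbd] with y hy t ht
      exact hy _ (hrs ht).2

/-! ### Contour shifts and the roots of the symbol. -/

open Complex in
/-- Horizontal contour shift for functions with quadratic decay. -/
theorem integral_contour_shift {F : Type*} [NormedAddCommGroup F] [NormedSpace ℂ F]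
    [CompleteSpace F] {g : ℂ → F} {δ C : ℝ}
    (hd : ∀ s : ℂ, s.im ∈ Set.uIcc 0 δ → DifferentiableAt ℂ g s)
    (hb : ∀ s : ℂ, s.im ∈ Set.uIcc 0 δ → ‖g s‖ ≤ C * (1 + s.re ^ 2)⁻¹) :
    ∫ x : ℝ, g x = ∫ x : ℝ, g (x + δ * I) := by
  have hint : ∀ a ∈ Set.uIcc 0 δ, Integrable fun x : ℝ => g (x + a * I) := by
    intro a ha
    refine (integrable_inv_one_add_sq.const_mul C).mono' ?_ (Filter.Eventually.of_forall fun x => ?_)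
    · refine Continuous.aestronglyMeasurable (continuous_iff_continuousAt.2 fun x => ?_)
      have h1 : ContinuousAt g (x + a * I) := (hd _ (by simpa using ha)).continuousAt
      exact ContinuousAt.comp (f := fun x : ℝ => (x + a * I : ℂ)) h1 (by fun_prop)
    · simpa using hb (x + a * I) (by simpa using ha)
  have hrect : ∀ T : ℝ, (∫ x : ℝ in (-T)..T, g x) - (∫ x : ℝ in (-T)..T, g (x + δ * I)) +
      I • (∫ y : ℝ in (0 : ℝ)..δ, g (T + y * I)) - I • (∫ y : ℝ in (0 : ℝ)..δ, g (-T + y * I)) = 0 := by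
    intro T
    have := integral_boundary_rect_eq_zero_of_differentiableOn g (-T) (T + δ * I) (by
      intro s hs
      have : s.im ∈ Set.uIcc 0 δ := by simpa using hs.2
      exact (hd s this).differentiableWithinAt)
    simpa using this
  -- The two vertical sides of the rectangle vanish in the limit; `ε` selects the right or the left
  -- one.
  have hside : ∀ ε : ℝ, (ε = 1 ∨ ε = -1) → Filter.Tendsto
      (fun T : ℝ => I • (∫ y : ℝ in (0 : ℝ)..δ, g ((ε * T : ℝ) + y * I))) Filter.atTop (nhds 0) := by
    intro ε hε
    have hε2 : ε ^ 2 = 1 := by rcases hε with rfl | rfl <;> norm_num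
    have hlim : Filter.Tendsto (fun T : ℝ => C * (1 + T ^ 2)⁻¹ * |δ - 0|) Filter.atTop (nhds 0) := by
      have : Filter.Tendsto (fun T : ℝ => (1 + T ^ 2)⁻¹) Filter.atTop (nhds 0) :=
        (Filter.tendsto_atTop_add_const_left _ _ (Filter.tendsto_pow_atTop two_ne_zero)).inv_tendsto_atTop
      simpa using (this.const_mul C).mul_const |δ - 0|
    refine squeeze_zero_norm (fun T => ?_) hlim
    rw [norm_smul, norm_I, one_mul]
    refine intervalIntegral.norm_integral_le_of_norm_le_const fun y hy => ?_
    have := hb ((ε * T : ℝ) + y * I) (by simpa using Set.uIoc_subset_uIcc hy)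
    simpa [mul_pow, hε2] using this
  have h1 := intervalIntegral_tendsto_integral (by simpa using hint 0 (by simp))
    Filter.tendsto_neg_atTop_atBot Filter.tendsto_id
  have h2 := intervalIntegral_tendsto_integral (hint δ (by simp))
    Filter.tendsto_neg_atTop_atBot Filter.tendsto_id
  have h3 := ((h1.sub h2).add (hside 1 (Or.inl rfl))).sub (hside (-1) (Or.inr rfl))
  have h4 := tendsto_nhds_unique (h3.congr fun T => by simpa using hrect T) tendsto_const_nhds
  simpa [sub_eq_zero] using h4

/-- Roots of `s² + 2zs + τ` for nonreal `z`, in terms of a square root `Q` of `z² - τ`. -/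
theorem abs_im_le_of_sq_eq {z Q : ℂ} {τ : ℝ} (hτ : τ ≤ 0) (h : Q ^ 2 = z ^ 2 - τ) :
    |Q.im| ≤ |z.im| := by
  have h1 := congrArg Complex.re h
  have h2 := congrArg Complex.im h
  simp [pow_two] at h1 h2
  -- Comparison of imaginary parts gives `Re Q Im Q = Re z Im z`. If `|Im Q|` exceeded `|Im z|`,
  -- then `(Re Q)² ≤ (Re z)²`, while the real parts with `τ ≤ 0` force the opposite strict
  -- inequality.
  by_contra! hlt
  have h3 : z.im ^ 2 < Q.im ^ 2 := sq_lt_sq.2 hlt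
  have h4 : Q.re * Q.im = z.re * z.im := by linarith
  have h5 : (Q.re * Q.im) ^ 2 = (z.re * z.im) ^ 2 := by rw [h4]
  nlinarith [sq_nonneg z.re, sq_nonneg z.im, sq_nonneg Q.re, mul_nonneg (sq_nonneg z.re) (sub_nonneg.2 h3.le)]

/-- Exchanging `z` and `Q` in `abs_im_le_of_sq_eq` reverses the sign of `τ`. -/
theorem abs_im_ge_of_sq_eq {z Q : ℂ} {τ : ℝ} (hτ : 0 ≤ τ) (h : Q ^ 2 = z ^ 2 - τ) :
    |z.im| ≤ |Q.im| := by
  have := abs_im_le_of_sq_eq (z := Q) (Q := z) (τ := -τ) (by linarith) (by rw [h]; push_cast; ring)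
  exact this

/-- Since `b² - a² = (b - a)(b + a)`, one of `a`, `-a` is within `√‖b² - a²‖` of `b`. No branch of
the square root has to be chosen. -/
theorem abs_im_sqrt_le {a b : ℂ} : |b.im| ≤ |a.im| + Real.sqrt ‖b ^ 2 - a ^ 2‖ := by
  have h : ‖b ^ 2 - a ^ 2‖ = ‖b - a‖ * ‖b + a‖ := by rw [← norm_mul]; congr 1; ring
  have h1 : |b.im| ≤ |a.im| + ‖b - a‖ := by
    have := Complex.abs_im_le_norm (b - a)
    rw [Complex.sub_im] at this
    have := abs_sub_abs_le_abs_sub b.im a.im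
    linarith
  have h2 : |b.im| ≤ |a.im| + ‖b + a‖ := by
    have := Complex.abs_im_le_norm (b + a)
    rw [Complex.add_im] at this
    have := abs_sub_abs_le_abs_sub b.im (-a.im)
    rw [abs_neg, sub_neg_eq_add] at this
    linarith
  rw [h]
  rcases le_total ‖b - a‖ ‖b + a‖ with h3 | h3
  · refine h1.trans (add_le_add_right (Real.le_sqrt_of_sq_le ?_) _)
    nlinarith [norm_nonneg (b - a)]
  · refine h2.trans (add_le_add_right (Real.le_sqrt_of_sq_le ?_) _)
    nlinarith [norm_nonneg (b + a)]

/-- Lower bound for the symbol on the shifted line. -/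
theorem norm_shifted_symbol_ge {z L : ℂ} {θ δ σ : ℝ} (hσ : σ = 1 ∨ σ = -1) (hz : 0 < σ * z.im)
    (hL : 0 ≤ L.re) (hLi : Real.sqrt |L.im| ≤ δ / 2) (hθ : 0 ≤ θ) (hθ1 : θ ≤ 1) (hδ : 0 < δ) {t : ℂ}
    (ht : t.im = σ * δ) :
    δ / 2 * (|z.im| + δ / 2) ≤ ‖t ^ 2 + 2 * z * t - L * θ‖ := by
  -- The roots are `-z ± b`. The root `a` belongs to the discriminant with `L` replaced by its real
  -- part, where the sign of `τ` is known; passing to `b` costs `√|Im L| ≤ δ / 2`, half of the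
  -- shift.
  obtain ⟨a, ha⟩ := IsSquare.exists_sq (z ^ 2 + ((L.re * θ : ℝ) : ℂ)) (Complex.isSquare _)
  obtain ⟨b, hb⟩ := IsSquare.exists_sq (z ^ 2 + L * θ) (Complex.isSquare _)
  have ha1 : |a.im| ≤ |z.im| := abs_im_le_of_sq_eq (τ := -(L.re * θ))
    (by have := mul_nonneg hL hθ; linarith) (by rw [← ha]; push_cast; ring)
  have hab : ‖b ^ 2 - a ^ 2‖ ≤ |L.im| := by
    rw [← ha, ← hb]
    have e : z ^ 2 + L * θ - (z ^ 2 + ((L.re * θ : ℝ) : ℂ)) = ((L.im * θ : ℝ) : ℂ) * Complex.I := by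
      apply Complex.ext <;> simp
    rw [e, norm_mul, Complex.norm_I, mul_one, Complex.norm_real, Real.norm_eq_abs, abs_mul, abs_of_nonneg hθ]
    exact mul_le_of_le_one_right (abs_nonneg _) hθ1
  have hb1 : |b.im| ≤ |z.im| + δ / 2 :=
    (abs_im_sqrt_le (a := a)).trans (add_le_add ha1 ((Real.sqrt_le_sqrt hab).trans hLi))
  have hfac : t ^ 2 + 2 * z * t - L * θ = (t + z - b) * (t + z + b) := by linear_combination -hb
  have hz' : |z.im| = σ * z.im := by
    rcases hσ with rfl | rfl
    · simp at hz ⊢; exact hz.le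
    · simp at hz ⊢; exact hz.le
  have hσb : |σ * b.im| = |b.im| := by rcases hσ with rfl | rfl <;> simp
  have hge : ∀ w : ℂ, σ * w.im ≤ ‖w‖ := fun w => by
    refine le_trans (le_abs_self _) (le_trans (le_of_eq ?_) (Complex.abs_im_le_norm w))
    rcases hσ with rfl | rfl <;> simp
  have hσ2 : σ * σ = 1 := by rcases hσ with rfl | rfl <;> norm_num
  have h1 : σ * (t + z - b).im = δ + |z.im| - σ * b.im := by
    simp only [Complex.sub_im, Complex.add_im, ht, hz']; linear_combination δ * hσ2
  have h2 : σ * (t + z + b).im = δ + |z.im| + σ * b.im := by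
    simp only [Complex.add_im, ht, hz']; linear_combination δ * hσ2
  have h3 := hge (t + z - b)
  have h4 := hge (t + z + b)
  rw [hfac, norm_mul]
  rw [h1] at h3
  rw [h2] at h4
  have h5 := abs_le.1 (hσb ▸ hb1 : |σ * b.im| ≤ |z.im| + δ / 2)
  have hz0 := abs_nonneg z.im
  have h6 : 0 ≤ ‖t + z - b‖ - (δ + |z.im| - σ * b.im) := by linarith
  have h7 : 0 ≤ ‖t + z + b‖ - (δ + |z.im| + σ * b.im) := by linarith
  have h8 : (δ + |z.im| - σ * b.im) * (δ + |z.im| + σ * b.im) ≤ ‖t + z - b‖ * ‖t + z + b‖ :=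
    mul_le_mul (by linarith) (by linarith) (by linarith) (norm_nonneg _)
  refine le_trans ?_ h8
  nlinarith

/-- Lower bound for the symbol at real points. -/
theorem norm_symbol_ge {z : ℂ} (hz : z.im ≠ 0) (s τ : ℝ) :
    |s| * (2 * |z.im|) ≤ ‖(s : ℂ) ^ 2 + 2 * z * s + τ‖ ∧
    |s| + |τ| ≤ ‖(s : ℂ) ^ 2 + 2 * z * s + τ‖ *
      ((1 + |s|) * (1 + (1 + 2 * ‖z‖ + 1) / (2 * |z.im|))) := by
  have hz0 : 0 < |z.im| := abs_pos.2 hz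
  set p := (s : ℂ) ^ 2 + 2 * z * s + τ with hp
  -- The imaginary part of the symbol controls `s`, and `τ` is then recovered from the symbol
  -- itself.
  have him : p.im = 2 * z.im * s := by simp [hp, pow_two]
  have h1 : |s| * (2 * |z.im|) ≤ ‖p‖ := by
    refine le_trans (le_of_eq ?_) (Complex.abs_im_le_norm p)
    rw [him, abs_mul, abs_mul]; simp; ring
  refine ⟨h1, ?_⟩
  have h2 : |s| ≤ ‖p‖ / (2 * |z.im|) := by rwa [le_div_iff₀ (by positivity)]
  have h3 : |τ| ≤ ‖p‖ + |s| * (|s| + 2 * ‖z‖) := by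
    have e : (τ : ℂ) = p - s * (s + 2 * z) := by rw [hp]; ring
    have := norm_sub_le p (s * (s + 2 * z))
    rw [← e, Complex.norm_real, norm_mul, Complex.norm_real] at this
    refine this.trans (add_le_add_right (mul_le_mul_of_nonneg_left ?_ (norm_nonneg _)) _)
    refine (norm_add_le _ _).trans ?_
    simp
  set A := ‖p‖ / (2 * |z.im|) with hA
  have hA0 : 0 ≤ A := by positivity
  have h4 : ‖p‖ * ((1 + |s|) * (1 + (1 + 2 * ‖z‖ + 1) / (2 * |z.im|))) =
      (1 + |s|) * (‖p‖ + A * (1 + 2 * ‖z‖ + 1)) := by rw [hA]; ring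
  rw [h4]
  have hs0 := abs_nonneg s
  have hz1 := norm_nonneg z
  have h5 : |s| * (|s| + 2 * ‖z‖) ≤ A * (|s| + 2 * ‖z‖) := mul_le_mul_of_nonneg_right h2 (by positivity)
  have hp0 := norm_nonneg p
  nlinarith [mul_nonneg hs0 hp0, mul_nonneg hs0 hA0, mul_nonneg (mul_nonneg hs0 hA0) hz1, mul_nonneg hA0 hz1]

/-! ### Polar coordinates and the radial substitution. -/

/-- Integration in polar coordinates. -/
theorem lintegral_eq_lintegral_sphere {E : Type*} [NormedAddCommGroup E] [NormedSpace ℝ E]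
    [MeasurableSpace E] [BorelSpace E] [FiniteDimensional ℝ E] [Nontrivial E] (μ : Measure E)
    [μ.IsAddHaarMeasure] {f : E → ENNReal} (hf : Measurable f) :
    ∫⁻ x, f x ∂μ = ∫⁻ v : Metric.sphere (0 : E) 1, (∫⁻ r in Set.Ioi (0 : ℝ),
      ENNReal.ofReal (r ^ (Module.finrank ℝ E - 1)) * f (r • v.1)) ∂μ.toSphere := by
  have h1 : ∫⁻ x, f x ∂μ = ∫⁻ x in ({0}ᶜ : Set E), f x ∂μ := by
    rw [restrict_compl_singleton]
  have hmp := μ.measurePreserving_homeomorphUnitSphereProd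
  have hg : Measurable fun p : Metric.sphere (0 : E) 1 × Set.Ioi (0 : ℝ) => f (p.2.1 • p.1.1) :=
    hf.comp (by fun_prop)
  have h2 := hmp.lintegral_comp hg
  rw [h1, ← lintegral_subtype_comap (measurableSet_singleton _).compl]
  have h3 : ∀ x : ({0}ᶜ : Set E), f ((homeomorphUnitSphereProd E x).2.1 •
      (homeomorphUnitSphereProd E x).1.1) = f x := by
    intro x
    have := homeomorphUnitSphereProd_symm_apply_coe E (homeomorphUnitSphereProd E x)
    rw [Homeomorph.symm_apply_apply] at this
    rw [← this]
  simp only [h3] at h2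
  rw [h2, lintegral_prod _ hg.aemeasurable]
  refine lintegral_congr fun v => ?_
  unfold Measure.volumeIoiPow
  refine (lintegral_withDensity_eq_lintegral_mul (g := fun r : Set.Ioi (0 : ℝ) => f (r.1 • v.1))
    _ (by fun_prop) (hf.comp (by fun_prop))).trans ?_
  exact lintegral_subtype_comap measurableSet_Ioi
    (fun r : ℝ => ENNReal.ofReal (r ^ (Module.finrank ℝ E - 1)) * f (r • v.1))

/-- The substitution is `r² = l² + t² - 1`. It maps `(1, ∞)` onto `(l, ∞)` and satisfies `r dr = t
dt`, which leaves the factor `(r/t)^(d-2)`. It is made for `r² - l² = t² - 1`: expressions in `r² -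
l²` lose their dependence on `l`. -/
theorem lintegral_Ioi_radial {d : ℕ} (hd : 2 ≤ d) {l : ℝ} (hl : 0 < l) (F : ℝ → ENNReal) :
    ∫⁻ r in Set.Ioi l, ENNReal.ofReal (r ^ (d - 1)) * F r =
      ∫⁻ t in Set.Ioi (1 : ℝ), ENNReal.ofReal (t ^ (d - 1)) *
        (ENNReal.ofReal ((Real.sqrt (l ^ 2 + t ^ 2 - 1) / t) ^ (d - 2)) *
          F (Real.sqrt (l ^ 2 + t ^ 2 - 1))) := by
  have hpos : ∀ t ∈ Set.Ioi (1 : ℝ), 0 < l ^ 2 + t ^ 2 - 1 := fun t ht => by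
    have h1 : (1 : ℝ) < t := ht
    nlinarith [pow_pos hl 2]
  have himg : (fun t : ℝ => Real.sqrt (l ^ 2 + t ^ 2 - 1)) '' Set.Ioi 1 = Set.Ioi l := by
    ext r
    constructor
    · rintro ⟨t, ht, rfl⟩
      have h1 : (1 : ℝ) < t := ht
      exact Real.lt_sqrt_of_sq_lt (by nlinarith)
    · intro hr
      have h1 : l < r := hr
      refine ⟨Real.sqrt (r ^ 2 - l ^ 2 + 1), Real.lt_sqrt_of_sq_lt (by nlinarith), ?_⟩
      beta_reduce
      rw [Real.sq_sqrt (by nlinarith)]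
      rw [show l ^ 2 + (r ^ 2 - l ^ 2 + 1) - 1 = r ^ 2 by ring, Real.sqrt_sq (by linarith)]
  rw [← himg, lintegral_image_eq_lintegral_abs_deriv_mul (f' := fun t => t / Real.sqrt (l ^ 2 + t ^ 2 - 1))
    measurableSet_Ioi]
  · refine setLIntegral_congr_fun measurableSet_Ioi fun t ht => ?_
    have h1 : (1 : ℝ) < t := ht
    have hR := Real.sqrt_pos.2 (hpos t ht)
    rw [← mul_assoc, ← mul_assoc, ← ENNReal.ofReal_mul (abs_nonneg _), ← ENNReal.ofReal_mul (by positivity)]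
    congr 2
    rw [abs_of_pos (by positivity)]
    obtain ⟨k, rfl⟩ := Nat.exists_eq_add_of_le hd
    rw [show 2 + k - 1 = k + 1 by omega, show 2 + k - 2 = k by omega]
    rw [div_pow]
    field_simp
    ring
  · intro t ht
    have h := (((hasDerivAt_pow 2 t).const_add (l ^ 2)).sub_const 1).sqrt (hpos t ht).ne'
    refine (h.congr_deriv ?_).hasDerivWithinAt
    have hR := Real.sqrt_pos.2 (hpos t ht)
    field_simp
    try norm_num
  · intro t ht u hu htu
    have h1 : (1 : ℝ) < t := ht
    have h2 : (1 : ℝ) < u := hu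
    have h3 := (Real.sqrt_inj (hpos t ht).le (hpos u hu).le).1 htu
    nlinarith

theorem lintegral_outer {E : Type*} [NormedAddCommGroup E] [NormedSpace ℝ E]
    [MeasurableSpace E] [BorelSpace E] [FiniteDimensional ℝ E] [Nontrivial E] (μ : Measure E)
    [μ.IsAddHaarMeasure] (hd : 2 ≤ Module.finrank ℝ E) {l : ℝ} (hl : 0 < l) {f : E → ENNReal}
    (hf : Measurable f) :
    ∫⁻ x in {x | l < ‖x‖}, f x ∂μ = ∫⁻ y in {y | 1 < ‖y‖},
      ENNReal.ofReal ((Real.sqrt (l ^ 2 + ‖y‖ ^ 2 - 1) / ‖y‖) ^ (Module.finrank ℝ E - 2)) *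
        f ((Real.sqrt (l ^ 2 + ‖y‖ ^ 2 - 1) / ‖y‖) • y) ∂μ := by
  have hset : ∀ a : ℝ, MeasurableSet {x : E | a < ‖x‖} := fun a =>
    measurableSet_lt measurable_const measurable_norm
  rw [← lintegral_indicator (hset l), ← lintegral_indicator (hset 1),
    lintegral_eq_lintegral_sphere μ (hf.indicator (hset l)),
    lintegral_eq_lintegral_sphere μ (Measurable.indicator (by fun_prop) (hset 1))]
  refine lintegral_congr fun v => ?_
  have hv : ‖v.1‖ = 1 := by simp
  have haux : ∀ (a : ℝ), 0 ≤ a → ∀ g : E → ENNReal,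
      ∫⁻ r in Set.Ioi (0 : ℝ), ENNReal.ofReal (r ^ (Module.finrank ℝ E - 1)) *
        Set.indicator {x : E | a < ‖x‖} g (r • v.1) =
      ∫⁻ r in Set.Ioi a, ENNReal.ofReal (r ^ (Module.finrank ℝ E - 1)) * g (r • v.1) := by
    intro a ha g
    rw [← lintegral_indicator measurableSet_Ioi, ← lintegral_indicator measurableSet_Ioi]
    refine lintegral_congr fun r => ?_
    by_cases h1 : a < r
    · have h2 : 0 < r := ha.trans_lt h1
      simp [h1, h2, norm_smul, hv, abs_of_pos h2]
    · by_cases h2 : 0 < r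
      · simp [h1, h2, norm_smul, hv, abs_of_pos h2]
      · simp [h1, h2]
  rw [haux l hl.le, haux 1 zero_le_one, lintegral_Ioi_radial hd hl (fun r => f (r • v.1))]
  refine setLIntegral_congr_fun measurableSet_Ioi fun t ht => ?_
  have h1 : (0 : ℝ) < t := lt_trans one_pos ht
  have h2 : ‖t • v.1‖ = t := by rw [norm_smul, hv, mul_one, Real.norm_of_nonneg h1.le]
  simp only [h2, smul_smul, div_mul_cancel₀ _ h1.ne']

/-- The identity for `lintegral` says that the restricted measure is the image of a weighted measure
under the radial map. Read as an identity of measures, it gives the Bochner version. -/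
theorem integral_outer {E F : Type*} [NormedAddCommGroup E] [NormedSpace ℝ E]
    [MeasurableSpace E] [BorelSpace E] [FiniteDimensional ℝ E] [Nontrivial E] (μ : Measure E)
    [μ.IsAddHaarMeasure] (hd : 2 ≤ Module.finrank ℝ E) {l : ℝ} (hl : 0 < l)
    [NormedAddCommGroup F] [NormedSpace ℝ F] {f : E → F}
    (hf : IntegrableOn f {x | l < ‖x‖} μ) :
    ∫ x in {x | l < ‖x‖}, f x ∂μ = ∫ y in {y | 1 < ‖y‖},
      ((Real.sqrt (l ^ 2 + ‖y‖ ^ 2 - 1) / ‖y‖) ^ (Module.finrank ℝ E - 2)) •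
        f ((Real.sqrt (l ^ 2 + ‖y‖ ^ 2 - 1) / ‖y‖) • y) ∂μ := by
  let T : E → E := fun y => (Real.sqrt (l ^ 2 + ‖y‖ ^ 2 - 1) / ‖y‖) • y
  let J : E → NNReal := fun y => Real.toNNReal
    ((Real.sqrt (l ^ 2 + ‖y‖ ^ 2 - 1) / ‖y‖) ^ (Module.finrank ℝ E - 2))
  have hT : Measurable T := by fun_prop
  have hJ : Measurable J := by fun_prop
  have hmap : μ.restrict {x | l < ‖x‖} =
      Measure.map T ((μ.restrict {y | 1 < ‖y‖}).withDensity fun y => (J y : ENNReal)) := by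
    ext s hs
    have h1 := lintegral_outer μ hd hl (f := s.indicator 1) (measurable_one.indicator hs)
    rw [lintegral_indicator_one hs] at h1
    rw [h1, Measure.map_apply hT hs, withDensity_apply _ (hT hs), ← lintegral_indicator (hT hs)]
    refine lintegral_congr fun y => ?_
    by_cases h : T y ∈ s
    · have h' : y ∈ T ⁻¹' s := h
      rw [Set.indicator_of_mem h', Set.indicator_of_mem h]
      simp [J, ENNReal.ofReal]
    · have h' : y ∉ T ⁻¹' s := h
      rw [Set.indicator_of_notMem h', Set.indicator_of_notMem h]
      simp
  rw [hmap, integral_map hT.aemeasurable (hmap ▸ hf.aestronglyMeasurable),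
    integral_withDensity_eq_integral_smul hJ]
  refine integral_congr_ae (Filter.Eventually.of_forall fun y => ?_)
  simp only [J, NNReal.smul_def, T]
  rw [Real.coe_toNNReal _ (by positivity)]

/-! ### Integrable majorants for the singularity of the reciprocal symbol. -/

theorem integrable_rpow_neg_half_mul : Integrable fun x : ℝ => |x| ^ (-(1 / 2) : ℝ) * ((1 + |x|) ^ 2)⁻¹ := by
  have h1 : IntegrableOn (fun x : ℝ => |x| ^ (-(1 / 2) : ℝ) * ((1 + |x|) ^ 2)⁻¹) (Set.Ioi 0) := by
    rw [← Set.Ioc_union_Ioi_eq_Ioi zero_le_one]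
    refine IntegrableOn.union ?_ ?_
    · have h2 : IntegrableOn (fun x : ℝ => x ^ (-(1 / 2) : ℝ)) (Set.Ioc 0 1) :=
        (intervalIntegrable_iff_integrableOn_Ioc_of_le zero_le_one).1
          (intervalIntegral.intervalIntegrable_rpow' (by norm_num))
      refine h2.mono' (Measurable.aestronglyMeasurable (by fun_prop)) ?_
      refine (ae_restrict_mem measurableSet_Ioc).mono fun x hx => ?_
      rw [norm_mul, abs_of_pos hx.1, Real.norm_of_nonneg (Real.rpow_nonneg hx.1.le _)]
      refine mul_le_of_le_one_right (Real.rpow_nonneg hx.1.le _) ?_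
      rw [Real.norm_of_nonneg (by positivity)]
      exact inv_le_one_of_one_le₀ (one_le_pow₀ (by linarith [hx.1]))
    · have h2 : IntegrableOn (fun x : ℝ => (1 + x ^ 2)⁻¹) (Set.Ioi 1) :=
        integrable_inv_one_add_sq.integrableOn
      refine h2.mono' (Measurable.aestronglyMeasurable (by fun_prop)) ?_
      refine (ae_restrict_mem measurableSet_Ioi).mono fun x hx => ?_
      have hx1 : (1 : ℝ) < x := hx
      rw [norm_mul, abs_of_pos (by linarith), Real.norm_of_nonneg (by positivity),
        Real.norm_of_nonneg (by positivity)]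
      refine (mul_le_of_le_one_left (by positivity)
        (Real.rpow_le_one_of_one_le_of_nonpos hx1.le (by norm_num))).trans ?_
      exact inv_anti₀ (by positivity) (by nlinarith)
  have h3 := (integrable_indicator_iff measurableSet_Ioi).2 h1
  have h4 := h3.add h3.comp_neg
  refine h4.congr ?_
  have h5 : ∀ᵐ x : ℝ, x ≠ 0 := by simp [ae_iff]
  filter_upwards [h5] with x hx
  rcases lt_or_gt_of_ne hx with h | h
  · simp [Set.indicator, h, h.not_gt]
  · simp [Set.indicator, h, h.not_gt]

/-- Because `l > 0`, the factorization `|r² - l²| = |r - l| (r + l)` shows a singularity of type `|r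
- l|^(-1/2)` in one variable. Of the decay in `1 + r`, the polar weight consumes all but two powers,
which suffice at infinity. -/
theorem integrable_radial_singular {E : Type*} [NormedAddCommGroup E] [NormedSpace ℝ E]
    [MeasurableSpace E] [BorelSpace E] [FiniteDimensional ℝ E] [Nontrivial E] (μ : Measure E)
    [μ.IsAddHaarMeasure] {l : ℝ} (hl : 0 < l) :
    Integrable (fun x : E => |‖x‖ ^ 2 - l ^ 2| ^ (-(1 / 2) : ℝ) *
      ((1 + ‖x‖) ^ (Module.finrank ℝ E + 1))⁻¹) μ := by
  rw [integrable_fun_norm_addHaar μ (f := fun r => |r ^ 2 - l ^ 2| ^ (-(1 / 2) : ℝ) *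
      ((1 + r) ^ (Module.finrank ℝ E + 1))⁻¹)]
  have h0 := (integrable_rpow_neg_half_mul.comp_sub_right l).const_mul
    (l ^ (-(1 / 2) : ℝ) * (1 + l) ^ 2)
  refine h0.integrableOn.mono' (Measurable.aestronglyMeasurable (by fun_prop)) ?_
  have h5 : ∀ᵐ x : ℝ, x ≠ l := by simp [ae_iff]
  filter_upwards [ae_restrict_mem measurableSet_Ioi, ae_restrict_of_ae h5] with r hr hrl
  have hr0 : (0 : ℝ) < r := hr
  have hrl' : 0 < |r - l| := abs_pos.2 (sub_ne_zero.2 hrl)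
  have hfac : |r ^ 2 - l ^ 2| = |r - l| * (r + l) := by
    rw [show r ^ 2 - l ^ 2 = (r - l) * (r + l) by ring, abs_mul, abs_of_pos (by linarith : 0 < r + l)]
  rw [Real.norm_of_nonneg (by positivity), smul_eq_mul]
  have h1 : |r ^ 2 - l ^ 2| ^ (-(1 / 2) : ℝ) ≤ l ^ (-(1 / 2) : ℝ) * |r - l| ^ (-(1 / 2) : ℝ) := by
    rw [hfac, Real.mul_rpow hrl'.le (by linarith), mul_comm]
    refine mul_le_mul_of_nonneg_right ?_ (by positivity)
    exact Real.rpow_le_rpow_of_nonpos hl (by linarith) (by norm_num)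
  have h2 : r ^ (Module.finrank ℝ E - 1) * ((1 + r) ^ (Module.finrank ℝ E + 1))⁻¹ ≤
      (1 + l) ^ 2 * ((1 + |r - l|) ^ 2)⁻¹ := by
    have hd : Module.finrank ℝ E + 1 = (Module.finrank ℝ E - 1) + 2 := by
      have := Module.finrank_pos (R := ℝ) (M := E)
      omega
    have h3 : 1 + |r - l| ≤ (1 + l) * (1 + r) := by
      have := abs_sub r l
      rw [abs_of_pos hr0, abs_of_pos hl] at this
      nlinarith
    rw [hd, pow_add, ← div_eq_mul_inv, ← div_eq_mul_inv, div_le_div_iff₀ (by positivity) (by positivity)]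
    have h4 : r ^ (Module.finrank ℝ E - 1) ≤ (1 + r) ^ (Module.finrank ℝ E - 1) :=
      pow_le_pow_left₀ hr0.le (by linarith) _
    have h5 : (1 + |r - l|) ^ 2 ≤ (1 + l) ^ 2 * (1 + r) ^ 2 := by
      rw [← mul_pow]; exact pow_le_pow_left₀ (by positivity) h3 2
    calc _ ≤ (1 + r) ^ (Module.finrank ℝ E - 1) * ((1 + l) ^ 2 * (1 + r) ^ 2) :=
          mul_le_mul h4 h5 (by positivity) (by positivity)
      _ = _ := by ring
  calc r ^ (Module.finrank ℝ E - 1) * (|r ^ 2 - l ^ 2| ^ (-(1 / 2) : ℝ) *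
        ((1 + r) ^ (Module.finrank ℝ E + 1))⁻¹)
      = |r ^ 2 - l ^ 2| ^ (-(1 / 2) : ℝ) * (r ^ (Module.finrank ℝ E - 1) *
        ((1 + r) ^ (Module.finrank ℝ E + 1))⁻¹) := by ring
    _ ≤ (l ^ (-(1 / 2) : ℝ) * |r - l| ^ (-(1 / 2) : ℝ)) * ((1 + l) ^ 2 * ((1 + |r - l|) ^ 2)⁻¹) :=
        mul_le_mul h1 h2 (by positivity) (by positivity)
    _ = _ := by ring

/-- The arithmetic-geometric inequality. It splits `1 / (|s| + |τ|)`, singular on a set of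
codimension two, into a product of two singularities that are each integrable in one dimension. -/
theorem inv_add_le_rpow_mul {a b : ℝ} (ha : 0 < a) (hb : 0 < b) :
    (a + b)⁻¹ ≤ a ^ (-(1 / 2) : ℝ) * b ^ (-(1 / 2) : ℝ) := by
  rw [← Real.mul_rpow ha.le hb.le, ← Real.rpow_neg_one (a + b)]
  have h : (a * b) ^ (-(1 / 2) : ℝ) = (Real.sqrt (a * b)) ^ (-1 : ℝ) := by
    rw [Real.sqrt_eq_rpow, ← Real.rpow_mul (by positivity)]; norm_num
  rw [h]
  refine Real.rpow_le_rpow_of_nonpos (by positivity) ?_ (by norm_num)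
  exact Real.sqrt_le_iff.2 ⟨by positivity, by nlinarith⟩


/-! ### Coordinates along `ν` and transversal to it. -/

theorem exists_perp_isometry {d : ℕ} {ν : RSp (d + 1)} (hν : ‖ν‖ = 1) :
    ∃ B : RSp d →ₗᵢ[ℝ] RSp (d + 1), (∀ y, inner ℝ ν (B y) = 0) ∧
      ∀ x : PerpR ν, ∃ y, B y = x.1 := by
  have : Fact (Module.finrank ℝ (RSp (d + 1)) = d + 1) := ⟨by simp⟩
  have h0 : ν ≠ 0 := fun h => by simp [h] at hν
  let b := OrthonormalBasis.fromOrthogonalSpanSingleton (𝕜 := ℝ) d h0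
  refine ⟨(PerpR ν).subtypeₗᵢ.comp b.repr.symm.toLinearIsometry, fun y => ?_, fun x => ⟨b.repr x, ?_⟩⟩
  · exact Submodule.mem_orthogonal_singleton_iff_inner_right.1 (b.repr.symm y).2
  · simp

/-- The coordinates `(s, y) ↦ s ν + B y` on `ℝⁿ`. -/
def lineCoord {d : ℕ} (ν : RSp (d + 1)) (B : RSp d →ₗᵢ[ℝ] RSp (d + 1)) (p : ℝ × RSp d) :
    RSp (d + 1) := p.1 • ν + B p.2

theorem norm_sq_lineCoord {d : ℕ} {ν : RSp (d + 1)} (hν : ‖ν‖ = 1)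
    {B : RSp d →ₗᵢ[ℝ] RSp (d + 1)} (hB : ∀ y, inner ℝ ν (B y) = 0) (p : ℝ × RSp d) :
    ‖lineCoord ν B p‖ ^ 2 = p.1 ^ 2 + ‖p.2‖ ^ 2 := by
  unfold lineCoord
  rw [pow_two, norm_add_sq_eq_norm_sq_add_norm_sq_real (by rw [inner_smul_left, hB, mul_zero]),
    norm_smul, hν, B.norm_map, mul_one, Real.norm_eq_abs, abs_mul_abs_self]
  ring

theorem exists_lineCoord_equiv {d : ℕ} {ν : RSp (d + 1)} (hν : ‖ν‖ = 1)
    {B : RSp d →ₗᵢ[ℝ] RSp (d + 1)} (hB : ∀ y, inner ℝ ν (B y) = 0) :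
    ∃ e : (ℝ × RSp d) ≃L[ℝ] RSp (d + 1), ∀ p, e p = lineCoord ν B p := by
  let T : (ℝ × RSp d) →ₗ[ℝ] RSp (d + 1) :=
    (LinearMap.toSpanSingleton ℝ _ ν).coprod B.toLinearMap
  have hT : ∀ p, T p = lineCoord ν B p := fun p => by simp [T, lineCoord]
  have hinj : Function.Injective T := by
    rw [injective_iff_map_eq_zero]
    intro p hp
    have h := norm_sq_lineCoord hν hB p
    rw [← hT, hp, norm_zero] at h
    have h1 : p.1 = 0 := by nlinarith [sq_nonneg p.1, sq_nonneg ‖p.2‖]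
    have h2 : ‖p.2‖ = 0 := by nlinarith [sq_nonneg p.1, sq_nonneg ‖p.2‖]
    exact Prod.ext h1 (norm_eq_zero.1 h2)
  refine ⟨(T.linearEquivOfInjective hinj (by simp; ring)).toContinuousLinearEquiv, fun p => ?_⟩
  rw [← hT]; rfl

theorem measurableEmbedding_lineCoord {d : ℕ} {ν : RSp (d + 1)} (hν : ‖ν‖ = 1)
    {B : RSp d →ₗᵢ[ℝ] RSp (d + 1)} (hB : ∀ y, inner ℝ ν (B y) = 0) :
    MeasurableEmbedding (lineCoord ν B) := by
  obtain ⟨e, he⟩ := exists_lineCoord_equiv hν hB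
  rw [← funext he]
  exact e.toHomeomorph.measurableEmbedding

/-- Uniqueness of Haar measure. The value of the constant is irrelevant: it ends up in the constants
of the later identities and estimates. -/
theorem exists_volume_eq_smul_map {d : ℕ} {ν : RSp (d + 1)} (hν : ‖ν‖ = 1)
    {B : RSp d →ₗᵢ[ℝ] RSp (d + 1)} (hB : ∀ y, inner ℝ ν (B y) = 0) :
    ∃ C : NNReal, C ≠ 0 ∧ (volume : Measure (RSp (d + 1))) =
      C • Measure.map (lineCoord ν B) (volume : Measure (ℝ × RSp d)) := by
  obtain ⟨e, he⟩ := exists_lineCoord_equiv hν hB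
  rw [← funext he]
  have hprod : (volume : Measure (ℝ × RSp d)).IsAddHaarMeasure := by
    rw [Measure.volume_eq_prod]; infer_instance
  have : (Measure.map e (volume : Measure (ℝ × RSp d))).IsAddHaarMeasure :=
    e.isAddHaarMeasure_map _
  refine ⟨_, fun h => ?_, Measure.isAddLeftInvariant_eq_smul volume
    (Measure.map e (volume : Measure (ℝ × RSp d)))⟩
  have := Measure.isAddLeftInvariant_eq_smul volume (Measure.map e (volume : Measure (ℝ × RSp d)))
  rw [h, zero_smul] at this
  exact NeZero.ne (volume : Measure (RSp (d + 1))) this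

/-! ### Weighted spaces -/

theorem measurable_expWeight {n : ℕ} (W : C(RSp n, ℝ)) :
    Measurable fun w : RSp n => ENNReal.ofReal (Real.exp (-2 * W w)) := by fun_prop

theorem absolutelyContinuous_expMeasure {n : ℕ} (W : C(RSp n, ℝ)) :
    expMeasure W ≪ (volume : Measure (RSp n)) := withDensity_absolutelyContinuous _ _

theorem absolutelyContinuous_expMeasure' {n : ℕ} (W : C(RSp n, ℝ)) :
    (volume : Measure (RSp n)) ≪ expMeasure W :=
  withDensity_absolutelyContinuous' (by fun_prop)
    (Filter.Eventually.of_forall fun x => by simp [Real.exp_pos])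

theorem ae_expMeasure {n : ℕ} (W : C(RSp n, ℝ)) :
    ae (expMeasure W) = ae (volume : Measure (RSp n)) :=
  le_antisymm (absolutelyContinuous_expMeasure W).ae_le (absolutelyContinuous_expMeasure' W).ae_le

instance {n : ℕ} (W : C(RSp n, ℝ)) : IsLocallyFiniteMeasure (expMeasure W) :=
  IsLocallyFiniteMeasure.withDensity_coe
    (f := fun w => Real.toNNReal (Real.exp (-2 * W w))) (by fun_prop)

/-- All weighted norms are read off from this one: `u` has in `e^{W}L²` the size that `e^{-W}u` has
in `L²`. -/
theorem eLpNorm_expMeasure {n : ℕ} (W : C(RSp n, ℝ)) (u : RSp n → ℂ) :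
    eLpNorm u 2 (expMeasure W) = eLpNorm (fun w => ((Real.exp (-W w) : ℝ) : ℂ) * u w) 2 volume := by
  rw [eLpNorm_eq_lintegral_rpow_enorm_toReal (by norm_num) (by norm_num),
    eLpNorm_eq_lintegral_rpow_enorm_toReal (by norm_num) (by norm_num)]
  unfold expMeasure
  rw [lintegral_withDensity_eq_lintegral_mul_non_measurable _ (measurable_expWeight W)
    (Filter.Eventually.of_forall fun x => ENNReal.ofReal_lt_top)]
  congr 1
  refine lintegral_congr fun w => ?_
  simp only [Pi.mul_apply, ENNReal.toReal_ofNat, ENNReal.rpow_ofNat, enorm_mul, mul_pow]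
  congr 1
  rw [← ofReal_norm, Complex.norm_real, Real.norm_of_nonneg (Real.exp_pos _).le,
    ← ENNReal.ofReal_pow (Real.exp_pos _).le, ← Real.exp_nat_mul]
  congr 2
  push_cast; ring

theorem aestronglyMeasurable_expMeasure {n : ℕ} (W : C(RSp n, ℝ)) {u : RSp n → ℂ} :
    AEStronglyMeasurable u (expMeasure W) ↔ AEStronglyMeasurable u volume :=
  ⟨fun h => h.mono_ac (absolutelyContinuous_expMeasure' W),
    fun h => h.mono_ac (absolutelyContinuous_expMeasure W)⟩

theorem memLp_expMeasure_iff {n : ℕ} (W : C(RSp n, ℝ)) {u : RSp n → ℂ} :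
    MemLp u 2 (expMeasure W) ↔ MemLp (fun w => ((Real.exp (-W w) : ℝ) : ℂ) * u w) 2 volume := by
  unfold MemLp
  rw [eLpNorm_expMeasure, aestronglyMeasurable_expMeasure]
  refine and_congr_left fun _ => ⟨fun h => ?_, fun h => ?_⟩
  · exact (Continuous.aestronglyMeasurable (by fun_prop)).mul h
  · have h1 : AEStronglyMeasurable (fun w => ((Real.exp (W w) : ℝ) : ℂ) *
        (((Real.exp (-W w) : ℝ) : ℂ) * u w)) volume :=
      (Continuous.aestronglyMeasurable (by fun_prop)).mul h
    refine h1.congr (Filter.Eventually.of_forall fun w => ?_)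
    beta_reduce
    rw [← mul_assoc, ← Complex.ofReal_mul, ← Real.exp_add]
    simp

/-- Multiplication by `e^{-W}` as an isometry `e^{W} L² → L²`. -/
def expToL2 {n : ℕ} (W : C(RSp n, ℝ)) : ExpL2 W →ₗᵢ[ℂ] Lp ℂ 2 (volume : Measure (RSp n)) where
  toFun u := ((memLp_expMeasure_iff W).1 (Lp.memLp u)).toLp _
  map_add' u v := by
    rw [← MemLp.toLp_add]
    refine MemLp.toLp_congr _ _ ?_
    have h := Lp.coeFn_add u v
    rw [Filter.EventuallyEq, ae_expMeasure W] at h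
    filter_upwards [h] with w hw
    simp only [Pi.add_apply] at hw ⊢
    rw [hw, mul_add]
  map_smul' c u := by
    rw [RingHom.id_apply, ← MemLp.toLp_const_smul]
    refine MemLp.toLp_congr _ _ ?_
    have h := Lp.coeFn_smul c u
    rw [Filter.EventuallyEq, ae_expMeasure W] at h
    filter_upwards [h] with w hw
    simp only [Pi.smul_apply, smul_eq_mul] at hw ⊢
    rw [hw]; ring
  norm_map' u := by
    change ‖((memLp_expMeasure_iff W).1 (Lp.memLp u)).toLp _‖ = _
    rw [Lp.norm_toLp, Lp.norm_def, eLpNorm_expMeasure]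

theorem coeFn_expToL2 {n : ℕ} (W : C(RSp n, ℝ)) (u : ExpL2 W) :
    expToL2 W u =ᵐ[volume] fun w => ((Real.exp (-W w) : ℝ) : ℂ) * u w :=
  MemLp.coeFn_toLp ((memLp_expMeasure_iff W).1 (Lp.memLp u))

/-- The bilinear pairing of `e^{W} L²` with `e^{-W} L²`. -/
def expPairing {n : ℕ} (W W' : C(RSp n, ℝ)) : ExpL2 W →L[ℂ] ExpL2 W' →L[ℂ] ℂ :=
  ((ContinuousLinearMap.mul ℂ ℂ).lpPairing volume 2 2).bilinearComp
    (expToL2 W).toContinuousLinearMap (expToL2 W').toContinuousLinearMap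

theorem expPairing_apply {n : ℕ} {W W' : C(RSp n, ℝ)} (h : ∀ w, W' w = -W w) (u : ExpL2 W)
    (v : ExpL2 W') : expPairing W W' u v = ∫ w, u w * v w := by
  unfold expPairing
  rw [ContinuousLinearMap.bilinearComp_apply, ContinuousLinearMap.lpPairing_eq_integral]
  refine integral_congr_ae ?_
  filter_upwards [coeFn_expToL2 W u, coeFn_expToL2 W' v] with w h1 h2
  have e : ((Real.exp (-W w) : ℝ) : ℂ) * ((Real.exp (W w) : ℝ) : ℂ) = 1 := by
    rw [← Complex.ofReal_mul, ← Real.exp_add]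
    simp
  simp only [ContinuousLinearMap.mul_apply', LinearIsometry.coe_toContinuousLinearMap, h1, h2, h,
    neg_neg]
  linear_combination (u w * v w) * e

theorem integrable_mul_of_expL2 {n : ℕ} {W W' : C(RSp n, ℝ)} (h : ∀ w, W' w = -W w) {u v : RSp n → ℂ}
    (hu : MemLp u 2 (expMeasure W)) (hv : MemLp v 2 (expMeasure W')) :
    Integrable (fun w => u w * v w) volume := by
  have := ((memLp_expMeasure_iff W).1 hu).integrable_mul ((memLp_expMeasure_iff W').1 hv)
  refine this.congr (Filter.Eventually.of_forall fun w => ?_)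
  have e : ((Real.exp (-W w) : ℝ) : ℂ) * ((Real.exp (W w) : ℝ) : ℂ) = 1 := by
    rw [← Complex.ofReal_mul, ← Real.exp_add]
    simp
  simp only [Pi.mul_apply, h, neg_neg]
  linear_combination (u w * v w) * e

theorem norm_expPairing_le {n : ℕ} {W W' : C(RSp n, ℝ)} (u : ExpL2 W)
    (v : ExpL2 W') : ‖expPairing W W' u v‖ ≤ ‖u‖ * ‖v‖ := by
  unfold expPairing
  rw [ContinuousLinearMap.bilinearComp_apply]
  refine (ContinuousLinearMap.le_opNorm₂ _ _ _).trans ?_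
  have h1 : ‖(ContinuousLinearMap.mul ℂ ℂ).lpPairing (volume : Measure (RSp n)) 2 2‖ ≤ 1 :=
    ContinuousLinearMap.opNorm_le_bound₂ _ zero_le_one fun f g => by
      rw [ContinuousLinearMap.lpPairing_eq_integral]
      simp only [ContinuousLinearMap.mul_apply', one_mul]
      have h2 := L2.inner_def (𝕜 := ℂ) (star f) g
      have h3 : ∫ w, f w * g w = inner ℂ (star f) g := by
        rw [h2]
        refine integral_congr_ae ?_
        filter_upwards [Lp.coeFn_star f] with w hw
        simp [hw, mul_comm]
      rw [h3]
      exact (norm_inner_le_norm _ _).trans (le_of_eq (by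
        congr 1
        rw [Lp.norm_def, Lp.norm_def]
        congr 1
        refine eLpNorm_congr_norm_ae ?_
        filter_upwards [Lp.coeFn_star f] with w hw
        rw [hw, Pi.star_apply, norm_star]))
  calc _ ≤ 1 * ‖expToL2 W u‖ * ‖expToL2 W' v‖ := by
        gcongr
        all_goals exact le_rfl
    _ = _ := by simp

/-- The identity map between two `L²` spaces with comparable norms. -/
def lpInclusion {X : Type*} [MeasurableSpace X] (μ μ' : Measure X) (hac : μ' ≪ μ) (c : ℝ)
    (h : ∀ u : X → ℂ, eLpNorm u 2 μ' ≤ ENNReal.ofReal c * eLpNorm u 2 μ) :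
    Lp ℂ 2 μ →L[ℂ] Lp ℂ 2 μ' :=
  have hm : ∀ u : Lp ℂ 2 μ, MemLp u 2 μ' := fun u =>
    ⟨(Lp.aestronglyMeasurable u).mono_ac hac,
      (h u).trans_lt (ENNReal.mul_lt_top ENNReal.ofReal_lt_top (Lp.eLpNorm_lt_top u))⟩
  LinearMap.mkContinuous
    { toFun := fun u => (hm u).toLp u
      map_add' := fun u v => by
        rw [← MemLp.toLp_add]
        exact MemLp.toLp_congr _ _ (hac.ae_le (Lp.coeFn_add u v))
      map_smul' := fun a u => by
        rw [RingHom.id_apply, ← MemLp.toLp_const_smul]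
        exact MemLp.toLp_congr _ _ (hac.ae_le (Lp.coeFn_smul a u)) } (max c 0) fun u => by
      change ‖(hm u).toLp u‖ ≤ _
      rw [Lp.norm_toLp, Lp.norm_def]
      have := ENNReal.toReal_mono (ENNReal.mul_ne_top ENNReal.ofReal_ne_top (Lp.eLpNorm_ne_top u)) (h u)
      rwa [ENNReal.toReal_mul, ENNReal.toReal_ofReal'] at this

theorem coeFn_lpInclusion {X : Type*} [MeasurableSpace X] {μ μ' : Measure X} (hac : μ' ≪ μ) (c : ℝ)
    (h : ∀ u : X → ℂ, eLpNorm u 2 μ' ≤ ENNReal.ofReal c * eLpNorm u 2 μ) (u : Lp ℂ 2 μ) :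
    lpInclusion μ μ' hac c h u =ᵐ[μ'] u :=
  MemLp.coeFn_toLp (f := u) ⟨(Lp.aestronglyMeasurable u).mono_ac hac,
      (h u).trans_lt (ENNReal.mul_lt_top ENNReal.ofReal_lt_top (Lp.eLpNorm_lt_top u))⟩

theorem eLpNorm_le_of_weight_le {n : ℕ} {a b : RSp n → ℝ} {c : ℝ}
    (hab : ∀ w, |a w| ≤ c * |b w|) (u : RSp n → ℂ) :
    eLpNorm (fun w => (a w : ℂ) * u w) 2 volume ≤
      ENNReal.ofReal c * eLpNorm (fun w => (b w : ℂ) * u w) 2 volume := by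
  refine eLpNorm_le_mul_eLpNorm_of_ae_le_mul (Filter.Eventually.of_forall fun w => ?_) 2
  rw [norm_mul, norm_mul, Complex.norm_real, Complex.norm_real, ← mul_assoc]
  exact mul_le_mul_of_nonneg_right (hab w) (norm_nonneg _)

/-- The inclusion `e^{W} L² ⊆ e^{W'} L²` for `W ≤ W' + C`. -/
def expInclusion {n : ℕ} (W W' : C(RSp n, ℝ)) (C : ℝ) (h : ∀ w, W w ≤ W' w + C) :
    ExpL2 W →L[ℂ] ExpL2 W' :=
  lpInclusion _ _ ((absolutelyContinuous_expMeasure W').trans (absolutelyContinuous_expMeasure' W))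
    (Real.exp C) fun u => by
      rw [eLpNorm_expMeasure, eLpNorm_expMeasure]
      refine eLpNorm_le_of_weight_le (fun w => ?_) u
      rw [Real.abs_exp, Real.abs_exp, ← Real.exp_add]
      exact Real.exp_le_exp.2 (by linarith [h w])

theorem coeFn_expInclusion {n : ℕ} {W W' : C(RSp n, ℝ)} {C : ℝ} (h : ∀ w, W w ≤ W' w + C)
    (u : ExpL2 W) : expInclusion W W' C h u =ᵐ[volume] u := by
  have : expInclusion W W' C h u =ᵐ[expMeasure W'] u := coeFn_lpInclusion _ _ _ u
  rwa [Filter.EventuallyEq, ae_expMeasure W'] at this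

theorem eLpNorm_volume_eq {n : ℕ} (u : RSp n → ℂ) :
    eLpNorm u 2 volume = eLpNorm (fun w => ((1 : ℝ) : ℂ) * u w) 2 volume := by simp

/-- The inclusion `e^{W} L² ⊆ L²` for `W ≤ 0`. -/
def expToLp {n : ℕ} (W : C(RSp n, ℝ)) (h : ∀ w, W w ≤ 0) :
    ExpL2 W →L[ℂ] Lp ℂ 2 (volume : Measure (RSp n)) :=
  lpInclusion _ _ (absolutelyContinuous_expMeasure' W) 1 fun u => by
      rw [eLpNorm_expMeasure, eLpNorm_volume_eq u]
      refine eLpNorm_le_of_weight_le (fun w => ?_) u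
      rw [Real.abs_exp, abs_one, one_mul]
      exact Real.one_le_exp (by linarith [h w])

theorem coeFn_expToLp {n : ℕ} {W : C(RSp n, ℝ)} (h : ∀ w, W w ≤ 0)
    (u : ExpL2 W) : expToLp W h u =ᵐ[volume] u :=
  coeFn_lpInclusion _ _ _ u

/-- The inclusion `L² ⊆ e^{W} L²` for `W ≥ 0`. -/
def lpToExp {n : ℕ} (W : C(RSp n, ℝ)) (h : ∀ w, 0 ≤ W w) :
    Lp ℂ 2 (volume : Measure (RSp n)) →L[ℂ] ExpL2 W :=
  lpInclusion _ _ (absolutelyContinuous_expMeasure W) 1 fun u => by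
      rw [eLpNorm_expMeasure, eLpNorm_volume_eq u]
      refine eLpNorm_le_of_weight_le (fun w => ?_) u
      rw [Real.abs_exp, abs_one, one_mul]
      exact Real.exp_le_one_iff.2 (by linarith [h w])

theorem coeFn_lpToExp {n : ℕ} {W : C(RSp n, ℝ)} (h : ∀ w, 0 ≤ W w)
    (u : Lp ℂ 2 (volume : Measure (RSp n))) : lpToExp W h u =ᵐ[volume] u := by
  have : lpToExp W h u =ᵐ[expMeasure W] u :=
    coeFn_lpInclusion _ _ _ u
  rwa [Filter.EventuallyEq, ae_expMeasure W] at this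

/-! ### Exponential modes -/

theorem toC_apply {n : ℕ} (x : RSp n) (i : Fin n) : toC x i = (x i : ℂ) := rfl

theorem norm_toC {n : ℕ} (x : RSp n) : ‖toC x‖ = ‖x‖ := by
  simp [EuclideanSpace.norm_eq, toC_apply]

theorem norm_cdot_le {n : ℕ} (a b : CSp n) : ‖cdot a b‖ ≤ ‖a‖ * ‖b‖ := by
  unfold cdot
  refine (norm_sum_le _ _).trans ?_
  simp only [norm_mul]
  rw [EuclideanSpace.norm_eq, EuclideanSpace.norm_eq, ]
  exact Real.sum_mul_le_sqrt_mul_sqrt _ _ _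

theorem cdot_comm {n : ℕ} (a b : CSp n) : cdot a b = cdot b a := by
  simp only [cdot, mul_comm]

theorem cdot_add {n : ℕ} (a b c : CSp n) : cdot a (b + c) = cdot a b + cdot a c := by
  simp [cdot, mul_add, Finset.sum_add_distrib]

theorem add_cdot {n : ℕ} (a b c : CSp n) : cdot (a + b) c = cdot a c + cdot b c := by
  simp [cdot, add_mul, Finset.sum_add_distrib]

theorem cdot_smul {n : ℕ} (a b : CSp n) (c : ℂ) : cdot a (c • b) = c * cdot a b := by
  simp [cdot, Finset.mul_sum]; congr; ext; ring

theorem smul_cdot {n : ℕ} (a b : CSp n) (c : ℂ) : cdot (c • a) b = c * cdot a b := by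
  rw [cdot_comm, cdot_smul, cdot_comm]

theorem neg_cdot {n : ℕ} (a b : CSp n) : cdot (-a) b = -cdot a b := by
  simp [cdot]

theorem cdot_neg {n : ℕ} (a b : CSp n) : cdot a (-b) = -cdot a b := by
  simp [cdot]

theorem cdot_toC {n : ℕ} (x y : RSp n) : cdot (toC x) (toC y) = ((inner ℝ x y : ℝ) : ℂ) := by
  simp [cdot, toC_apply, PiLp.inner_apply, mul_comm]

/-- The imaginary part of a complex vector. -/
def imPart {n : ℕ} (ζ : CSp n) : RSp n := WithLp.toLp 2 fun i => (ζ i).im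

theorem norm_imPart_le {n : ℕ} (ζ : CSp n) : ‖imPart ζ‖ ≤ ‖ζ‖ := by
  rw [EuclideanSpace.norm_eq, EuclideanSpace.norm_eq]
  refine Real.sqrt_le_sqrt (Finset.sum_le_sum fun i _ => ?_)
  exact pow_le_pow_left₀ (norm_nonneg _) (Complex.abs_im_le_norm _) 2

theorem imPart_add {n : ℕ} (a b : CSp n) : imPart (a + b) = imPart a + imPart b := by
  ext i; simp [imPart]

theorem imPart_neg {n : ℕ} (a : CSp n) : imPart (-a) = -imPart a := by
  ext i; simp [imPart]

theorem imPart_toC {n : ℕ} (x : RSp n) : imPart (toC x) = 0 := by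
  ext i; simp [imPart, toC]

theorem imPart_smul_toC {n : ℕ} (c : ℂ) (x : RSp n) : imPart (c • toC x) = c.im • x := by
  ext i; simp [imPart, toC]

theorem imPart_sub {n : ℕ} (a b : CSp n) : imPart (a - b) = imPart a - imPart b := by
  ext i; simp [imPart]

theorem continuous_imPart {n : ℕ} : Continuous (imPart : CSp n → RSp n) := by
  unfold imPart; fun_prop

theorem continuous_toC {n : ℕ} : Continuous (toC : RSp n → CSp n) := by
  unfold toC; fun_prop

theorem continuous_cdot {n : ℕ} {X : Type*} [TopologicalSpace X] {f g : X → CSp n}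
    (hf : Continuous f) (hg : Continuous g) : Continuous fun x => cdot (f x) (g x) := by
  unfold cdot; fun_prop

/-- The exponential `w ↦ e^{i ζ · w}`. -/
def expMode {n : ℕ} (ζ : CSp n) (w : RSp n) : ℂ := Complex.exp (Complex.I * cdot ζ (toC w))

theorem continuous_expMode {n : ℕ} (ζ : CSp n) : Continuous (expMode ζ) := by
  unfold expMode
  have := continuous_cdot (f := fun _ : RSp n => ζ) continuous_const continuous_toC
  fun_prop

theorem im_cdot_toC {n : ℕ} (ζ : CSp n) (w : RSp n) :
    (cdot ζ (toC w)).im = inner ℝ (imPart ζ) w := by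
  simp [cdot, toC_apply, imPart, PiLp.inner_apply, mul_comm]

theorem norm_expMode {n : ℕ} (ζ : CSp n) (w : RSp n) :
    ‖expMode ζ w‖ = Real.exp (-inner ℝ (imPart ζ) w) := by
  rw [expMode, Complex.norm_exp, ← im_cdot_toC]
  simp

theorem norm_expMode_le {n : ℕ} {ζ : CSp n} {κ : ℝ} (h : ‖imPart ζ‖ ≤ κ) (w : RSp n) :
    ‖expMode ζ w‖ ≤ Real.exp (κ * ‖w‖) := by
  rw [norm_expMode]
  refine Real.exp_le_exp.2 ?_
  have := abs_real_inner_le_norm (imPart ζ) w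
  have h2 := mul_le_mul_of_nonneg_right h (norm_nonneg w)
  linarith [neg_abs_le (inner ℝ (imPart ζ) w)]

theorem expMode_add {n : ℕ} (ζ η : CSp n) (w : RSp n) :
    expMode (ζ + η) w = expMode ζ w * expMode η w := by
  rw [expMode, expMode, expMode, ← Complex.exp_add, add_cdot, mul_add]

theorem integrable_exp_neg_norm {n : ℕ} {a : ℝ} (ha : 0 < a) :
    Integrable fun w : RSp n => Real.exp (-a * ‖w‖) := by
  have h1 : Integrable fun w : RSp n => (1 + ‖w‖) ^ (-((n : ℝ) + 1)) :=
    integrable_one_add_norm (by simp)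
  refine (h1.const_mul ((n + 1).factorial / a ^ (n + 1) * Real.exp a)).mono'
    (Continuous.aestronglyMeasurable (by fun_prop)) (Filter.Eventually.of_forall fun w => ?_)
  rw [Real.norm_of_nonneg (Real.exp_pos _).le]
  have h2 := Real.pow_div_factorial_le_exp (x := a * (1 + ‖w‖)) (by positivity) (n + 1)
  have h3 : (1 + ‖w‖) ^ (-((n : ℝ) + 1)) = ((1 + ‖w‖) ^ (n + 1))⁻¹ := by
    rw [Real.rpow_neg (by positivity)]
    norm_cast
  have h4 : Real.exp (a * (1 + ‖w‖)) = Real.exp a * (Real.exp (-a * ‖w‖))⁻¹ := by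
    rw [← Real.exp_neg, ← Real.exp_add]; congr 1; ring
  rw [h4, div_le_iff₀ (by positivity), mul_pow] at h2
  rw [h3]
  have hE := Real.exp_pos (-a * ‖w‖)
  have h5 : a ^ (n + 1) * (1 + ‖w‖) ^ (n + 1) * Real.exp (-a * ‖w‖) ≤
      Real.exp a * ((n + 1).factorial : ℝ) := by
    calc _ ≤ Real.exp a * (Real.exp (-a * ‖w‖))⁻¹ * ((n + 1).factorial : ℝ) * Real.exp (-a * ‖w‖) :=
          mul_le_mul_of_nonneg_right h2 hE.le
      _ = _ := by field_simp
  have h6 : 0 < a ^ (n + 1) * (1 + ‖w‖) ^ (n + 1) := by positivity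
  calc Real.exp (-a * ‖w‖) ≤ Real.exp a * ((n + 1).factorial : ℝ) / (a ^ (n + 1) * (1 + ‖w‖) ^ (n + 1)) := by
        rw [le_div_iff₀ h6]; linarith
    _ = _ := by field_simp

theorem memLp_exp_norm {n : ℕ} {κ γ : ℝ} (hγ : 0 < γ) (h : κ < γ) :
    MemLp (fun w : RSp n => ((Real.exp (κ * ‖w‖) : ℝ) : ℂ)) 2 (expMeasure (bracketWeight n γ)) := by
  rw [memLp_expMeasure_iff, memLp_two_iff_integrable_sq_norm
    (Continuous.aestronglyMeasurable (by fun_prop))]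
  refine (integrable_exp_neg_norm (n := n) (a := 2 * (γ - κ)) (by linarith)).mono'
    (Continuous.aestronglyMeasurable (by fun_prop)) (Filter.Eventually.of_forall fun w => ?_)
  rw [← Complex.ofReal_mul, Complex.norm_real, ← Real.exp_add, Real.norm_eq_abs, Real.norm_eq_abs,
    Real.abs_exp, abs_of_nonneg (by positivity), ← Real.exp_nat_mul]
  refine Real.exp_le_exp.2 ?_
  have : ‖w‖ ≤ Real.sqrt (1 + ‖w‖ ^ 2) := Real.le_sqrt_of_sq_le (by linarith)
  simp only [bracketWeight, ContinuousMap.coe_mk]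
  push_cast
  nlinarith

/-- The norm of `e^{κ|w|}` in `e^{γ⟨w⟩} L²`. -/
def modeBound (n : ℕ) (γ κ : ℝ) : ℝ :=
  (eLpNorm (fun w : RSp n => ((Real.exp (κ * ‖w‖) : ℝ) : ℂ)) 2
    (expMeasure (bracketWeight n γ))).toReal

theorem modeBound_nonneg (n : ℕ) (γ κ : ℝ) : 0 ≤ modeBound n γ κ := ENNReal.toReal_nonneg

theorem memLp_of_exp_bound {n : ℕ} {κ γ C : ℝ} (hγ : 0 < γ) (h : κ < γ) {u : RSp n → ℂ}
    (hu : AEStronglyMeasurable u (expMeasure (bracketWeight n γ)))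
    (hb : ∀ w, ‖u w‖ ≤ C * Real.exp (κ * ‖w‖)) :
    MemLp u 2 (expMeasure (bracketWeight n γ)) := by
  refine (memLp_exp_norm (n := n) hγ h).of_le_mul (c := C) hu (Filter.Eventually.of_forall fun w => ?_)
  rw [Complex.norm_real, Real.norm_of_nonneg (Real.exp_pos _).le]
  exact hb w

theorem norm_toLp_le_of_exp_bound {n : ℕ} {κ γ C : ℝ} (hC : 0 ≤ C) (hγ : 0 < γ) (h : κ < γ)
    {u : ExpL2 (bracketWeight n γ)} {v : RSp n → ℂ} (huv : u =ᵐ[expMeasure (bracketWeight n γ)] v)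
    (hb : ∀ w, ‖v w‖ ≤ C * Real.exp (κ * ‖w‖)) :
    ‖u‖ ≤ C * modeBound n γ κ := by
  have h1 := eLpNorm_le_mul_eLpNorm_of_ae_le_mul (f := v) (μ := expMeasure (bracketWeight n γ))
    (g := fun w : RSp n => ((Real.exp (κ * ‖w‖) : ℝ) : ℂ)) (c := C)
    (Filter.Eventually.of_forall fun w => by
      rw [Complex.norm_real, Real.norm_of_nonneg (Real.exp_pos _).le]; exact hb w) 2
  rw [Lp.norm_def, eLpNorm_congr_ae huv]
  have := ENNReal.toReal_mono (ENNReal.mul_ne_top ENNReal.ofReal_ne_top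
    (memLp_exp_norm (n := n) hγ h).eLpNorm_ne_top) h1
  rwa [ENNReal.toReal_mul, ENNReal.toReal_ofReal hC] at this

theorem memLp_expMode {n : ℕ} {γ : ℝ} {ζ : CSp n} (h : ‖imPart ζ‖ < γ) :
    MemLp (expMode ζ) 2 (expMeasure (bracketWeight n γ)) :=
  memLp_of_exp_bound (C := 1) ((norm_nonneg _).trans_lt h) h
    (continuous_expMode ζ).aestronglyMeasurable fun w => by
      rw [one_mul]; exact norm_expMode_le le_rfl w

open Classical in
/-- `e^{i ζ · w}` as an element of `e^{γ⟨w⟩} L²`. -/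
def modeLp {n : ℕ} (γ : ℝ) (ζ : CSp n) : ExpL2 (bracketWeight n γ) :=
  if h : ‖imPart ζ‖ < γ then (memLp_expMode h).toLp _ else 0

theorem coeFn_modeLp {n : ℕ} {γ : ℝ} {ζ : CSp n} (h : ‖imPart ζ‖ < γ) :
    modeLp γ ζ =ᵐ[expMeasure (bracketWeight n γ)] expMode ζ := by
  rw [modeLp, dif_pos h]
  exact MemLp.coeFn_toLp _

theorem coeFn_modeLp_volume {n : ℕ} {γ : ℝ} {ζ : CSp n} (h : ‖imPart ζ‖ < γ) :
    modeLp γ ζ =ᵐ[volume] expMode ζ := by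
  have := coeFn_modeLp h
  rwa [Filter.EventuallyEq, ae_expMeasure] at this

theorem norm_modeLp_le {n : ℕ} {γ κ : ℝ} (hγ : 0 < γ) (hκ : κ < γ) {ζ : CSp n} (h : ‖imPart ζ‖ ≤ κ) :
    ‖modeLp γ ζ‖ ≤ modeBound n γ κ := by
  have := norm_toLp_le_of_exp_bound (C := 1) zero_le_one hγ hκ (coeFn_modeLp (h.trans_lt hκ))
    (fun w => by rw [one_mul]; exact norm_expMode_le h w)
  rwa [one_mul] at this

theorem sq_le_exp {t a : ℝ} (ht : 0 ≤ t) (ha : 0 < a) : t ^ 2 ≤ 2 / a ^ 2 * Real.exp (a * t) := by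
  have h := Real.pow_div_factorial_le_exp (x := a * t) (by positivity) 2
  rw [div_le_iff₀ (by positivity), Nat.factorial_two] at h
  rw [div_mul_eq_mul_div, le_div_iff₀ (by positivity)]
  push_cast at h
  linarith [mul_pow a t 2]

theorem self_le_exp {t a : ℝ} (ha : 0 < a) : t ≤ 1 / a * Real.exp (a * t) := by
  have h := Real.add_one_le_exp (a * t)
  rw [div_mul_eq_mul_div, le_div_iff₀ ha]
  linarith

theorem norm_coord_le {n : ℕ} (w : RSp n) (j : Fin n) : |w j| ≤ ‖w‖ := by
  simpa using PiLp.norm_apply_le w j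

theorem memLp_coord_expMode {n : ℕ} {γ : ℝ} {ζ : CSp n} (h : ‖imPart ζ‖ < γ) (j : Fin n) :
    MemLp (fun w : RSp n => Complex.I * (w j : ℂ) * expMode ζ w) 2
      (expMeasure (bracketWeight n γ)) := by
  have hε : 0 < (γ - ‖imPart ζ‖) / 2 := by linarith
  refine memLp_of_exp_bound (κ := (γ + ‖imPart ζ‖) / 2) (C := 1 / ((γ - ‖imPart ζ‖) / 2))
    ((norm_nonneg _).trans_lt h) (by linarith) ?_ fun w => ?_
  · have := continuous_expMode ζ
    exact Continuous.aestronglyMeasurable (by fun_prop)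
  · rw [norm_mul, norm_mul, Complex.norm_I, one_mul, Complex.norm_real, Real.norm_eq_abs]
    calc |w j| * ‖expMode ζ w‖ ≤ (1 / ((γ - ‖imPart ζ‖) / 2) * Real.exp ((γ - ‖imPart ζ‖) / 2 * ‖w‖)) *
          Real.exp (‖imPart ζ‖ * ‖w‖) :=
          mul_le_mul ((norm_coord_le w j).trans (self_le_exp hε)) (norm_expMode_le le_rfl w)
            (norm_nonneg _) (by positivity)
      _ = _ := by rw [mul_assoc, ← Real.exp_add]; congr 2; ring

/-- The remainder of `e^{iη·w}` after its linear part is at most `|η|² |w|² e^{|η||w|}`, and the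
growth in `w` is paid for by the gap between `‖imPart ζ‖` and `γ`. Hence the expansion holds in the
norm of the weighted space. -/
theorem differentiableAt_modeLp {n : ℕ} {γ : ℝ} {ζ : CSp n} (h : ‖imPart ζ‖ < γ) :
    DifferentiableAt ℂ (modeLp γ) ζ := by
  set κ := ‖imPart ζ‖ with hκ
  have hκ0 : 0 ≤ κ := norm_nonneg _
  have hγ : 0 < γ := hκ0.trans_lt h
  -- One `ε` absorbs the exponential of the remainder and another one the factor `|w|²`; the rate `κ
  -- + 2ε` is still below `γ`.
  set ε := (γ - κ) / 4 with hε
  have hε0 : 0 < ε := by rw [hε]; linarith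
  let D : CSp n →L[ℂ] ExpL2 (bracketWeight n γ) := ∑ j, (EuclideanSpace.proj (𝕜 := ℂ) j).smulRight
    ((memLp_coord_expMode h j).toLp _)
  have hD : ∀ η, D η =ᵐ[expMeasure (bracketWeight n γ)]
      fun w => Complex.I * cdot η (toC w) * expMode ζ w := by
    intro η
    have h1 : D η = ∑ j, η j • (memLp_coord_expMode h j).toLp _ := by
      simp only [D, sum_apply, ContinuousLinearMap.smulRight_apply]
      rfl
    have h2 : ∀ᵐ w ∂expMeasure (bracketWeight n γ), ∀ j,
        (η j • (memLp_coord_expMode h j).toLp _ : ExpL2 (bracketWeight n γ)) w =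
          η j * (Complex.I * (w j : ℂ) * expMode ζ w) := by
      rw [ae_all_iff]
      intro j
      filter_upwards [Lp.coeFn_smul (η j) ((memLp_coord_expMode h j).toLp _),
        (memLp_coord_expMode h j).coeFn_toLp] with w h3 h4
      rw [h3, Pi.smul_apply, h4, smul_eq_mul]
    rw [h1]
    filter_upwards [Lp.coeFn_fun_finsetSum Finset.univ (fun j => (η j • (memLp_coord_expMode h j).toLp _ :
      ExpL2 (bracketWeight n γ))), h2] with w h3 h4
    rw [h3]
    simp only [h4]
    simp only [cdot, toC_apply, Finset.mul_sum, Finset.sum_mul]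
    exact Finset.sum_congr rfl fun j _ => by ring
  have hO : (fun ζ' => modeLp γ ζ' - modeLp γ ζ - D (ζ' - ζ)) =O[nhds ζ] fun ζ' => ‖ζ' - ζ‖ ^ 2 := by
    refine Asymptotics.IsBigO.of_bound (2 / ε ^ 2 * modeBound n γ (κ + 2 * ε)) ?_
    filter_upwards [Metric.ball_mem_nhds ζ hε0] with ζ' hζ'
    have hη : ‖ζ' - ζ‖ < ε := by rwa [← dist_eq_norm]
    set η := ζ' - ζ with hη'
    have hζ'' : ζ' = ζ + η := by rw [hη']; abel
    have hIm : ‖imPart ζ'‖ < γ := by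
      rw [hζ'', imPart_add]
      have := norm_add_le (imPart ζ) (imPart η)
      have := norm_imPart_le η
      linarith
    rw [Real.norm_of_nonneg (by positivity)]
    have key : modeLp γ ζ' - modeLp γ ζ - D η =ᵐ[expMeasure (bracketWeight n γ)]
        fun w => expMode ζ' w - expMode ζ w - Complex.I * cdot η (toC w) * expMode ζ w := by
      filter_upwards [Lp.coeFn_sub (modeLp γ ζ' - modeLp γ ζ) (D η),
        Lp.coeFn_sub (modeLp γ ζ') (modeLp γ ζ), coeFn_modeLp hIm, coeFn_modeLp h, hD η]
        with w h1 h2 h3 h4 h5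
      rw [h1, Pi.sub_apply, h2, Pi.sub_apply, h3, h4, h5]
    have hb := norm_toLp_le_of_exp_bound (C := ‖η‖ ^ 2 * (2 / ε ^ 2)) (κ := κ + 2 * ε) (by positivity)
      hγ (by linarith) key fun w => ?_
    · linarith
    · have e : expMode ζ' w - expMode ζ w - Complex.I * cdot η (toC w) * expMode ζ w =
          expMode ζ w * (Complex.exp (Complex.I * cdot η (toC w)) -
            ∑ m ∈ Finset.range 2, (Complex.I * cdot η (toC w)) ^ m / m.factorial) := by
        rw [hζ'', expMode_add]
        simp [Finset.sum_range_succ, expMode]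
        ring
      have h1 := Complex.norm_exp_sub_sum_le_norm_mul_exp (Complex.I * cdot η (toC w)) 2
      have h2 : ‖Complex.I * cdot η (toC w)‖ ≤ ‖η‖ * ‖w‖ := by
        rw [norm_mul, Complex.norm_I, one_mul, ← norm_toC w]
        exact norm_cdot_le _ _
      rw [e, norm_mul]
      calc ‖expMode ζ w‖ * _ ≤ Real.exp (κ * ‖w‖) * ((‖η‖ * ‖w‖) ^ 2 * Real.exp (ε * ‖w‖)) := by
            refine mul_le_mul (norm_expMode_le le_rfl w) (h1.trans ?_) (norm_nonneg _) (Real.exp_pos _).le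
            refine mul_le_mul (pow_le_pow_left₀ (norm_nonneg _) h2 2) (Real.exp_le_exp.2 (h2.trans ?_))
              (Real.exp_pos _).le (by positivity)
            exact mul_le_mul_of_nonneg_right hη.le (norm_nonneg _)
        _ = ‖η‖ ^ 2 * (‖w‖ ^ 2 * (Real.exp (κ * ‖w‖) * Real.exp (ε * ‖w‖))) := by ring
        _ ≤ ‖η‖ ^ 2 * ((2 / ε ^ 2 * Real.exp (ε * ‖w‖)) * (Real.exp (κ * ‖w‖) * Real.exp (ε * ‖w‖))) := by
            gcongr
            exact sq_le_exp (norm_nonneg _) hε0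
        _ = _ := by
            rw [← Real.exp_add, mul_assoc (2 / ε ^ 2), ← Real.exp_add, mul_assoc]
            congr 3; ring
  have h0 := hO.hasFDerivAt (𝕜 := ℂ) one_lt_two
  have h1 : DifferentiableAt ℂ (fun ζ' => (modeLp γ ζ' - modeLp γ ζ - D (ζ' - ζ)) + modeLp γ ζ + D (ζ' - ζ)) ζ :=
    (h0.differentiableAt.add_const _).add (by fun_prop)
  refine h1.congr_of_eventuallyEq (Filter.Eventually.of_forall fun ζ' => ?_)
  beta_reduce
  abel

/-- The rank one operator `f ↦ (∫ e^{-i ζ · w} f(w) dw) e^{i ζ · w}`. -/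
def modeOp {n : ℕ} (γ : ℝ) (ζ : CSp n) :
    ExpL2 (bracketWeight n (-γ)) →L[ℂ] ExpL2 (bracketWeight n γ) :=
  (expPairing (bracketWeight n γ) (bracketWeight n (-γ)) (modeLp γ (-ζ))).smulRight (modeLp γ ζ)

theorem modeOp_apply {n : ℕ} (γ : ℝ) (ζ : CSp n) (f : ExpL2 (bracketWeight n (-γ))) :
    modeOp γ ζ f = expPairing (bracketWeight n γ) (bracketWeight n (-γ)) (modeLp γ (-ζ)) f •
      modeLp γ ζ := rfl

theorem differentiableAt_modeOp {n : ℕ} {γ : ℝ} {ζ : CSp n} (h : ‖imPart ζ‖ < γ) :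
    DifferentiableAt ℂ (modeOp γ) ζ := by
  have h1 : DifferentiableAt ℂ (fun ζ => modeLp (n := n) γ (-ζ)) ζ := by
    have h2 : DifferentiableAt ℂ (modeLp (n := n) γ) (-ζ) :=
      differentiableAt_modeLp (by rwa [imPart_neg, norm_neg])
    exact DifferentiableAt.comp (g := modeLp (n := n) γ) (f := fun ζ => -ζ) ζ h2 differentiableAt_id.neg
  have h3 := ((ContinuousLinearMap.smulRightL ℂ (ExpL2 (bracketWeight n (-γ)))
    (ExpL2 (bracketWeight n γ))).isBoundedBilinearMap.differentiableAt
      (expPairing (bracketWeight n γ) (bracketWeight n (-γ)) (modeLp γ (-ζ)), modeLp γ ζ))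
  exact DifferentiableAt.comp (f := fun ζ => (expPairing (bracketWeight n γ) (bracketWeight n (-γ))
    (modeLp γ (-ζ)), modeLp γ ζ)) ζ h3
    (((expPairing (bracketWeight n γ) (bracketWeight n (-γ))).differentiableAt.comp ζ h1).prodMk
      (differentiableAt_modeLp h))

theorem norm_modeOp_le {n : ℕ} {γ κ : ℝ} (hγ : 0 < γ) (hκ : κ < γ) {ζ : CSp n} (h : ‖imPart ζ‖ ≤ κ) :
    ‖modeOp γ ζ‖ ≤ modeBound n γ κ ^ 2 := by
  refine ContinuousLinearMap.opNorm_le_bound _ (sq_nonneg _) fun f => ?_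
  rw [modeOp_apply, norm_smul]
  have h1 := norm_modeLp_le hγ hκ h
  have h2 := norm_modeLp_le hγ hκ (ζ := -ζ) (by rwa [imPart_neg, norm_neg])
  have h0 := modeBound_nonneg n γ κ
  calc _ ≤ (‖modeLp γ (-ζ)‖ * ‖f‖) * ‖modeLp γ ζ‖ :=
        mul_le_mul_of_nonneg_right (norm_expPairing_le _ _) (norm_nonneg _)
    _ ≤ (modeBound n γ κ * ‖f‖) * modeBound n γ κ := by gcongr
    _ = _ := by ring

theorem bracketWeight_neg (n : ℕ) (γ : ℝ) (w : RSp n) :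
    bracketWeight n (-γ) w = -bracketWeight n γ w := by simp [bracketWeight]

/-! ### Symbols -/

/-- A reference symbol without zeros in the strip `|Im ζ| ≤ γ`. -/
def refSymbol {n : ℕ} (γ : ℝ) (ζ : CSp n) : ℂ := cdot ζ ζ + ((2 * γ ^ 2 + 1 : ℝ) : ℂ)

/-- The ratio `1 - p / p₁` of the symbol and the reference symbol. -/
def symbolRatio {n : ℕ} (γ : ℝ) (ρ ζ : CSp n) : ℂ :=
  (((2 * γ ^ 2 + 1 : ℝ) : ℂ) - 2 * cdot ρ ζ) / refSymbol γ ζ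

/-- The symbol of the derivative with index `J`. -/
def jetMono {n m : ℕ} (J : JetIndex n m) (ζ : CSp n) : ℂ := ∏ j, Complex.I * ζ (J.2 j)

theorem re_cdot_self {n : ℕ} (ζ : CSp n) : (cdot ζ ζ).re = ‖ζ‖ ^ 2 - 2 * ‖imPart ζ‖ ^ 2 := by
  rw [EuclideanSpace.norm_sq_eq, EuclideanSpace.norm_sq_eq, cdot, Complex.re_sum, Finset.mul_sum,
    ← Finset.sum_sub_distrib]
  refine Finset.sum_congr rfl fun i _ => ?_
  rw [← Complex.normSq_eq_norm_sq, Complex.normSq_apply]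
  simp [imPart]
  ring

/-- In the strip, `Re ζ·ζ = ‖ζ‖² - 2‖Im ζ‖² ≥ ‖ζ‖² - 2γ²`; this is the origin of the constant `2γ² +
1` in `refSymbol`. -/
theorem norm_refSymbol_ge {n : ℕ} {γ : ℝ} {ζ : CSp n} (h : ‖imPart ζ‖ ≤ γ) :
    1 + ‖ζ‖ ^ 2 ≤ ‖refSymbol γ ζ‖ := by
  refine le_trans ?_ (Complex.re_le_norm _)
  rw [refSymbol, Complex.add_re, Complex.ofReal_re, re_cdot_self]
  nlinarith [norm_nonneg (imPart ζ)]

theorem refSymbol_ne_zero {n : ℕ} {γ : ℝ} {ζ : CSp n} (h : ‖imPart ζ‖ ≤ γ) : refSymbol γ ζ ≠ 0 :=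
  fun h0 => by
    have := norm_refSymbol_ge h
    rw [h0, norm_zero] at this
    nlinarith [sq_nonneg ‖ζ‖]

/-- The quadratic parts of the symbol and the reference symbol cancel, so the ratio gains one power
of `ζ`; its powers then decay at any prescribed rate. -/
theorem norm_symbolRatio_le {n : ℕ} {γ P : ℝ} {ρ ζ : CSp n} (h : ‖imPart ζ‖ ≤ γ) (hρ : ‖ρ‖ ≤ P) :
    ‖symbolRatio γ ρ ζ‖ ≤ 2 * (2 * γ ^ 2 + 1 + 2 * P) * (1 + ‖ζ‖)⁻¹ := by
  have h1 := norm_refSymbol_ge h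
  have h0 : 0 < 1 + ‖ζ‖ ^ 2 := by positivity
  have hP : 0 ≤ P := (norm_nonneg _).trans hρ
  rw [symbolRatio, norm_div, ← div_eq_mul_inv, div_le_div_iff₀ (h0.trans_le h1) (by positivity)]
  have h2 : ‖((2 * γ ^ 2 + 1 : ℝ) : ℂ) - 2 * cdot ρ ζ‖ ≤ (2 * γ ^ 2 + 1) + 2 * (P * ‖ζ‖) := by
    refine (norm_sub_le _ _).trans (add_le_add (le_of_eq ?_) ?_)
    · rw [Complex.norm_real, Real.norm_of_nonneg (by positivity)]
    · rw [norm_mul, Complex.norm_two]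
      gcongr
      exact (norm_cdot_le _ _).trans (by gcongr)
  have hz := norm_nonneg ζ
  calc _ ≤ ((2 * γ ^ 2 + 1) + 2 * (P * ‖ζ‖)) * (1 + ‖ζ‖) := by gcongr
    _ ≤ 2 * (2 * γ ^ 2 + 1 + 2 * P) * (1 + ‖ζ‖ ^ 2) := by
        nlinarith [sq_nonneg (1 - ‖ζ‖), sq_nonneg γ, mul_nonneg hP hz,
          mul_nonneg (sq_nonneg γ) (sq_nonneg (1 - ‖ζ‖)), mul_nonneg hP (sq_nonneg (1 - ‖ζ‖)),
          mul_nonneg (sq_nonneg γ) hz, mul_nonneg hP (sq_nonneg ‖ζ‖), mul_nonneg (sq_nonneg γ) (sq_nonneg ‖ζ‖)]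
    _ ≤ _ := by gcongr

theorem norm_jetMono_le {n : ℕ} (J : JetIndex n 2) (ζ : CSp n) : ‖jetMono J ζ‖ ≤ (1 + ‖ζ‖) ^ 2 := by
  unfold jetMono
  rw [norm_prod]
  calc _ ≤ ∏ _j : Fin J.1, (1 + ‖ζ‖) := by
        refine Finset.prod_le_prod (fun _ _ => norm_nonneg _) fun j _ => ?_
        rw [norm_mul, Complex.norm_I, one_mul]
        linarith [PiLp.norm_apply_le ζ (J.2 j)]
    _ = (1 + ‖ζ‖) ^ (J.1 : ℕ) := by simp
    _ ≤ _ := pow_le_pow_right₀ (by linarith [norm_nonneg ζ]) (by omega)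

theorem differentiableAt_cdot {n : ℕ} {E : Type*} [NormedAddCommGroup E] [NormedSpace ℂ E]
    {f g : E → CSp n} {x : E} (hf : DifferentiableAt ℂ f x) (hg : DifferentiableAt ℂ g x) :
    DifferentiableAt ℂ (fun x => cdot (f x) (g x)) x := by
  unfold cdot
  refine DifferentiableAt.fun_sum fun i _ => ?_
  exact (((EuclideanSpace.proj (𝕜 := ℂ) i).differentiableAt (x := f x)).comp x hf).mul
    (((EuclideanSpace.proj (𝕜 := ℂ) i).differentiableAt (x := g x)).comp x hg)

/-- The operator valued integrand without the singular factor. -/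
def coreOp {n : ℕ} (γ : ℝ) (N : ℕ) (J : JetIndex n 2) (ρ ζ : CSp n) :
    ExpL2 (bracketWeight n (-γ)) →L[ℂ] ExpL2 (bracketWeight n γ) :=
  (jetMono J ζ * symbolRatio γ ρ ζ ^ N) • modeOp γ ζ

theorem differentiableAt_coreScalar {n : ℕ} {γ : ℝ} {N : ℕ} {J : JetIndex n 2} {E : Type*}
    [NormedAddCommGroup E] [NormedSpace ℂ E] {f g : E → CSp n} {x : E}
    (hf : DifferentiableAt ℂ f x) (hg : DifferentiableAt ℂ g x) (h : ‖imPart (g x)‖ ≤ γ) :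
    DifferentiableAt ℂ (fun x => jetMono J (g x) * symbolRatio γ (f x) (g x) ^ N) x := by
  have h1 : DifferentiableAt ℂ (fun x => jetMono J (g x)) x := by
    unfold jetMono
    have h3 : ∀ j ∈ (Finset.univ : Finset (Fin J.1)),
        DifferentiableAt ℂ (fun x => Complex.I * g x (J.2 j)) x := fun j _ =>
      (((EuclideanSpace.proj (𝕜 := ℂ) (J.2 j)).differentiableAt (x := g x)).comp x hg).const_mul
        Complex.I
    exact (HasFDerivAt.finsetProd fun j hj => (h3 j hj).hasFDerivAt).differentiableAt
  have h2 : DifferentiableAt ℂ (fun x => symbolRatio γ (f x) (g x)) x := by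
    unfold symbolRatio
    simp only [div_eq_mul_inv]
    exact (((differentiableAt_cdot hf hg).const_mul (2 : ℂ)).const_sub _).mul
      (DifferentiableAt.inv (h := fun x => refSymbol γ (g x))
        ((differentiableAt_cdot hg hg).add_const _) (refSymbol_ne_zero h))
  exact h1.mul (h2.pow N)

theorem differentiableAt_coreOp {n : ℕ} {γ : ℝ} {N : ℕ} {J : JetIndex n 2} {E : Type*}
    [NormedAddCommGroup E] [NormedSpace ℂ E] {f g : E → CSp n} {x : E}
    (hf : DifferentiableAt ℂ f x) (hg : DifferentiableAt ℂ g x) (h : ‖imPart (g x)‖ < γ) :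
    DifferentiableAt ℂ (fun x => coreOp γ N J (f x) (g x)) x := by
  unfold coreOp
  exact (differentiableAt_coreScalar hf hg h.le).smul
    (DifferentiableAt.comp (g := modeOp γ) x (differentiableAt_modeOp h) hg)

/-- Continuity of the integrand, from its differentiability in `(ρ, ζ)`. -/
theorem continuousAt_coreOp {n : ℕ} {γ : ℝ} {N : ℕ} {J : JetIndex n 2} {X : Type*}
    [TopologicalSpace X] {ρ : CSp n} {g : X → CSp n} {x : X}
    (hg : ContinuousAt g x) (h : ‖imPart (g x)‖ < γ) :
    ContinuousAt (fun x => coreOp γ N J ρ (g x)) x :=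
  ContinuousAt.comp (g := fun ζ => coreOp γ N J ρ ζ) (f := g)
    (differentiableAt_coreOp (f := fun _ : CSp n => ρ) (g := fun ζ => ζ)
      (differentiableAt_const _) differentiableAt_id h).continuousAt hg

/-- Two of the `2 + 2k` powers of the ratio compensate the derivatives of order at most two. The
others are divided evenly: `k` become decay in `s` and `k` become decay in `y`. -/
theorem norm_coreScalar_le {n : ℕ} {γ P Y s y : ℝ} {k : ℕ} {J : JetIndex n 2} {ρ ζ : CSp n}
    (h : ‖imPart ζ‖ ≤ γ) (hρ : ‖ρ‖ ≤ P) (hs : |s| ≤ ‖ζ‖) (hy0 : 0 ≤ y)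
    (hy : 1 + y ≤ Y * (1 + ‖ζ‖)) :
    ‖jetMono J ζ * symbolRatio γ ρ ζ ^ (2 + 2 * k)‖ ≤ ((2 * (2 * γ ^ 2 + 1 + 2 * P)) ^ (2 + 2 * k) *
      Y ^ k) * (((1 + |s|) ^ k)⁻¹ * ((1 + y) ^ k)⁻¹) := by
  have hP : 0 ≤ P := (norm_nonneg _).trans hρ
  have hz : 0 < 1 + ‖ζ‖ := by positivity
  set A := 2 * (2 * γ ^ 2 + 1 + 2 * P) with hA
  have hA0 : 0 ≤ A := by positivity
  have h1 : ((1 + ‖ζ‖) ^ k)⁻¹ ≤ ((1 + |s|) ^ k)⁻¹ :=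
    inv_anti₀ (by positivity) (pow_le_pow_left₀ (by positivity) (by linarith) _)
  have h2 : ((1 + ‖ζ‖) ^ k)⁻¹ ≤ Y ^ k * ((1 + y) ^ k)⁻¹ := by
    rw [← div_eq_mul_inv, inv_eq_one_div, div_le_div_iff₀ (by positivity) (by positivity), one_mul, ← mul_pow]
    exact pow_le_pow_left₀ (by positivity) hy _
  have hY : 0 ≤ Y ^ k * ((1 + y) ^ k)⁻¹ := le_trans (by positivity) h2
  rw [norm_mul, norm_pow]
  calc _ ≤ (1 + ‖ζ‖) ^ 2 * (A * (1 + ‖ζ‖)⁻¹) ^ (2 + 2 * k) := by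
        gcongr
        · exact norm_jetMono_le J ζ
        · exact norm_symbolRatio_le h hρ
    _ = A ^ (2 + 2 * k) * (((1 + ‖ζ‖) ^ k)⁻¹ * ((1 + ‖ζ‖) ^ k)⁻¹) := by
        rw [mul_pow, pow_add (1 + ‖ζ‖)⁻¹, pow_mul', inv_pow, inv_pow]
        field_simp
    _ ≤ A ^ (2 + 2 * k) * (((1 + |s|) ^ k)⁻¹ * (Y ^ k * ((1 + y) ^ k)⁻¹)) := by
        gcongr
    _ = _ := by ring

theorem norm_coreOp_le {n : ℕ} {γ κ P Y s y : ℝ} {k : ℕ} {J : JetIndex n 2} {ρ ζ : CSp n}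
    (hγ : 0 < γ) (hκ : κ < γ)
    (h : ‖imPart ζ‖ ≤ κ) (hρ : ‖ρ‖ ≤ P) (hs : |s| ≤ ‖ζ‖) (hy0 : 0 ≤ y)
    (hy : 1 + y ≤ Y * (1 + ‖ζ‖)) :
    ‖coreOp γ (2 + 2 * k) J ρ ζ‖ ≤ ((2 * (2 * γ ^ 2 + 1 + 2 * P)) ^ (2 + 2 * k) *
      Y ^ k * modeBound n γ κ ^ 2) * (((1 + |s|) ^ k)⁻¹ * ((1 + y) ^ k)⁻¹) := by
  rw [coreOp, norm_smul]
  calc _ ≤ _ := mul_le_mul (norm_coreScalar_le (k := k) (J := J) (h.trans hκ.le) hρ hs hy0 hy)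
        (norm_modeOp_le hγ hκ h) (norm_nonneg _) ((norm_nonneg _).trans (norm_coreScalar_le (k := k) (J := J) (h.trans hκ.le) hρ hs hy0 hy))
    _ = _ := by ring

/-- One power of `1 + |s|` pays for the growth in `norm_symbol_ge`, and `inv_add_le_rpow_mul`
separates the variables. The result is the product majorant used for every singular integrand. -/
theorem norm_inv_symbol_mul_le {z : ℂ} (hz : z.im ≠ 0) {s τ y : ℝ} (hs : s ≠ 0) (hτ : τ ≠ 0)
    (hy : 0 ≤ y) (d : ℕ) :
    ‖((s : ℂ) ^ 2 + 2 * z * s + τ)⁻¹‖ * (((1 + |s|) ^ (d + 3))⁻¹ * ((1 + y) ^ (d + 3))⁻¹) ≤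
      (1 + (1 + 2 * ‖z‖ + 1) / (2 * |z.im|)) * ((|s| ^ (-(1 / 2) : ℝ) * ((1 + |s|) ^ 2)⁻¹) *
        (|τ| ^ (-(1 / 2) : ℝ) * ((1 + y) ^ (d + 1))⁻¹)) := by
  obtain ⟨h1, h2⟩ := norm_symbol_ge hz s τ
  set q := (s : ℂ) ^ 2 + 2 * z * s + τ
  set X := 1 + (1 + 2 * ‖z‖ + 1) / (2 * |z.im|)
  have hs0 := abs_pos.2 hs
  have hτ0 := abs_pos.2 hτ
  have hX : 0 < X := by positivity
  have hq : 0 < ‖q‖ := by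
    refine lt_of_lt_of_le ?_ h1
    have := abs_pos.2 hz
    positivity
  have h3 : ‖q⁻¹‖ ≤ (1 + |s|) * X * (|s| ^ (-(1 / 2) : ℝ) * |τ| ^ (-(1 / 2) : ℝ)) := by
    rw [norm_inv]
    calc ‖q‖⁻¹ ≤ (1 + |s|) * X * (|s| + |τ|)⁻¹ := by
          rw [← div_eq_mul_inv, inv_eq_one_div, div_le_div_iff₀ hq (by positivity)]
          linarith
      _ ≤ _ := by
          gcongr
          exact inv_add_le_rpow_mul hs0 hτ0
  have h4 : (1 + |s|) * ((1 + |s|) ^ (d + 3))⁻¹ ≤ ((1 + |s|) ^ 2)⁻¹ := by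
    rw [← div_eq_mul_inv, inv_eq_one_div, div_le_div_iff₀ (by positivity) (by positivity), one_mul, ← pow_succ']
    exact pow_le_pow_right₀ (by linarith) (by omega)
  have h5 : ((1 + y) ^ (d + 3))⁻¹ ≤ ((1 + y) ^ (d + 1))⁻¹ :=
    inv_anti₀ (by positivity) (pow_le_pow_right₀ (by linarith) (by omega))
  calc _ ≤ ((1 + |s|) * X * (|s| ^ (-(1 / 2) : ℝ) * |τ| ^ (-(1 / 2) : ℝ))) *
        (((1 + |s|) ^ (d + 3))⁻¹ * ((1 + y) ^ (d + 1))⁻¹) := by gcongr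
    _ = X * ((|s| ^ (-(1 / 2) : ℝ) * ((1 + |s|) * ((1 + |s|) ^ (d + 3))⁻¹)) *
        (|τ| ^ (-(1 / 2) : ℝ) * ((1 + y) ^ (d + 1))⁻¹)) := by ring
    _ ≤ _ := by gcongr

/-! ### Complex square roots -/

/-- The principal complex square root. -/
def csqrt (w : ℂ) : ℂ := w ^ (((2 : ℕ) : ℂ)⁻¹)

theorem csqrt_sq (w : ℂ) : csqrt w ^ 2 = w := Complex.cpow_nat_inv_pow w two_ne_zero

theorem csqrt_ofReal {x : ℝ} (hx : 0 ≤ x) : csqrt (x : ℂ) = (Real.sqrt x : ℝ) := by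
  rw [csqrt, Real.sqrt_eq_rpow, Complex.ofReal_cpow hx]
  norm_num

theorem differentiableAt_csqrt {w : ℂ} (hw : 0 < w.re) : DifferentiableAt ℂ csqrt w := by
  unfold csqrt
  exact differentiableAt_id.cpow_const (Or.inl hw)

/-- Comparison with the real root of `Re w` through `abs_im_sqrt_le`. The bound sees only `Im w`, so
it is unaffected when a positive real number such as `‖y‖² - 1` is added to `w`. -/
theorem abs_im_csqrt_le {w : ℂ} (hw : 0 ≤ w.re) : |(csqrt w).im| ≤ Real.sqrt |w.im| := by
  have h := abs_im_sqrt_le (a := ((Real.sqrt w.re : ℝ) : ℂ)) (b := csqrt w)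
  have e : csqrt w ^ 2 - ((Real.sqrt w.re : ℝ) : ℂ) ^ 2 = ((w.im : ℝ) : ℂ) * Complex.I := by
    rw [csqrt_sq, ← Complex.ofReal_pow, Real.sq_sqrt hw]
    apply Complex.ext <;> simp
  rw [e, Complex.ofReal_im, abs_zero, zero_add, norm_mul, Complex.norm_I, mul_one,
    Complex.norm_real, Real.norm_eq_abs] at h
  exact h

theorem norm_csqrt_sq (w : ℂ) : ‖csqrt w‖ ^ 2 = ‖w‖ := by rw [← norm_pow, csqrt_sq]

/-! ### The deformed contours -/

/-- The vector `ρ = z ν + ρ_⊥` for complex `ρ_⊥`. -/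
def paramVec {n : ℕ} {ν : RSp n} (p : ℂ × PerpC ν) : CSp n := p.1 • toC ν + p.2.1

/-- The point `t ν + c B y - ρ_⊥` of a contour. -/
def contourVec {d : ℕ} (ν : RSp (d + 1)) (B : RSp d →ₗᵢ[ℝ] RSp (d + 1)) (ρ : CSp (d + 1))
    (t c : ℂ) (y : RSp d) : CSp (d + 1) := t • toC ν + c • toC (B y) - ρ

/-- The admissible set of complex `ρ_⊥`. -/
def perpDomain {n : ℕ} (γ : ℝ) (ν : RSp n) : Set (PerpC ν) :=
  -- The first condition keeps `√L` holomorphic. The numerical bounds are a budget for the imaginary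
  -- part of the frequency: at most `γ/4` from the shift, `γ/8` from the square root and `γ/4` from
  -- `ρ_⊥`, less than `3γ/4` in total.
  {ρ | 0 < (cdot ρ.1 ρ.1).re ∧ Real.sqrt |(cdot ρ.1 ρ.1).im| < γ / 8 ∧ ‖imPart ρ.1‖ < γ / 4}

/-- The half space of parameters with `σ Im z > 0`. -/
def paramDomain {n : ℕ} (γ : ℝ) (ν : RSp n) (σ : ℝ) : Set (ℂ × PerpC ν) :=
  {z : ℂ | 0 < σ * z.im} ×ˢ perpDomain γ ν

/-- The shifted line variable `s + i σ γ/4`. -/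
def shiftVar (γ σ s : ℝ) : ℂ := (s : ℂ) + ((σ * (γ / 4) : ℝ) : ℂ) * Complex.I

/-- The integrand over `|y| < 1`. -/
def innerFun {d : ℕ} (γ σ : ℝ) {ν : RSp (d + 1)} (B : RSp d →ₗᵢ[ℝ] RSp (d + 1)) (N : ℕ)
    (J : JetIndex (d + 1) 2) (p : ℂ × PerpC ν) (x : ℝ × RSp d) :
    ExpL2 (bracketWeight (d + 1) (-γ)) →L[ℂ] ExpL2 (bracketWeight (d + 1) γ) :=
  -- The power of `√L` is the Jacobian of the scaling of `y` by `√L`, after which the constant term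
  -- of the symbol is `-L (1 - ‖y‖²)`.
  (csqrt (cdot p.2.1 p.2.1) ^ d * (shiftVar γ σ x.1 ^ 2 + 2 * p.1 * shiftVar γ σ x.1 -
      cdot p.2.1 p.2.1 * ((1 - ‖x.2‖ ^ 2 : ℝ) : ℂ))⁻¹) •
    coreOp γ N J (paramVec p)
      (contourVec ν B p.2.1 (shiftVar γ σ x.1) (csqrt (cdot p.2.1 p.2.1)) x.2)

/-- The radial scaling factor on `|y| > 1`. -/
def outerScale {d : ℕ} (L : ℂ) (y : RSp d) : ℂ :=
  -- With this scale `c` one has `c² ‖y‖² - L = ‖y‖² - 1`, so `ρ_⊥` disappears from the symbol.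
  csqrt (L + ((‖y‖ ^ 2 - 1 : ℝ) : ℂ)) * ((‖y‖⁻¹ : ℝ) : ℂ)

/-- The integrand over `|y| > 1`. -/
def outerFun {d : ℕ} (γ : ℝ) {ν : RSp (d + 1)} (B : RSp d →ₗᵢ[ℝ] RSp (d + 1)) (N : ℕ)
    (J : JetIndex (d + 1) 2) (p : ℂ × PerpC ν) (x : ℝ × RSp d) :
    ExpL2 (bracketWeight (d + 1) (-γ)) →L[ℂ] ExpL2 (bracketWeight (d + 1) γ) :=
  -- The holomorphic continuation of the Jacobian in `integral_outer`.
  (outerScale (cdot p.2.1 p.2.1) x.2 ^ (d - 2) *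
      ((x.1 : ℂ) ^ 2 + 2 * p.1 * x.1 + ((‖x.2‖ ^ 2 - 1 : ℝ) : ℂ))⁻¹) •
    coreOp γ N J (paramVec p)
      (contourVec ν B p.2.1 x.1 (outerScale (cdot p.2.1 p.2.1) x.2) x.2)

theorem isOpen_perpDomain {n : ℕ} (γ : ℝ) (ν : RSp n) : IsOpen (perpDomain γ ν) := by
  have h1 : Continuous fun ρ : PerpC ν => cdot ρ.1 ρ.1 :=
    continuous_cdot continuous_subtype_val continuous_subtype_val
  have h2 : Continuous fun ρ : PerpC ν => imPart ρ.1 := continuous_imPart.comp continuous_subtype_val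
  exact (isOpen_lt continuous_const (Complex.continuous_re.comp h1)).and
    ((isOpen_lt (Complex.continuous_im.comp h1).abs.sqrt continuous_const).and
      (isOpen_lt h2.norm continuous_const))

theorem isOpen_paramDomain {n : ℕ} (γ : ℝ) (ν : RSp n) (σ : ℝ) : IsOpen (paramDomain γ ν σ) :=
  (isOpen_lt continuous_const (continuous_const.mul Complex.continuous_im)).prod
    (isOpen_perpDomain γ ν)

theorem perpToC_mem_perpDomain {n : ℕ} {γ : ℝ} (hγ : 0 < γ) {ν : RSp n} {x : PerpR ν} (hx : x ≠ 0) :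
    perpToC x ∈ perpDomain γ ν := by
  have h : cdot (perpToC x).1 (perpToC x).1 = ((‖x.1‖ ^ 2 : ℝ) : ℂ) := by
    change cdot (toC x.1) (toC x.1) = _
    rw [cdot_toC, real_inner_self_eq_norm_sq]
  have hx' : 0 < ‖x.1‖ := norm_pos_iff.2 fun h0 => hx (Subtype.ext h0)
  refine ⟨?_, ?_, ?_⟩
  · rw [h, Complex.ofReal_re]; positivity
  · rw [h, Complex.ofReal_im]; simpa using hγ
  · change ‖imPart (toC x.1)‖ < _
    rw [imPart_toC, norm_zero]; positivity

theorem shiftVar_im (γ σ s : ℝ) : (shiftVar γ σ s).im = σ * (γ / 4) := by simp [shiftVar]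

theorem shiftVar_re (γ σ s : ℝ) : (shiftVar γ σ s).re = s := by simp [shiftVar]

section

variable {d : ℕ} {γ : ℝ} {ν : RSp (d + 1)} {B : RSp d →ₗᵢ[ℝ] RSp (d + 1)}

/-- The bilinear product with `ν` isolates `t`, because both `B y` and `ρ_⊥` are annihilated by it.
-/
theorem norm_le_norm_contourVec (hν : ‖ν‖ = 1) (hB : ∀ y, inner ℝ ν (B y) = 0) (ρ : PerpC ν)
    (t c : ℂ) (y : RSp d) : ‖t‖ ≤ ‖contourVec ν B ρ.1 t c y‖ := by
  have h1 : cdot (contourVec ν B ρ.1 t c y) (toC ν) = t := by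
    have h2 : cdot ρ.1 (toC ν) = 0 := ρ.2
    rw [contourVec, sub_eq_add_neg, add_cdot, add_cdot, smul_cdot, smul_cdot, neg_cdot, h2, cdot_toC,
      cdot_toC, real_inner_self_eq_norm_sq, hν, real_inner_comm, hB]
    simp
  have := norm_cdot_le (contourVec ν B ρ.1 t c y) (toC ν)
  rwa [h1, norm_toC, hν, mul_one] at this

theorem norm_imPart_contourVec_le (hν : ‖ν‖ = 1) (ρ : CSp (d + 1)) (t c : ℂ) (y : RSp d) :
    ‖imPart (contourVec ν B ρ t c y)‖ ≤ |t.im| + |c.im| * ‖y‖ + ‖imPart ρ‖ := by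
  rw [contourVec, imPart_sub, imPart_add, imPart_smul_toC, imPart_smul_toC]
  refine (norm_sub_le _ _).trans (add_le_add ((norm_add_le _ _).trans (add_le_add ?_ ?_)) le_rfl)
  · rw [norm_smul, hν, mul_one, Real.norm_eq_abs]
  · rw [norm_smul, B.norm_map, Real.norm_eq_abs]

theorem norm_smul_le_of_contourVec (hν : ‖ν‖ = 1) (hB : ∀ y, inner ℝ ν (B y) = 0) (ρ : PerpC ν)
    (t c : ℂ) (y : RSp d) : ‖c‖ * ‖y‖ ≤ 2 * ‖contourVec ν B ρ.1 t c y‖ + ‖ρ.1‖ := by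
  have h1 : c • toC (B y) = contourVec ν B ρ.1 t c y + ρ.1 - t • toC ν := by
    rw [contourVec]; abel
  have h2 : ‖c • toC (B y)‖ = ‖c‖ * ‖y‖ := by rw [norm_smul, norm_toC, B.norm_map]
  have h3 := norm_sub_le (contourVec ν B ρ.1 t c y + ρ.1) (t • toC ν)
  have h4 := norm_add_le (contourVec ν B ρ.1 t c y) ρ.1
  have h5 := norm_le_norm_contourVec hν hB ρ t c y
  rw [norm_smul t, norm_toC, hν, mul_one] at h3
  rw [← h2, h1]
  linarith

theorem norm_imPart_inner_le (hγ : 0 < γ) (hν : ‖ν‖ = 1) {σ : ℝ} (hσ : σ = 1 ∨ σ = -1) {ρ : PerpC ν}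
    (hρ : ρ ∈ perpDomain γ ν) {s : ℝ} {y : RSp d} (hy : ‖y‖ ≤ 1) :
    ‖imPart (contourVec ν B ρ.1 (shiftVar γ σ s) (csqrt (cdot ρ.1 ρ.1)) y)‖ ≤ 3 * γ / 4 := by
  obtain ⟨h1, h2, h3⟩ := hρ
  have h4 := norm_imPart_contourVec_le (B := B) hν ρ.1 (shiftVar γ σ s) (csqrt (cdot ρ.1 ρ.1)) y
  have h5 := abs_im_csqrt_le h1.le
  have h6 : |(csqrt (cdot ρ.1 ρ.1)).im| * ‖y‖ ≤ γ / 8 :=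
    (mul_le_of_le_one_right (abs_nonneg _) hy).trans (h5.trans h2.le)
  have h7 : |(shiftVar γ σ s).im| = γ / 4 := by
    rw [shiftVar_im]
    rcases hσ with rfl | rfl <;> simp <;> linarith
  linarith

theorem norm_outerScale_mul {L : ℂ} {y : RSp d} (hy : 1 < ‖y‖) :
    ‖outerScale L y‖ * ‖y‖ = ‖csqrt (L + ((‖y‖ ^ 2 - 1 : ℝ) : ℂ))‖ := by
  have hy0 : ‖y‖ ≠ 0 := by positivity
  rw [outerScale, norm_mul, Complex.norm_real, Real.norm_of_nonneg (by positivity)]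
  field_simp

/-- Although `y` is unbounded, `|Im c| ‖y‖` is the imaginary part of `√(L + ‖y‖² - 1)` in modulus,
which `|Im L|` alone controls. This uniformity allows the radial deformation up to infinity. -/
theorem norm_imPart_outer_le (hγ : 0 < γ) (hν : ‖ν‖ = 1) {ρ : PerpC ν}
    (hρ : ρ ∈ perpDomain γ ν) {s : ℝ} {y : RSp d} (hy : 1 < ‖y‖) :
    ‖imPart (contourVec ν B ρ.1 s (outerScale (cdot ρ.1 ρ.1) y) y)‖ ≤ 3 * γ / 4 := by
  obtain ⟨h1, h2, h3⟩ := hρ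
  have h4 := norm_imPart_contourVec_le (B := B) hν ρ.1 s (outerScale (cdot ρ.1 ρ.1) y) y
  have h5 := abs_im_csqrt_le (w := cdot ρ.1 ρ.1 + ((‖y‖ ^ 2 - 1 : ℝ) : ℂ))
    (by rw [Complex.add_re, Complex.ofReal_re]; nlinarith)
  have h6 : |(outerScale (cdot ρ.1 ρ.1) y).im| * ‖y‖ ≤ γ / 8 := by
    have hy0 : ‖y‖ ≠ 0 := by positivity
    rw [outerScale, Complex.im_mul_ofReal, abs_mul, abs_of_nonneg (by positivity : 0 ≤ ‖y‖⁻¹), mul_assoc,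
      inv_mul_cancel₀ hy0, mul_one]
    refine h5.trans ?_
    rw [Complex.add_im, Complex.ofReal_im, add_zero]
    exact h2.le
  rw [Complex.ofReal_im, abs_zero] at h4
  linarith

theorem inner_symbol_lower (hγ : 0 < γ) {σ : ℝ} (hσ : σ = 1 ∨ σ = -1) {p : ℂ × PerpC ν}
    (hp : p ∈ paramDomain γ ν σ) {s : ℝ} {y : RSp d} (hy : ‖y‖ ≤ 1) :
    (γ / 8) ^ 2 ≤ ‖shiftVar γ σ s ^ 2 + 2 * p.1 * shiftVar γ σ s -
      cdot p.2.1 p.2.1 * ((1 - ‖y‖ ^ 2 : ℝ) : ℂ)‖ := by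
  have h := norm_shifted_symbol_ge (δ := γ / 4) (θ := 1 - ‖y‖ ^ 2) hσ hp.1 hp.2.1.le
    (by linarith [hp.2.2.1]) (by nlinarith [norm_nonneg y]) (by nlinarith [norm_nonneg y]) (by linarith)
    (shiftVar_im γ σ s)
  refine le_trans ?_ h
  nlinarith [abs_nonneg p.1.im]

theorem outer_symbol_ne_zero {σ : ℝ} {p : ℂ × PerpC ν} (hp : p ∈ paramDomain γ ν σ)
    {s : ℝ} {y : RSp d} (hy : 1 < ‖y‖) :
    (s : ℂ) ^ 2 + 2 * p.1 * s + ((‖y‖ ^ 2 - 1 : ℝ) : ℂ) ≠ 0 := by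
  intro h0
  have hz : p.1.im ≠ 0 := fun h => by have := hp.1; simp [h] at this
  have h := (norm_symbol_ge hz s (‖y‖ ^ 2 - 1)).2
  rw [h0, norm_zero, zero_mul] at h
  have := abs_nonneg s
  have h1 : |‖y‖ ^ 2 - 1| ≤ 0 := by linarith
  have h2 := abs_nonpos_iff.1 h1
  nlinarith

theorem differentiable_perp : Differentiable ℂ fun p : ℂ × PerpC ν => p.2.1 :=
  (PerpC ν).subtypeL.differentiable.comp differentiable_snd

theorem differentiable_paramVec : Differentiable ℂ (paramVec : ℂ × PerpC ν → CSp (d + 1)) := by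
  unfold paramVec
  exact (differentiable_fst.smul_const _).add differentiable_perp

theorem differentiableAt_innerFun (hγ : 0 < γ) (hν : ‖ν‖ = 1) {σ : ℝ} (hσ : σ = 1 ∨ σ = -1) {N : ℕ}
    {J : JetIndex (d + 1) 2} {p : ℂ × PerpC ν} (hp : p ∈ paramDomain γ ν σ) {x : ℝ × RSp d}
    (hx : ‖x.2‖ ≤ 1) : DifferentiableAt ℂ (fun p => innerFun γ σ B N J p x) p := by
  have hL : DifferentiableAt ℂ (fun p : ℂ × PerpC ν => cdot p.2.1 p.2.1) p :=
    differentiableAt_cdot differentiable_perp.differentiableAt differentiable_perp.differentiableAt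
  have hs : DifferentiableAt ℂ (fun p : ℂ × PerpC ν => csqrt (cdot p.2.1 p.2.1)) p :=
    DifferentiableAt.comp (g := csqrt) p (differentiableAt_csqrt hp.2.1) hL
  have hq : DifferentiableAt ℂ (fun p : ℂ × PerpC ν => shiftVar γ σ x.1 ^ 2 + 2 * p.1 * shiftVar γ σ x.1 -
      cdot p.2.1 p.2.1 * ((1 - ‖x.2‖ ^ 2 : ℝ) : ℂ)) p := by
    have := hL.mul_const ((1 - ‖x.2‖ ^ 2 : ℝ) : ℂ)
    fun_prop
  have hq0 : shiftVar γ σ x.1 ^ 2 + 2 * p.1 * shiftVar γ σ x.1 -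
      cdot p.2.1 p.2.1 * ((1 - ‖x.2‖ ^ 2 : ℝ) : ℂ) ≠ 0 := fun h => by
    have := inner_symbol_lower (s := x.1) hγ hσ hp hx
    rw [h, norm_zero] at this
    have : 0 < (γ / 8) ^ 2 := by positivity
    linarith
  refine ((hs.pow d).mul (DifferentiableAt.inv hq hq0)).smul (differentiableAt_coreOp
    differentiable_paramVec.differentiableAt ?_
    ((norm_imPart_inner_le hγ hν hσ hp.2 hx).trans_lt (by linarith)))
  unfold contourVec
  exact ((hs.smul_const _).const_add _).sub differentiable_perp.differentiableAt

theorem differentiableAt_outerFun (hγ : 0 < γ) (hν : ‖ν‖ = 1) {σ : ℝ} {N : ℕ}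
    {J : JetIndex (d + 1) 2} {p : ℂ × PerpC ν} (hp : p ∈ paramDomain γ ν σ) {x : ℝ × RSp d}
    (hx : 1 < ‖x.2‖) : DifferentiableAt ℂ (fun p => outerFun γ B N J p x) p := by
  have hL : DifferentiableAt ℂ (fun p : ℂ × PerpC ν => cdot p.2.1 p.2.1 + ((‖x.2‖ ^ 2 - 1 : ℝ) : ℂ)) p :=
    (differentiableAt_cdot differentiable_perp.differentiableAt
      differentiable_perp.differentiableAt).add_const _
  have hs : DifferentiableAt ℂ (fun p : ℂ × PerpC ν => outerScale (cdot p.2.1 p.2.1) x.2) p := by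
    unfold outerScale
    refine (DifferentiableAt.comp (g := csqrt) p (differentiableAt_csqrt ?_) hL).mul_const _
    rw [Complex.add_re, Complex.ofReal_re]
    nlinarith [hp.2.1]
  have hq : DifferentiableAt ℂ (fun p : ℂ × PerpC ν =>
      (x.1 : ℂ) ^ 2 + 2 * p.1 * x.1 + ((‖x.2‖ ^ 2 - 1 : ℝ) : ℂ)) p := by fun_prop
  refine ((hs.pow _).mul (DifferentiableAt.inv hq (outer_symbol_ne_zero hp hx))).smul
    (differentiableAt_coreOp differentiable_paramVec.differentiableAt ?_
    ((norm_imPart_outer_le hγ hν hp.2 hx).trans_lt (by linarith)))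
  unfold contourVec
  exact ((hs.smul_const _).const_add _).sub differentiable_perp.differentiableAt

theorem continuous_shiftVar {σ : ℝ} : Continuous fun x : ℝ × RSp d => shiftVar γ σ x.1 := by
  unfold shiftVar; fun_prop

theorem continuousOn_innerFun (hγ : 0 < γ) (hν : ‖ν‖ = 1) {σ : ℝ} (hσ : σ = 1 ∨ σ = -1) {N : ℕ}
    {J : JetIndex (d + 1) 2} {p : ℂ × PerpC ν} (hp : p ∈ paramDomain γ ν σ) :
    ContinuousOn (innerFun γ σ B N J p) (Set.univ ×ˢ Metric.ball 0 1) := by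
  intro x hx
  have hx2 : ‖x.2‖ ≤ 1 := (mem_ball_zero_iff.1 hx.2).le
  refine ContinuousAt.continuousWithinAt ?_
  have hs := (continuous_shiftVar (γ := γ) (σ := σ) (d := d)).continuousAt (x := x)
  have hq : ContinuousAt (fun x : ℝ × RSp d => shiftVar γ σ x.1 ^ 2 + 2 * p.1 * shiftVar γ σ x.1 -
      cdot p.2.1 p.2.1 * ((1 - ‖x.2‖ ^ 2 : ℝ) : ℂ)) x := by fun_prop
  refine ContinuousAt.smul (continuousAt_const.mul (ContinuousAt.inv₀ hq fun h => ?_))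
    (continuousAt_coreOp ?_ ((norm_imPart_inner_le hγ hν hσ hp.2 hx2).trans_lt (by linarith)))
  · have := inner_symbol_lower (s := x.1) hγ hσ hp hx2
    rw [h, norm_zero] at this
    have : 0 < (γ / 8) ^ 2 := by positivity
    linarith
  · unfold contourVec
    have h2 : ContinuousAt (fun x : ℝ × RSp d => toC (B x.2)) x :=
      (continuous_toC.comp (B.continuous.comp continuous_snd)).continuousAt
    fun_prop

theorem continuousOn_outerFun (hγ : 0 < γ) (hν : ‖ν‖ = 1) {σ : ℝ} {N : ℕ}
    {J : JetIndex (d + 1) 2} {p : ℂ × PerpC ν} (hp : p ∈ paramDomain γ ν σ) :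
    ContinuousOn (outerFun γ B N J p) (Set.univ ×ˢ {y | 1 < ‖y‖}) := by
  intro x hx
  have hx2 : 1 < ‖x.2‖ := hx.2
  refine ContinuousAt.continuousWithinAt ?_
  have hs : ContinuousAt (fun x : ℝ × RSp d => outerScale (cdot p.2.1 p.2.1) x.2) x := by
    unfold outerScale
    refine ContinuousAt.mul (ContinuousAt.comp (g := csqrt) ?_ (by fun_prop)) ?_
    · refine (differentiableAt_csqrt ?_).continuousAt
      rw [Complex.add_re, Complex.ofReal_re]
      nlinarith [hp.2.1]
    · refine Complex.continuous_ofReal.continuousAt.comp (ContinuousAt.inv₀ (by fun_prop) ?_)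
      positivity
  have hq : ContinuousAt (fun x : ℝ × RSp d =>
      (x.1 : ℂ) ^ 2 + 2 * p.1 * x.1 + ((‖x.2‖ ^ 2 - 1 : ℝ) : ℂ)) x := by fun_prop
  refine ContinuousAt.smul ((hs.pow _).mul (ContinuousAt.inv₀ hq (outer_symbol_ne_zero hp hx2)))
    (continuousAt_coreOp ?_ ((norm_imPart_outer_le hγ hν hp.2 hx2).trans_lt (by linarith)))
  unfold contourVec
  have h2 : ContinuousAt (fun x : ℝ × RSp d => toC (B x.2)) x :=
    (continuous_toC.comp (B.continuous.comp continuous_snd)).continuousAt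
  fun_prop

end

/-! ### Majorants and analyticity of the contour integrals. -/

theorem nontrivial_RSp {d : ℕ} (hd : 2 ≤ d) : Nontrivial (RSp d) :=
  Module.nontrivial_of_finrank_pos (R := ℝ) (by simp; omega)

section

variable {d : ℕ} {γ : ℝ} {ν : RSp (d + 1)} {B : RSp d →ₗᵢ[ℝ] RSp (d + 1)}

/-- The majorant constant for the regular part of the integrands. -/
def coreConst (d : ℕ) (γ P : ℝ) : ℝ :=
  (2 * (2 * γ ^ 2 + 1 + 2 * P)) ^ (2 + 2 * (d + 3)) * (2 + P) ^ (d + 3) *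
    modeBound (d + 1) γ (3 * γ / 4) ^ 2

theorem coreConst_nonneg {P : ℝ} (hP : 0 ≤ P) : 0 ≤ coreConst d γ P := by
  unfold coreConst; positivity

theorem norm_innerFun_le (hγ : 0 < γ) (hν : ‖ν‖ = 1) (hB : ∀ y, inner ℝ ν (B y) = 0) {σ : ℝ}
    (hσ : σ = 1 ∨ σ = -1) {J : JetIndex (d + 1) 2} {p : ℂ × PerpC ν} (hp : p ∈ paramDomain γ ν σ)
    {P : ℝ} (hP : ‖paramVec p‖ ≤ P) (hP2 : ‖p.2.1‖ ≤ P) {x : ℝ × RSp d} (hx : ‖x.2‖ ≤ 1) :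
    ‖innerFun γ σ B (2 + 2 * (d + 3)) J p x‖ ≤
      P ^ d * ((γ / 8) ^ 2)⁻¹ * coreConst d γ P * ((1 + |x.1|) ^ (d + 3))⁻¹ := by
  have hP0 : 0 ≤ P := (norm_nonneg _).trans hP
  have h1 := inner_symbol_lower (s := x.1) hγ hσ hp hx
  set ζ := contourVec ν B p.2.1 (shiftVar γ σ x.1) (csqrt (cdot p.2.1 p.2.1)) x.2 with hζ
  have hs : |x.1| ≤ ‖ζ‖ := by
    refine le_trans ?_ (norm_le_norm_contourVec hν hB p.2 (shiftVar γ σ x.1) _ x.2)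
    have := Complex.abs_re_le_norm (shiftVar γ σ x.1)
    rwa [shiftVar_re] at this
  -- On the unit ball no transversal decay is needed; with `y := 0` the second decay factor equals
  -- 1.
  have h2 := norm_coreOp_le (k := d + 3) (J := J) (Y := 2 + P) (y := 0) hγ (κ := 3 * γ / 4) (by linarith)
    (norm_imPart_inner_le (B := B) (s := x.1) hγ hν hσ hp.2 hx) hP hs le_rfl
    (by nlinarith [norm_nonneg ζ])
  have h3 : ‖csqrt (cdot p.2.1 p.2.1)‖ ≤ P := by
    refine abs_le_of_sq_le_sq' ?_ hP0 |>.2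
    rw [norm_csqrt_sq]
    refine (norm_cdot_le _ _).trans ?_
    rw [pow_two]; gcongr
  rw [innerFun, norm_smul, norm_mul, norm_pow, norm_inv]
  have h4 : 0 < (γ / 8) ^ 2 := by positivity
  rw [mul_assoc _ (coreConst d γ P)]
  refine mul_le_mul ?_ (h2.trans (le_of_eq (by simp [coreConst]))) (norm_nonneg _) (by positivity)
  gcongr

theorem norm_outerFun_le (hγ : 0 < γ) (hν : ‖ν‖ = 1) (hB : ∀ y, inner ℝ ν (B y) = 0) {σ : ℝ}
    {J : JetIndex (d + 1) 2} {p : ℂ × PerpC ν} (hp : p ∈ paramDomain γ ν σ)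
    {P X : ℝ} (hP : ‖paramVec p‖ ≤ P) (hP2 : ‖p.2.1‖ ≤ P)
    (hX : 1 + (1 + 2 * ‖p.1‖ + 1) / (2 * |p.1.im|) ≤ X) {x : ℝ × RSp d} (hs0 : x.1 ≠ 0)
    (hx : 1 < ‖x.2‖) :
    ‖outerFun γ B (2 + 2 * (d + 3)) J p x‖ ≤
      (1 + P) ^ (d - 2) * coreConst d γ P * X * ((|x.1| ^ (-(1 / 2) : ℝ) * ((1 + |x.1|) ^ 2)⁻¹) *
        (|‖x.2‖ ^ 2 - 1| ^ (-(1 / 2) : ℝ) * ((1 + ‖x.2‖) ^ (d + 1))⁻¹)) := by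
  have hP0 : 0 ≤ P := (norm_nonneg _).trans hP
  have hz : p.1.im ≠ 0 := fun h => by have := hp.1; simp [h] at this
  have hτ : ‖x.2‖ ^ 2 - 1 ≠ 0 := by nlinarith
  have hy0 : 0 < ‖x.2‖ := by linarith
  set c := outerScale (cdot p.2.1 p.2.1) x.2 with hc
  set ζ := contourVec ν B p.2.1 x.1 c x.2 with hζ
  have hs : |x.1| ≤ ‖ζ‖ := by
    refine le_trans (le_of_eq ?_) (norm_le_norm_contourVec hν hB p.2 (x.1 : ℂ) _ x.2)
    rw [Complex.norm_real, Real.norm_eq_abs]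
  have hcy : (‖c‖ * ‖x.2‖) ^ 2 = ‖cdot p.2.1 p.2.1 + ((‖x.2‖ ^ 2 - 1 : ℝ) : ℂ)‖ := by
    rw [hc, norm_outerScale_mul hx, norm_csqrt_sq]
  have hL : ‖cdot p.2.1 p.2.1‖ ≤ P ^ 2 := by
    refine (norm_cdot_le _ _).trans ?_
    rw [pow_two]; gcongr
  have hc1 : ‖c‖ ≤ 1 + P := by
    have h1 : ‖cdot p.2.1 p.2.1 + ((‖x.2‖ ^ 2 - 1 : ℝ) : ℂ)‖ ≤ P ^ 2 + ‖x.2‖ ^ 2 := by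
      refine (norm_add_le _ _).trans (add_le_add hL ?_)
      rw [Complex.norm_real, Real.norm_of_nonneg (by nlinarith)]
      linarith
    rw [← hcy] at h1
    have h2 : (‖c‖ * ‖x.2‖) ^ 2 ≤ ((1 + P) * ‖x.2‖) ^ 2 := by nlinarith [mul_nonneg hP0 (sq_nonneg ‖x.2‖), sq_nonneg P, mul_nonneg (sq_nonneg P) (by nlinarith : 0 ≤ ‖x.2‖ ^ 2 - 1)]
    have h3 := (abs_le_of_sq_le_sq' h2 (by positivity)).2
    exact le_of_mul_le_mul_right h3 hy0
  -- The frequency controls `y`: since `Re L > 0`, the length `‖c‖ ‖y‖` is at least `√(‖y‖² - 1)`,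
  -- and up to `ρ_⊥` it is bounded by `2‖ζ‖`.
  have hY : 1 + ‖x.2‖ ≤ (2 + P) * (1 + ‖ζ‖) := by
    have h1 := norm_smul_le_of_contourVec hν hB p.2 (x.1 : ℂ) c x.2
    rw [← hζ] at h1
    have h2 : ‖x.2‖ ^ 2 - 1 ≤ (‖c‖ * ‖x.2‖) ^ 2 := by
      rw [hcy]
      refine le_trans ?_ (Complex.re_le_norm _)
      rw [Complex.add_re, Complex.ofReal_re]
      linarith [hp.2.1]
    have h3 : (‖c‖ * ‖x.2‖) ^ 2 ≤ (2 * ‖ζ‖ + P) ^ 2 := pow_le_pow_left₀ (by positivity) (h1.trans (by linarith)) 2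
    have hz0 := norm_nonneg ζ
    have h4 : ‖x.2‖ ≤ 1 + 2 * ‖ζ‖ + P := by
      refine (abs_le_of_sq_le_sq' ?_ (by positivity)).2
      nlinarith
    nlinarith
  have h2 := norm_coreOp_le (k := d + 3) (J := J) (Y := 2 + P) (y := ‖x.2‖) hγ (κ := 3 * γ / 4) (by linarith)
    (norm_imPart_outer_le (B := B) (s := x.1) hγ hν hp.2 hx) hP hs hy0.le hY
  have h3 := norm_inv_symbol_mul_le hz hs0 hτ hy0.le d
  have hC := coreConst_nonneg (d := d) (γ := γ) hP0
  rw [outerFun, norm_smul, norm_mul, norm_pow]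
  calc _ ≤ (1 + P) ^ (d - 2) * ‖((x.1 : ℂ) ^ 2 + 2 * p.1 * x.1 + ((‖x.2‖ ^ 2 - 1 : ℝ) : ℂ))⁻¹‖ *
        (coreConst d γ P * (((1 + |x.1|) ^ (d + 3))⁻¹ * ((1 + ‖x.2‖) ^ (d + 3))⁻¹)) := by
        refine mul_le_mul ?_ (h2.trans (le_of_eq (by simp [coreConst]))) (norm_nonneg _) (by positivity)
        gcongr
    _ = (1 + P) ^ (d - 2) * coreConst d γ P * (‖((x.1 : ℂ) ^ 2 + 2 * p.1 * x.1 + ((‖x.2‖ ^ 2 - 1 : ℝ) : ℂ))⁻¹‖ *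
        (((1 + |x.1|) ^ (d + 3))⁻¹ * ((1 + ‖x.2‖) ^ (d + 3))⁻¹)) := by ring
    _ ≤ (1 + P) ^ (d - 2) * coreConst d γ P * (X * ((|x.1| ^ (-(1 / 2) : ℝ) * ((1 + |x.1|) ^ 2)⁻¹) *
        (|‖x.2‖ ^ 2 - 1| ^ (-(1 / 2) : ℝ) * ((1 + ‖x.2‖) ^ (d + 1))⁻¹))) := by
        have hX0 : 0 ≤ X := le_trans (by positivity) hX
        exact mul_le_mul_of_nonneg_left (h3.trans (mul_le_mul_of_nonneg_right hX (by positivity)))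
          (by positivity)
    _ = _ := by ring

/-- The measures of the two parts of the contour. -/
def innerMeasure (d : ℕ) : Measure (ℝ × RSp d) :=
  volume.prod (volume.restrict (Metric.ball 0 1))

def outerMeasure (d : ℕ) : Measure (ℝ × RSp d) :=
  volume.prod (volume.restrict {y | 1 < ‖y‖})

theorem measurableSet_one_lt_norm (d : ℕ) : MeasurableSet {y : RSp d | 1 < ‖y‖} :=
  measurableSet_lt measurable_const measurable_norm

theorem innerMeasure_eq (d : ℕ) : innerMeasure d =
    (volume : Measure (ℝ × RSp d)).restrict (Set.univ ×ˢ Metric.ball 0 1) := by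
  rw [innerMeasure, Measure.volume_eq_prod, ← Measure.prod_restrict, Measure.restrict_univ]

theorem outerMeasure_eq (d : ℕ) : outerMeasure d =
    (volume : Measure (ℝ × RSp d)).restrict (Set.univ ×ˢ {y | 1 < ‖y‖}) := by
  rw [outerMeasure, Measure.volume_eq_prod, ← Measure.prod_restrict, Measure.restrict_univ]

theorem ae_innerMeasure (d : ℕ) : ∀ᵐ x ∂innerMeasure d, ‖x.2‖ ≤ 1 := by
  rw [innerMeasure_eq]
  filter_upwards [ae_restrict_mem (MeasurableSet.univ.prod measurableSet_ball)] with x hx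
  exact (mem_ball_zero_iff.1 hx.2).le

theorem ae_fst_ne_zero (d : ℕ) (S : Set (RSp d)) :
    ∀ᵐ x ∂((volume : Measure ℝ).prod ((volume : Measure (RSp d)).restrict S)), x.1 ≠ 0 := by
  have h : ∀ᵐ s : ℝ, s ≠ 0 := by simp [ae_iff]
  exact Measure.quasiMeasurePreserving_fst.ae h

theorem ae_outerMeasure (d : ℕ) : ∀ᵐ x ∂outerMeasure d, x.1 ≠ 0 ∧ 1 < ‖x.2‖ := by
  refine (ae_fst_ne_zero d _).and ?_
  change ∀ᵐ x ∂outerMeasure d, 1 < ‖x.2‖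
  rw [outerMeasure_eq]
  filter_upwards [ae_restrict_mem (MeasurableSet.univ.prod (measurableSet_one_lt_norm d))] with x hx
  exact hx.2

theorem integrable_inv_one_add_abs_pow (d : ℕ) :
    Integrable fun s : ℝ => ((1 + |s|) ^ (d + 3))⁻¹ := by
  refine integrable_inv_one_add_sq.mono' (Measurable.aestronglyMeasurable (by fun_prop))
    (Filter.Eventually.of_forall fun s => ?_)
  rw [Real.norm_of_nonneg (by positivity)]
  refine inv_anti₀ (by positivity) ?_
  have h1 := abs_nonneg s
  calc 1 + s ^ 2 ≤ (1 + |s|) ^ 2 := by rw [← sq_abs s]; nlinarith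
    _ ≤ _ := pow_le_pow_right₀ (by linarith) (by omega)

theorem integrable_innerBound (d : ℕ) (C : ℝ) :
    Integrable (fun x : ℝ × RSp d => C * ((1 + |x.1|) ^ (d + 3))⁻¹) (innerMeasure d) := by
  have hb : Integrable (fun _ : RSp d => (1 : ℝ)) (volume.restrict (Metric.ball 0 1)) :=
    integrableOn_const (hs := measure_ball_lt_top.ne)
  have := ((integrable_inv_one_add_abs_pow d).mul_prod hb).const_mul C
  simpa [innerMeasure] using this

theorem integrable_outerBound (hd : 2 ≤ d) (C : ℝ) (S : Set (RSp d)) {l : ℝ} (hl : 0 < l) :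
    Integrable (fun x : ℝ × RSp d => C * ((|x.1| ^ (-(1 / 2) : ℝ) * ((1 + |x.1|) ^ 2)⁻¹) *
        (|‖x.2‖ ^ 2 - l ^ 2| ^ (-(1 / 2) : ℝ) * ((1 + ‖x.2‖) ^ (d + 1))⁻¹)))
      (volume.prod (volume.restrict S)) := by
  have := nontrivial_RSp hd
  have h := integrable_radial_singular (volume : Measure (RSp d)) hl
  rw [finrank_euclideanSpace_fin] at h
  exact (integrable_rpow_neg_half_mul.mul_prod h.restrict).const_mul C

/-- The constants of the majorants depend on the parameters only through `P` and `X`, so a single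
integrable function serves a whole neighbourhood. -/
theorem exists_nhds_bound {σ : ℝ} {p : ℂ × PerpC ν} (hp : p ∈ paramDomain γ ν σ) :
    ∃ P X : ℝ, ∃ V ∈ nhds p, ∀ q ∈ V, q ∈ paramDomain γ ν σ ∧ ‖paramVec q‖ ≤ P ∧ ‖q.2.1‖ ≤ P ∧
      1 + (1 + 2 * ‖q.1‖ + 1) / (2 * |q.1.im|) ≤ X := by
  have hz : p.1.im ≠ 0 := fun h => by have := hp.1; simp [h] at this
  have c1 : ContinuousAt (fun q : ℂ × PerpC ν => ‖paramVec q‖) p :=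
    differentiable_paramVec.continuous.norm.continuousAt
  have c2 : ContinuousAt (fun q : ℂ × PerpC ν => ‖q.2.1‖) p :=
    differentiable_perp.continuous.norm.continuousAt
  have c3 : ContinuousAt (fun q : ℂ × PerpC ν => 1 + (1 + 2 * ‖q.1‖ + 1) / (2 * |q.1.im|)) p := by
    have h1 : ContinuousAt (fun q : ℂ × PerpC ν => |q.1.im|) p :=
      (Complex.continuous_im.comp continuous_fst).abs.continuousAt
    refine continuousAt_const.add (ContinuousAt.div (by fun_prop) (continuousAt_const.mul h1) ?_)
    have := abs_pos.2 hz
    positivity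
  refine ⟨max (‖paramVec p‖ + 1) (‖p.2.1‖ + 1), 1 + (1 + 2 * ‖p.1‖ + 1) / (2 * |p.1.im|) + 1,
    paramDomain γ ν σ ∩ ({q | ‖paramVec q‖ < ‖paramVec p‖ + 1} ∩ ({q | ‖q.2.1‖ < ‖p.2.1‖ + 1} ∩
      {q | 1 + (1 + 2 * ‖q.1‖ + 1) / (2 * |q.1.im|) <
        1 + (1 + 2 * ‖p.1‖ + 1) / (2 * |p.1.im|) + 1})), Filter.inter_mem ((isOpen_paramDomain γ ν σ).mem_nhds hp)
    (Filter.inter_mem (c1.eventually (eventually_lt_nhds (lt_add_one _)))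
      (Filter.inter_mem (c2.eventually (eventually_lt_nhds (lt_add_one _)))
        (c3.eventually (eventually_lt_nhds (lt_add_one _))))), fun q hq => ?_⟩
  obtain ⟨h0, h1, h2, h3⟩ := hq
  exact ⟨h0, (le_of_lt h1).trans (le_max_left _ _), (le_of_lt h2).trans (le_max_right _ _), le_of_lt h3⟩

theorem aestronglyMeasurable_innerFun (hγ : 0 < γ) (hν : ‖ν‖ = 1) {σ : ℝ} (hσ : σ = 1 ∨ σ = -1) {N : ℕ}
    {J : JetIndex (d + 1) 2} {p : ℂ × PerpC ν} (hp : p ∈ paramDomain γ ν σ) :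
    AEStronglyMeasurable (innerFun γ σ B N J p) (innerMeasure d) := by
  rw [innerMeasure_eq]
  exact (continuousOn_innerFun hγ hν hσ hp).aestronglyMeasurable
    (MeasurableSet.univ.prod measurableSet_ball)

theorem aestronglyMeasurable_outerFun (hγ : 0 < γ) (hν : ‖ν‖ = 1) {σ : ℝ} {N : ℕ}
    {J : JetIndex (d + 1) 2} {p : ℂ × PerpC ν} (hp : p ∈ paramDomain γ ν σ) :
    AEStronglyMeasurable (outerFun γ B N J p) (outerMeasure d) := by
  rw [outerMeasure_eq]
  exact (continuousOn_outerFun hγ hν hp).aestronglyMeasurable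
    (MeasurableSet.univ.prod (measurableSet_one_lt_norm d))

theorem integrable_outerFun (hd : 2 ≤ d) (hγ : 0 < γ) (hν : ‖ν‖ = 1) (hB : ∀ y, inner ℝ ν (B y) = 0)
    {σ : ℝ} {J : JetIndex (d + 1) 2} {p : ℂ × PerpC ν} (hp : p ∈ paramDomain γ ν σ) :
    Integrable (outerFun γ B (2 + 2 * (d + 3)) J p) (outerMeasure d) := by
  obtain ⟨P, X, V, hV, h⟩ := exists_nhds_bound hp
  obtain ⟨-, h1, h2, h3⟩ := h p (mem_of_mem_nhds hV)
  have hb := integrable_outerBound hd ((1 + P) ^ (d - 2) * coreConst d γ P * X) {y | 1 < ‖y‖} one_pos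
  simp only [one_pow] at hb
  refine hb.mono' (aestronglyMeasurable_outerFun hγ hν hp) ?_
  filter_upwards [ae_outerMeasure d] with x hx
  exact norm_outerFun_le hγ hν hB hp h1 h2 h3 hx.1 hx.2

theorem integrable_innerFun (hγ : 0 < γ) (hν : ‖ν‖ = 1) (hB : ∀ y, inner ℝ ν (B y) = 0)
    {σ : ℝ} (hσ : σ = 1 ∨ σ = -1) {J : JetIndex (d + 1) 2} {p : ℂ × PerpC ν}
    (hp : p ∈ paramDomain γ ν σ) :
    Integrable (innerFun γ σ B (2 + 2 * (d + 3)) J p) (innerMeasure d) := by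
  obtain ⟨P, X, V, hV, h⟩ := exists_nhds_bound hp
  obtain ⟨-, h1, h2, h3⟩ := h p (mem_of_mem_nhds hV)
  refine (integrable_innerBound d (P ^ d * ((γ / 8) ^ 2)⁻¹ * coreConst d γ P)).mono'
    (aestronglyMeasurable_innerFun hγ hν hσ hp) ?_
  filter_upwards [ae_innerMeasure d] with x hx
  exact norm_innerFun_le hγ hν hB hσ hp h1 h2 hx

instance {n : ℕ} (ν : RSp n) : FiniteDimensional ℂ (PerpC ν) :=
  FiniteDimensional.finiteDimensional_submodule _

/-- The contribution of the deformed contours. -/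
def contourOp (γ σ : ℝ) (B : RSp d →ₗᵢ[ℝ] RSp (d + 1)) (J : JetIndex (d + 1) 2) (p : ℂ × PerpC ν) :
    ExpL2 (bracketWeight (d + 1) (-γ)) →L[ℂ] ExpL2 (bracketWeight (d + 1) γ) :=
  (∫ x, innerFun γ σ B (2 + 2 * (d + 3)) J p x ∂innerMeasure d) +
    ∫ x, outerFun γ B (2 + 2 * (d + 3)) J p x ∂outerMeasure d

theorem analyticOnNhd_contourOp (hd : 2 ≤ d) (hγ : 0 < γ) (hν : ‖ν‖ = 1)
    (hB : ∀ y, inner ℝ ν (B y) = 0) {σ : ℝ} (hσ : σ = 1 ∨ σ = -1) (J : JetIndex (d + 1) 2) :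
    AnalyticOnNhd ℂ (contourOp (ν := ν) γ σ B J) (paramDomain γ ν σ) := by
  unfold contourOp
  refine AnalyticOnNhd.add ?_ ?_
  · refine analyticOnNhd_integral (isOpen_paramDomain γ ν σ)
      (fun p hp => aestronglyMeasurable_innerFun hγ hν hσ hp) ?_ fun p hp => ?_
    · filter_upwards [ae_innerMeasure d] with x hx p hp
      exact (differentiableAt_innerFun hγ hν hσ hp hx).differentiableWithinAt
    · obtain ⟨P, X, V, hV, h⟩ := exists_nhds_bound hp
      refine ⟨V, hV, _, integrable_innerBound d (P ^ d * ((γ / 8) ^ 2)⁻¹ * coreConst d γ P), ?_⟩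
      filter_upwards [ae_innerMeasure d] with x hx q hq
      obtain ⟨h0, h1, h2, h3⟩ := h q hq
      exact norm_innerFun_le hγ hν hB hσ h0 h1 h2 hx
  · refine analyticOnNhd_integral (isOpen_paramDomain γ ν σ)
      (fun p hp => aestronglyMeasurable_outerFun hγ hν hp) ?_ fun p hp => ?_
    · filter_upwards [ae_outerMeasure d] with x hx p hp
      exact (differentiableAt_outerFun hγ hν hp hx.2).differentiableWithinAt
    · obtain ⟨P, X, V, hV, h⟩ := exists_nhds_bound hp
      have hb := integrable_outerBound hd ((1 + P) ^ (d - 2) * coreConst d γ P * X) {y | 1 < ‖y‖} one_pos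
      simp only [one_pow] at hb
      refine ⟨V, hV, _, hb, ?_⟩
      filter_upwards [ae_outerMeasure d] with x hx q hq
      obtain ⟨h0, h1, h2, h3⟩ := h q hq
      exact norm_outerFun_le hγ hν hB h0 h1 h2 h3 hx.1 hx.2

end

/-! ### Fourier multipliers on `L²` -/

theorem memLp_bounded_mul {n : ℕ} (b : BoundedContinuousFunction (RSp n) ℂ)
    (f : Lp ℂ 2 (volume : Measure (RSp n))) : MemLp (fun x => b x * f x) 2 volume :=
  (Lp.memLp f).of_le_mul (c := ‖b‖) (b.continuous.aestronglyMeasurable.mul (Lp.aestronglyMeasurable f))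
    (Filter.Eventually.of_forall fun x => by
      rw [norm_mul]; gcongr; exact b.norm_coe_le_norm x)

/-- Multiplication of `L²` functions by bounded continuous functions. -/
def mulL2 (n : ℕ) : BoundedContinuousFunction (RSp n) ℂ →L[ℂ]
    Lp ℂ 2 (volume : Measure (RSp n)) →L[ℂ] Lp ℂ 2 (volume : Measure (RSp n)) :=
  LinearMap.mkContinuous₂ (LinearMap.mk₂ ℂ (fun b f => (memLp_bounded_mul b f).toLp _)
    (fun b c f => by
      rw [← MemLp.toLp_add]
      exact MemLp.toLp_congr _ _ (Filter.Eventually.of_forall fun x => by simp [add_mul]))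
    (fun c b f => by
      rw [← MemLp.toLp_const_smul]
      exact MemLp.toLp_congr _ _ (Filter.Eventually.of_forall fun x => by simp [mul_assoc]))
    (fun b f g => by
      rw [← MemLp.toLp_add]
      refine MemLp.toLp_congr _ _ ?_
      filter_upwards [Lp.coeFn_add f g] with x hx
      rw [hx, Pi.add_apply, Pi.add_apply, mul_add])
    (fun c b f => by
      rw [← MemLp.toLp_const_smul]
      refine MemLp.toLp_congr _ _ ?_
      filter_upwards [Lp.coeFn_smul c f] with x hx
      simp [hx, mul_left_comm])) 1 fun b f => by
    rw [one_mul]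
    refine Lp.norm_le_mul_norm_of_ae_le_mul ?_
    filter_upwards [(memLp_bounded_mul b f).coeFn_toLp] with x hx
    rw [LinearMap.mk₂_apply, hx, norm_mul]
    gcongr
    exact b.norm_coe_le_norm x

theorem coeFn_mulL2 {n : ℕ} (b : BoundedContinuousFunction (RSp n) ℂ)
    (f : Lp ℂ 2 (volume : Measure (RSp n))) : mulL2 n b f =ᵐ[volume] fun x => b x * f x :=
  (memLp_bounded_mul b f).coeFn_toLp

/-- The Fourier multiplier on `L²` with a bounded continuous symbol. -/
def fourierMult (n : ℕ) : BoundedContinuousFunction (RSp n) ℂ →L[ℂ]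
    Lp ℂ 2 (volume : Measure (RSp n)) →L[ℂ] Lp ℂ 2 (volume : Measure (RSp n)) :=
  let F : Lp ℂ 2 (volume : Measure (RSp n)) →L[ℂ] Lp ℂ 2 (volume : Measure (RSp n)) :=
    (Lp.fourierTransformₗᵢ (RSp n) ℂ).toContinuousLinearEquiv.toContinuousLinearMap
  let F' : Lp ℂ 2 (volume : Measure (RSp n)) →L[ℂ] Lp ℂ 2 (volume : Measure (RSp n)) :=
    (Lp.fourierTransformₗᵢ (RSp n) ℂ).symm.toContinuousLinearEquiv.toContinuousLinearMap
  ((ContinuousLinearMap.compL ℂ _ _ _ F').comp ((ContinuousLinearMap.compL ℂ _ _ _).flip F)).comp (mulL2 n)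

theorem fourierMult_apply {n : ℕ} (b : BoundedContinuousFunction (RSp n) ℂ)
    (f : Lp ℂ 2 (volume : Measure (RSp n))) : fourierMult n b f = 𝓕⁻ (mulL2 n b (𝓕 f)) := rfl

/-- The Fourier transform on `L²` is defined abstractly, so it has to be identified with the
integral. Both are tested against smooth functions of compact support, one through tempered
distributions and the other through Fubini. -/
theorem coeFn_fourier_of_integrable {n : ℕ} (f : Lp ℂ 2 (volume : Measure (RSp n)))
    (hf : Integrable f) : (𝓕 f : Lp ℂ 2 (volume : Measure (RSp n))) =ᵐ[volume] 𝓕 (f : RSp n → ℂ) := by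
  have hc : Continuous (𝓕 (f : RSp n → ℂ)) :=
    VectorFourier.fourierIntegral_continuous Real.continuous_fourierChar
      (innerSL ℝ).continuous₂ hf
  refine ae_eq_of_integral_contDiff_smul_eq ((Lp.memLp _).locallyIntegrable (by norm_num))
    hc.locallyIntegrable fun g hg hgc => ?_
  have hgc' : HasCompactSupport fun x => (g x : ℂ) := hgc.comp_left (g := fun t : ℝ => (t : ℂ)) (by simp)
  have hg' : ContDiff ℝ ∞ fun x => (g x : ℂ) := Complex.ofRealCLM.contDiff.comp hg
  set G : 𝓢(RSp n, ℂ) := hgc'.toSchwartzMap hg' with hG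
  have h1 : ∀ x, G x = g x := fun x => rfl
  have h2 := congrArg (fun T => T G) (Lp.fourier_toTemperedDistribution_eq f)
  simp only [TemperedDistribution.fourier_apply, Lp.toTemperedDistribution_apply] at h2
  have h3 := VectorFourier.integral_fourierIntegral_smul_eq_flip (L := innerₗ (RSp n))
    Real.continuous_fourierChar continuous_inner (μ := volume) (ν := volume) G.integrable hf
  simp only [flip_innerₗ] at h3
  calc ∫ x, g x • (𝓕 f : Lp ℂ 2 (volume : Measure (RSp n))) x
      = ∫ x, G x • (𝓕 f : Lp ℂ 2 (volume : Measure (RSp n))) x := by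
        refine integral_congr_ae (Filter.Eventually.of_forall fun x => ?_)
        simp [h1]
    _ = ∫ x, (𝓕 G) x • f x := h2.symm
    _ = ∫ x, G x • 𝓕 (f : RSp n → ℂ) x := h3
    _ = _ := by
        refine integral_congr_ae (Filter.Eventually.of_forall fun x => ?_)
        simp [h1]

theorem integrable_lp_mul_schwartz {n : ℕ} (u : Lp ℂ 2 (volume : Measure (RSp n))) (φ : 𝓢(RSp n, ℂ)) :
    Integrable fun w => u w * φ w :=
  MemLp.integrable_mul (Lp.memLp u) (φ.memLp 2)

theorem integral_fourierMult_mul {n : ℕ} (b : BoundedContinuousFunction (RSp n) ℂ)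
    (f : Lp ℂ 2 (volume : Measure (RSp n))) (hf : Integrable f) (φ : 𝓢(RSp n, ℂ)) :
    Integrable (fun w => fourierMult n b f w * φ w) ∧
    Integrable (fun ξ => b ξ * 𝓕 (f : RSp n → ℂ) ξ * (𝓕⁻ φ) ξ) ∧
    ∫ w, fourierMult n b f w * φ w = ∫ ξ, b ξ * 𝓕 (f : RSp n → ℂ) ξ * (𝓕⁻ φ) ξ := by
  have he : (fun ξ => mulL2 n b (𝓕 f) ξ * (𝓕⁻ φ) ξ) =ᵐ[volume]
      fun ξ => b ξ * 𝓕 (f : RSp n → ℂ) ξ * (𝓕⁻ φ) ξ := by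
    filter_upwards [coeFn_mulL2 b (𝓕 f), coeFn_fourier_of_integrable f hf] with x h1 h2
    rw [h1, h2]
  refine ⟨integrable_lp_mul_schwartz _ φ, (integrable_lp_mul_schwartz _ (𝓕⁻ φ)).congr he, ?_⟩
  have h2 := congrArg (fun T => T φ) (Lp.fourierInv_toTemperedDistribution_eq (mulL2 n b (𝓕 f)))
  simp only [TemperedDistribution.fourierInv_apply, Lp.toTemperedDistribution_apply, smul_eq_mul] at h2
  rw [← integral_congr_ae he, fourierMult_apply]
  simp only [mul_comm _ (φ _), mul_comm _ ((𝓕⁻ φ) _)]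
  exact h2.symm

/-! ### The regular part of the resolvent -/

/-- The frequency `2πξ` as a complex vector. -/
def freqVec {n : ℕ} (ξ : RSp n) : CSp n := toC ((2 * Real.pi) • ξ)

theorem continuous_freqVec {n : ℕ} : Continuous (freqVec : RSp n → CSp n) :=
  continuous_toC.comp (continuous_const_smul _)

theorem imPart_freqVec {n : ℕ} (ξ : RSp n) : imPart (freqVec ξ) = 0 := imPart_toC _

theorem continuous_refSymbol_freqVec {n : ℕ} (γ : ℝ) : Continuous fun ξ : RSp n => refSymbol γ (freqVec ξ) :=
  (continuous_cdot continuous_freqVec continuous_freqVec).add_const _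

theorem refSymbol_freqVec_ne_zero {n : ℕ} {γ : ℝ} (hγ : 0 ≤ γ) (ξ : RSp n) : refSymbol γ (freqVec ξ) ≠ 0 :=
  refSymbol_ne_zero (by rw [imPart_freqVec, norm_zero]; exact hγ)

/-- The linear part of the symbol ratio, as a bounded continuous function of the frequency. -/
def ratioLin {n : ℕ} {γ : ℝ} (hγ : 0 ≤ γ) : CSp n →ₗ[ℂ] BoundedContinuousFunction (RSp n) ℂ where
  toFun ρ := BoundedContinuousFunction.ofNormedAddCommGroup
    (fun ξ => -(2 * cdot ρ (freqVec ξ)) / refSymbol γ (freqVec ξ))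
    ((continuous_const.mul (continuous_cdot continuous_const continuous_freqVec)).neg.div
      (continuous_refSymbol_freqVec γ) (refSymbol_freqVec_ne_zero hγ)) (2 * ‖ρ‖) (fun ξ => by
      have h1 := norm_refSymbol_ge (ζ := freqVec ξ) (γ := γ) (by rw [imPart_freqVec, norm_zero]; exact hγ)
      rw [norm_div, norm_neg, norm_mul, Complex.norm_two, div_le_iff₀ (by nlinarith [sq_nonneg ‖freqVec ξ‖])]
      have h2 := norm_cdot_le ρ (freqVec ξ)
      have h3 : ‖freqVec ξ‖ ≤ ‖refSymbol γ (freqVec ξ)‖ := by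
        nlinarith [sq_nonneg (‖freqVec ξ‖ - 1), norm_nonneg (freqVec ξ)]
      calc 2 * ‖cdot ρ (freqVec ξ)‖ ≤ 2 * (‖ρ‖ * ‖refSymbol γ (freqVec ξ)‖) := by
            gcongr; exact h2.trans (by gcongr)
        _ = _ := by ring)
  map_add' ρ σ := by
    ext ξ
    simp [add_cdot]
    ring
  map_smul' c ρ := by
    ext ξ
    simp [smul_cdot]
    ring

/-- The constant part of the symbol ratio. -/
def ratioConst (n : ℕ) {γ : ℝ} (hγ : 0 ≤ γ) : BoundedContinuousFunction (RSp n) ℂ :=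
  BoundedContinuousFunction.ofNormedAddCommGroup
    (fun ξ => ((2 * γ ^ 2 + 1 : ℝ) : ℂ) / refSymbol γ (freqVec ξ))
    (continuous_const.div (continuous_refSymbol_freqVec γ) (refSymbol_freqVec_ne_zero hγ))
    (2 * γ ^ 2 + 1) (fun ξ => by
      have h1 := norm_refSymbol_ge (ζ := freqVec ξ) (γ := γ) (by rw [imPart_freqVec, norm_zero]; exact hγ)
      rw [norm_div, Complex.norm_real, Real.norm_of_nonneg (by positivity)]
      exact div_le_self (by positivity) (by nlinarith [sq_nonneg ‖freqVec ξ‖]))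

/-- The symbol ratio as a bounded continuous function of the frequency. -/
def ratioFun {n : ℕ} {γ : ℝ} (hγ : 0 ≤ γ) (ρ : CSp n) : BoundedContinuousFunction (RSp n) ℂ :=
  ratioConst n hγ + LinearMap.toContinuousLinearMap (ratioLin hγ) ρ

theorem ratioFun_apply {n : ℕ} {γ : ℝ} (hγ : 0 ≤ γ) (ρ : CSp n) (ξ : RSp n) :
    ratioFun hγ ρ ξ = symbolRatio γ ρ (freqVec ξ) := by
  rw [symbolRatio, sub_div, sub_eq_add_neg, ← neg_div]
  rfl

theorem analyticAt_ratioFun {n : ℕ} {γ : ℝ} (hγ : 0 ≤ γ) (ρ : CSp n) :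
    AnalyticAt ℂ (ratioFun hγ) ρ :=
  analyticAt_const.add (ContinuousLinearMap.analyticAt _ _)

/-- The symbol of a derivative of order at most two, divided by the reference symbol. -/
def jetFun {n : ℕ} {γ : ℝ} (hγ : 0 ≤ γ) (J : JetIndex n 2) : BoundedContinuousFunction (RSp n) ℂ :=
  BoundedContinuousFunction.ofNormedAddCommGroup
    (fun ξ => jetMono J (freqVec ξ) / refSymbol γ (freqVec ξ))
    (by
      refine Continuous.div ?_ (continuous_refSymbol_freqVec γ) (refSymbol_freqVec_ne_zero hγ)
      unfold jetMono
      refine continuous_finsetProd _ fun j _ => continuous_const.mul ?_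
      exact (EuclideanSpace.proj (𝕜 := ℂ) (J.2 j)).continuous.comp continuous_freqVec)
    2 (fun ξ => by
      have h1 := norm_refSymbol_ge (ζ := freqVec ξ) (γ := γ) (by rw [imPart_freqVec, norm_zero]; exact hγ)
      rw [norm_div, div_le_iff₀ (by nlinarith [sq_nonneg ‖freqVec ξ‖])]
      have h2 := norm_jetMono_le J (freqVec ξ)
      nlinarith [sq_nonneg (‖freqVec ξ‖ - 1)])

theorem jetFun_apply {n : ℕ} {γ : ℝ} (hγ : 0 ≤ γ) (J : JetIndex n 2) (ξ : RSp n) :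
    jetFun hγ J ξ = jetMono J (freqVec ξ) / refSymbol γ (freqVec ξ) := rfl

/-- The truncated Neumann series of the symbol. -/
def neumannFun {n : ℕ} {γ : ℝ} (hγ : 0 ≤ γ) (N : ℕ) (J : JetIndex n 2) (ρ : CSp n) :
    BoundedContinuousFunction (RSp n) ℂ := jetFun hγ J * ∑ k ∈ Finset.range N, ratioFun hγ ρ ^ k

/-- As a map into the Banach algebra of bounded continuous functions, `ratioFun` is affine in `ρ`,
so the truncated series is a polynomial in `ρ`. -/
theorem analyticAt_neumannFun {n : ℕ} {γ : ℝ} (hγ : 0 ≤ γ) (N : ℕ) (J : JetIndex n 2) (ρ : CSp n) :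
    AnalyticAt ℂ (neumannFun hγ N J) ρ := by
  unfold neumannFun
  exact analyticAt_const.mul (Finset.analyticAt_fun_sum _ fun k _ => (analyticAt_ratioFun hγ ρ).pow k)

theorem neumannFun_apply {n : ℕ} {γ : ℝ} (hγ : 0 ≤ γ) (N : ℕ) (J : JetIndex n 2) (ρ : CSp n) (ξ : RSp n) :
    neumannFun hγ N J ρ ξ = jetMono J (freqVec ξ) / refSymbol γ (freqVec ξ) *
      ∑ k ∈ Finset.range N, symbolRatio γ ρ (freqVec ξ) ^ k := by
  simp [neumannFun, jetFun_apply, ratioFun_apply]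

/-- The part of the resolvent that is a bounded multiplier on `L²`. -/
def neumannOp {n : ℕ} {γ : ℝ} (hγ : 0 ≤ γ) (N : ℕ) (J : JetIndex n 2) (ρ : CSp n) :
    ExpL2 (bracketWeight n (-γ)) →L[ℂ] ExpL2 (bracketWeight n γ) :=
  (lpToExp (bracketWeight n γ) (fun _ => mul_nonneg hγ (Real.sqrt_nonneg _))).comp
    ((fourierMult n (neumannFun hγ N J ρ)).comp (expToLp (bracketWeight n (-γ)) (fun _ =>
      mul_nonpos_of_nonpos_of_nonneg (neg_nonpos.2 hγ) (Real.sqrt_nonneg _))))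

theorem analyticAt_neumannOp {n : ℕ} {γ : ℝ} (hγ : 0 ≤ γ) (N : ℕ) (J : JetIndex n 2) (ρ : CSp n) :
    AnalyticAt ℂ (neumannOp hγ N J) ρ := by
  have h := ((ContinuousLinearMap.compL ℂ _ _ _ (lpToExp (bracketWeight n γ)
      (fun _ => mul_nonneg hγ (Real.sqrt_nonneg _)))).comp
    (((ContinuousLinearMap.compL ℂ _ _ _).flip (expToLp (bracketWeight n (-γ)) (fun _ =>
      mul_nonpos_of_nonpos_of_nonneg (neg_nonpos.2 hγ) (Real.sqrt_nonneg _)))).comp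
      (fourierMult n))).analyticAt (neumannFun hγ N J ρ)
  exact AnalyticAt.fun_comp (f := neumannFun hγ N J) h (analyticAt_neumannFun hγ N J ρ)

/-! ### Lower bounds for the symbol with negative constant term. -/

/-- In the case of equality, `Im z ≠ 0` would give `(Re Q)² = (Re z)²`, and then the real parts
would force `τ = 0`. -/
theorem abs_im_lt_of_sq_eq {z Q : ℂ} (hz : z.im ≠ 0) {τ : ℝ} (hτ : τ < 0) (hQ : Q ^ 2 = z ^ 2 - τ) :
    |Q.im| < |z.im| := by
  refine lt_of_le_of_ne (abs_im_le_of_sq_eq hτ.le hQ) fun h => ?_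
  have h3 := congrArg Complex.re hQ
  have h4 := congrArg Complex.im hQ
  simp [pow_two] at h3 h4
  have h5 : Q.im ^ 2 = z.im ^ 2 := sq_eq_sq_iff_abs_eq_abs _ _ |>.2 h
  have h6 : (Q.re * Q.im) ^ 2 = (z.re * z.im) ^ 2 := by congr 1; linarith
  have h7 : z.im ^ 2 * (Q.re ^ 2 - z.re ^ 2) = 0 := by
    rw [mul_pow, mul_pow, h5] at h6; linarith
  have h8 : Q.re ^ 2 - z.re ^ 2 = 0 := (mul_eq_zero.1 h7).resolve_left (pow_ne_zero 2 hz)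
  nlinarith

/-- Both roots `-z ± Q` have imaginary part of the sign opposite to `Im z`, at height at least `|Im
z| - |Im Q| > 0`. The closed half plane on the side of `Im z` keeps this distance from each of them.
-/
theorem symbol_line_sq_ge {z : ℂ} (hz : z.im ≠ 0) {τ : ℝ} (hτ : τ < 0) :
    ∃ c > 0, ∀ s : ℂ, 0 ≤ s.im * z.im → c ≤ ‖s ^ 2 + 2 * z * s + τ‖ := by
  obtain ⟨Q, hQ⟩ := IsSquare.exists_sq (z ^ 2 - (τ : ℂ)) (Complex.isSquare _)
  have h2 : |Q.im| < |z.im| := abs_im_lt_of_sq_eq hz hτ hQ.symm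
  refine ⟨(|z.im| - |Q.im|) ^ 2, by have := sub_pos.2 h2; positivity, fun s hs => ?_⟩
  have h3 : s ^ 2 + 2 * z * s + τ = (s + z - Q) * (s + z + Q) := by linear_combination -hQ
  have h4 : |z.im| ≤ |(s + z).im| := by
    rw [Complex.add_im]
    rw [← sq_le_sq]
    nlinarith [sq_nonneg s.im]
  have h5 : |z.im| - |Q.im| ≤ ‖s + z - Q‖ := by
    refine le_trans ?_ (Complex.abs_im_le_norm _)
    rw [Complex.sub_im]
    linarith [abs_sub_abs_le_abs_sub (s + z).im Q.im]
  have h6 : |z.im| - |Q.im| ≤ ‖s + z + Q‖ := by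
    refine le_trans ?_ (Complex.abs_im_le_norm _)
    rw [Complex.add_im _ Q]
    have := abs_sub_abs_le_abs_sub (s + z).im (-Q.im)
    rw [abs_neg, sub_neg_eq_add] at this
    linarith
  rw [h3, norm_mul, pow_two]
  exact mul_le_mul h5 h6 (by linarith) (norm_nonneg _)

/-! ### The resolvent integrand at real parameters and its deformation. -/

section

variable {d : ℕ} {γ : ℝ} {ν : RSp (d + 1)} {B : RSp d →ₗᵢ[ℝ] RSp (d + 1)}

/-- The symbol `ζ · ζ + 2 ρ · ζ`. -/
def fullSymbol {n : ℕ} (ρ ζ : CSp n) : ℂ := cdot ζ ζ + 2 * cdot ρ ζ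

/-- The operator valued integrand over real frequencies. -/
def resolventFun {n : ℕ} (γ : ℝ) (N : ℕ) (J : JetIndex n 2) (ρ : CSp n) (ξ : RSp n) :
    ExpL2 (bracketWeight n (-γ)) →L[ℂ] ExpL2 (bracketWeight n γ) :=
  (fullSymbol ρ (toC ξ))⁻¹ • coreOp γ N J ρ (toC ξ)

/-- The translation by `-ρ_⊥` completes the square in the transversal variables; what is left
depends only on `t` and `c² ‖y‖²`. -/
theorem fullSymbol_contourVec (hν : ‖ν‖ = 1) (hB : ∀ y, inner ℝ ν (B y) = 0) (p : ℂ × PerpC ν)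
    (t c : ℂ) (y : RSp d) : fullSymbol (paramVec p) (contourVec ν B p.2.1 t c y) =
      t ^ 2 + 2 * p.1 * t + (c ^ 2 * ((‖y‖ ^ 2 : ℝ) : ℂ) - cdot p.2.1 p.2.1) := by
  have h1 : cdot p.2.1 (toC ν) = 0 := p.2.2
  have h2 : cdot (toC ν) p.2.1 = 0 := by rw [cdot_comm]; exact h1
  have h3 : cdot (toC (B y)) (toC ν) = 0 := by rw [cdot_toC, real_inner_comm, hB]; simp
  have h4 : cdot (toC ν) (toC (B y)) = 0 := by rw [cdot_comm]; exact h3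
  have h5 : cdot (toC ν) (toC ν) = 1 := by rw [cdot_toC, real_inner_self_eq_norm_sq, hν]; simp
  have h6 : cdot (toC (B y)) (toC (B y)) = ((‖y‖ ^ 2 : ℝ) : ℂ) := by
    rw [cdot_toC, real_inner_self_eq_norm_sq, B.norm_map]
  simp only [fullSymbol, paramVec, contourVec, sub_eq_add_neg, add_cdot, cdot_add, smul_cdot, cdot_smul, neg_cdot,
    cdot_neg, h1, h2, h3, h4, h5, h6, cdot_comm (toC (B y)) p.2.1]
  ring

theorem toC_lineCoord_sub (ρ : RSp (d + 1)) (x : ℝ × RSp d) :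
    toC (lineCoord ν B x - ρ) = contourVec ν B (toC ρ) x.1 1 x.2 := by
  ext i
  simp [lineCoord, contourVec, toC_apply]

theorem contourVec_smul (ρ : CSp (d + 1)) (t : ℂ) (c : ℝ) (y : RSp d) :
    contourVec ν B ρ t 1 (c • y) = contourVec ν B ρ t c y := by
  ext i
  simp [contourVec, toC_apply]

/-- The integrand in the coordinates adapted to `ν`. -/
def lineFun (γ : ℝ) (B : RSp d →ₗᵢ[ℝ] RSp (d + 1)) (N : ℕ) (J : JetIndex (d + 1) 2) (p : ℂ × PerpC ν)
    (t : ℂ) (y : RSp d) : ExpL2 (bracketWeight (d + 1) (-γ)) →L[ℂ] ExpL2 (bracketWeight (d + 1) γ) :=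
  (t ^ 2 + 2 * p.1 * t + (((‖y‖ ^ 2 : ℝ) : ℂ) - cdot p.2.1 p.2.1))⁻¹ •
    coreOp γ N J (paramVec p) (contourVec ν B p.2.1 t 1 y)

theorem resolventFun_lineCoord (hν : ‖ν‖ = 1) (hB : ∀ y, inner ℝ ν (B y) = 0) {N : ℕ}
    {J : JetIndex (d + 1) 2} (z : ℂ) (x : PerpR ν) (v : ℝ × RSp d) :
    resolventFun γ N J (paramVec (z, perpToC x)) (lineCoord ν B v - x.1) =
      lineFun γ B N J (z, perpToC x) v.1 v.2 := by
  rw [resolventFun, lineFun, toC_lineCoord_sub]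
  have := fullSymbol_contourVec hν hB (z, perpToC x) v.1 1 v.2
  rw [one_pow, one_mul] at this
  rw [← this]
  rfl

theorem cdot_perpToC (x : PerpR ν) : cdot (perpToC x).1 (perpToC x).1 = ((‖x.1‖ ^ 2 : ℝ) : ℂ) := by
  change cdot (toC x.1) (toC x.1) = _
  rw [cdot_toC, real_inner_self_eq_norm_sq]

theorem norm_imPart_real_line (ρ : RSp (d + 1)) (t : ℝ) (y : RSp d) :
    imPart (contourVec ν B (toC ρ) t 1 y) = 0 := by
  rw [← toC_lineCoord_sub (B := B) (ν := ν) ρ (t, y), imPart_toC]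

theorem norm_lineFun_le (hγ : 0 < γ) (hν : ‖ν‖ = 1) (hB : ∀ y, inner ℝ ν (B y) = 0)
    {J : JetIndex (d + 1) 2} {z : ℂ} (hz : z.im ≠ 0) (x : PerpR ν) {t : ℝ} (ht : t ≠ 0) {y : RSp d}
    (hy : ‖y‖ ≠ ‖x.1‖) {P : ℝ} (hP : ‖paramVec (z, perpToC x)‖ ≤ P) (hP2 : ‖(perpToC x).1‖ ≤ P) :
    ‖lineFun γ B (2 + 2 * (d + 3)) J (z, perpToC x) t y‖ ≤
      (coreConst d γ P * (1 + (1 + 2 * ‖z‖ + 1) / (2 * |z.im|))) *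
        ((|t| ^ (-(1 / 2) : ℝ) * ((1 + |t|) ^ 2)⁻¹) *
        (|‖y‖ ^ 2 - ‖x.1‖ ^ 2| ^ (-(1 / 2) : ℝ) * ((1 + ‖y‖) ^ (d + 1))⁻¹)) := by
  have hP0 : 0 ≤ P := (norm_nonneg _).trans hP
  set ζ := contourVec ν B (perpToC x).1 t 1 y with hζ
  have hs : |t| ≤ ‖ζ‖ := by
    refine le_trans (le_of_eq ?_) (norm_le_norm_contourVec hν hB (perpToC x) (t : ℂ) _ y)
    rw [Complex.norm_real, Real.norm_eq_abs]
  have hY : 1 + ‖y‖ ≤ (2 + P) * (1 + ‖ζ‖) := by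
    have h1 := norm_smul_le_of_contourVec hν hB (perpToC x) (t : ℂ) 1 y
    rw [← hζ, norm_one, one_mul] at h1
    nlinarith [norm_nonneg ζ]
  have hτ : ‖y‖ ^ 2 - ‖x.1‖ ^ 2 ≠ 0 := fun h => hy
    ((sq_eq_sq₀ (norm_nonneg _) (norm_nonneg _)).1 (sub_eq_zero.1 h))
  have him : ‖imPart ζ‖ ≤ 3 * γ / 4 := by
    rw [hζ, show (perpToC x).1 = toC x.1 from rfl, norm_imPart_real_line, norm_zero]; positivity
  have h2 := norm_coreOp_le (k := d + 3) (J := J) (Y := 2 + P) (y := ‖y‖) hγ (κ := 3 * γ / 4)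
    (by linarith) him hP hs (norm_nonneg _) hY
  have h3 := norm_inv_symbol_mul_le hz ht hτ (norm_nonneg y) d
  rw [lineFun, norm_smul]
  have e : (((‖y‖ ^ 2 : ℝ) : ℂ) - cdot (perpToC x).1 (perpToC x).1) = ((‖y‖ ^ 2 - ‖x.1‖ ^ 2 : ℝ) : ℂ) := by
    rw [cdot_perpToC]; push_cast; ring
  rw [e]
  calc _ ≤ ‖((t : ℂ) ^ 2 + 2 * z * t + ((‖y‖ ^ 2 - ‖x.1‖ ^ 2 : ℝ) : ℂ))⁻¹‖ *
        (coreConst d γ P * (((1 + |t|) ^ (d + 3))⁻¹ * ((1 + ‖y‖) ^ (d + 3))⁻¹)) :=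
        mul_le_mul_of_nonneg_left (h2.trans (le_of_eq (by simp [coreConst]))) (norm_nonneg _)
    _ = coreConst d γ P * (‖((t : ℂ) ^ 2 + 2 * z * t + ((‖y‖ ^ 2 - ‖x.1‖ ^ 2 : ℝ) : ℂ))⁻¹‖ *
        (((1 + |t|) ^ (d + 3))⁻¹ * ((1 + ‖y‖) ^ (d + 3))⁻¹)) := by ring
    _ ≤ coreConst d γ P * ((1 + (1 + 2 * ‖z‖ + 1) / (2 * |z.im|)) *
        ((|t| ^ (-(1 / 2) : ℝ) * ((1 + |t|) ^ 2)⁻¹) *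
        (|‖y‖ ^ 2 - ‖x.1‖ ^ 2| ^ (-(1 / 2) : ℝ) * ((1 + ‖y‖) ^ (d + 1))⁻¹))) :=
        mul_le_mul_of_nonneg_left h3 (coreConst_nonneg hP0)
    _ = _ := by ring

theorem continuous_contourVec {X : Type*} [TopologicalSpace X] {f : X → ℂ} {g : X → RSp d}
    (hf : Continuous f) (hg : Continuous g) (ρ : CSp (d + 1)) (c : ℂ) :
    Continuous fun x => contourVec ν B ρ (f x) c (g x) := by
  unfold contourVec
  have : Continuous fun x => toC (B (g x)) := continuous_toC.comp (B.continuous.comp hg)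
  fun_prop

theorem ae_norm_ne (d : ℕ) (hd : 2 ≤ d) (l : ℝ) : ∀ᵐ y : RSp d, ‖y‖ ≠ l := by
  have := nontrivial_RSp hd
  have h := Measure.addHaar_sphere (volume : Measure (RSp d)) 0 l
  rw [ae_iff]
  convert h using 2
  ext y
  simp

theorem aestronglyMeasurable_lineFun (hγ : 0 < γ) {N : ℕ} {J : JetIndex (d + 1) 2} (z : ℂ) (x : PerpR ν) :
    AEStronglyMeasurable (fun v : ℝ × RSp d => lineFun γ B N J (z, perpToC x) v.1 v.2) volume := by
  unfold lineFun
  have hq : Continuous fun v : ℝ × RSp d => (v.1 : ℂ) ^ 2 + 2 * z * v.1 +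
      (((‖v.2‖ ^ 2 : ℝ) : ℂ) - cdot (perpToC x).1 (perpToC x).1) := by fun_prop
  refine AEStronglyMeasurable.smul hq.measurable.inv.aestronglyMeasurable
    (Continuous.aestronglyMeasurable ?_)
  · refine continuous_iff_continuousAt.2 fun v => ?_
    refine continuousAt_coreOp (g := fun v : ℝ × RSp d => contourVec ν B (perpToC x).1 v.1 1 v.2)
      (continuous_contourVec (by fun_prop) (by fun_prop) _ _).continuousAt ?_
    rw [show (perpToC x).1 = toC x.1 from rfl, norm_imPart_real_line, norm_zero]
    exact hγ

theorem integrable_lineFun (hd : 2 ≤ d) (hγ : 0 < γ) (hν : ‖ν‖ = 1) (hB : ∀ y, inner ℝ ν (B y) = 0)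
    {J : JetIndex (d + 1) 2} {z : ℂ} (hz : z.im ≠ 0) {x : PerpR ν} (hx : x ≠ 0) :
    Integrable (fun v : ℝ × RSp d => lineFun γ B (2 + 2 * (d + 3)) J (z, perpToC x) v.1 v.2) := by
  have hl : 0 < ‖x.1‖ := norm_pos_iff.2 fun h0 => hx (Subtype.ext h0)
  have hb := integrable_outerBound hd (coreConst d γ (max ‖paramVec (z, perpToC x)‖ ‖(perpToC x).1‖) *
    (1 + (1 + 2 * ‖z‖ + 1) / (2 * |z.im|))) Set.univ hl
  rw [Measure.restrict_univ, ← Measure.volume_eq_prod] at hb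
  refine hb.mono' (aestronglyMeasurable_lineFun hγ z x) ?_
  have h1 : ∀ᵐ v : ℝ × RSp d, v.1 ≠ 0 := by
    have := ae_fst_ne_zero d Set.univ
    rwa [Measure.restrict_univ, ← Measure.volume_eq_prod] at this
  have h2 : ∀ᵐ v : ℝ × RSp d, ‖v.2‖ ≠ ‖x.1‖ := by
    rw [Measure.volume_eq_prod]
    exact Measure.quasiMeasurePreserving_snd.ae (ae_norm_ne d hd _)
  filter_upwards [h1, h2] with v h1 h2
  exact norm_lineFun_le hγ hν hB hz x h1 h2 (le_max_left _ _) (le_max_right _ _)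

theorem integrable_integral_resolventFun (hν : ‖ν‖ = 1) (hB : ∀ y, inner ℝ ν (B y) = 0) :
    ∃ C : NNReal, C ≠ 0 ∧ ∀ {F : Type} [NormedAddCommGroup F] [NormedSpace ℝ F] (g : RSp (d + 1) → F)
      (x : RSp (d + 1)),
      (Integrable (fun v => g (lineCoord ν B v - x)) → Integrable g) ∧
      ∫ ξ, g ξ = C • ∫ v, g (lineCoord ν B v - x) := by
  obtain ⟨C, hC, hvol⟩ := exists_volume_eq_smul_map hν hB
  have hE := measurableEmbedding_lineCoord hν hB
  refine ⟨C, hC, fun g x => ⟨fun h => ?_, ?_⟩⟩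
  · have h1 : Integrable (fun ξ => g (ξ - x)) := by
      rw [hvol]
      exact Integrable.smul_measure_nnreal ((hE.integrable_map_iff (f := lineCoord ν B) (g := fun ξ => g (ξ - x))).2 h)
    simpa using h1.comp_add_right x
  · rw [← integral_sub_right_eq_self g x, hvol, integral_smul_nnreal_measure, hE.integral_map]

/-- For `‖y‖ < ‖ρ_⊥‖` the constant term is negative, so no root is met on the way towards the side
of `Im z`; the imaginary part of the frequency grows only to `γ/4`. -/
theorem integral_lineFun_shift (hγ : 0 < γ) (hν : ‖ν‖ = 1) (hB : ∀ y, inner ℝ ν (B y) = 0) {σ : ℝ}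
    (hσ : σ = 1 ∨ σ = -1) {J : JetIndex (d + 1) 2} {z : ℂ} (hz : 0 < σ * z.im) (x : PerpR ν)
    {y : RSp d} (hy : ‖y‖ < ‖x.1‖) :
    ∫ t : ℝ, lineFun γ B (2 + 2 * (d + 3)) J (z, perpToC x) t y =
      ∫ t : ℝ, lineFun γ B (2 + 2 * (d + 3)) J (z, perpToC x) (shiftVar γ σ t) y := by
  have hz0 : z.im ≠ 0 := fun h => by simp [h] at hz
  have hτ : ‖y‖ ^ 2 - ‖x.1‖ ^ 2 < 0 := by nlinarith [norm_nonneg y]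
  obtain ⟨c, hc, hsym⟩ := symbol_line_sq_ge hz0 hτ
  have e : (((‖y‖ ^ 2 : ℝ) : ℂ) - cdot (perpToC x).1 (perpToC x).1) = ((‖y‖ ^ 2 - ‖x.1‖ ^ 2 : ℝ) : ℂ) := by
    rw [cdot_perpToC]; push_cast; ring
  have him : ∀ s : ℂ, s.im ∈ Set.uIcc 0 (σ * (γ / 4)) → 0 ≤ s.im * z.im ∧ |s.im| ≤ γ / 4 := by
    intro s hs
    rcases hσ with rfl | rfl
    · rw [one_mul] at hz
      rw [one_mul, Set.uIcc_of_le (by positivity)] at hs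
      exact ⟨mul_nonneg hs.1 hz.le, abs_le.2 ⟨by linarith [hs.1], hs.2⟩⟩
    · rw [Set.uIcc_of_ge (by linarith)] at hs
      exact ⟨mul_nonneg_of_nonpos_of_nonpos hs.2 (by linarith), abs_le.2 ⟨by linarith [hs.1], by linarith [hs.2]⟩⟩
  have hζ : ∀ s : ℂ, s.im ∈ Set.uIcc 0 (σ * (γ / 4)) →
      ‖imPart (contourVec ν B (perpToC x).1 s 1 y)‖ ≤ 3 * γ / 4 := fun s hs => by
    have h := norm_imPart_contourVec_le (B := B) hν (perpToC x).1 s 1 y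
    have h' : ‖imPart (perpToC x).1‖ = 0 := by
      rw [show (perpToC x).1 = toC x.1 from rfl, imPart_toC, norm_zero]
    rw [Complex.one_im, abs_zero, zero_mul, h'] at h
    linarith [(him s hs).2]
  obtain ⟨P, hP⟩ : ∃ P, ‖paramVec (z, perpToC x)‖ ≤ P := ⟨_, le_rfl⟩
  have hP0 : 0 ≤ P := (norm_nonneg _).trans hP
  unfold shiftVar
  refine integral_contour_shift (g := fun t => lineFun γ B (2 + 2 * (d + 3)) J (z, perpToC x) t y)
    (δ := σ * (γ / 4)) (C := c⁻¹ * coreConst d γ P) (fun s hs => ?_) fun s hs => ?_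
  · unfold lineFun
    have hd1 : DifferentiableAt ℂ (fun t : ℂ => contourVec ν B (perpToC x).1 t 1 y) s := by
      unfold contourVec
      fun_prop
    have hd2 : DifferentiableAt ℂ (fun t : ℂ => t ^ 2 + 2 * z * t +
        (((‖y‖ ^ 2 : ℝ) : ℂ) - cdot (perpToC x).1 (perpToC x).1)) s := by fun_prop
    refine (hd2.inv ?_).smul
      (differentiableAt_coreOp (differentiableAt_const _) hd1 ((hζ s hs).trans_lt (by linarith)))
    rw [e]
    exact norm_pos_iff.1 (hc.trans_le (hsym s (him s hs).1))
  · have h1 := hsym s (him s hs).1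
    have hs1 : |s.re| ≤ ‖contourVec ν B (perpToC x).1 s 1 y‖ :=
      (Complex.abs_re_le_norm s).trans (norm_le_norm_contourVec hν hB (perpToC x) s _ y)
    have h2 := norm_coreOp_le (k := d + 3) (J := J) (Y := 2 + P) (y := 0) hγ (κ := 3 * γ / 4)
      (by linarith) (hζ s hs) hP hs1 le_rfl
      (by nlinarith [norm_nonneg (contourVec ν B (perpToC x).1 s 1 y)])
    have h3 : ((1 + |s.re|) ^ (d + 3))⁻¹ ≤ (1 + s.re ^ 2)⁻¹ := by
      refine inv_anti₀ (by positivity) ?_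
      have h1 := abs_nonneg s.re
      calc 1 + s.re ^ 2 ≤ (1 + |s.re|) ^ 2 := by rw [← sq_abs s.re]; nlinarith
        _ ≤ _ := pow_le_pow_right₀ (by linarith) (by omega)
    have hC := coreConst_nonneg (d := d) (γ := γ) hP0
    change ‖lineFun γ B (2 + 2 * (d + 3)) J (z, perpToC x) s y‖ ≤ _
    rw [lineFun, norm_smul, e, norm_inv, mul_assoc c⁻¹]
    refine mul_le_mul (inv_anti₀ hc h1) (h2.trans ?_) (norm_nonneg _) (by positivity)
    calc _ = coreConst d γ P * ((1 + |s.re|) ^ (d + 3))⁻¹ := by simp [coreConst]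
      _ ≤ _ := mul_le_mul_of_nonneg_left h3 hC

theorem csqrt_cdot_perpToC (x : PerpR ν) : csqrt (cdot (perpToC x).1 (perpToC x).1) = (‖x.1‖ : ℂ) := by
  rw [cdot_perpToC, csqrt_ofReal (by positivity), Real.sqrt_sq (norm_nonneg _)]

theorem innerFun_eq {N : ℕ} (σ : ℝ) {J : JetIndex (d + 1) 2} (z : ℂ) (x : PerpR ν) (v : ℝ × RSp d) :
    innerFun γ σ B N J (z, perpToC x) v =
      (‖x.1‖ ^ d) • lineFun γ B N J (z, perpToC x) (shiftVar γ σ v.1) (‖x.1‖ • v.2) := by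
  rw [innerFun, lineFun, contourVec_smul, csqrt_cdot_perpToC, RCLike.real_smul_eq_coe_smul (K := ℂ), smul_smul]
  congr 2
  · push_cast; rfl
  · congr 1
    rw [cdot_perpToC, norm_smul, norm_norm]
    push_cast
    ring

theorem outerFun_eq {N : ℕ} {J : JetIndex (d + 1) 2} (z : ℂ) (x : PerpR ν) {v : ℝ × RSp d} (hv : 1 < ‖v.2‖) :
    outerFun γ B N J (z, perpToC x) v =
      ((Real.sqrt (‖x.1‖ ^ 2 + ‖v.2‖ ^ 2 - 1) / ‖v.2‖) ^ (d - 2)) • lineFun γ B N J (z, perpToC x) v.1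
        ((Real.sqrt (‖x.1‖ ^ 2 + ‖v.2‖ ^ 2 - 1) / ‖v.2‖) • v.2) := by
  have h0 : 0 ≤ ‖x.1‖ ^ 2 + ‖v.2‖ ^ 2 - 1 := by nlinarith [sq_nonneg ‖x.1‖]
  have h1 : outerScale (cdot (perpToC x).1 (perpToC x).1) v.2 =
      ((Real.sqrt (‖x.1‖ ^ 2 + ‖v.2‖ ^ 2 - 1) / ‖v.2‖ : ℝ) : ℂ) := by
    rw [outerScale, cdot_perpToC, ← Complex.ofReal_add, csqrt_ofReal (by linarith), div_eq_mul_inv,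
      Complex.ofReal_mul, ← add_sub_assoc]
  have hv0 : ‖v.2‖ ≠ 0 := by positivity
  rw [outerFun, lineFun, contourVec_smul, h1, RCLike.real_smul_eq_coe_smul (K := ℂ), smul_smul]
  congr 2
  · push_cast; rfl
  · congr 2
    rw [cdot_perpToC, ← Complex.ofReal_sub, norm_smul, Real.norm_of_nonneg (by positivity),
      div_mul_cancel₀ _ hv0, Real.sq_sqrt h0]
    congr 1
    ring

/-- The sphere `‖y‖ = ‖ρ_⊥‖` is a null set. Inside it the ball is scaled to the unit ball and the
`t`-line is shifted, outside it the radial substitution is applied. Neither changes the integral at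
real `ρ_⊥`, but the new integrands have holomorphic continuations. -/
theorem integral_lineFun_eq_contourOp (hd : 2 ≤ d) (hγ : 0 < γ) (hν : ‖ν‖ = 1)
    (hB : ∀ y, inner ℝ ν (B y) = 0) {σ : ℝ} (hσ : σ = 1 ∨ σ = -1) {J : JetIndex (d + 1) 2} {z : ℂ}
    (hz : 0 < σ * z.im) {x : PerpR ν} (hx : x ≠ 0) :
    ∫ v : ℝ × RSp d, lineFun γ B (2 + 2 * (d + 3)) J (z, perpToC x) v.1 v.2 =
      contourOp γ σ B J (z, perpToC x) := by
  have hz0 : z.im ≠ 0 := fun h => by simp [h] at hz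
  have := nontrivial_RSp hd
  have hl : 0 < ‖x.1‖ := norm_pos_iff.2 fun h0 => hx (Subtype.ext h0)
  have hp : (z, perpToC x) ∈ paramDomain γ ν σ := ⟨hz, perpToC_mem_perpDomain hγ hx⟩
  have hint := integrable_lineFun hd hγ hν hB (J := J) hz0 hx
  set N := 2 + 2 * (d + 3)
  set Φ : RSp d → (ExpL2 (bracketWeight (d + 1) (-γ)) →L[ℂ] ExpL2 (bracketWeight (d + 1) γ)) :=
    fun y => ∫ t : ℝ, lineFun γ B N J (z, perpToC x) t y with hΦ
  have hΦi : Integrable Φ := by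
    rw [Measure.volume_eq_prod] at hint
    exact hint.integral_prod_right
  have h1 : ∫ v : ℝ × RSp d, lineFun γ B N J (z, perpToC x) v.1 v.2 = ∫ y, Φ y := by
    rw [Measure.volume_eq_prod, integral_prod_symm _ (by rwa [Measure.volume_eq_prod] at hint)]
  have h2 : ∫ y, Φ y = (∫ y in Metric.ball 0 ‖x.1‖, Φ y) + ∫ y in {y | ‖x.1‖ < ‖y‖}, Φ y := by
    rw [← integral_add_compl measurableSet_ball hΦi]
    congr 1
    refine setIntegral_congr_set ?_
    filter_upwards [ae_norm_ne d hd ‖x.1‖] with y hy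
    refine propext ?_
    change ¬ y ∈ Metric.ball 0 ‖x.1‖ ↔ ‖x.1‖ < ‖y‖
    rw [mem_ball_zero_iff, not_lt]
    exact ⟨fun h => lt_of_le_of_ne h hy.symm, le_of_lt⟩
  have h3 : ∫ y in Metric.ball 0 ‖x.1‖, Φ y = ∫ v, innerFun γ σ B N J (z, perpToC x) v ∂innerMeasure d := by
    rw [innerMeasure, integral_prod_symm _ (integrable_innerFun hγ hν hB hσ hp)]
    have e1 := Measure.setIntegral_comp_smul_of_pos (volume : Measure (RSp d)) Φ (Metric.ball 0 1) hl
    rw [finrank_euclideanSpace_fin, smul_unitBall_of_pos hl] at e1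
    have e2 : ∫ y in Metric.ball 0 ‖x.1‖, Φ y = ‖x.1‖ ^ d • ∫ y in Metric.ball 0 1, Φ (‖x.1‖ • y) := by
      rw [e1, smul_smul, mul_inv_cancel₀ (by positivity), one_smul]
    rw [e2, ← integral_smul]
    refine setIntegral_congr_fun measurableSet_ball fun y hy => ?_
    have hy1 : ‖y‖ < 1 := mem_ball_zero_iff.1 hy
    have hy2 : ‖‖x.1‖ • y‖ < ‖x.1‖ := by
      rw [norm_smul, norm_norm]; exact mul_lt_of_lt_one_right hl hy1
    simp only [hΦ]
    rw [integral_lineFun_shift hγ hν hB hσ hz x hy2, ← integral_smul]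
    exact integral_congr_ae (Filter.Eventually.of_forall fun t => (innerFun_eq σ z x (t, y)).symm)
  have h4 : ∫ y in {y | ‖x.1‖ < ‖y‖}, Φ y = ∫ v, outerFun γ B N J (z, perpToC x) v ∂outerMeasure d := by
    rw [outerMeasure, integral_prod_symm _ (integrable_outerFun hd hγ hν hB hp),
      integral_outer volume (by rw [finrank_euclideanSpace_fin]; exact hd) hl hΦi.integrableOn]
    refine setIntegral_congr_fun (measurableSet_one_lt_norm d) fun y hy => ?_
    simp only [hΦ]
    rw [finrank_euclideanSpace_fin, ← integral_smul]
    exact integral_congr_ae (Filter.Eventually.of_forall fun t => (outerFun_eq z x (v := (t, y)) hy).symm)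
  rw [h1, h2, h3, h4, contourOp]

end

/-! ### Pairing with test functions -/

theorem integral_fourierInv_mul {n : ℕ} {h φ : RSp n → ℂ} (hh : Integrable h) (hφ : Integrable φ) :
    ∫ w, (𝓕⁻ h) w * φ w = ∫ ξ, h ξ * (𝓕⁻ φ) ξ := by
  have h3 := VectorFourier.integral_fourierIntegral_smul_eq_flip (L := -innerₗ (RSp n))
    Real.continuous_fourierChar (by
      change Continuous fun p : RSp n × RSp n => -(inner ℝ p.1 p.2)
      fun_prop) (μ := volume) (ν := volume) hh hφ
  have h4 : (-innerₗ (RSp n)).flip = -innerₗ (RSp n) := by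
    ext x y
    simp [real_inner_comm]
  rw [h4] at h3
  exact h3

theorem continuous_fourierInv {n : ℕ} {h : RSp n → ℂ} (hh : Integrable h) : Continuous (𝓕⁻ h) :=
  VectorFourier.fourierIntegral_continuous (L := -innerₗ (RSp n)) Real.continuous_fourierChar (by
      change Continuous fun p : RSp n × RSp n => -(inner ℝ p.1 p.2)
      fun_prop) hh

theorem norm_fourierInv_le {n : ℕ} (h : RSp n → ℂ) (w : RSp n) : ‖(𝓕⁻ h) w‖ ≤ ∫ ξ, ‖h ξ‖ :=
  VectorFourier.norm_fourierIntegral_le_integral_norm _ _ _ _ _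

theorem expMode_freqVec {n : ℕ} (ξ w : RSp n) :
    expMode (freqVec ξ) w = Complex.exp (((2 * Real.pi * inner ℝ ξ w : ℝ) : ℂ) * Complex.I) := by
  rw [expMode, freqVec, cdot_toC, inner_smul_left, mul_comm]
  rfl

theorem expMode_neg_freqVec {n : ℕ} (ξ w : RSp n) :
    expMode (-freqVec ξ) w = Complex.exp (((-2 * Real.pi * inner ℝ w ξ : ℝ) : ℂ) * Complex.I) := by
  rw [expMode, freqVec, neg_cdot, cdot_toC, inner_smul_left, real_inner_comm]
  congr 1
  push_cast
  simp
  ring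

theorem norm_imPart_freqVec_lt {n : ℕ} {γ : ℝ} (hγ : 0 < γ) (ξ : RSp n) : ‖imPart (freqVec ξ)‖ < γ := by
  rw [imPart_freqVec, norm_zero]; exact hγ

theorem norm_imPart_neg_freqVec_lt {n : ℕ} {γ : ℝ} (hγ : 0 < γ) (ξ : RSp n) :
    ‖imPart (-freqVec ξ)‖ < γ := by
  rw [imPart_neg, imPart_freqVec, neg_zero, norm_zero]; exact hγ

theorem expPairing_modeLp_neg {n : ℕ} {γ : ℝ} (hγ : 0 < γ) (f : ExpL2 (bracketWeight n (-γ))) (ξ : RSp n) :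
    expPairing (bracketWeight n γ) (bracketWeight n (-γ)) (modeLp γ (-freqVec ξ)) f =
      𝓕 (f : RSp n → ℂ) ξ := by
  rw [expPairing_apply (bracketWeight_neg n γ), Real.fourier_eq']
  refine integral_congr_ae ?_
  filter_upwards [coeFn_modeLp_volume (norm_imPart_neg_freqVec_lt hγ ξ)] with w hw
  rw [hw, expMode_neg_freqVec, smul_eq_mul]

theorem modeOp_freqVec_apply {n : ℕ} {γ : ℝ} (hγ : 0 < γ) (f : ExpL2 (bracketWeight n (-γ))) (ξ : RSp n) :
    modeOp γ (freqVec ξ) f = 𝓕 (f : RSp n → ℂ) ξ • modeLp γ (freqVec ξ) := by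
  rw [modeOp_apply, expPairing_modeLp_neg hγ]

theorem expPairing_modeLp_freqVec {n : ℕ} {γ : ℝ} (hγ : 0 < γ) {g : ExpL2 (bracketWeight n (-γ))}
    {φ : RSp n → ℂ} (hg : g =ᵐ[volume] φ) (ξ : RSp n) :
    expPairing (bracketWeight n γ) (bracketWeight n (-γ)) (modeLp γ (freqVec ξ)) g = (𝓕⁻ φ) ξ := by
  rw [expPairing_apply (bracketWeight_neg n γ), Real.fourierInv_eq']
  refine integral_congr_ae ?_
  filter_upwards [coeFn_modeLp_volume (norm_imPart_freqVec_lt hγ ξ), hg] with w hw h2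
  rw [hw, h2, expMode_freqVec, smul_eq_mul, real_inner_comm]

theorem imPart_zero {n : ℕ} : imPart (0 : CSp n) = 0 := by
  ext i; simp [imPart]

theorem norm_modeLp_zero_pos {n : ℕ} {γ : ℝ} (hγ : 0 < γ) : 0 < ‖modeLp (n := n) γ 0‖ := by
  rw [norm_pos_iff]
  intro h
  have h1 := coeFn_modeLp_volume (n := n) (γ := γ) (ζ := 0) (by simpa [imPart_zero] using hγ)
  rw [h] at h1
  have h2 : (0 : ExpL2 (bracketWeight n γ)) =ᵐ[volume] (0 : RSp n → ℂ) := by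
    have := Lp.coeFn_zero ℂ 2 (expMeasure (bracketWeight n γ))
    rwa [Filter.EventuallyEq, ae_expMeasure] at this
  have h3 : ∀ᵐ w : RSp n, False := by
    filter_upwards [h1, h2] with w h1 h2
    rw [h2] at h1
    exact Complex.exp_ne_zero _ h1.symm
  exact NeZero.ne (volume : Measure (RSp n)) (by simpa using h3)

/-- At real frequencies the modes are unimodular. A common positive lower bound for their norms lets
scalar integrability be recovered from that of an operator valued integrand. -/
theorem norm_modeLp_zero_le {n : ℕ} {γ : ℝ} (hγ : 0 < γ) (ξ : RSp n) :
    ‖modeLp (n := n) γ 0‖ ≤ ‖modeLp γ (freqVec ξ)‖ := by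
  refine Lp.norm_le_norm_of_ae_le ?_
  have h0 : ‖imPart (0 : CSp n)‖ < γ := by simpa [imPart_zero] using hγ
  filter_upwards [coeFn_modeLp h0, coeFn_modeLp (norm_imPart_freqVec_lt hγ ξ)] with w h1 h2
  rw [h1, h2, norm_expMode, norm_expMode, imPart_freqVec, imPart_zero]

/-- Existence of the representative in `e^{W} L²` of a compactly supported continuous function. -/
theorem exists_expL2_of_hasCompactSupport {n : ℕ} (W : C(RSp n, ℝ)) {g : RSp n → ℂ} (hg : Continuous g)
    (hc : HasCompactSupport g) : ∃ u : ExpL2 W, u =ᵐ[volume] g := by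
  have h : MemLp g 2 (expMeasure W) := hg.memLp_of_hasCompactSupport hc
  refine ⟨h.toLp g, ?_⟩
  have := h.coeFn_toLp
  rwa [Filter.EventuallyEq, ae_expMeasure] at this

theorem locallyIntegrable_expL2 {n : ℕ} {W : C(RSp n, ℝ)} (u : ExpL2 W) :
    LocallyIntegrable (u : RSp n → ℂ) volume := by
  have h : LocallyIntegrable (expToL2 W u : RSp n → ℂ) volume :=
    (Lp.memLp _).locallyIntegrable (by norm_num)
  have hc : Continuous fun w => ((Real.exp (W w) : ℝ) : ℂ) := by fun_prop
  refine (LocallyIntegrable.continuous_smul hc h).congr ?_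
  filter_upwards [coeFn_expToL2 W u] with w hw
  rw [hw, smul_eq_mul, ← mul_assoc, ← Complex.ofReal_mul, ← Real.exp_add]
  simp

/-- An operator valued integral of modes acts as an inverse Fourier transform. -/
theorem integral_modeOp_pairing {n : ℕ} {γ : ℝ} (hγ : 0 < γ) {s : RSp n → ℂ} (hs : Measurable s)
    (hint : Integrable fun ξ => s ξ • modeOp γ (freqVec ξ)) (f : ExpL2 (bracketWeight n (-γ)))
    (hf : Integrable f) (φ : 𝓢(RSp n, ℂ)) :
    Integrable (fun w => (∫ ξ, s ξ • modeOp γ (freqVec ξ)) f w * φ w) ∧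
    Integrable (fun ξ => s ξ * 𝓕 (f : RSp n → ℂ) ξ * (𝓕⁻ φ) ξ) ∧
    ∫ w, (∫ ξ, s ξ • modeOp γ (freqVec ξ)) f w * φ w =
      ∫ ξ, s ξ * 𝓕 (f : RSp n → ℂ) ξ * (𝓕⁻ φ) ξ := by
  have hcF : Continuous (𝓕 (f : RSp n → ℂ)) :=
    VectorFourier.fourierIntegral_continuous Real.continuous_fourierChar
      (innerSL ℝ).continuous₂ hf
  set h : RSp n → ℂ := fun ξ => s ξ * 𝓕 (f : RSp n → ℂ) ξ with hh
  have happ : ∀ ξ, (s ξ • modeOp γ (freqVec ξ)) f = h ξ • modeLp γ (freqVec ξ) := fun ξ => by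
    rw [_root_.smul_apply, modeOp_freqVec_apply hγ, smul_smul]
  have hhi : Integrable h := by
    have h1 : Integrable fun ξ => ‖modeLp (n := n) γ 0‖⁻¹ * (‖s ξ • modeOp γ (freqVec ξ)‖ * ‖f‖) :=
      (hint.norm.mul_const _).const_mul _
    refine h1.mono' (hs.aestronglyMeasurable.mul hcF.aestronglyMeasurable)
      (Filter.Eventually.of_forall fun ξ => ?_)
    rw [← div_eq_inv_mul, le_div_iff₀ (norm_modeLp_zero_pos hγ)]
    refine le_trans ?_ (ContinuousLinearMap.le_opNorm _ f)
    rw [happ, norm_smul]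
    exact mul_le_mul_of_nonneg_left (norm_modeLp_zero_le hγ ξ) (norm_nonneg _)
  -- Pairing with a test function is continuous and linear, so it passes under the Bochner integral;
  -- a mode paired with the test function is its inverse Fourier transform.
  have hae : (∫ ξ, s ξ • modeOp γ (freqVec ξ)) f =ᵐ[volume] 𝓕⁻ h := by
    refine ae_eq_of_integral_contDiff_smul_eq (locallyIntegrable_expL2 _)
      (continuous_fourierInv hhi).locallyIntegrable fun g hg hgc => ?_
    have hgc' : HasCompactSupport fun x => (g x : ℂ) := hgc.comp_left (g := fun t : ℝ => (t : ℂ)) (by simp)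
    have hg' : Continuous fun x => (g x : ℂ) := Complex.continuous_ofReal.comp hg.continuous
    obtain ⟨G, hG⟩ := exists_expL2_of_hasCompactSupport (bracketWeight n (-γ)) hg' hgc'
    have e1 : ∫ w, g w • (∫ ξ, s ξ • modeOp γ (freqVec ξ)) f w =
        expPairing (bracketWeight n γ) (bracketWeight n (-γ)) ((∫ ξ, s ξ • modeOp γ (freqVec ξ)) f) G := by
      rw [expPairing_apply (bracketWeight_neg n γ)]
      refine integral_congr_ae ?_
      filter_upwards [hG] with w hw
      rw [hw, Complex.real_smul, mul_comm]
    have e2 : expPairing (bracketWeight n γ) (bracketWeight n (-γ)) ((∫ ξ, s ξ • modeOp γ (freqVec ξ)) f) G =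
        ∫ ξ, h ξ * (𝓕⁻ fun x => (g x : ℂ)) ξ := by
      have := (((expPairing (bracketWeight n γ) (bracketWeight n (-γ))).flip G).comp
        (ContinuousLinearMap.apply ℂ (ExpL2 (bracketWeight n γ)) f)).integral_comp_comm hint
      refine this.symm.trans (integral_congr_ae (Filter.Eventually.of_forall fun ξ => ?_))
      change expPairing (bracketWeight n γ) (bracketWeight n (-γ)) ((s ξ • modeOp γ (freqVec ξ)) f) G = _
      rw [happ, map_smul, _root_.smul_apply, expPairing_modeLp_freqVec hγ hG, smul_eq_mul]
    rw [e1, e2, ← integral_fourierInv_mul hhi (hg'.integrable_of_hasCompactSupport hgc')]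
    refine integral_congr_ae (Filter.Eventually.of_forall fun w => ?_)
    change _ = g w • (𝓕⁻ h) w
    rw [Complex.real_smul, mul_comm]
  have hae' : (fun w => (∫ ξ, s ξ • modeOp γ (freqVec ξ)) f w * φ w) =ᵐ[volume]
      fun w => (𝓕⁻ h) w * φ w := by
    filter_upwards [hae] with w hw
    rw [hw]
  refine ⟨Integrable.congr ?_ hae'.symm, ?_, ?_⟩
  · exact φ.integrable.bdd_mul (continuous_fourierInv hhi).aestronglyMeasurable
      (Filter.Eventually.of_forall (norm_fourierInv_le h))
  · have h1 : Continuous (𝓕⁻ (φ : RSp n → ℂ)) := continuous_fourierInv φ.integrable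
    rw [SchwartzMap.fourierInv_coe]
    exact hhi.mul_bdd h1.aestronglyMeasurable (Filter.Eventually.of_forall (norm_fourierInv_le φ))
  · rw [integral_congr_ae hae', integral_fourierInv_mul hhi φ.integrable, SchwartzMap.fourierInv_coe]

theorem fourierInv_iteratedLineDerivOp {n k : ℕ} (m : Fin k → RSp n) (φ : 𝓢(RSp n, ℂ)) (ξ : RSp n) :
    (𝓕⁻ (LineDeriv.iteratedLineDerivOp m φ)) ξ =
      (∏ j, -(2 * Real.pi * Complex.I * ((inner ℝ ξ (m j) : ℝ) : ℂ))) * (𝓕⁻ φ) ξ := by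
  induction k with
  | zero => simp
  | succ k ih =>
    have ht : (inner ℝ · (m 0) : RSp n → ℝ).HasTemperateGrowth := by fun_prop
    rw [LineDeriv.iteratedLineDerivOp_succ_left, SchwartzMap.fourierInv_lineDerivOp_eq,
      _root_.smul_apply, SchwartzMap.smulLeftCLM_apply_apply ht, ih, Fin.prod_univ_succ,
      Complex.real_smul, smul_eq_mul]
    simp only [Fin.tail]
    ring

/-- The sign `(-1) ^ k` is the one in the definition of weak derivatives, so it cancels when
derivatives are moved from the test function to the symbol. -/
theorem exists_schwartz_partialDeriv {n : ℕ} (J : JetIndex n 2) (φ : 𝓢(RSp n, ℂ)) :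
    ∃ ψ : 𝓢(RSp n, ℂ), (∀ x, ψ x = partialDeriv J.1 J.2 φ x) ∧
      ∀ ξ, (𝓕⁻ ψ) ξ = (-1) ^ (J.1 : ℕ) * (jetMono J (freqVec ξ) * (𝓕⁻ φ) ξ) := by
  refine ⟨LineDeriv.iteratedLineDerivOp (fun j => EuclideanSpace.single (J.2 j) (1 : ℝ)) φ,
    fun x => SchwartzMap.iteratedLineDerivOp_eq_iteratedFDeriv, fun ξ => ?_⟩
  rw [fourierInv_iteratedLineDerivOp, ← mul_assoc]
  congr 1
  have : ∀ j : Fin J.1, -(2 * Real.pi * Complex.I *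
      ((inner ℝ ξ (EuclideanSpace.single (J.2 j) (1 : ℝ)) : ℝ) : ℂ)) =
      (-1) * (Complex.I * freqVec ξ (J.2 j)) := fun j => by
    rw [EuclideanSpace.inner_single_right, freqVec, toC_apply]
    simp
    ring
  simp only [this, Finset.prod_mul_distrib, jetMono]
  simp

theorem integrable_of_expL2 {n : ℕ} {γ : ℝ} (hγ : 0 < γ) (f : ExpL2 (bracketWeight n (-γ))) :
    Integrable (f : RSp n → ℂ) := by
  have h1 : MemLp (fun _ : RSp n => (1 : ℂ)) 2 (expMeasure (bracketWeight n γ)) :=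
    memLp_of_exp_bound (κ := 0) (C := 1) hγ hγ aestronglyMeasurable_const (fun w => by simp)
  have := integrable_mul_of_expL2 (bracketWeight_neg n γ) h1 (Lp.memLp f)
  simpa using this

theorem continuous_jetMono_freqVec {n : ℕ} (J : JetIndex n 2) :
    Continuous fun ξ : RSp n => jetMono J (freqVec ξ) := by
  unfold jetMono
  refine continuous_finsetProd _ fun j _ => continuous_const.mul ?_
  exact (EuclideanSpace.proj (𝕜 := ℂ) (J.2 j)).continuous.comp continuous_freqVec

theorem fullSymbol_eq {n : ℕ} {γ : ℝ} {ρ ζ : CSp n} (h : refSymbol γ ζ ≠ 0) :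
    fullSymbol ρ ζ = refSymbol γ ζ * (1 - symbolRatio γ ρ ζ) := by
  rw [mul_sub, symbolRatio, mul_div_cancel₀ _ h, fullSymbol, refSymbol]
  ring

/-- With `p = p₁ (1 - q)` this is the finite geometric sum with its remainder. It is exact, and
smallness of `q` plays no role. -/
theorem neumann_add_tail {n : ℕ} {γ : ℝ} {ρ ζ : CSp n} (h : refSymbol γ ζ ≠ 0) (h' : fullSymbol ρ ζ ≠ 0)
    (N : ℕ) (m : ℂ) : m / refSymbol γ ζ * ∑ k ∈ Finset.range N, symbolRatio γ ρ ζ ^ k +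
      (fullSymbol ρ ζ)⁻¹ * (m * symbolRatio γ ρ ζ ^ N) = m * (fullSymbol ρ ζ)⁻¹ := by
  have h1 := mul_geom_sum (symbolRatio γ ρ ζ) N
  have h2 := fullSymbol_eq (ρ := ρ) h
  field_simp
  rw [h2]
  linear_combination -(m * refSymbol γ ζ) * h1

/-- For real `x` the imaginary part of the symbol is a multiple of `Im z (ν·ξ)`, hence nonzero off a
hyperplane. -/
theorem ae_fullSymbol_ne_zero {n : ℕ} {ν : RSp n} (hν : ‖ν‖ = 1) {z : ℂ} (hz : z.im ≠ 0) (x : RSp n) :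
    ∀ᵐ ξ : RSp n, fullSymbol (z • toC ν + toC x) (freqVec ξ) ≠ 0 := by
  have h : ∀ᵐ ξ : RSp n, inner ℝ ν ξ ≠ (0 : ℝ) := by
    have := Measure.addHaar_submodule (volume : Measure (RSp n)) (LinearMap.ker (innerₗ (RSp n) ν))
      (fun h => by
        have : ν ∈ LinearMap.ker (innerₗ (RSp n) ν) := by rw [h]; trivial
        rw [LinearMap.mem_ker, innerₗ_apply_apply, real_inner_self_eq_norm_sq, hν] at this
        norm_num at this)
    rw [ae_iff]
    convert this using 2
    ext ξ
    simp
  filter_upwards [h] with ξ hξ h0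
  have h1 := congrArg Complex.im h0
  rw [fullSymbol, freqVec, add_cdot, smul_cdot, cdot_toC, cdot_toC, cdot_toC, inner_smul_right ν] at h1
  simp only [Complex.add_im, Complex.mul_im, Complex.ofReal_im, Complex.ofReal_re, Complex.zero_im,
    Complex.re_ofNat, Complex.im_ofNat] at h1
  have h2 : z.im * inner ℝ ν ξ * Real.pi = 0 := by linarith
  exact (mul_ne_zero (mul_ne_zero hz hξ) Real.pi_ne_zero) h2

theorem faddeevSymbol_eq {n : ℕ} (ρ : CSp n) (ξ : RSp n) :
    faddeevSymbol ρ ((2 * Real.pi) • ξ) = fullSymbol ρ (freqVec ξ) := by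
  rw [faddeevSymbol, fullSymbol, freqVec, cdot_toC, real_inner_self_eq_norm_sq]

/-- The sign of the imaginary part. -/
def imSign (z : ℂ) : ℝ := if 0 < z.im then 1 else -1

theorem imSign_eq (z : ℂ) : imSign z = 1 ∨ imSign z = -1 := by unfold imSign; split_ifs <;> simp

theorem imSign_mul_im_pos {z : ℂ} (hz : z.im ≠ 0) : 0 < imSign z * z.im := by
  unfold imSign
  split_ifs with h
  · simpa
  · have := lt_of_le_of_ne (not_lt.1 h) hz
    linarith

/-- The direction of the shift depends on the half plane of `z`; being locally constant, it does not
disturb analyticity. -/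
theorem eventually_imSign_eq {z : ℂ} (hz : z.im ≠ 0) : ∀ᶠ w in nhds z, imSign w = imSign z := by
  rcases lt_or_gt_of_ne hz with h | h
  · filter_upwards [(isOpen_lt Complex.continuous_im continuous_const).mem_nhds h] with w hw
    have hw' : w.im < 0 := hw
    rw [imSign, imSign, if_neg (not_lt.2 hw'.le), if_neg (not_lt.2 h.le)]
  · filter_upwards [(isOpen_lt continuous_const Complex.continuous_im).mem_nhds h] with w hw
    have hw' : 0 < w.im := hw
    rw [imSign, imSign, if_pos hw', if_pos h]

/-! ### Assembly of the resolvent from multiplier and contour parts. -/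

section

variable {d : ℕ} {γ : ℝ} {ν : RSp (d + 1)} {B : RSp d →ₗᵢ[ℝ] RSp (d + 1)}

/-- The constant `κ` collects the Haar constant of the line coordinates and the Jacobian of `ξ ↦
2πξ`. It must not depend on `J`, `z` or `x`, since it enters the definition of the analytic family.
-/
theorem exists_contourOp_eq_integral (hd : 2 ≤ d) (hγ : 0 < γ) (hν : ‖ν‖ = 1)
    (hB : ∀ y, inner ℝ ν (B y) = 0) : ∃ κ : ℝ, ∀ (J : JetIndex (d + 1) 2) (z : ℂ) (x : PerpR ν),
      z.im ≠ 0 → x ≠ 0 →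
      Integrable (fun ξ => resolventFun γ (2 + 2 * (d + 3)) J (paramVec (z, perpToC x)) ((2 * Real.pi) • ξ)) ∧
      ∫ ξ, resolventFun γ (2 + 2 * (d + 3)) J (paramVec (z, perpToC x)) ((2 * Real.pi) • ξ) =
        (κ : ℂ) • contourOp γ (imSign z) B J (z, perpToC x) := by
  obtain ⟨C, -, hC⟩ := integrable_integral_resolventFun hν hB
  refine ⟨|((2 * Real.pi) ^ (d + 1))⁻¹| * C, fun J z x hz hx => ?_⟩
  obtain ⟨h1, h2⟩ := hC (resolventFun γ (2 + 2 * (d + 3)) J (paramVec (z, perpToC x))) x.1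
  simp only [resolventFun_lineCoord hν hB] at h1 h2
  refine ⟨(h1 (integrable_lineFun hd hγ hν hB hz hx)).comp_smul (by positivity), ?_⟩
  rw [Measure.integral_comp_smul, finrank_euclideanSpace_fin, h2,
    integral_lineFun_eq_contourOp hd hγ hν hB (imSign_eq z) (imSign_mul_im_pos hz) hx, NNReal.smul_def,
    smul_smul, RCLike.real_smul_eq_coe_smul (K := ℂ)]
  rfl

/-- The derivative with index `J` of the resolvent, at complex parameters. -/
def resolventComp (hγ : 0 < γ) (κ : ℝ) (B : RSp d →ₗᵢ[ℝ] RSp (d + 1)) (J : JetIndex (d + 1) 2)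
    (p : ℂ × PerpC ν) :
    ExpL2 (bracketWeight (d + 1) (-γ)) →L[ℂ] ExpL2 (bracketWeight (d + 1) γ) :=
  neumannOp hγ.le (2 + 2 * (d + 3)) J (paramVec p) + (κ : ℂ) • contourOp γ (imSign p.1) B J p

theorem analyticOnNhd_resolventComp (hd : 2 ≤ d) (hγ : 0 < γ) (hν : ‖ν‖ = 1)
    (hB : ∀ y, inner ℝ ν (B y) = 0) (κ : ℝ) (J : JetIndex (d + 1) 2) :
    AnalyticOnNhd ℂ (resolventComp (ν := ν) hγ κ B J) ({z : ℂ | z.im ≠ 0} ×ˢ perpDomain γ ν) := by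
  intro p hp
  have h1 : AnalyticAt ℂ (fun p : ℂ × PerpC ν => neumannOp hγ.le (2 + 2 * (d + 3)) J (paramVec p)) p := by
    refine AnalyticAt.fun_comp (f := paramVec) (analyticAt_neumannOp hγ.le _ J _) ?_
    exact (analyticAt_fst.smul analyticAt_const).add
      (((PerpC ν).subtypeL.comp (ContinuousLinearMap.snd ℂ ℂ (PerpC ν))).analyticAt p)
  have h2 : AnalyticAt ℂ (fun q => (κ : ℂ) • contourOp (ν := ν) γ (imSign p.1) B J q) p :=
    analyticAt_const.fun_smul (analyticOnNhd_contourOp hd hγ hν hB (imSign_eq p.1) J p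
      ⟨imSign_mul_im_pos hp.1, hp.2⟩)
  refine (h1.add h2).congr ?_
  filter_upwards [continuous_fst.continuousAt.eventually (eventually_imSign_eq hp.1)] with q hq
  rw [resolventComp, ← hq]
  rfl

/-- The multiplier part and the contour part represent the two summands in `neumann_add_tail`;
together they act on test functions as the Fourier multiplier with symbol `jetMono J / p`. -/
theorem resolventComp_pairing (hγ : 0 < γ) (hν : ‖ν‖ = 1) {κ : ℝ} {J : JetIndex (d + 1) 2} {z : ℂ}
    {x : PerpR ν} (hz : z.im ≠ 0)
    (hi : Integrable (fun ξ => resolventFun γ (2 + 2 * (d + 3)) J (paramVec (z, perpToC x)) ((2 * Real.pi) • ξ)))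
    (he : ∫ ξ, resolventFun γ (2 + 2 * (d + 3)) J (paramVec (z, perpToC x)) ((2 * Real.pi) • ξ) =
        (κ : ℂ) • contourOp γ (imSign z) B J (z, perpToC x))
    (f : ExpL2 (bracketWeight (d + 1) (-γ))) (φ : 𝓢(RSp (d + 1), ℂ)) :
    Integrable (fun w => resolventComp hγ κ B J (z, perpToC x) f w * φ w) ∧
    Integrable (fun ξ => jetMono J (freqVec ξ) * (fullSymbol (rhoVec z x) (freqVec ξ))⁻¹ *
      𝓕 (f : RSp (d + 1) → ℂ) ξ * (𝓕⁻ φ) ξ) ∧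
    ∫ w, resolventComp hγ κ B J (z, perpToC x) f w * φ w =
      ∫ ξ, jetMono J (freqVec ξ) * (fullSymbol (rhoVec z x) (freqVec ξ))⁻¹ *
      𝓕 (f : RSp (d + 1) → ℂ) ξ * (𝓕⁻ φ) ξ := by
  have hρ : paramVec (z, perpToC x) = rhoVec z x := rfl
  rw [hρ] at hi he
  set N := 2 + 2 * (d + 3)
  set s : RSp (d + 1) → ℂ := fun ξ => (fullSymbol (rhoVec z x) (freqVec ξ))⁻¹ *
    (jetMono J (freqVec ξ) * symbolRatio γ (rhoVec z x) (freqVec ξ) ^ N) with hs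
  have hres : (fun ξ => resolventFun γ N J (rhoVec z x) ((2 * Real.pi) • ξ)) =
      fun ξ => s ξ • modeOp γ (freqVec ξ) := by
    ext1 ξ
    rw [resolventFun, coreOp, smul_smul]
    rfl
  have hsm : Measurable s := by
    refine Measurable.mul (Measurable.inv ?_) ?_
    · exact ((continuous_cdot continuous_freqVec continuous_freqVec).add
        (continuous_const.mul (continuous_cdot continuous_const continuous_freqVec))).measurable
    · have := (ratioFun hγ.le (rhoVec z x)).continuous.congr (ratioFun_apply hγ.le _)
      exact ((continuous_jetMono_freqVec J).mul (this.pow N)).measurable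
  rw [hres] at hi he
  have hf := integrable_of_expL2 hγ f
  set g : Lp ℂ 2 (volume : Measure (RSp (d + 1))) := expToLp (bracketWeight (d + 1) (-γ)) (fun _ =>
      mul_nonpos_of_nonpos_of_nonneg (neg_nonpos.2 hγ.le) (Real.sqrt_nonneg _)) f
  have hgf : g =ᵐ[volume] f := coeFn_expToLp _ f
  obtain ⟨a1, a2, a3⟩ := integral_fourierMult_mul (neumannFun hγ.le N J (rhoVec z x)) g
    (hf.congr hgf.symm) φ
  obtain ⟨b1, b2, b3⟩ := integral_modeOp_pairing hγ hsm hi f hf φ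
  have hu : (fun w => resolventComp hγ κ B J (z, perpToC x) f w * φ w) =ᵐ[volume]
      fun w => fourierMult _ (neumannFun hγ.le N J (rhoVec z x)) g w * φ w +
        (∫ ξ, s ξ • modeOp γ (freqVec ξ)) f w * φ w := by
    have h1 := Lp.coeFn_add (neumannOp hγ.le N J (rhoVec z x) f) ((∫ ξ, s ξ • modeOp γ (freqVec ξ)) f)
    rw [Filter.EventuallyEq, ae_expMeasure] at h1
    have h2 : neumannOp hγ.le N J (rhoVec z x) f =ᵐ[volume]
      fourierMult _ (neumannFun hγ.le N J (rhoVec z x)) g :=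
      coeFn_lpToExp (fun _ => mul_nonneg hγ.le (Real.sqrt_nonneg _)) _
    filter_upwards [h1, h2] with w h1 h2
    rw [← add_mul, ← h2]
    congr 1
    rw [← Pi.add_apply, ← h1, he]
    rfl
  have hG : ∀ ξ, 𝓕 (g : RSp (d + 1) → ℂ) ξ = 𝓕 (f : RSp (d + 1) → ℂ) ξ := Real.fourier_congr_ae hgf
  have hv : (fun ξ => neumannFun hγ.le N J (rhoVec z x) ξ * 𝓕 (g : RSp (d + 1) → ℂ) ξ * (𝓕⁻ φ) ξ +
      s ξ * 𝓕 (f : RSp (d + 1) → ℂ) ξ * (𝓕⁻ φ) ξ) =ᵐ[volume] fun ξ => jetMono J (freqVec ξ) *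
      (fullSymbol (rhoVec z x) (freqVec ξ))⁻¹ * 𝓕 (f : RSp (d + 1) → ℂ) ξ * (𝓕⁻ φ) ξ := by
    filter_upwards [ae_fullSymbol_ne_zero hν hz x.1] with ξ hξ
    rw [show z • toC ν + toC x.1 = rhoVec z x from rfl] at hξ
    rw [hG, neumannFun_apply, ← add_mul, ← add_mul,
      ← neumann_add_tail (refSymbol_freqVec_ne_zero hγ.le ξ) hξ N]
  refine ⟨(a1.add b1).congr hu.symm, (a2.add b2).congr hv, ?_⟩
  rw [integral_congr_ae hu, ← integral_congr_ae hv, integral_add a1 b1, integral_add a2 b2, a3, b3]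

end

/-! ### The weighted Sobolev space -/

/-- Test functions belong to the dual space `e^{-W}L²`, so each defining equation compares two
continuous functionals. Closedness gives completeness and the orthogonal projection. -/
theorem isClosed_expSobolev {n m : ℕ} {W W' : C(RSp n, ℝ)} (h : ∀ w, W' w = -W w) :
    IsClosed (ExpSobolev W m : Set (PiLp 2 fun _ : JetIndex n m => ExpL2 W)) := by
  have hcont : ∀ (J : JetIndex n m) {g : RSp n → ℂ}, Continuous g → HasCompactSupport g →
      Continuous fun v : PiLp 2 fun _ : JetIndex n m => ExpL2 W => ∫ x, v J x * g x := by
    intro J g hg hc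
    obtain ⟨G, hG⟩ := exists_expL2_of_hasCompactSupport W' hg hc
    have : (fun v : PiLp 2 fun _ : JetIndex n m => ExpL2 W => ∫ x, v J x * g x) =
        fun v => expPairing W W' (v J) G := by
      ext v
      rw [expPairing_apply h]
      refine integral_congr_ae ?_
      filter_upwards [hG] with w hw
      rw [hw]
    rw [this]
    exact ((expPairing W W').flip G).continuous.comp (PiLp.continuous_apply 2 _ J)
  have hset : (ExpSobolev W m : Set (PiLp 2 fun _ : JetIndex n m => ExpL2 W)) =
      ⋂ (J : JetIndex n m) (φ : RSp n → ℂ) (_ : ContDiff ℝ ∞ φ) (_ : HasCompactSupport φ),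
        {v | ∫ x, v (jetZero n m) x * partialDeriv J.1 J.2 φ x = (-1) ^ (J.1 : ℕ) * ∫ x, v J x * φ x} := by
    ext v
    simp only [Set.mem_iInter]
    rfl
  rw [hset]
  refine isClosed_iInter fun J => isClosed_iInter fun φ => isClosed_iInter fun hφ => isClosed_iInter fun hc => ?_
  exact isClosed_eq (hcont _ (continuous_partialDeriv _ hφ) (hasCompactSupport_partialDeriv _ hc))
    (continuous_const.mul (hcont _ hφ.continuous hc))

instance {n m : ℕ} (γ : ℝ) : CompleteSpace (ExpSobolev (bracketWeight n γ) m) :=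
  (isClosed_expSobolev (bracketWeight_neg n γ)).completeSpace_coe

/-- The embedding of `e^{W} L²` as a factor of the product of jets. -/
def jetSingle {n m : ℕ} (W : C(RSp n, ℝ)) (J : JetIndex n m) :
    ExpL2 W →L[ℂ] PiLp 2 fun _ : JetIndex n m => ExpL2 W :=
  (PiLp.continuousLinearEquiv 2 ℂ fun _ : JetIndex n m => ExpL2 W).symm.toContinuousLinearMap.comp
    (ContinuousLinearMap.single ℂ (fun _ : JetIndex n m => ExpL2 W) J)

theorem sum_jetSingle_apply {n m : ℕ} {W : C(RSp n, ℝ)} (u : JetIndex n m → ExpL2 W) (K : JetIndex n m) :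
    (∑ J, jetSingle W J (u J)) K = u K := by
  have h1 : ∀ J, (jetSingle W J (u J)) K = (Pi.single J (u J) : JetIndex n m → ExpL2 W) K := fun J => rfl
  have h2 := map_sum (PiLp.proj 2 (𝕜 := ℂ) (fun _ : JetIndex n m => ExpL2 W) K)
    (fun J => jetSingle W J (u J)) Finset.univ
  refine h2.trans ?_
  simp only [PiLp.proj_apply, h1]
  exact Finset.sum_pi_single K u Finset.univ |>.trans (if_pos (Finset.mem_univ K))

section

variable {d : ℕ} {γ : ℝ} {ν : RSp (d + 1)}

/-- The resolvent with values in the weighted Sobolev space. -/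
def sobolevResolvent (hγ : 0 < γ) (κ : ℝ) (B : RSp d →ₗᵢ[ℝ] RSp (d + 1)) (p : ℂ × PerpC ν) :
    ExpL2 (bracketWeight (d + 1) (-γ)) →L[ℂ] ExpSobolev (bracketWeight (d + 1) γ) 2 :=
  -- The projection puts the values in the Sobolev space for every parameter, without proving that
  -- the components at complex `ρ_⊥` are weak derivatives of one function. It is continuous and
  -- linear, which preserves analyticity, and at real points it acts as the identity on the jet.
  ∑ J, ((ExpSobolev (bracketWeight (d + 1) γ) 2).orthogonalProjectionOnto.comp
    (jetSingle (bracketWeight (d + 1) γ) J)).comp (resolventComp hγ κ B J p)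

variable {B : RSp d →ₗᵢ[ℝ] RSp (d + 1)}

theorem analyticOnNhd_sobolevResolvent (hd : 2 ≤ d) (hγ : 0 < γ) (hν : ‖ν‖ = 1)
    (hB : ∀ y, inner ℝ ν (B y) = 0) (κ : ℝ) :
    AnalyticOnNhd ℂ (sobolevResolvent (ν := ν) hγ κ B) ({z : ℂ | z.im ≠ 0} ×ˢ perpDomain γ ν) := by
  intro p hp
  unfold sobolevResolvent
  refine Finset.analyticAt_fun_sum _ fun J _ => ?_
  have h := (ContinuousLinearMap.compL ℂ (ExpL2 (bracketWeight (d + 1) (-γ))) _ _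
    ((ExpSobolev (bracketWeight (d + 1) γ) 2).orthogonalProjectionOnto.comp
      (jetSingle (bracketWeight (d + 1) γ) J))).analyticAt (resolventComp hγ κ B J p)
  exact AnalyticAt.fun_comp (f := resolventComp hγ κ B J) h
    (analyticOnNhd_resolventComp hd hγ hν hB κ J p hp)

theorem sobolevResolvent_apply {κ : ℝ} (hγ : 0 < γ) {p : ℂ × PerpC ν} (f : ExpL2 (bracketWeight (d + 1) (-γ)))
    (h : ∑ J, jetSingle (bracketWeight (d + 1) γ) J (resolventComp hγ κ B J p f) ∈
      ExpSobolev (bracketWeight (d + 1) γ) 2) :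
    expSobolevFn (sobolevResolvent hγ κ B p f) = resolventComp hγ κ B (jetZero _ 2) p f := by
  have h1 : sobolevResolvent hγ κ B p f = ⟨_, h⟩ := by
    rw [sobolevResolvent, _root_.sum_apply]
    simp only [ContinuousLinearMap.comp_apply]
    rw [← map_sum]
    exact Submodule.orthogonalProjectionOnto_mem_subspace_eq_self ⟨_, h⟩
  rw [expSobolevFn, h1]
  exact sum_jetSingle_apply (fun J => resolventComp hγ κ B J p f) _

theorem sobolevResolvent_isFaddeevInverse (hd : 2 ≤ d) (hγ : 0 < γ) (hν : ‖ν‖ = 1)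
    (hB : ∀ y, inner ℝ ν (B y) = 0) : ∃ κ : ℝ, ∀ (z : ℂ) (x : PerpR ν), z.im ≠ 0 → x ≠ 0 →
      ∀ f : ExpL2 (bracketWeight (d + 1) (-γ)),
      IsFaddeevInverse (rhoVec z x) f (resolventComp hγ κ B (jetZero _ 2) (z, perpToC x) f) ∧
      expSobolevFn (sobolevResolvent hγ κ B (z, perpToC x) f) =
        resolventComp hγ κ B (jetZero _ 2) (z, perpToC x) f := by
  obtain ⟨κ, hκ⟩ := exists_contourOp_eq_integral hd hγ hν hB
  refine ⟨κ, fun z x hz hx f => ?_⟩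
  have hp : ∀ (J : JetIndex (d + 1) 2) (φ : 𝓢(RSp (d + 1), ℂ)), _ := fun J φ =>
    resolventComp_pairing hγ hν (B := B) hz (hκ J z x hz hx).1 (hκ J z x hz hx).2 f φ
  have hz0 : ∀ ζ : CSp (d + 1), jetMono (jetZero (d + 1) 2) ζ = 1 := fun ζ => by
    unfold jetMono jetZero
    simp
  have h0 : ∀ φ : 𝓢(RSp (d + 1), ℂ), _ := hp (jetZero _ 2)
  simp only [hz0, one_mul] at h0
  refine ⟨fun φ => ?_, sobolevResolvent_apply hγ f fun J φ hφ hc => ?_⟩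
  · simp only [faddeevSymbol_eq]
    exact h0 φ
  · have hs := sum_jetSingle_apply (fun J => resolventComp hγ κ B J (z, perpToC x) f)
    rw [hs, hs]
    set Φ : 𝓢(RSp (d + 1), ℂ) := hc.toSchwartzMap hφ
    obtain ⟨ψ, h1, h2⟩ := exists_schwartz_partialDeriv J Φ
    have e1 : ∀ w, partialDeriv J.1 J.2 φ w = ψ w := fun w => (h1 w).symm
    have e2 : ∀ w, φ w = Φ w := fun w => rfl
    simp only [e1, e2]
    -- On the Fourier side both members of the weak derivative equation are the same integral: the
    -- factor `jetMono J` comes from the test function in one and from the symbol in the other.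
    rw [(h0 ψ).2.2, (hp J Φ).2.2, ← integral_const_mul]
    refine integral_congr_ae (Filter.Eventually.of_forall fun ξ => ?_)
    simp only [h2]
    ring

end

/-! ### Passage from the weight `⟨w⟩` to the weight `|w|`. -/

theorem bracketWeight_le_normWeight {n : ℕ} {γ : ℝ} (hγ : 0 ≤ γ) (w : RSp n) :
    bracketWeight n γ w ≤ normWeight n γ w + γ := by
  have h : Real.sqrt (1 + ‖w‖ ^ 2) ≤ ‖w‖ + 1 := by
    rw [Real.sqrt_le_iff]
    exact ⟨by positivity, by nlinarith [norm_nonneg w]⟩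
  have := mul_le_mul_of_nonneg_left h hγ
  change γ * Real.sqrt (1 + ‖w‖ ^ 2) ≤ γ * ‖w‖ + γ
  linarith

theorem normWeight_neg_le {n : ℕ} {γ : ℝ} (hγ : 0 ≤ γ) (w : RSp n) :
    normWeight n (-γ) w ≤ bracketWeight n (-γ) w + γ := by
  have := bracketWeight_le_normWeight hγ w
  change -γ * ‖w‖ ≤ -γ * Real.sqrt (1 + ‖w‖ ^ 2) + γ
  change γ * Real.sqrt (1 + ‖w‖ ^ 2) ≤ γ * ‖w‖ + γ at this
  linarith

theorem IsFaddeevInverse.congr {n : ℕ} {ρ : CSp n} {f f' u u' : RSp n → ℂ} (h : IsFaddeevInverse ρ f u)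
    (hf : f =ᵐ[volume] f') (hu : u =ᵐ[volume] u') : IsFaddeevInverse ρ f' u' := by
  intro φ
  obtain ⟨h1, h2, h3⟩ := h φ
  have hF : ∀ ξ, 𝓕 f ξ = 𝓕 f' ξ := Real.fourier_congr_ae hf
  simp only [hF] at h2 h3
  have hu' : (fun w => u w * φ w) =ᵐ[volume] fun w => u' w * φ w := by
    filter_upwards [hu] with w hw
    rw [hw]
  exact ⟨h1.congr hu', h2, by rw [← integral_congr_ae hu', h3]⟩

section

variable {d : ℕ} {γ : ℝ} {ν : RSp (d + 1)}

/-- The linear map extending operators between bracket weights to norm weights. -/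
def bracketToNorm (n : ℕ) {γ : ℝ} (hγ : 0 ≤ γ) :
    (ExpL2 (bracketWeight n (-γ)) →L[ℂ] ExpL2 (bracketWeight n γ)) →L[ℂ]
      (ExpL2 (normWeight n (-γ)) →L[ℂ] ExpL2 (normWeight n γ)) :=
  (ContinuousLinearMap.compL ℂ _ _ _ (expInclusion _ _ γ (bracketWeight_le_normWeight hγ))).comp
    ((ContinuousLinearMap.compL ℂ _ _ _).flip (expInclusion _ _ γ (normWeight_neg_le hγ)))

/-- The operator `G₀(zν + x)` between exponentially weighted spaces. -/
def normResolvent (hγ : 0 < γ) (κ : ℝ) (B : RSp d →ₗᵢ[ℝ] RSp (d + 1)) (z : ℂ) (x : PerpR ν) :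
    ExpL2 (normWeight (d + 1) (-γ)) →L[ℂ] ExpL2 (normWeight (d + 1) γ) :=
  bracketToNorm (d + 1) hγ.le (resolventComp hγ κ B (jetZero _ 2) (z, perpToC x))

variable {B : RSp d →ₗᵢ[ℝ] RSp (d + 1)}

theorem normResolvent_isFaddeevInverse {hγ : 0 < γ} {κ : ℝ} {z : ℂ} {x : PerpR ν}
    (h : ∀ f : ExpL2 (bracketWeight (d + 1) (-γ)),
      IsFaddeevInverse (rhoVec z x) f (resolventComp hγ κ B (jetZero _ 2) (z, perpToC x) f))
    (f : ExpL2 (normWeight (d + 1) (-γ))) : IsFaddeevInverse (rhoVec z x) f (normResolvent hγ κ B z x f) := by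
  refine (h (expInclusion _ _ γ (normWeight_neg_le hγ.le) f)).congr (coeFn_expInclusion _ f) ?_
  exact (coeFn_expInclusion (bracketWeight_le_normWeight hγ.le) _).symm

/-- The inclusion of the real points as a real linear map. -/
def perpToCL (ν : RSp (d + 1)) : PerpR ν →ₗ[ℝ] PerpC ν where
  toFun := perpToC
  map_add' x y := by
    refine Subtype.ext ?_
    ext i
    simp [perpToC, toC_apply]
  map_smul' c x := by
    refine Subtype.ext ?_
    ext i
    simp [perpToC, toC_apply]

theorem analyticOnNhd_normResolvent_left (hd : 2 ≤ d) (hγ : 0 < γ) (hν : ‖ν‖ = 1)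
    (hB : ∀ y, inner ℝ ν (B y) = 0) (κ : ℝ) {x : PerpR ν} (hx : x ≠ 0) :
    AnalyticOnNhd ℂ (fun z => normResolvent hγ κ B z x) {z : ℂ | z.im ≠ 0} := by
  intro z hz
  have h := analyticOnNhd_resolventComp hd hγ hν hB κ (jetZero _ 2) (z, perpToC x)
    ⟨hz, perpToC_mem_perpDomain hγ hx⟩
  have h2 : AnalyticAt ℂ (fun z : ℂ => (z, perpToC x)) z := AnalyticAt.prod analyticAt_id analyticAt_const
  have h3 := (bracketToNorm (d + 1) hγ.le).analyticAt
    (resolventComp hγ κ B (jetZero _ 2) (z, perpToC x))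
  exact AnalyticAt.fun_comp (f := fun z => resolventComp hγ κ B (jetZero _ 2) (z, perpToC x)) h3
    (AnalyticAt.fun_comp (f := fun z : ℂ => (z, perpToC x)) h h2)

/-- The complex analytic extension is restricted along the real linear inclusion of the real points,
so real analyticity is inherited from part (1). -/
theorem analyticOnNhd_normResolvent_right (hd : 2 ≤ d) (hγ : 0 < γ) (hν : ‖ν‖ = 1)
    (hB : ∀ y, inner ℝ ν (B y) = 0) (κ : ℝ) {z : ℂ} (hz : z.im ≠ 0) :
    AnalyticOnNhd ℝ (fun x : PerpR ν => normResolvent hγ κ B z x) {x : PerpR ν | x ≠ 0} := by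
  intro x hx
  have h := analyticOnNhd_resolventComp hd hγ hν hB κ (jetZero _ 2) (z, perpToC x)
    ⟨hz, perpToC_mem_perpDomain hγ hx⟩
  have h2 : AnalyticAt ℂ (fun ρ : PerpC ν => (z, ρ)) (perpToC x) := AnalyticAt.prod analyticAt_const analyticAt_id
  have h3 := (bracketToNorm (d + 1) hγ.le).analyticAt
    (resolventComp hγ κ B (jetZero _ 2) (z, perpToC x))
  have h4 : AnalyticAt ℂ (fun ρ : PerpC ν => bracketToNorm (d + 1) hγ.le
      (resolventComp hγ κ B (jetZero _ 2) (z, ρ))) (perpToC x) :=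
    AnalyticAt.fun_comp (f := fun ρ => resolventComp hγ κ B (jetZero _ 2) (z, ρ)) h3
      (AnalyticAt.fun_comp (f := fun ρ : PerpC ν => (z, ρ)) h h2)
  exact AnalyticAt.fun_comp (f := fun x : PerpR ν => perpToC x) (h4.restrictScalars (𝕜 := ℝ))
    ((LinearMap.toContinuousLinearMap (perpToCL ν)).analyticAt x)

end

open scoped ENNReal

/-! ### A weighted estimate near a sphere -/

/-- The embedding of `W^{1,1}` in `L^∞` on an interval of length one: the fundamental theorem of
calculus, averaged over the window. -/
theorem enorm_le_lintegral_of_contDiff {H : ℝ → ℂ} (hH : ContDiff ℝ 1 H) (r : ℝ) :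
    ‖H r‖ₑ ≤ ∫⁻ s in Set.Icc (-(1 / 2) : ℝ) (1 / 2), (‖H (r + s)‖ₑ + ‖deriv H (r + s)‖ₑ) := by
  have hc := hH.continuous
  have hc' : Continuous (deriv H) := hH.continuous_deriv le_rfl
  have hvol : volume (Set.Icc (-(1 / 2) : ℝ) (1 / 2)) = 1 := by
    rw [Real.volume_Icc]; norm_num
  have hm : Measurable fun s => ‖H (r + s)‖ₑ := (by fun_prop : Continuous fun s => H (r + s)).measurable.enorm
  rw [lintegral_add_left hm]
  have h1 : ∀ s ∈ Set.Icc (-(1 / 2) : ℝ) (1 / 2), ‖H r‖ₑ ≤ ‖H (r + s)‖ₑ +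
      ∫⁻ s in Set.Icc (-(1 / 2) : ℝ) (1 / 2), ‖deriv H (r + s)‖ₑ := by
    intro s hs
    have e : ∫ t in (0 : ℝ)..s, deriv H (r + t) = H (r + s) - H r := by
      rw [intervalIntegral.integral_comp_add_left (fun t => deriv H t), add_zero]
      exact intervalIntegral.integral_deriv_eq_sub (fun t _ => (hH.differentiable one_ne_zero) t)
        (hc'.intervalIntegrable _ _)
    have e2 : H r = H (r + s) - ∫ t in (0 : ℝ)..s, deriv H (r + t) := by rw [e]; ring
    calc ‖H r‖ₑ ≤ ‖H (r + s)‖ₑ + ‖∫ t in (0 : ℝ)..s, deriv H (r + t)‖ₑ := by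
          rw [e2]; exact enorm_sub_le
      _ ≤ _ := by
          gcongr
          rw [intervalIntegral.intervalIntegral_eq_integral_uIoc, enorm_smul]
          have : ‖(if (0 : ℝ) ≤ s then (1 : ℝ) else -1)‖ₑ = 1 := by split_ifs <;> simp
          rw [this, one_mul]
          refine (enorm_integral_le_lintegral_enorm _).trans (lintegral_mono_set ?_)
          refine Set.uIoc_subset_uIcc.trans ?_
          exact Set.uIcc_subset_Icc (by norm_num) hs
  calc ‖H r‖ₑ = ∫⁻ _s in Set.Icc (-(1 / 2) : ℝ) (1 / 2), ‖H r‖ₑ := by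
        rw [setLIntegral_const, hvol, mul_one]
    _ ≤ ∫⁻ s in Set.Icc (-(1 / 2) : ℝ) (1 / 2), (‖H (r + s)‖ₑ +
      ∫⁻ s in Set.Icc (-(1 / 2) : ℝ) (1 / 2), ‖deriv H (r + s)‖ₑ) :=
        setLIntegral_mono' measurableSet_Icc h1
    _ = _ := by
        rw [lintegral_add_left hm, setLIntegral_const, hvol, mul_one]

/-- The singular kernel on the line. -/
def lineKernel (s : ℝ) : ℝ := |s| ^ (-(1 / 2) : ℝ)

theorem lineKernel_nonneg (s : ℝ) : 0 ≤ lineKernel s := Real.rpow_nonneg (abs_nonneg _) _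

theorem measurable_lineKernel : Measurable lineKernel := by unfold lineKernel; fun_prop

/-- The kernel is locally integrable at 0 and at most 1 where `|s| ≥ 1`, so one bound serves all
translates of the window. -/
theorem exists_lintegral_lineKernel_le : ∃ M : NNReal, ∀ c : ℝ,
    ∫⁻ s in Set.Icc (-(1 / 2) : ℝ) (1 / 2), ENNReal.ofReal (lineKernel (c - s)) ≤ M := by
  have hfin : ∫⁻ s, ENNReal.ofReal (lineKernel s * ((1 + |s|) ^ 2)⁻¹) < ⊤ := by
    have := integrable_rpow_neg_half_mul.lintegral_lt_top
    exact this
  set A := ∫⁻ s, ENNReal.ofReal (lineKernel s * ((1 + |s|) ^ 2)⁻¹) with hA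
  have hbound : ∀ s, lineKernel s ≤ 4 * (lineKernel s * ((1 + |s|) ^ 2)⁻¹) + 1 := fun s => by
    by_cases h : |s| ≤ 1
    · have h1 : (4 : ℝ)⁻¹ ≤ ((1 + |s|) ^ 2)⁻¹ := inv_anti₀ (by positivity) (by nlinarith [abs_nonneg s])
      have := mul_le_mul_of_nonneg_left h1 (lineKernel_nonneg s)
      linarith
    · have h1 : lineKernel s ≤ 1 := by
        unfold lineKernel
        exact Real.rpow_le_one_of_one_le_of_nonpos (not_le.1 h).le (by norm_num)
      have : 0 ≤ lineKernel s * ((1 + |s|) ^ 2)⁻¹ := mul_nonneg (lineKernel_nonneg s) (by positivity)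
      linarith
  refine ⟨(4 * A + 1).toNNReal, fun c => ?_⟩
  rw [ENNReal.coe_toNNReal (by finiteness)]
  calc ∫⁻ s in Set.Icc (-(1 / 2) : ℝ) (1 / 2), ENNReal.ofReal (lineKernel (c - s))
      ≤ ∫⁻ s in Set.Icc (-(1 / 2) : ℝ) (1 / 2),
        (4 * ENNReal.ofReal (lineKernel (c - s) * ((1 + |c - s|) ^ 2)⁻¹) + 1) := by
        refine lintegral_mono fun s => ?_
        refine (ENNReal.ofReal_le_ofReal (hbound (c - s))).trans ?_
        rw [ENNReal.ofReal_add (mul_nonneg (by norm_num) (mul_nonneg (lineKernel_nonneg _) (by positivity)))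
          zero_le_one, ENNReal.ofReal_mul (by norm_num)]
        simp
    _ ≤ 4 * A + 1 := by
        have hm : Measurable fun s => ENNReal.ofReal (lineKernel (c - s) * ((1 + |c - s|) ^ 2)⁻¹) := by
          have := measurable_lineKernel
          fun_prop
        rw [lintegral_add_right _ measurable_const, lintegral_const_mul _ hm, setLIntegral_const, Real.volume_Icc]
        refine add_le_add (mul_le_mul_right ?_ _) (by norm_num)
        refine (setLIntegral_le_lintegral _ _).trans ?_
        rw [lintegral_sub_left_eq_self (fun s => ENNReal.ofReal (lineKernel s * ((1 + |s|) ^ 2)⁻¹)) c]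

theorem lineKernel_eq (s : ℝ) : lineKernel s = (Real.sqrt |s|)⁻¹ := by
  rw [lineKernel, Real.rpow_neg (abs_nonneg s), ← Real.sqrt_eq_rpow]

/-- For `m ≠ 0` the inequalities `|X| ≥ |u| |m|` and `|u| ≥ R / (2D)` produce the power of `R`. At
`m = 0` the kernel takes the conventional value 0, so the hypothesis `h0` is needed to make the left
side vanish too. -/
theorem lineKernel_le_of_mul_le {D R u m X : ℝ} (hD : 1 ≤ D) (hR : 1 ≤ R) (hu : R / (2 * D) ≤ |u|)
    (h : |u| * |m| ≤ |X|) (h0 : m = 0 → X = 0) :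
    lineKernel X ≤ (2 * D) * R ^ (-(1 / 2) : ℝ) * lineKernel m := by
  have hR0 : R ^ (-(1 / 2) : ℝ) = (Real.sqrt R)⁻¹ := by
    rw [Real.rpow_neg (by linarith), ← Real.sqrt_eq_rpow]
  rw [hR0, lineKernel_eq, lineKernel_eq]
  by_cases hm : m = 0
  · rw [h0 hm, hm]; simp
  have hu0 : 0 < |u| := lt_of_lt_of_le (by positivity) hu
  have hm0 : 0 < |m| := abs_pos.2 hm
  calc (Real.sqrt |X|)⁻¹ ≤ (Real.sqrt (|u| * |m|))⁻¹ :=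
        inv_anti₀ (Real.sqrt_pos.2 (by positivity)) (Real.sqrt_le_sqrt h)
    _ = (Real.sqrt |u|)⁻¹ * (Real.sqrt |m|)⁻¹ := by rw [Real.sqrt_mul hu0.le, mul_inv]
    _ ≤ _ := by
        gcongr
        have h1 : Real.sqrt R ≤ 2 * D * Real.sqrt |u| := by
          rw [Real.sqrt_le_iff]
          refine ⟨by positivity, ?_⟩
          rw [mul_pow, Real.sq_sqrt hu0.le]
          rw [div_le_iff₀ (by positivity)] at hu
          nlinarith [mul_nonneg hu0.le (by nlinarith : 0 ≤ 2 * D * (2 * D - 1))]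
        rw [inv_le_iff_one_le_mul₀ (Real.sqrt_pos.2 hu0)]
        have h2 : 0 < Real.sqrt R := Real.sqrt_pos.2 (by linarith)
        calc (1 : ℝ) = Real.sqrt R * (Real.sqrt R)⁻¹ := by field_simp
          _ ≤ 2 * D * Real.sqrt |u| * (Real.sqrt R)⁻¹ := by gcongr
          _ = _ := by ring

/-- Comparison of the kernel near a sphere with one dimensional kernels. -/
theorem sphere_kernel_le {D R u v : ℝ} (hD : 1 ≤ D) (hR : 1 ≤ R) (hu : u ^ 2 + v ^ 2 ≤ D * u ^ 2) :
    lineKernel (R ^ 2 - (u ^ 2 + v ^ 2)) ≤ (2 * D) * R ^ (-(1 / 2) : ℝ) *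
      (1 + lineKernel (u - Real.sqrt (R ^ 2 - v ^ 2)) + lineKernel (u + Real.sqrt (R ^ 2 - v ^ 2))) := by
  have hR0 : R ^ (-(1 / 2) : ℝ) = (Real.sqrt R)⁻¹ := by
    rw [Real.rpow_neg (by linarith), ← Real.sqrt_eq_rpow]
  have hk1 := lineKernel_nonneg (u - Real.sqrt (R ^ 2 - v ^ 2))
  have hk2 := lineKernel_nonneg (u + Real.sqrt (R ^ 2 - v ^ 2))
  have hc : 0 ≤ (2 * D) * R ^ (-(1 / 2) : ℝ) := by positivity
  -- Well inside the sphere `R² - (u² + v²)` is of order `R²`, and the summand 1 on the right is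
  -- enough.
  by_cases hsmall : u ^ 2 + v ^ 2 ≤ R ^ 2 / 4
  · have h1 : lineKernel (R ^ 2 - (u ^ 2 + v ^ 2)) ≤ 2 * D * R ^ (-(1 / 2) : ℝ) := by
      have hR2 : 0 < Real.sqrt R := Real.sqrt_pos.2 (by linarith)
      have h2 : Real.sqrt R / (2 * D) ≤ Real.sqrt |R ^ 2 - (u ^ 2 + v ^ 2)| := by
        refine Real.le_sqrt_of_sq_le ?_
        rw [div_pow, Real.sq_sqrt (by linarith), abs_of_nonneg (by nlinarith),
          div_le_iff₀ (by positivity)]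
        have h3 : (1 : ℝ) ≤ D ^ 2 := by nlinarith
        have h4 : R ≤ R ^ 2 := by nlinarith
        have h5 : 3 / 4 * R ^ 2 ≤ R ^ 2 - (u ^ 2 + v ^ 2) := by linarith
        nlinarith [mul_le_mul h5 h3 zero_le_one (by nlinarith)]
      rw [lineKernel_eq, hR0]
      refine (inv_anti₀ (by positivity) h2).trans (le_of_eq ?_)
      rw [inv_div, div_eq_mul_inv]
    nlinarith [mul_nonneg hc (add_nonneg hk1 hk2)]
  -- Otherwise the cone condition makes `u` comparable to `R`. In `u² + v² - R² = (u - S)(u + S)`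
  -- the factor in which `u` and `±S` have the same sign is at least `|u|`, and the other one
  -- carries the singularity.
  · have hu1 : R / (2 * D) ≤ |u| := by
      refine (le_abs_self _).trans (sq_le_sq.1 ?_)
      rw [div_pow, div_le_iff₀ (by positivity)]
      have h1 : R ^ 2 / 4 ≤ D * u ^ 2 := by linarith [not_le.1 hsmall]
      have h2 : D * u ^ 2 ≤ D ^ 2 * u ^ 2 := by nlinarith [mul_nonneg (by linarith : 0 ≤ D) (mul_nonneg (sub_nonneg.2 hD) (sq_nonneg u))]
      nlinarith
    have hS := Real.sqrt_nonneg (R ^ 2 - v ^ 2)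
    set S := Real.sqrt (R ^ 2 - v ^ 2) with hSdef
    have key : lineKernel (R ^ 2 - (u ^ 2 + v ^ 2)) ≤ 2 * D * R ^ (-(1 / 2) : ℝ) * lineKernel (u - S) ∨
        lineKernel (R ^ 2 - (u ^ 2 + v ^ 2)) ≤ 2 * D * R ^ (-(1 / 2) : ℝ) * lineKernel (u + S) := by
      by_cases hv : 0 ≤ R ^ 2 - v ^ 2
      · have hSS : S ^ 2 = R ^ 2 - v ^ 2 := Real.sq_sqrt hv
        have hX : R ^ 2 - (u ^ 2 + v ^ 2) = -((u - S) * (u + S)) := by linear_combination -hSS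
        rcases le_total 0 u with h | h
        · left
          refine lineKernel_le_of_mul_le hD hR hu1 ?_ fun h0 => by rw [hX, h0]; ring
          rw [hX, abs_neg, abs_mul, mul_comm]
          gcongr
          linarith
        · right
          refine lineKernel_le_of_mul_le hD hR hu1 ?_ fun h0 => by rw [hX, h0]; ring
          rw [hX, abs_neg, abs_mul]
          refine mul_le_mul_of_nonneg_right ?_ (abs_nonneg _)
          rw [abs_of_nonpos h, abs_of_nonpos (by linarith)]
          linarith
      -- Beyond the cylinder `|v| = R` the square root is 0 by convention, and `|R² - (u² + v²)|` is
      -- at least `u²`.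
      · left
        have hS0 : S = 0 := Real.sqrt_eq_zero_of_nonpos (not_le.1 hv).le
        refine lineKernel_le_of_mul_le hD hR hu1 ?_ fun h0 => ?_
        · rw [hS0, sub_zero, abs_mul_abs_self, abs_of_neg (by nlinarith [not_le.1 hv, sq_nonneg u])]
          nlinarith [not_le.1 hv]
        · rw [hS0, sub_zero] at h0
          rw [h0, abs_zero] at hu1
          have : 0 < R / (2 * D) := by positivity
          linarith
    rcases key with h | h <;> refine h.trans (mul_le_mul_of_nonneg_left ?_ hc) <;> linarith

theorem norm_sub_smul_single_sq {d : ℕ} (η : RSp d) (j : Fin d) (s : ℝ) :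
    ‖η - s • EuclideanSpace.single j (1 : ℝ)‖ ^ 2 =
      (η j - s) ^ 2 + Real.sqrt (‖η‖ ^ 2 - η j ^ 2) ^ 2 := by
  have h1 : η j ^ 2 ≤ ‖η‖ ^ 2 := by
    rw [← sq_abs, ← Real.norm_eq_abs]
    exact pow_le_pow_left₀ (norm_nonneg _) (PiLp.norm_apply_le η j) 2
  rw [Real.sq_sqrt (by linarith), norm_sub_sq_real, inner_smul_right, EuclideanSpace.inner_single_right,
    norm_smul, PiLp.norm_single]
  simp
  ring

/-- The weighted estimate in one coordinate direction. -/
theorem exists_lintegral_cone_kernel_le (d : ℕ) (hd : 1 ≤ d) : ∃ M : NNReal, ∀ (R : ℝ), 1 ≤ R →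
    ∀ (H : RSp d → ℂ) (j : Fin d), ContDiff ℝ 1 H →
    ∫⁻ η in {η | ‖η‖ ^ 2 ≤ d * η j ^ 2}, ENNReal.ofReal (lineKernel (R ^ 2 - ‖η‖ ^ 2)) * ‖H η‖ₑ ≤
      ENNReal.ofReal (R ^ (-(1 / 2) : ℝ)) * (M * ∫⁻ η, (‖H η‖ₑ +
        ‖fderiv ℝ H η (EuclideanSpace.single j 1)‖ₑ)) := by
  obtain ⟨M, hM⟩ := exists_lintegral_lineKernel_le
  refine ⟨(2 * d) * (1 + M + M), fun R hR H j hH => ?_⟩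
  set I : Set ℝ := Set.Icc (-(1 / 2) : ℝ) (1 / 2) with hI
  have hvolI : volume I = 1 := by rw [hI, Real.volume_Icc]; norm_num
  set e : RSp d := EuclideanSpace.single j 1 with he
  set Dj : Set (RSp d) := {η | ‖η‖ ^ 2 ≤ d * η j ^ 2} with hDj
  have hDjm : MeasurableSet Dj := measurableSet_le (by fun_prop) (by fun_prop)
  set K : RSp d → ℝ≥0∞ := Dj.indicator fun η => ENNReal.ofReal (lineKernel (R ^ 2 - ‖η‖ ^ 2)) with hK
  have hKm : Measurable K := by
    have := measurable_lineKernel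
    exact Measurable.indicator (by fun_prop) hDjm
  set h : RSp d → ℝ≥0∞ := fun η => ‖H η‖ₑ + ‖fderiv ℝ H η e‖ₑ with hh
  have hhm : Measurable h := by
    have h1 := hH.continuous
    have h2 : Continuous fun η => fderiv ℝ H η e := (hH.continuous_fderiv one_ne_zero).clm_apply continuous_const
    exact h1.measurable.enorm.add h2.measurable.enorm
  have hstep : ∀ η, ‖H η‖ₑ ≤ ∫⁻ s in I, h (η + s • e) := fun η => by
    have hl : ContDiff ℝ 1 fun s : ℝ => H (η + s • e) := hH.comp (by fun_prop)
    have h1 := enorm_le_lintegral_of_contDiff hl 0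
    simp only [zero_smul, add_zero, zero_add] at h1
    refine h1.trans (le_of_eq ?_)
    congr 1
    ext1 s
    have hd1 : HasDerivAt (fun s : ℝ => η + s • e) e s := by
      simpa using ((hasDerivAt_id s).smul_const e).const_add η
    have h2 := ((hH.differentiable one_ne_zero (η + s • e)).hasFDerivAt).comp_hasDerivAt s hd1
    have h3 : deriv (fun s : ℝ => H (η + s • e)) s = fderiv ℝ H (η + s • e) e := h2.deriv
    rw [h3]
  have hker : ∀ η, ∫⁻ s in I, K (η - s • e) ≤ ENNReal.ofReal (R ^ (-(1 / 2) : ℝ)) *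
      (((2 * d) * (1 + M + M) : NNReal) : ℝ≥0∞) := fun η => by
    set S := Real.sqrt (R ^ 2 - Real.sqrt (‖η‖ ^ 2 - η j ^ 2) ^ 2) with hS
    have h1 : ∀ s, K (η - s • e) ≤ ENNReal.ofReal (2 * d * R ^ (-(1 / 2) : ℝ)) *
        (1 + ENNReal.ofReal (lineKernel ((η j - S) - s)) + ENNReal.ofReal (lineKernel ((η j + S) - s))) := fun s => by
      by_cases hs : η - s • e ∈ Dj
      · rw [hK, Set.indicator_of_mem hs]
        have hs' : ‖η - s • e‖ ^ 2 ≤ d * (η - s • e) j ^ 2 := hs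
        have hj : (η - s • e) j = η j - s := by simp [he]
        rw [hj, norm_sub_smul_single_sq] at hs'
        rw [norm_sub_smul_single_sq]
        have h2 := sphere_kernel_le (by exact_mod_cast hd : (1 : ℝ) ≤ d) hR hs'
        rw [← hS] at h2
        refine (ENNReal.ofReal_le_ofReal h2).trans (le_of_eq ?_)
        rw [ENNReal.ofReal_mul (by positivity), ENNReal.ofReal_add (add_nonneg zero_le_one (lineKernel_nonneg _))
          (lineKernel_nonneg _), ENNReal.ofReal_add zero_le_one (lineKernel_nonneg _), ENNReal.ofReal_one,
          show η j - s - S = η j - S - s by ring, show η j - s + S = η j + S - s by ring]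
      · rw [hK, Set.indicator_of_notMem hs]
        exact zero_le
    have hm : ∀ c : ℝ, Measurable fun s => ENNReal.ofReal (lineKernel (c - s)) := fun c => by
      have := measurable_lineKernel
      fun_prop
    calc ∫⁻ s in I, K (η - s • e) ≤ ∫⁻ s in I, ENNReal.ofReal (2 * d * R ^ (-(1 / 2) : ℝ)) *
        (1 + ENNReal.ofReal (lineKernel ((η j - S) - s)) + ENNReal.ofReal (lineKernel ((η j + S) - s))) :=
          lintegral_mono h1
      _ = ENNReal.ofReal (2 * d * R ^ (-(1 / 2) : ℝ)) * (1 +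
          (∫⁻ s in I, ENNReal.ofReal (lineKernel ((η j - S) - s))) +
          ∫⁻ s in I, ENNReal.ofReal (lineKernel ((η j + S) - s))) := by
          rw [lintegral_const_mul' _ _ ENNReal.ofReal_ne_top, lintegral_add_right _ (hm _),
            lintegral_add_right _ (hm _), setLIntegral_const, hvolI, mul_one]
      _ ≤ ENNReal.ofReal (2 * d * R ^ (-(1 / 2) : ℝ)) * (1 + M + M) := by
          gcongr
          · exact hM _
          · exact hM _
      _ = _ := by
          rw [mul_comm (2 * (d : ℝ)), ENNReal.ofReal_mul (by positivity), mul_assoc]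
          congr 1
          push_cast
          congr 1
          rw [ENNReal.ofReal_mul (by norm_num)]
          simp
  -- `|H|` is replaced by its window integral along `e`, the integrals are exchanged, and a
  -- translation moves the window onto the kernel, where `hker` bounds it uniformly.
  calc ∫⁻ η in Dj, ENNReal.ofReal (lineKernel (R ^ 2 - ‖η‖ ^ 2)) * ‖H η‖ₑ
      = ∫⁻ η, K η * ‖H η‖ₑ := by
        rw [← lintegral_indicator hDjm]
        congr 1
        ext1 η
        by_cases hη : η ∈ Dj <;> simp [hK, hη]
    _ ≤ ∫⁻ η, K η * ∫⁻ s in I, h (η + s • e) := lintegral_mono fun η => by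
        gcongr
        exact hstep η
    _ = ∫⁻ η, ∫⁻ s in I, K η * h (η + s • e) := by
        congr 1
        ext1 η
        rw [lintegral_const_mul]
        fun_prop
    _ = ∫⁻ s in I, ∫⁻ η, K η * h (η + s • e) := by
        rw [lintegral_lintegral_swap]
        refine Measurable.aemeasurable ?_
        fun_prop
    _ = ∫⁻ s in I, ∫⁻ η, K (η - s • e) * h η := by
        congr 1
        ext1 s
        rw [← lintegral_sub_right_eq_self (fun η => K η * h (η + s • e)) (s • e)]
        simp
    _ = ∫⁻ η, ∫⁻ s in I, K (η - s • e) * h η := by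
        rw [lintegral_lintegral_swap]
        refine Measurable.aemeasurable ?_
        fun_prop
    _ ≤ ∫⁻ η, (ENNReal.ofReal (R ^ (-(1 / 2) : ℝ)) *
      (((2 * d) * (1 + M + M) : NNReal) : ℝ≥0∞)) * h η := lintegral_mono fun η => by
        rw [lintegral_mul_const _ (by fun_prop)]
        gcongr
        exact hker η
    _ = _ := by
        rw [lintegral_const_mul _ hhm, mul_assoc]

/-- The weighted estimate. -/
theorem exists_lintegral_sphere_kernel_le (d : ℕ) (hd : 1 ≤ d) : ∃ M : NNReal, ∀ (R : ℝ), 1 ≤ R →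
    ∀ H : RSp d → ℂ, ContDiff ℝ 1 H →
    ∫⁻ η, ENNReal.ofReal (lineKernel (R ^ 2 - ‖η‖ ^ 2)) * ‖H η‖ₑ ≤
      ENNReal.ofReal (R ^ (-(1 / 2) : ℝ)) * (M * ∑ j, ∫⁻ η, (‖H η‖ₑ +
        ‖fderiv ℝ H η (EuclideanSpace.single j 1)‖ₑ)) := by
  obtain ⟨M, hM⟩ := exists_lintegral_cone_kernel_le d hd
  refine ⟨M, fun R hR H hH => ?_⟩
  -- The largest coordinate satisfies `d η_j² ≥ ‖η‖²`, so the cones cover the space.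
  have hcov : (Set.univ : Set (RSp d)) ⊆ ⋃ j : Fin d, {η | ‖η‖ ^ 2 ≤ d * η j ^ 2} := fun η _ => by
    rw [Set.mem_iUnion]
    by_contra! hcon
    have : Nonempty (Fin d) := ⟨⟨0, hd⟩⟩
    have h1 : ∑ j : Fin d, d * η j ^ 2 < ∑ j : Fin d, ‖η‖ ^ 2 :=
      Finset.sum_lt_sum_of_nonempty Finset.univ_nonempty fun j _ => not_le.1 (hcon j)
    rw [← Finset.mul_sum, Finset.sum_const, Finset.card_univ, Fintype.card_fin, nsmul_eq_mul,
      EuclideanSpace.norm_sq_eq] at h1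
    simp at h1
  calc ∫⁻ η, ENNReal.ofReal (lineKernel (R ^ 2 - ‖η‖ ^ 2)) * ‖H η‖ₑ
      = ∫⁻ η in Set.univ, ENNReal.ofReal (lineKernel (R ^ 2 - ‖η‖ ^ 2)) * ‖H η‖ₑ := by rw [Measure.restrict_univ]
    _ ≤ ∫⁻ η in ⋃ j : Fin d, {η | ‖η‖ ^ 2 ≤ d * η j ^ 2}, ENNReal.ofReal (lineKernel (R ^ 2 - ‖η‖ ^ 2)) * ‖H η‖ₑ :=
        lintegral_mono_set hcov
    _ ≤ ∑ j : Fin d, ∫⁻ η in {η | ‖η‖ ^ 2 ≤ d * η j ^ 2}, ENNReal.ofReal (lineKernel (R ^ 2 - ‖η‖ ^ 2)) * ‖H η‖ₑ := by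
        refine (lintegral_iUnion_le _ _).trans (le_of_eq ?_)
        rw [tsum_fintype]
    _ ≤ ∑ j : Fin d, ENNReal.ofReal (R ^ (-(1 / 2) : ℝ)) * (M * ∫⁻ η, (‖H η‖ₑ +
        ‖fderiv ℝ H η (EuclideanSpace.single j 1)‖ₑ)) := Finset.sum_le_sum fun j _ => hM R hR H j hH
    _ = _ := by rw [← Finset.mul_sum, ← Finset.mul_sum]

/-! ### One dimensional estimates -/

theorem integrable_shift_of_bound {F : ℂ → ℂ} {δ C : ℝ} (hd : ∀ s : ℂ, |s.im| ≤ δ → DifferentiableAt ℂ F s)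
    (hb : ∀ s : ℂ, |s.im| ≤ δ → ‖F s‖ ≤ C * (1 + s.re ^ 2)⁻¹) {a : ℝ} (ha : |a| ≤ δ) :
    Integrable fun t : ℝ => F (t + a * Complex.I) := by
  refine (integrable_inv_one_add_sq.const_mul C).mono' ?_ (Filter.Eventually.of_forall fun x => ?_)
  · refine Continuous.aestronglyMeasurable (continuous_iff_continuousAt.2 fun x => ?_)
    have h1 : ContinuousAt F (x + a * Complex.I) := (hd _ (by simpa using ha)).continuousAt
    exact ContinuousAt.comp (g := F) (f := fun t : ℝ => (t : ℂ) + a * Complex.I) h1 (by fun_prop)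
  · simpa using hb (x + a * Complex.I) (by simpa using ha)

/-- Moving the contour away from a simple pole. -/
theorem norm_integral_div_sub_le {F : ℂ → ℂ} {δ C : ℝ} (hδ : 0 < δ)
    (hd : ∀ s : ℂ, |s.im| ≤ δ → DifferentiableAt ℂ F s)
    (hb : ∀ s : ℂ, |s.im| ≤ δ → ‖F s‖ ≤ C * (1 + s.re ^ 2)⁻¹) {a : ℝ} (ha : |a| = δ) {r : ℂ}
    (hr : r.im * a < 0) :
    δ * ‖∫ t : ℝ, F t * (t - r)⁻¹‖ ≤ ∫ t : ℝ, ‖F (t + a * Complex.I)‖ := by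
  have hr0 : r.im ≠ 0 := fun h => by simp [h] at hr
  have hC : 0 ≤ C := by
    have := (norm_nonneg _).trans (hb 0 (by simpa using hδ.le))
    simpa using this
  have him : ∀ s : ℂ, s.im ∈ Set.uIcc 0 a → |s.im| ≤ δ ∧ |r.im| ≤ ‖s - r‖ := fun s hs => by
    -- The pole lies on the side opposite to the shift, so in the swept strip its distance never
    -- falls below `|Im r|`, and on the final line it exceeds `δ`.
    have h1 : 0 ≤ s.im * a ∧ |s.im| ≤ |a| := by
      rcases le_total 0 a with h | h
      · rw [Set.uIcc_of_le h] at hs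
        exact ⟨mul_nonneg hs.1 h, by rw [abs_of_nonneg hs.1, abs_of_nonneg h]; exact hs.2⟩
      · rw [Set.uIcc_of_ge h] at hs
        exact ⟨mul_nonneg_of_nonpos_of_nonpos hs.2 h, by rw [abs_of_nonpos hs.2, abs_of_nonpos h]; linarith [hs.1]⟩
    refine ⟨h1.2.trans ha.le, le_trans ?_ (Complex.abs_im_le_norm _)⟩
    rw [Complex.sub_im, abs_sub_comm]
    refine sq_le_sq.1 ?_
    have ha0 : 0 < a ^ 2 := by rw [← sq_abs, ha]; positivity
    have h2 : r.im * s.im ≤ 0 := by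
      by_contra! h
      have := mul_pos h ha0
      nlinarith [mul_nonneg h1.1 (by linarith : 0 ≤ -(r.im * a))]
    nlinarith [sq_nonneg s.im]
  have hshift : ∫ t : ℝ, F t * (t - r)⁻¹ = ∫ t : ℝ, F (t + a * Complex.I) * (t + a * Complex.I - r)⁻¹ := by
    refine integral_contour_shift (g := fun s => F s * (s - r)⁻¹) (C := C * |r.im|⁻¹) (fun s hs => ?_) fun s hs => ?_
    · obtain ⟨h1, h2⟩ := him s hs
      exact (hd s h1).mul (DifferentiableAt.inv (by fun_prop) (norm_pos_iff.1 ((abs_pos.2 hr0).trans_le h2)))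
    · obtain ⟨h1, h2⟩ := him s hs
      rw [norm_mul, norm_inv, mul_right_comm]
      exact mul_le_mul (hb s h1) (inv_anti₀ (abs_pos.2 hr0) h2) (by positivity) (by positivity)
  rw [hshift, ← le_div_iff₀' hδ, div_eq_mul_inv, ← integral_mul_const]
  refine norm_integral_le_of_norm_le ((integrable_shift_of_bound hd hb ha.le).norm.mul_const _)
    (Filter.Eventually.of_forall fun t => ?_)
  rw [norm_mul, norm_inv]
  refine mul_le_mul_of_nonneg_left (inv_anti₀ hδ ?_) (norm_nonneg _)
  refine le_trans ?_ (Complex.abs_im_le_norm _)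
  have e : ((t : ℂ) + a * Complex.I - r).im = a - r.im := by simp
  rw [e, ← ha]
  refine sq_le_sq.1 ?_
  nlinarith [sq_nonneg r.im]

theorem integrable_mul_inv_sub {F : ℂ → ℂ} (hF : Integrable fun t : ℝ => F t) {r : ℂ} (hr : r.im ≠ 0) :
    Integrable fun t : ℝ => F t * (t - r)⁻¹ := by
  have hne : ∀ t : ℝ, (t : ℂ) - r ≠ 0 := fun t h => hr (by
    have := congrArg Complex.im h
    simpa using this)
  have hc : Continuous fun t : ℝ => ((t : ℂ) - r)⁻¹ := Continuous.inv₀ (by fun_prop) hne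
  refine hF.mul_bdd (c := |r.im|⁻¹) hc.aestronglyMeasurable (Filter.Eventually.of_forall fun t => ?_)
  rw [norm_inv]
  refine inv_anti₀ (abs_pos.2 hr) ?_
  have := Complex.abs_im_le_norm ((t : ℂ) - r)
  simpa using this

/-- The line integral of a holomorphic function divided by the symbol. -/
theorem norm_integral_div_symbol_le {F : ℂ → ℂ} {δ C : ℝ} (hδ : 0 < δ)
    (hd : ∀ s : ℂ, |s.im| ≤ δ → DifferentiableAt ℂ F s)
    (hb : ∀ s : ℂ, |s.im| ≤ δ → ‖F s‖ ≤ C * (1 + s.re ^ 2)⁻¹) {z Q : ℂ} (hz : z.im ≠ 0) {τ : ℝ}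
    (hτ : τ ≠ 0) (hQ : Q ^ 2 = z ^ 2 - τ) {X : ℝ} (hX : X = ‖Q‖ ∨ X = |z.im|) :
    δ * X * ‖∫ t : ℝ, F t * ((t : ℂ) ^ 2 + 2 * z * t + τ)⁻¹‖ ≤
      (∫ t : ℝ, ‖F (t + (δ : ℝ) * Complex.I)‖) + ∫ t : ℝ, ‖F (t + (-δ : ℝ) * Complex.I)‖ := by
  have hC : 0 ≤ C := by
    have := (norm_nonneg _).trans (hb 0 (by simpa using hδ.le))
    simpa using this
  have hX0 : 0 ≤ X := by rcases hX with h | h <;> rw [h] <;> positivity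
  have hpos : ∀ a : ℝ, 0 ≤ ∫ t : ℝ, ‖F (t + a * Complex.I)‖ := fun a => integral_nonneg fun _ => norm_nonneg _
  have hfac : ∀ s : ℂ, s ^ 2 + 2 * z * s + τ = (s - (-z + Q)) * (s - (-z - Q)) := fun s => by
    linear_combination hQ
  rcases lt_or_gt_of_ne hτ with hneg | hpos'
  -- For `τ < 0` both roots are on the side opposite to `Im z`, and a single shift towards `Im z`
  -- handles the whole quotient. On the new line both roots are at distance at least `δ`, and one of
  -- them at distance at least `X`.
  · obtain ⟨c, hc, hsym⟩ := symbol_line_sq_ge hz hneg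
    obtain ⟨a, ha, haz⟩ : ∃ a : ℝ, |a| = δ ∧ 0 < a * z.im := by
      rcases lt_or_gt_of_ne hz with h | h
      · exact ⟨-δ, by rw [abs_neg, abs_of_pos hδ], by nlinarith⟩
      · exact ⟨δ, abs_of_pos hδ, by positivity⟩
    have him : ∀ s : ℂ, s.im ∈ Set.uIcc 0 a → |s.im| ≤ δ ∧ 0 ≤ s.im * z.im := fun s hs => by
      rcases le_total 0 a with h | h
      · rw [Set.uIcc_of_le h] at hs
        refine ⟨by rw [abs_of_nonneg hs.1, ← ha, abs_of_nonneg h]; exact hs.2, mul_nonneg hs.1 ?_⟩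
        by_contra! h'
        nlinarith
      · rw [Set.uIcc_of_ge h] at hs
        refine ⟨by rw [abs_of_nonpos hs.2, ← ha, abs_of_nonpos h]; linarith [hs.1],
          mul_nonneg_of_nonpos_of_nonpos hs.2 ?_⟩
        by_contra! h'
        nlinarith
    have hshift : ∫ t : ℝ, F t * ((t : ℂ) ^ 2 + 2 * z * t + τ)⁻¹ = ∫ t : ℝ, F (t + a * Complex.I) *
        ((t + a * Complex.I) ^ 2 + 2 * z * (t + a * Complex.I) + τ)⁻¹ := by
      refine integral_contour_shift (g := fun s => F s * (s ^ 2 + 2 * z * s + τ)⁻¹) (C := C * c⁻¹)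
        (fun s hs => ?_) fun s hs => ?_
      · obtain ⟨h1, h2⟩ := him s hs
        exact (hd s h1).mul (DifferentiableAt.inv (by fun_prop) (norm_pos_iff.1 (hc.trans_le (hsym s h2))))
      · obtain ⟨h1, h2⟩ := him s hs
        rw [norm_mul, norm_inv]
        exact (mul_le_mul (hb s h1) (inv_anti₀ hc (hsym s h2)) (by positivity) (by positivity)).trans
          (le_of_eq (by ring))
    have hlow : ∀ t : ℝ, δ * X ≤ ‖((t : ℂ) + a * Complex.I) ^ 2 + 2 * z * (t + a * Complex.I) + τ‖ := fun t => by
      rw [hfac]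
      set s : ℂ := (t : ℂ) + a * Complex.I
      have e1 : (s - (-z + Q)).im = (a + z.im) - Q.im := by simp [s]; ring
      have e2 : (s - (-z - Q)).im = (a + z.im) + Q.im := by simp [s]; ring
      have h0 := abs_im_le_of_sq_eq hneg.le hQ
      have h1 : δ + |z.im| ≤ |a + z.im| := by
        rw [← ha]
        rcases lt_or_gt_of_ne hz with h | h
        · have : a < 0 := by nlinarith
          rw [abs_of_neg this, abs_of_neg h, abs_of_neg (by linarith)]; linarith
        · have : 0 < a := by nlinarith
          rw [abs_of_pos this, abs_of_pos h, abs_of_pos (by linarith)]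
      have f1 : δ ≤ ‖s - (-z + Q)‖ := by
        refine le_trans ?_ (Complex.abs_im_le_norm _)
        rw [e1]
        linarith [abs_sub_abs_le_abs_sub (a + z.im) Q.im]
      have f2 : δ ≤ ‖s - (-z - Q)‖ := by
        refine le_trans ?_ (Complex.abs_im_le_norm _)
        rw [e2]
        have := abs_sub_abs_le_abs_sub (a + z.im) (-Q.im)
        rw [abs_neg, sub_neg_eq_add] at this
        linarith
      -- The roots are `2‖Q‖` apart, so one is at distance at least `‖Q‖`. Likewise the two vertical
      -- displacements average to `a + Im z`, whose modulus exceeds `|Im z|`.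
      have f3 : X ≤ ‖s - (-z + Q)‖ ∨ X ≤ ‖s - (-z - Q)‖ := by
        by_contra! hcon
        obtain ⟨g1, g2⟩ := hcon
        rcases hX with h | h
        · have h2 : 2 * Q = (s - (-z - Q)) - (s - (-z + Q)) := by ring
          have h3 := norm_sub_le (s - (-z - Q)) (s - (-z + Q))
          rw [← h2, norm_mul, Complex.norm_two] at h3
          linarith
        · have g3 := (Complex.abs_im_le_norm (s - (-z + Q))).trans_lt g1
          have g4 := (Complex.abs_im_le_norm (s - (-z - Q))).trans_lt g2
          rw [e1] at g3
          rw [e2] at g4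
          have h2 := abs_add_le (a + z.im - Q.im) (a + z.im + Q.im)
          rw [show a + z.im - Q.im + (a + z.im + Q.im) = 2 * (a + z.im) by ring, abs_mul, abs_two] at h2
          linarith
      rw [norm_mul]
      rcases f3 with h | h
      · rw [mul_comm]; exact mul_le_mul h f2 hδ.le (norm_nonneg _)
      · exact mul_le_mul f1 h hX0 (norm_nonneg _)
    have hmain : δ * X * ‖∫ t : ℝ, F t * ((t : ℂ) ^ 2 + 2 * z * t + τ)⁻¹‖ ≤ ∫ t : ℝ, ‖F (t + a * Complex.I)‖ := by
      rcases hX0.eq_or_lt with h | h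
      · rw [← h, mul_zero, zero_mul]; exact hpos a
      have hδX : 0 < δ * X := by positivity
      rw [hshift, ← le_div_iff₀' hδX, div_eq_mul_inv, ← integral_mul_const]
      refine norm_integral_le_of_norm_le ((integrable_shift_of_bound hd hb ha.le).norm.mul_const _)
        (Filter.Eventually.of_forall fun t => ?_)
      rw [norm_mul, norm_inv]
      exact mul_le_mul_of_nonneg_left (inv_anti₀ hδX (hlow t)) (norm_nonneg _)
    rcases eq_or_eq_neg_of_abs_eq ha with h | h
    · rw [h] at hmain; exact hmain.trans (le_add_of_nonneg_right (hpos _))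
    · rw [h] at hmain; exact hmain.trans (le_add_of_nonneg_left (hpos _))
  -- For `τ > 0` the roots are on different sides of the real line. Partial fractions give the
  -- factor `1/(2Q)`, and each term is shifted away from its own pole. Since `|Im z| ≤ ‖Q‖` here,
  -- the bound with `‖Q‖` covers both choices of `X`.
  · have hQz : |z.im| ≤ |Q.im| := abs_im_ge_of_sq_eq hpos'.le hQ
    have hQ0 : Q.im ≠ 0 := fun h => by
      rw [h, abs_zero] at hQz
      exact hz (abs_nonpos_iff.1 hQz)
    have hlt : |z.im| < |Q.im| := abs_im_lt_of_sq_eq (τ := -τ) hQ0 (by linarith) (by rw [hQ]; push_cast; ring)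
    have hQn : Q ≠ 0 := fun h => hQ0 (by rw [h]; rfl)
    have hXQ : X ≤ ‖Q‖ := by
      rcases hX with h | h
      · exact h.le
      · rw [h]; exact hlt.le.trans (Complex.abs_im_le_norm Q)
    have hFi : Integrable fun t : ℝ => F t := by
      simpa using integrable_shift_of_bound hd hb (a := 0) (by simpa using hδ.le)
    have hQQ : 0 < (|Q.im| - |z.im|) := sub_pos.2 hlt
    have hsgn : (-z + Q).im * Q.im > 0 ∧ (-z - Q).im * Q.im < 0 := by
      have h1 : z.im * Q.im ≤ |z.im| * |Q.im| := by rw [← abs_mul]; exact le_abs_self _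
      have h2 : -(z.im * Q.im) ≤ |z.im| * |Q.im| := by rw [← abs_mul]; exact neg_le_abs _
      have h3 : |z.im| * |Q.im| < Q.im * Q.im := by
        rw [← abs_mul_abs_self Q.im]
        exact mul_lt_mul_of_pos_right hlt (abs_pos.2 hQ0)
      simp only [Complex.add_im, Complex.sub_im, Complex.neg_im]
      constructor <;> nlinarith
    have hr1 : (-z + Q).im ≠ 0 := fun h => by rw [h] at hsgn; simp at hsgn
    have hr2 : (-z - Q).im ≠ 0 := fun h => by rw [h] at hsgn; simp at hsgn
    have hpf : ∀ t : ℝ, F t * ((t : ℂ) ^ 2 + 2 * z * t + τ)⁻¹ =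
        (2 * Q)⁻¹ * (F t * (t - (-z + Q))⁻¹ - F t * (t - (-z - Q))⁻¹) := fun t => by
      have n1 : (t : ℂ) - (-z + Q) ≠ 0 := fun h => hr1 (by
        have := congrArg Complex.im h
        rw [Complex.sub_im, Complex.ofReal_im, Complex.zero_im, zero_sub, neg_eq_zero] at this
        exact this)
      have n2 : (t : ℂ) - (-z - Q) ≠ 0 := fun h => hr2 (by
        have := congrArg Complex.im h
        rw [Complex.sub_im, Complex.ofReal_im, Complex.zero_im, zero_sub, neg_eq_zero] at this
        exact this)
      rw [hfac]
      field_simp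
      ring
    obtain ⟨a, ha, haQ⟩ : ∃ a : ℝ, |a| = δ ∧ a * Q.im < 0 := by
      rcases lt_or_gt_of_ne hQ0 with h | h
      · exact ⟨δ, abs_of_pos hδ, by nlinarith⟩
      · exact ⟨-δ, by rw [abs_neg, abs_of_pos hδ], by nlinarith⟩
    have hQ2 : 0 < Q.im ^ 2 := by positivity
    have b1 := norm_integral_div_sub_le hδ hd hb ha (r := -z + Q) (by
      by_contra! h
      nlinarith [mul_nonneg h (sub_nonneg.2 haQ.le), mul_pos_of_neg_of_neg haQ haQ])
    have b2 := norm_integral_div_sub_le hδ hd hb (a := -a) (by rw [abs_neg, ha]) (r := -z - Q) (by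
      by_contra! h
      nlinarith)
    have hI : ‖∫ t : ℝ, F t * ((t : ℂ) ^ 2 + 2 * z * t + τ)⁻¹‖ ≤ (2 * ‖Q‖)⁻¹ *
        (‖∫ t : ℝ, F t * (t - (-z + Q))⁻¹‖ + ‖∫ t : ℝ, F t * (t - (-z - Q))⁻¹‖) := by
      simp only [hpf]
      rw [integral_const_mul, integral_sub (integrable_mul_inv_sub hFi hr1) (integrable_mul_inv_sub hFi hr2),
        norm_mul, norm_inv, norm_mul, Complex.norm_two]
      gcongr
      exact norm_sub_le _ _
    have hQpos : 0 < ‖Q‖ := norm_pos_iff.2 hQn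
    have hsum : (∫ t : ℝ, ‖F (t + a * Complex.I)‖) + (∫ t : ℝ, ‖F (t + (-a : ℝ) * Complex.I)‖) =
        (∫ t : ℝ, ‖F (t + (δ : ℝ) * Complex.I)‖) + ∫ t : ℝ, ‖F (t + (-δ : ℝ) * Complex.I)‖ := by
      rcases eq_or_eq_neg_of_abs_eq ha with h | h
      · rw [h]
      · rw [h, neg_neg, add_comm]
    have hS := add_nonneg (hpos δ) (hpos (-δ))
    calc δ * X * ‖∫ t : ℝ, F t * ((t : ℂ) ^ 2 + 2 * z * t + τ)⁻¹‖
        ≤ δ * ‖Q‖ * ((2 * ‖Q‖)⁻¹ *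
        (‖∫ t : ℝ, F t * (t - (-z + Q))⁻¹‖ + ‖∫ t : ℝ, F t * (t - (-z - Q))⁻¹‖)) := by gcongr
      _ = 2⁻¹ * (δ * ‖∫ t : ℝ, F t * (t - (-z + Q))⁻¹‖ + δ * ‖∫ t : ℝ, F t * (t - (-z - Q))⁻¹‖) := by
          field_simp
      _ ≤ 2⁻¹ * ((∫ t : ℝ, ‖F (t + a * Complex.I)‖) + (∫ t : ℝ, ‖F (t + (-a : ℝ) * Complex.I)‖)) := by
          gcongr
      _ ≤ _ := by rw [hsum]; linarith

/-! ### The Fourier–Laplace transform of test functions -/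

/-- The Fourier–Laplace transform `ζ ↦ ∫ e^{iζ·w} f(w) dw`. -/
def laplaceTransform {n : ℕ} (f : RSp n → ℂ) (ζ : CSp n) : ℂ := ∫ w, expMode ζ w * f w

theorem differentiable_laplaceTransform {n : ℕ} {f : RSp n → ℂ} (hf : Continuous f) (hc : HasCompactSupport f) :
    Differentiable ℂ (laplaceTransform f) := by
  intro ζ
  obtain ⟨g, hg⟩ := exists_expL2_of_hasCompactSupport (bracketWeight n (-(‖imPart ζ‖ + 1))) hf hc
  have h1 : DifferentiableAt ℂ (fun ζ' => (expPairing (bracketWeight n (‖imPart ζ‖ + 1))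
      (bracketWeight n (-(‖imPart ζ‖ + 1)))).flip g (modeLp (‖imPart ζ‖ + 1) ζ')) ζ :=
    ((expPairing (bracketWeight n (‖imPart ζ‖ + 1))
      (bracketWeight n (-(‖imPart ζ‖ + 1)))).flip g).differentiableAt.comp ζ
      (differentiableAt_modeLp (lt_add_one _))
  refine h1.congr_of_eventuallyEq ?_
  have ho : ∀ᶠ ζ' in nhds ζ, ‖imPart ζ'‖ < ‖imPart ζ‖ + 1 :=
    (continuous_imPart.norm.continuousAt).eventually_lt continuousAt_const (lt_add_one _)
  filter_upwards [ho] with ζ' hζ'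
  rw [ContinuousLinearMap.flip_apply, expPairing_apply (bracketWeight_neg n _), laplaceTransform]
  refine integral_congr_ae ?_
  filter_upwards [coeFn_modeLp_volume hζ', hg] with w h2 h3
  rw [h2, h3]

theorem norm_laplaceTransform_le {n : ℕ} {f : RSp n → ℂ} (hf : Continuous f) (hc : HasCompactSupport f)
    {ζ : CSp n} {κ : ℝ} (h : ‖imPart ζ‖ ≤ κ) :
    ‖laplaceTransform f ζ‖ ≤ ∫ w, Real.exp (κ * ‖w‖) * ‖f w‖ := by
  have hcont : Continuous fun w : RSp n => Real.exp (κ * ‖w‖) * ‖f w‖ := by fun_prop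
  refine norm_integral_le_of_norm_le (hcont.integrable_of_hasCompactSupport hc.norm.mul_left)
    (Filter.Eventually.of_forall fun w => ?_)
  rw [norm_mul]
  exact mul_le_mul_of_nonneg_right (norm_expMode_le h w) (norm_nonneg _)

theorem hasFDerivAt_expMode {n : ℕ} (ζ : CSp n) (w : RSp n) :
    DifferentiableAt ℝ (expMode ζ) w ∧
      ∀ v, fderiv ℝ (expMode ζ) w v = Complex.I * cdot ζ (toC v) * expMode ζ w := by
  have h : DifferentiableAt ℝ (expMode ζ) w := by
    unfold expMode cdot toC
    fun_prop
  refine ⟨h, fun v => ?_⟩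
  rw [← h.lineDeriv_eq_fderiv]
  refine HasLineDerivAt.lineDeriv ?_
  have e : (fun t : ℝ => expMode ζ (w + t • v)) = fun t : ℝ =>
      Complex.exp (Complex.I * (cdot ζ (toC w) + (t : ℂ) * cdot ζ (toC v))) := by
    funext t
    have : toC (w + t • v) = toC w + (t : ℂ) • toC v := by ext i; simp [toC_apply]
    rw [expMode, this, cdot_add, cdot_smul]
  rw [HasLineDerivAt, e]
  have h1 : HasDerivAt (fun t : ℝ => (t : ℂ)) 1 0 := Complex.ofRealCLM.hasDerivAt
  have h2 := (((h1.mul_const (cdot ζ (toC v))).const_add (cdot ζ (toC w))).const_mul Complex.I).cexp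
  refine h2.congr_deriv ?_
  rw [expMode]
  simp
  ring

theorem cdot_mul_laplaceTransform {n : ℕ} {f : RSp n → ℂ} (hf : ContDiff ℝ 1 f) (hc : HasCompactSupport f)
    (ζ : CSp n) (v : RSp n) :
    Complex.I * cdot ζ (toC v) * laplaceTransform f ζ = -laplaceTransform (fun w => fderiv ℝ f w v) ζ := by
  have hf' : Continuous fun w => fderiv ℝ f w v := (hf.continuous_fderiv one_ne_zero).clm_apply continuous_const
  have hc' : HasCompactSupport fun w => fderiv ℝ f w v := hc.fderiv_apply ℝ v
  have hE := continuous_expMode ζ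
  have e : ∀ w, fderiv ℝ (expMode ζ) w v * f w = Complex.I * cdot ζ (toC v) * (expMode ζ w * f w) := fun w => by
    rw [(hasFDerivAt_expMode ζ w).2]; ring
  have h := integral_mul_fderiv_eq_neg_fderiv_mul_of_integrable (𝕜 := ℂ) (μ := volume) (f := expMode ζ) (g := f) (v := v)
    (by
      simp only [e]
      exact ((hE.mul hf.continuous).integrable_of_hasCompactSupport hc.mul_left).const_mul _)
    ((hE.mul hf').integrable_of_hasCompactSupport hc'.mul_left)
    ((hE.mul hf.continuous).integrable_of_hasCompactSupport hc.mul_left)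
    (fun w _ => (hasFDerivAt_expMode ζ w).1) (fun w _ => hf.differentiable one_ne_zero w)
  rw [laplaceTransform, laplaceTransform, h, neg_neg, ← integral_const_mul]
  exact integral_congr_ae (Filter.Eventually.of_forall fun w => (e w).symm)

theorem exists_laplaceTransform_bound {n : ℕ} {f : RSp n → ℂ} (hf : ContDiff ℝ 1 f) (hc : HasCompactSupport f)
    (κ : ℝ) (v : RSp n) : ∃ C : ℝ, 0 ≤ C ∧ ∀ ζ : CSp n, ‖imPart ζ‖ ≤ κ →
      ‖laplaceTransform f ζ‖ ≤ C ∧ ‖cdot ζ (toC v)‖ * ‖laplaceTransform f ζ‖ ≤ C := by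
  have hf' : Continuous fun w => fderiv ℝ f w v := (hf.continuous_fderiv one_ne_zero).clm_apply continuous_const
  have hc' : HasCompactSupport fun w => fderiv ℝ f w v := hc.fderiv_apply ℝ v
  obtain ⟨a, ha⟩ : ∃ a, a = ∫ w, Real.exp (κ * ‖w‖) * ‖f w‖ := ⟨_, rfl⟩
  obtain ⟨b, hb⟩ : ∃ b, b = ∫ w, Real.exp (κ * ‖w‖) * ‖fderiv ℝ f w v‖ := ⟨_, rfl⟩
  have ha0 : 0 ≤ a := by rw [ha]; exact integral_nonneg fun w => by positivity
  have hb0 : 0 ≤ b := by rw [hb]; exact integral_nonneg fun w => by positivity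
  refine ⟨a + b, by positivity, fun ζ hζ => ⟨?_, ?_⟩⟩
  · have := norm_laplaceTransform_le hf.continuous hc hζ
    linarith
  · have h1 := norm_laplaceTransform_le hf' hc' hζ
    have h2 := congrArg norm (cdot_mul_laplaceTransform hf hc ζ v)
    rw [norm_mul, norm_mul, Complex.norm_I, one_mul, norm_neg] at h2
    linarith

section

variable {d : ℕ} {ν : RSp (d + 1)} {B : RSp d →ₗᵢ[ℝ] RSp (d + 1)}

theorem imPart_contourVec (x : RSp (d + 1)) (s : ℂ) (y : RSp d) :
    imPart (contourVec ν B (toC x) s 1 y) = s.im • ν := by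
  rw [contourVec, imPart_sub, imPart_add, imPart_smul_toC, imPart_smul_toC, imPart_toC]
  simp

theorem cdot_contourVec_normal (hν : ‖ν‖ = 1) (hB : ∀ y, inner ℝ ν (B y) = 0) (x : PerpR ν) (s : ℂ) (y : RSp d) :
    cdot (contourVec ν B (toC x.1) s 1 y) (toC ν) = s := by
  have h1 : cdot (toC x.1) (toC ν) = 0 := (perpToC x).2
  have h3 : cdot (toC (B y)) (toC ν) = 0 := by rw [cdot_toC, real_inner_comm, hB]; simp
  have h5 : cdot (toC ν) (toC ν) = 1 := by rw [cdot_toC, real_inner_self_eq_norm_sq, hν]; simp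
  rw [contourVec, sub_eq_add_neg, add_cdot, add_cdot, smul_cdot, smul_cdot, neg_cdot, h1, h3, h5]
  simp

/-- The product of the transforms of two test functions along the complexified line. -/
def testLine (ν : RSp (d + 1)) (B : RSp d →ₗᵢ[ℝ] RSp (d + 1)) (f φ : RSp (d + 1) → ℂ) (x : RSp (d + 1))
    (y : RSp d) (s : ℂ) : ℂ :=
  laplaceTransform f (-contourVec ν B (toC x) s 1 y) * laplaceTransform φ (contourVec ν B (toC x) s 1 y)

theorem differentiable_testLine {f φ : RSp (d + 1) → ℂ} (hf : Continuous f) (hfc : HasCompactSupport f)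
    (hφ : Continuous φ) (hφc : HasCompactSupport φ) (x : RSp (d + 1)) (y : RSp d) :
    Differentiable ℂ (testLine ν B f φ x y) := by
  have h : Differentiable ℂ fun s => contourVec ν B (toC x) s 1 y := by
    unfold contourVec
    fun_prop
  exact ((differentiable_laplaceTransform hf hfc).comp h.neg).mul ((differentiable_laplaceTransform hφ hφc).comp h)

/-- Integration by parts along `ν` gives each transform one power of decay in `ζ·ν = s`; the product
has the quadratic decay required by the contour shifts. -/
theorem exists_norm_testLine_le (hν : ‖ν‖ = 1) (hB : ∀ y, inner ℝ ν (B y) = 0) {f φ : RSp (d + 1) → ℂ}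
    (hf : ContDiff ℝ 1 f) (hfc : HasCompactSupport f) (hφ : ContDiff ℝ 1 φ) (hφc : HasCompactSupport φ)
    (δ : ℝ) : ∃ C : ℝ, ∀ (x : PerpR ν) (y : RSp d) (s : ℂ), |s.im| ≤ δ →
      ‖testLine ν B f φ x.1 y s‖ ≤ C * (1 + s.re ^ 2)⁻¹ := by
  obtain ⟨C, hC, h1⟩ := exists_laplaceTransform_bound hf hfc δ ν
  obtain ⟨D, hD, h2⟩ := exists_laplaceTransform_bound hφ hφc δ ν
  refine ⟨2 * (C * D), fun x y s hs => ?_⟩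
  have him : ‖imPart (contourVec ν B (toC x.1) s 1 y)‖ ≤ δ := by
    rw [imPart_contourVec, norm_smul, hν, mul_one]; exact hs
  obtain ⟨a1, a2⟩ := h1 (-contourVec ν B (toC x.1) s 1 y) (by rwa [imPart_neg, norm_neg])
  obtain ⟨b1, b2⟩ := h2 (contourVec ν B (toC x.1) s 1 y) him
  rw [neg_cdot, norm_neg, cdot_contourVec_normal hν hB] at a2
  rw [cdot_contourVec_normal hν hB] at b2
  rw [testLine, norm_mul, ← div_eq_mul_inv, le_div_iff₀ (by positivity)]
  obtain ⟨p, hp⟩ : ∃ p, p = ‖laplaceTransform f (-contourVec ν B (toC x.1) s 1 y)‖ := ⟨_, rfl⟩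
  obtain ⟨q, hq⟩ : ∃ q, q = ‖laplaceTransform φ (contourVec ν B (toC x.1) s 1 y)‖ := ⟨_, rfl⟩
  rw [← hp] at a1 a2 ⊢
  rw [← hq] at b1 b2 ⊢
  have hp0 : 0 ≤ p := by rw [hp]; positivity
  have hq0 : 0 ≤ q := by rw [hq]; positivity
  have hre : s.re ^ 2 ≤ ‖s‖ ^ 2 := by
    rw [← sq_abs]
    exact pow_le_pow_left₀ (abs_nonneg _) (Complex.abs_re_le_norm s) 2
  have k1 : p * q ≤ C * D := mul_le_mul a1 b1 hq0 hC
  have k2 : ‖s‖ * p * (‖s‖ * q) ≤ C * D := mul_le_mul a2 b2 (by positivity) hC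
  have k3 : p * q * s.re ^ 2 ≤ p * q * ‖s‖ ^ 2 := mul_le_mul_of_nonneg_left hre (by positivity)
  nlinarith

/-- The frequency associated with the line coordinates. -/
def lineFreq (ν : RSp (d + 1)) (B : RSp d →ₗᵢ[ℝ] RSp (d + 1)) (x : RSp (d + 1)) (v : ℝ × RSp d) : RSp (d + 1) :=
  (2 * Real.pi)⁻¹ • (lineCoord ν B v - x)

theorem contourVec_eq_freqVec (x : RSp (d + 1)) (t a : ℝ) (y : RSp d) :
    contourVec ν B (toC x) (t + a * Complex.I) 1 y =
      freqVec (lineFreq ν B x (t, y)) + ((a : ℂ) * Complex.I) • toC ν := by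
  rw [freqVec, lineFreq, smul_inv_smul₀ (by positivity), toC_lineCoord_sub, contourVec, contourVec, add_smul]
  abel

theorem expMode_smul_normal (a : ℝ) (w : RSp (d + 1)) :
    expMode (((a : ℂ) * Complex.I) • toC ν) w = ((Real.exp (-(a * inner ℝ ν w)) : ℝ) : ℂ) := by
  rw [expMode, smul_cdot, cdot_toC, Complex.ofReal_exp]
  congr 1
  push_cast
  linear_combination (a * (inner ℝ ν w : ℝ) : ℂ) * Complex.I_sq

/-- Multiplication by a real exponential in the direction `ν`. -/
def expTilt (ν : RSp (d + 1)) (a : ℝ) (f : RSp (d + 1) → ℂ) (w : RSp (d + 1)) : ℂ :=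
  ((Real.exp (a * inner ℝ ν w) : ℝ) : ℂ) * f w

/-- Moving the line by `ia` tilts `f` by `e^{a ν·w}` and `φ` by `e^{-a ν·w}`. The shifted integrand
is thus again a product of ordinary Fourier transforms, to which Plancherel applies. -/
theorem testLine_eq (f φ : RSp (d + 1) → ℂ) (x : RSp (d + 1)) (t a : ℝ) (y : RSp d) :
    testLine ν B f φ x y (t + a * Complex.I) =
      𝓕 (expTilt ν a f) (lineFreq ν B x (t, y)) * 𝓕⁻ (expTilt ν (-a) φ) (lineFreq ν B x (t, y)) := by
  rw [testLine, contourVec_eq_freqVec, Real.fourier_eq', Real.fourierInv_eq', laplaceTransform, laplaceTransform]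
  congr 1
  · refine integral_congr_ae (Filter.Eventually.of_forall fun w => ?_)
    beta_reduce
    rw [neg_add, ← neg_smul, show -((a : ℂ) * Complex.I) = ((-a : ℝ) : ℂ) * Complex.I by push_cast; ring,
      expMode_add, expMode_neg_freqVec, expMode_smul_normal, smul_eq_mul, expTilt, neg_mul a, neg_neg, mul_assoc]
  · refine integral_congr_ae (Filter.Eventually.of_forall fun w => ?_)
    beta_reduce
    rw [expMode_add, expMode_freqVec, expMode_smul_normal, smul_eq_mul, expTilt, neg_mul, mul_assoc,
      real_inner_comm]

end

/-! ### Plancherel estimates for products of Fourier transforms -/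

theorem eLpNorm_fourier {n : ℕ} (a : 𝓢(RSp n, ℂ)) :
    eLpNorm (𝓕 a : 𝓢(RSp n, ℂ)) 2 volume = eLpNorm a 2 volume := by
  have hfin : ∀ b : 𝓢(RSp n, ℂ), eLpNorm b 2 volume ≠ ⊤ := fun b =>
    MemLp.eLpNorm_ne_top (b.memLp 2 volume)
  have h := a.norm_fourier_toL2_eq
  rw [SchwartzMap.norm_toLp, SchwartzMap.norm_toLp] at h
  exact (ENNReal.toReal_eq_toReal_iff' (hfin _) (hfin _)).1 h

theorem eLpNorm_fourierInv {n : ℕ} (a : 𝓢(RSp n, ℂ)) :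
    eLpNorm (𝓕⁻ a : 𝓢(RSp n, ℂ)) 2 volume = eLpNorm a 2 volume := by
  rw [← eLpNorm_fourier, FourierTransform.fourier_fourierInv_eq]

theorem lintegral_enorm_mul_le {n : ℕ} (a b : 𝓢(RSp n, ℂ)) :
    ∫⁻ ξ, ‖a ξ * b ξ‖ₑ ≤ eLpNorm a 2 volume * eLpNorm b 2 volume := by
  have h := eLpNorm_smul_le_mul_eLpNorm (p := 2) (q := 2) (r := 1) (μ := volume)
    b.continuous.aestronglyMeasurable a.continuous.aestronglyMeasurable
  rwa [eLpNorm_one_eq_lintegral_enorm] at h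

theorem lintegral_fourier_mul_le {n : ℕ} (a b : 𝓢(RSp n, ℂ)) :
    ∫⁻ ξ, ‖𝓕 a ξ * 𝓕⁻ b ξ‖ₑ ≤ eLpNorm a 2 volume * eLpNorm b 2 volume := by
  refine (lintegral_enorm_mul_le (𝓕 a) (𝓕⁻ b)).trans (le_of_eq ?_)
  rw [eLpNorm_fourier, eLpNorm_fourierInv]

theorem eLpNorm_lineDeriv_fourier {n : ℕ} (a : 𝓢(RSp n, ℂ)) (v : RSp n) :
    eLpNorm (fun ξ => fderiv ℝ (𝓕 a : 𝓢(RSp n, ℂ)) ξ v) 2 volume =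
      ENNReal.ofReal (2 * Real.pi) * eLpNorm (fun w => ((inner ℝ w v : ℝ) : ℂ) * a w) 2 volume := by
  have h := SchwartzMap.lineDerivOp_fourier_eq a v
  have h1 : (fun ξ => fderiv ℝ (𝓕 a : 𝓢(RSp n, ℂ)) ξ v) =
      (LineDeriv.lineDerivOp v (𝓕 a) : 𝓢(RSp n, ℂ)) := rfl
  rw [h1, h, eLpNorm_fourier]
  have h2 : (-(2 * (Real.pi : ℂ) * Complex.I) • SchwartzMap.smulLeftCLM ℂ (inner ℝ · v) a : 𝓢(RSp n, ℂ)) =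
      (-(2 * (Real.pi : ℂ) * Complex.I)) • fun w => ((inner ℝ w v : ℝ) : ℂ) * a w := by
    funext w
    have : (inner ℝ · v : RSp n → ℝ).HasTemperateGrowth := by fun_prop
    simp [SchwartzMap.smulLeftCLM_apply_apply this]
  rw [h2, eLpNorm_const_smul]
  congr 1
  rw [← ofReal_norm, norm_neg, norm_mul, norm_mul, Complex.norm_I, Complex.norm_real, Complex.norm_two,
    Real.norm_of_nonneg Real.pi_pos.le, mul_one]

theorem eLpNorm_lineDeriv_fourierInv {n : ℕ} (a : 𝓢(RSp n, ℂ)) (v : RSp n) :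
    eLpNorm (fun ξ => fderiv ℝ (𝓕⁻ a : 𝓢(RSp n, ℂ)) ξ v) 2 volume =
      ENNReal.ofReal (2 * Real.pi) * eLpNorm (fun w => ((inner ℝ w v : ℝ) : ℂ) * a w) 2 volume := by
  have h := SchwartzMap.lineDerivOp_fourierInv_eq a v
  have h1 : (fun ξ => fderiv ℝ (𝓕⁻ a : 𝓢(RSp n, ℂ)) ξ v) =
      (LineDeriv.lineDerivOp v (𝓕⁻ a) : 𝓢(RSp n, ℂ)) := rfl
  rw [h1, h, eLpNorm_fourierInv]
  have h2 : ((2 * (Real.pi : ℂ) * Complex.I) • SchwartzMap.smulLeftCLM ℂ (inner ℝ · v) a : 𝓢(RSp n, ℂ)) =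
      (2 * (Real.pi : ℂ) * Complex.I) • fun w => ((inner ℝ w v : ℝ) : ℂ) * a w := by
    funext w
    have : (inner ℝ · v : RSp n → ℝ).HasTemperateGrowth := by fun_prop
    simp [SchwartzMap.smulLeftCLM_apply_apply this]
  rw [h2, eLpNorm_const_smul]
  congr 1
  rw [← ofReal_norm, norm_mul, norm_mul, Complex.norm_I, Complex.norm_real, Complex.norm_two,
    Real.norm_of_nonneg Real.pi_pos.le, mul_one]

theorem lintegral_fderiv_fourier_mul_le {n : ℕ} (a b : 𝓢(RSp n, ℂ)) (v : RSp n) :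
    ∫⁻ ξ, ‖fderiv ℝ (fun ξ => 𝓕 a ξ * 𝓕⁻ b ξ) ξ v‖ₑ ≤ ENNReal.ofReal (2 * Real.pi) *
      (eLpNorm a 2 volume * eLpNorm (fun w => ((inner ℝ w v : ℝ) : ℂ) * b w) 2 volume +
        eLpNorm (fun w => ((inner ℝ w v : ℝ) : ℂ) * a w) 2 volume * eLpNorm b 2 volume) := by
  have h1 := lintegral_enorm_mul_le (𝓕 a) (LineDeriv.lineDerivOp v (𝓕⁻ b))
  have h2 := lintegral_enorm_mul_le (LineDeriv.lineDerivOp v (𝓕 a)) (𝓕⁻ b)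
  have e1 := eLpNorm_lineDeriv_fourierInv b v
  have e2 := eLpNorm_lineDeriv_fourier a v
  change eLpNorm (LineDeriv.lineDerivOp v (𝓕⁻ b) : 𝓢(RSp n, ℂ)) 2 volume = _ at e1
  change eLpNorm (LineDeriv.lineDerivOp v (𝓕 a) : 𝓢(RSp n, ℂ)) 2 volume = _ at e2
  rw [e1, eLpNorm_fourier] at h1
  rw [e2, eLpNorm_fourierInv] at h2
  calc ∫⁻ ξ, ‖fderiv ℝ (fun ξ => 𝓕 a ξ * 𝓕⁻ b ξ) ξ v‖ₑ
      ≤ ∫⁻ ξ, (‖(𝓕 a) ξ * (LineDeriv.lineDerivOp v (𝓕⁻ b) : 𝓢(RSp n, ℂ)) ξ‖ₑ +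
        ‖(LineDeriv.lineDerivOp v (𝓕 a) : 𝓢(RSp n, ℂ)) ξ * (𝓕⁻ b) ξ‖ₑ) := by
        refine lintegral_mono fun ξ => ?_
        have e : fderiv ℝ (fun ξ => 𝓕 a ξ * 𝓕⁻ b ξ) ξ v =
            (𝓕 a) ξ * (LineDeriv.lineDerivOp v (𝓕⁻ b) : 𝓢(RSp n, ℂ)) ξ +
              (LineDeriv.lineDerivOp v (𝓕 a) : 𝓢(RSp n, ℂ)) ξ * (𝓕⁻ b) ξ := by
          rw [fderiv_fun_mul (𝓕 a : 𝓢(RSp n, ℂ)).differentiableAt (𝓕⁻ b : 𝓢(RSp n, ℂ)).differentiableAt,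
            SchwartzMap.lineDerivOp_apply_eq_fderiv, SchwartzMap.lineDerivOp_apply_eq_fderiv]
          simp [mul_comm]
        rw [e]
        exact enorm_add_le _ _
    _ ≤ _ := by
        rw [lintegral_add_left (Continuous.measurable (by fun_prop))]
        refine (add_le_add h1 h2).trans (le_of_eq ?_)
        ring

section

variable {n : ℕ} {γ : ℝ}

theorem contDiff_expTilt {d : ℕ} (ν : RSp (d + 1)) (a : ℝ) {f : RSp (d + 1) → ℂ} (hf : ContDiff ℝ ∞ f) :
    ContDiff ℝ ∞ (expTilt ν a f) := by
  unfold expTilt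
  have h : ContDiff ℝ ∞ fun w : RSp (d + 1) => Real.exp (a * inner ℝ ν w) :=
    Real.contDiff_exp.comp (contDiff_const.mul (contDiff_const.inner ℝ contDiff_id))
  exact (Complex.ofRealCLM.contDiff.comp h).mul hf

theorem hasCompactSupport_expTilt {d : ℕ} (ν : RSp (d + 1)) (a : ℝ) {f : RSp (d + 1) → ℂ} (hf : HasCompactSupport f) :
    HasCompactSupport (expTilt ν a f) := hf.mul_left

theorem norm_expTilt_le {d : ℕ} {ν : RSp (d + 1)} (hν : ‖ν‖ = 1) {a : ℝ} {δ : ℝ} (ha : |a| ≤ δ)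
    (f : RSp (d + 1) → ℂ) (w : RSp (d + 1)) : ‖expTilt ν a f w‖ ≤ Real.exp (δ * ‖w‖) * ‖f w‖ := by
  rw [expTilt, norm_mul, Complex.norm_real, Real.norm_of_nonneg (Real.exp_pos _).le]
  have h : a * inner ℝ ν w ≤ δ * ‖w‖ := by
    refine (le_abs_self _).trans ?_
    rw [abs_mul]
    have := abs_real_inner_le_norm ν w
    rw [hν, one_mul] at this
    exact mul_le_mul ha this (abs_nonneg _) ((abs_nonneg _).trans ha)
  gcongr

theorem eLpNorm_expTilt_le {d : ℕ} (hγ : 0 < γ) {ν : RSp (d + 1)} (hν : ‖ν‖ = 1) {a : ℝ} (ha : |a| ≤ γ / 2)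
    (f : RSp (d + 1) → ℂ) :
    eLpNorm (expTilt ν a f) 2 volume ≤ eLpNorm f 2 (expMeasure (normWeight (d + 1) (-γ))) := by
  rw [eLpNorm_expMeasure]
  refine eLpNorm_mono fun w => (norm_expTilt_le hν ha f w).trans ?_
  rw [norm_mul, Complex.norm_real, Real.norm_of_nonneg (Real.exp_pos _).le]
  refine mul_le_mul_of_nonneg_right (Real.exp_le_exp.2 ?_) (norm_nonneg _)
  change γ / 2 * ‖w‖ ≤ -(-γ * ‖w‖)
  nlinarith [norm_nonneg w]

/-- The weight `e^{γ|w|}` is spent in halves: one covers the tilt, the other absorbs the factor `w`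
that arises from differentiating a Fourier transform. -/
theorem eLpNorm_inner_expTilt_le {d : ℕ} (hγ : 0 < γ) {ν : RSp (d + 1)} (hν : ‖ν‖ = 1) {a : ℝ} (ha : |a| ≤ γ / 2)
    (f : RSp (d + 1) → ℂ) {v : RSp (d + 1)} (hv : ‖v‖ = 1) :
    eLpNorm (fun w => ((inner ℝ w v : ℝ) : ℂ) * expTilt ν a f w) 2 volume ≤
      ENNReal.ofReal (2 / γ) * eLpNorm f 2 (expMeasure (normWeight (d + 1) (-γ))) := by
  rw [eLpNorm_expMeasure]
  refine eLpNorm_le_mul_eLpNorm_of_ae_le_mul (Filter.Eventually.of_forall fun w => ?_) 2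
  rw [norm_mul, Complex.norm_real, Real.norm_eq_abs, norm_mul, Complex.norm_real,
    Real.norm_of_nonneg (Real.exp_pos _).le]
  have h1 : |(inner ℝ w v : ℝ)| ≤ ‖w‖ := by
    have := abs_real_inner_le_norm w v
    rwa [hv, mul_one] at this
  have h2 : ‖w‖ ≤ 2 / γ * Real.exp (γ / 2 * ‖w‖) := by
    have := self_le_exp (t := ‖w‖) (half_pos hγ)
    rwa [one_div_div] at this
  have h3 : Real.exp (-(normWeight (d + 1) (-γ) w)) = Real.exp (γ / 2 * ‖w‖) * Real.exp (γ / 2 * ‖w‖) := by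
    rw [← Real.exp_add]
    congr 1
    change -(-γ * ‖w‖) = _
    ring
  rw [h3]
  calc |(inner ℝ w v : ℝ)| * ‖expTilt ν a f w‖
      ≤ (2 / γ * Real.exp (γ / 2 * ‖w‖)) * (Real.exp (γ / 2 * ‖w‖) * ‖f w‖) :=
        mul_le_mul (h1.trans h2) (norm_expTilt_le hν ha f w) (norm_nonneg _) (by positivity)
    _ = _ := by ring

/-- The product of the Fourier transforms of tilted test functions. -/
def tiltProduct {d : ℕ} (ν : RSp (d + 1)) (a : ℝ) (f φ : RSp (d + 1) → ℂ) (ξ : RSp (d + 1)) : ℂ :=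
  𝓕 (expTilt ν a f) ξ * 𝓕⁻ (expTilt ν (-a) φ) ξ

theorem tiltProduct_bounds {d : ℕ} (hγ : 0 < γ) {ν : RSp (d + 1)} (hν : ‖ν‖ = 1) {f φ : RSp (d + 1) → ℂ}
    (hf : ContDiff ℝ ∞ f) (hfc : HasCompactSupport f) (hφ : ContDiff ℝ ∞ φ) (hφc : HasCompactSupport φ)
    {a : ℝ} (ha : |a| ≤ γ / 2) :
    ContDiff ℝ 1 (tiltProduct ν a f φ) ∧
    ∫⁻ ξ, ‖tiltProduct ν a f φ ξ‖ₑ ≤ eLpNorm f 2 (expMeasure (normWeight (d + 1) (-γ))) *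
      eLpNorm φ 2 (expMeasure (normWeight (d + 1) (-γ))) ∧
    ∀ v : RSp (d + 1), ‖v‖ = 1 → ∫⁻ ξ, ‖fderiv ℝ (tiltProduct ν a f φ) ξ v‖ₑ ≤
      ENNReal.ofReal (2 * Real.pi) * (2 * ENNReal.ofReal (2 / γ)) *
        (eLpNorm f 2 (expMeasure (normWeight (d + 1) (-γ))) *
          eLpNorm φ 2 (expMeasure (normWeight (d + 1) (-γ)))) := by
  obtain ⟨A, hA⟩ : ∃ A : 𝓢(RSp (d + 1), ℂ), ⇑A = expTilt ν a f :=
    ⟨(hasCompactSupport_expTilt ν a hfc).toSchwartzMap (contDiff_expTilt ν a hf), rfl⟩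
  obtain ⟨D, hD⟩ : ∃ D : 𝓢(RSp (d + 1), ℂ), ⇑D = expTilt ν (-a) φ :=
    ⟨(hasCompactSupport_expTilt ν (-a) hφc).toSchwartzMap (contDiff_expTilt ν (-a) hφ), rfl⟩
  have ha' : |-a| ≤ γ / 2 := by rwa [abs_neg]
  have e : tiltProduct ν a f φ = fun ξ => (𝓕 A) ξ * (𝓕⁻ D) ξ := by
    funext ξ
    rw [tiltProduct, ← hA, ← hD, SchwartzMap.fourier_coe, SchwartzMap.fourierInv_coe]
  have n1 := eLpNorm_expTilt_le hγ hν ha f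
  have n2 := eLpNorm_expTilt_le hγ hν ha' φ
  rw [← hA] at n1
  rw [← hD] at n2
  rw [e]
  refine ⟨((𝓕 A : 𝓢(RSp (d + 1), ℂ)).smooth 1).mul ((𝓕⁻ D : 𝓢(RSp (d + 1), ℂ)).smooth 1),
    (lintegral_fourier_mul_le A D).trans (mul_le_mul' n1 n2), fun v hv => ?_⟩
  have n3 := eLpNorm_inner_expTilt_le hγ hν ha f hv
  have n4 := eLpNorm_inner_expTilt_le hγ hν ha' φ hv
  rw [← hA] at n3
  rw [← hD] at n4
  refine (lintegral_fderiv_fourier_mul_le A D v).trans ?_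
  rw [mul_assoc]
  refine mul_le_mul_right ((add_le_add (mul_le_mul' n1 n4) (mul_le_mul' n3 n2)).trans (le_of_eq ?_)) _
  ring

end

/-! ### Weighted integrals in the line coordinates -/

section

variable {d : ℕ} {ν : RSp (d + 1)} {B : RSp d →ₗᵢ[ℝ] RSp (d + 1)}

theorem continuous_lineFreq (x : RSp (d + 1)) : Continuous (lineFreq ν B x) := by
  have : Continuous fun v : ℝ × RSp d => B v.2 := B.continuous.comp continuous_snd
  unfold lineFreq lineCoord
  fun_prop

theorem exists_lintegral_lineFreq (hν : ‖ν‖ = 1) (hB : ∀ y, inner ℝ ν (B y) = 0) :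
    ∃ c : NNReal, ∀ (x : RSp (d + 1)) (G : RSp (d + 1) → ℝ≥0∞), Measurable G →
      ∫⁻ v, G (lineFreq ν B x v) = c * ∫⁻ ξ, G ξ := by
  obtain ⟨C, hC, hvol⟩ := exists_volume_eq_smul_map hν hB
  have hr : (2 * Real.pi)⁻¹ ≠ 0 := by positivity
  refine ⟨C⁻¹ * Real.toNNReal |((2 * Real.pi)⁻¹ ^ (d + 1))⁻¹|, fun x G hG => ?_⟩
  have hg : Measurable fun ξ : RSp (d + 1) => G ((2 * Real.pi)⁻¹ • (ξ - x)) := hG.comp (by fun_prop)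
  have h1 : ∫⁻ ξ : RSp (d + 1), G ((2 * Real.pi)⁻¹ • (ξ - x)) = C * ∫⁻ v, G (lineFreq ν B x v) := by
    conv_lhs => rw [hvol]
    rw [lintegral_smul_measure, lintegral_map hg (measurableEmbedding_lineCoord hν hB).measurable]
    rfl
  have h2 : ∫⁻ ξ : RSp (d + 1), G ((2 * Real.pi)⁻¹ • (ξ - x)) =
      ENNReal.ofReal |((2 * Real.pi)⁻¹ ^ (d + 1))⁻¹| * ∫⁻ ξ, G ξ := by
    rw [lintegral_sub_right_eq_self (fun ξ => G ((2 * Real.pi)⁻¹ • ξ)) x]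
    have h3 := Measure.map_addHaar_smul (volume : Measure (RSp (d + 1))) hr
    rw [finrank_euclideanSpace_fin] at h3
    have h4 := lintegral_map (μ := volume) hG (measurable_const_smul ((2 * Real.pi)⁻¹) : Measurable fun ξ : RSp (d + 1) => _)
    rw [← h4, h3, lintegral_smul_measure, smul_eq_mul]
  have hC' : (C : ℝ≥0∞) ≠ 0 := by exact_mod_cast hC
  rw [ENNReal.coe_mul, mul_assoc]
  change _ = _ * (ENNReal.ofReal _ * _)
  rw [← h2, h1, ENNReal.coe_inv hC, ← mul_assoc, ENNReal.inv_mul_cancel hC' ENNReal.coe_ne_top, one_mul]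

theorem exists_integral_lineFreq (hν : ‖ν‖ = 1) (hB : ∀ y, inner ℝ ν (B y) = 0) :
    ∃ c : NNReal, ∀ (x : RSp (d + 1)) (G : RSp (d + 1) → ℂ),
      ∫ ξ, G ξ = c • ∫ v, G (lineFreq ν B x v) := by
  obtain ⟨C, -, hC⟩ := integrable_integral_resolventFun hν hB
  refine ⟨Real.toNNReal ((2 * Real.pi)⁻¹ ^ (d + 1)) * C, fun x G => ?_⟩
  have h1 := (hC (fun ξ => G ((2 * Real.pi)⁻¹ • ξ)) x).2
  rw [Measure.integral_comp_smul, finrank_euclideanSpace_fin] at h1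
  have hp : 0 < (2 * Real.pi)⁻¹ ^ (d + 1) := by positivity
  rw [mul_smul]
  change _ = _ • C • ∫ v, G ((2 * Real.pi)⁻¹ • (lineCoord ν B v - x))
  rw [← h1, abs_of_pos (inv_pos.2 hp), NNReal.smul_def, Real.coe_toNNReal _ hp.le, smul_inv_smul₀ hp.ne']

/-- A weight in the transversal variables dominated by first order derivatives in the mean. -/
def IsKernelBound (k : RSp d → ℝ≥0∞) (K : ℝ≥0∞) : Prop :=
  ∀ H : RSp d → ℂ, ContDiff ℝ 1 H → ∫⁻ η, k η * ‖H η‖ₑ ≤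
    K * ∑ j, ∫⁻ η, (‖H η‖ₑ + ‖fderiv ℝ H η (EuclideanSpace.single j 1)‖ₑ)

theorem fderiv_comp_lineFreq (x : RSp (d + 1)) {Θ : RSp (d + 1) → ℂ} (hΘ : ContDiff ℝ 1 Θ) (t : ℝ) :
    ContDiff ℝ 1 (fun η => Θ (lineFreq ν B x (t, η))) ∧ ∀ η v, ‖fderiv ℝ (fun η => Θ (lineFreq ν B x (t, η))) η v‖ₑ ≤
      ‖fderiv ℝ Θ (lineFreq ν B x (t, η)) (B v)‖ₑ := by
  have hd : ∀ η, HasFDerivAt (fun η => lineFreq ν B x (t, η)) ((2 * Real.pi)⁻¹ • B.toContinuousLinearMap) η := fun η => by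
    have h1 : HasFDerivAt (fun η => B η) B.toContinuousLinearMap η := B.toContinuousLinearMap.hasFDerivAt
    exact HasFDerivAt.const_smul (((h1.const_add (t • ν)).sub_const x)) ((2 * Real.pi)⁻¹ : ℝ)
  have hc : ContDiff ℝ 1 fun η => lineFreq ν B x (t, η) :=
    ContDiff.const_smul ((2 * Real.pi)⁻¹ : ℝ)
      (((contDiff_const (c := t • ν)).add B.toContinuousLinearMap.contDiff).sub (contDiff_const (c := x)))
  refine ⟨hΘ.comp hc, fun η v => ?_⟩
  have h2 := ((hΘ.differentiable one_ne_zero (lineFreq ν B x (t, η))).hasFDerivAt.comp η (hd η)).fderiv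
  change ‖fderiv ℝ (Θ ∘ fun η => lineFreq ν B x (t, η)) η v‖ₑ ≤ _
  rw [h2, ContinuousLinearMap.comp_apply, _root_.smul_apply, map_smul, enorm_smul]
  refine (mul_le_mul_left ?_ _).trans (one_mul _).le
  rw [Real.enorm_eq_ofReal (by positivity), ENNReal.ofReal_le_one]
  exact inv_le_one_of_one_le₀ (by linarith [Real.pi_gt_three])

/-- The kernel bound is applied on each slice of constant `t`; integration over `t` leaves the `L¹`
norms in `tiltProduct_bounds`. All dependence on the spectral parameter is confined to `k` and `K`.
-/
theorem exists_lintegral_kernel_mul_tiltProduct_le {γ : ℝ} (hγ : 0 < γ) (hν : ‖ν‖ = 1)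
    (hB : ∀ y, inner ℝ ν (B y) = 0) : ∃ M : NNReal, ∀ {k : RSp d → ℝ≥0∞} {K : ℝ≥0∞}, Measurable k →
    IsKernelBound k K → ∀ (x : RSp (d + 1)) {f φ : RSp (d + 1) → ℂ}, ContDiff ℝ ∞ f → HasCompactSupport f →
    ContDiff ℝ ∞ φ → HasCompactSupport φ → ∀ {a : ℝ}, |a| ≤ γ / 2 →
    ∫⁻ v : ℝ × RSp d, k v.2 * ‖tiltProduct ν a f φ (lineFreq ν B x v)‖ₑ ≤
      K * (M * (eLpNorm f 2 (expMeasure (normWeight (d + 1) (-γ))) *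
        eLpNorm φ 2 (expMeasure (normWeight (d + 1) (-γ))))) := by
  obtain ⟨c, hc⟩ := exists_lintegral_lineFreq hν hB
  refine ⟨d * (c * (1 + Real.toNNReal (2 * Real.pi) * (2 * Real.toNNReal (2 / γ)))),
    fun {k K} hkm hk x f φ hf hfc hφ hφc a ha => ?_⟩
  obtain ⟨hΘ, h0, h1⟩ := tiltProduct_bounds hγ hν hf hfc hφ hφc ha
  obtain ⟨Θ, eΘ⟩ : ∃ Θ, Θ = tiltProduct ν a f φ := ⟨_, rfl⟩
  obtain ⟨N, hN⟩ : ∃ N, N = eLpNorm f 2 (expMeasure (normWeight (d + 1) (-γ))) *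
        eLpNorm φ 2 (expMeasure (normWeight (d + 1) (-γ))) := ⟨_, rfl⟩
  rw [← eΘ, ← hN] at h0 h1
  rw [← eΘ] at hΘ ⊢
  rw [← hN]
  have hm : Measurable fun v : ℝ × RSp d => k v.2 * ‖Θ (lineFreq ν B x v)‖ₑ :=
    (hkm.comp measurable_snd).mul (hΘ.continuous.comp (continuous_lineFreq x)).enorm.measurable
  have hGm : ∀ j : Fin d, Measurable fun ξ : RSp (d + 1) =>
      ‖Θ ξ‖ₑ + ‖fderiv ℝ Θ ξ (B (EuclideanSpace.single j 1))‖ₑ := fun j => by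
    have h2 : Continuous fun ξ => fderiv ℝ Θ ξ (B (EuclideanSpace.single j 1)) :=
      (hΘ.continuous_fderiv one_ne_zero).clm_apply continuous_const
    exact hΘ.continuous.enorm.measurable.add h2.enorm.measurable
  have hGT : ∀ j : Fin d, Measurable fun v : ℝ × RSp d => ‖Θ (lineFreq ν B x v)‖ₑ +
      ‖fderiv ℝ Θ (lineFreq ν B x v) (B (EuclideanSpace.single j 1))‖ₑ := fun j =>
    (hGm j).comp (continuous_lineFreq x).measurable
  calc ∫⁻ v : ℝ × RSp d, k v.2 * ‖Θ (lineFreq ν B x v)‖ₑ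
      = ∫⁻ t, ∫⁻ η, k η * ‖Θ (lineFreq ν B x (t, η))‖ₑ := by
        rw [Measure.volume_eq_prod, lintegral_prod _ hm.aemeasurable]
    _ ≤ ∫⁻ t, K * ∑ j : Fin d, ∫⁻ η, (‖Θ (lineFreq ν B x (t, η))‖ₑ +
          ‖fderiv ℝ Θ (lineFreq ν B x (t, η)) (B (EuclideanSpace.single j 1))‖ₑ) := by
        refine lintegral_mono fun t => ?_
        obtain ⟨g1, g2⟩ := fderiv_comp_lineFreq (ν := ν) (B := B) x hΘ t
        refine (hk _ g1).trans (mul_le_mul_right (Finset.sum_le_sum fun j _ => lintegral_mono fun η => ?_) _)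
        exact add_le_add le_rfl (g2 η _)
    _ = K * ∑ j : Fin d, ∫⁻ v : ℝ × RSp d, (‖Θ (lineFreq ν B x v)‖ₑ +
          ‖fderiv ℝ Θ (lineFreq ν B x v) (B (EuclideanSpace.single j 1))‖ₑ) := by
        rw [lintegral_const_mul _ (Finset.measurable_fun_sum _ fun j _ => (hGT j).lintegral_prod_right'),
          lintegral_finsetSum _ fun j _ => (hGT j).lintegral_prod_right']
        congr 1
        refine Finset.sum_congr rfl fun j _ => ?_
        rw [Measure.volume_eq_prod, lintegral_prod _ (hGT j).aemeasurable]
    _ ≤ K * ∑ j : Fin d, c * (1 + ENNReal.ofReal (2 * Real.pi) * (2 * ENNReal.ofReal (2 / γ))) * N := by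
        refine mul_le_mul_right (Finset.sum_le_sum fun j _ => ?_) _
        rw [hc x _ (hGm j), mul_assoc]
        refine mul_le_mul_right ?_ _
        rw [lintegral_add_left hΘ.continuous.enorm.measurable, add_mul, one_mul]
        refine add_le_add h0 (h1 _ ?_)
        rw [B.norm_map]
        simp
    _ = _ := by
        rw [Finset.sum_const, Finset.card_univ, Fintype.card_fin, nsmul_eq_mul]
        push_cast
        simp only [ENNReal.ofReal, mul_assoc]

end

/-! ### Decay of the resolvent pairing -/

section

variable {d : ℕ} {ν : RSp (d + 1)} {B : RSp d →ₗᵢ[ℝ] RSp (d + 1)}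

theorem isKernelBound_const (hd : 1 ≤ d) (c : ℝ≥0∞) : IsKernelBound (fun _ : RSp d => c) c := by
  intro H hH
  rw [lintegral_const_mul _ hH.continuous.enorm.measurable]
  refine mul_le_mul_right ?_ _
  refine le_trans ?_ (Finset.single_le_sum (f := fun j : Fin d => ∫⁻ η, (‖H η‖ₑ +
    ‖fderiv ℝ H η (EuclideanSpace.single j 1)‖ₑ)) (fun _ _ => zero_le) (Finset.mem_univ ⟨0, hd⟩))
  exact lintegral_mono fun η => le_self_add

theorem enorm_line_integral_le {γ : ℝ} (hγ : 0 < γ) (hν : ‖ν‖ = 1) (hB : ∀ y, inner ℝ ν (B y) = 0)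
    {f φ : RSp (d + 1) → ℂ} (hf : ContDiff ℝ ∞ f) (hfc : HasCompactSupport f) (hφ : ContDiff ℝ ∞ φ)
    (hφc : HasCompactSupport φ) (x : PerpR ν) (y : RSp d) {z Q : ℂ} (hz : z.im ≠ 0) {τ : ℝ}
    (hτ : τ ≠ 0) (hQ : Q ^ 2 = z ^ 2 - τ) {X : ℝ} (hX : X = ‖Q‖ ∨ X = |z.im|) (hX0 : 0 < X) :
    ‖∫ t : ℝ, testLine ν B f φ x.1 y t * ((t : ℂ) ^ 2 + 2 * z * t + τ)⁻¹‖ₑ ≤ ENNReal.ofReal ((γ / 2 * X)⁻¹) *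
      ((∫⁻ t : ℝ, ‖tiltProduct ν (γ / 2) f φ (lineFreq ν B x.1 (t, y))‖ₑ) +
        ∫⁻ t : ℝ, ‖tiltProduct ν (-(γ / 2)) f φ (lineFreq ν B x.1 (t, y))‖ₑ) := by
  have hf1 : ContDiff ℝ 1 f := hf.of_le (by exact_mod_cast le_top)
  have hφ1 : ContDiff ℝ 1 φ := hφ.of_le (by exact_mod_cast le_top)
  have hδ : 0 < γ / 2 := by positivity
  obtain ⟨C, hC⟩ := exists_norm_testLine_le hν hB hf1 hfc hφ1 hφc (γ / 2)
  have hd : ∀ s : ℂ, |s.im| ≤ γ / 2 → DifferentiableAt ℂ (testLine ν B f φ x.1 y) s := fun s _ =>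
    (differentiable_testLine hf.continuous hfc hφ.continuous hφc x.1 y) s
  have hb := hC x y
  have hint : ∀ a : ℝ, |a| ≤ γ / 2 → ∫⁻ t : ℝ, ‖tiltProduct ν a f φ (lineFreq ν B x.1 (t, y))‖ₑ =
      ENNReal.ofReal (∫ t : ℝ, ‖testLine ν B f φ x.1 y (t + a * Complex.I)‖) := fun a ha => by
    rw [ofReal_integral_norm_eq_lintegral_enorm (integrable_shift_of_bound hd hb ha)]
    simp only [testLine_eq]
    rfl
  have hpos : ∀ a : ℝ, 0 ≤ ∫ t : ℝ, ‖testLine ν B f φ x.1 y (t + a * Complex.I)‖ := fun a =>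
    integral_nonneg fun _ => norm_nonneg _
  have h := norm_integral_div_symbol_le hδ hd hb hz hτ hQ hX
  have habs : |γ / 2| ≤ γ / 2 := (abs_of_pos hδ).le
  rw [hint _ habs, hint _ (by rwa [abs_neg]), ← ENNReal.ofReal_add (hpos _) (hpos _),
    ← ENNReal.ofReal_mul (by positivity), ← ofReal_norm]
  refine ENNReal.ofReal_le_ofReal ?_
  rwa [inv_mul_eq_div, le_div_iff₀' (by positivity)]

theorem exists_enorm_pairing_le {γ : ℝ} (hγ : 0 < γ) (hν : ‖ν‖ = 1) (hB : ∀ y, inner ℝ ν (B y) = 0)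
    (hd : 2 ≤ d) : ∃ M : NNReal, ∀ {k : RSp d → ℝ≥0∞} {K : ℝ≥0∞}, Measurable k → IsKernelBound k K →
    ∀ {z : ℂ} (x : PerpR ν), z.im ≠ 0 → ∀ {Q : RSp d → ℂ},
    (∀ y, Q y ^ 2 = z ^ 2 - ((‖y‖ ^ 2 - ‖x.1‖ ^ 2 : ℝ) : ℂ)) →
    ∀ {X : RSp d → ℝ}, (∀ y, X y = ‖Q y‖ ∨ X y = |z.im|) → (∀ᵐ y, 0 < X y) →
    (∀ᵐ y, ENNReal.ofReal ((γ / 2 * X y)⁻¹) ≤ k y) →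
    ∀ {f φ : RSp (d + 1) → ℂ}, ContDiff ℝ ∞ f → HasCompactSupport f →
    ContDiff ℝ ∞ φ → HasCompactSupport φ →
    ‖∫ ξ, (faddeevSymbol (rhoVec z x) ((2 * Real.pi) • ξ))⁻¹ * 𝓕 f ξ * 𝓕⁻ φ ξ‖ₑ ≤
      K * (M * (eLpNorm f 2 (expMeasure (normWeight (d + 1) (-γ))) *
        eLpNorm φ 2 (expMeasure (normWeight (d + 1) (-γ))))) := by
  obtain ⟨M, hM⟩ := exists_lintegral_kernel_mul_tiltProduct_le hγ hν hB
  obtain ⟨c, hc⟩ := exists_integral_lineFreq hν hB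
  refine ⟨c * (2 * M), fun {k K} hkm hk z x hz Q hQ X hX hX0 hXk f φ hf hfc hφ hφc => ?_⟩
  have hδ : 0 < γ / 2 := by positivity
  have habs : |γ / 2| ≤ γ / 2 := (abs_of_pos hδ).le
  have b1 := hM hkm hk x.1 hf hfc hφ hφc habs
  have b2 := hM hkm hk x.1 hf hfc hφ hφc (a := -(γ / 2)) (by rwa [abs_neg])
  obtain ⟨N, hN⟩ : ∃ N, N = eLpNorm f 2 (expMeasure (normWeight (d + 1) (-γ))) *
        eLpNorm φ 2 (expMeasure (normWeight (d + 1) (-γ))) := ⟨_, rfl⟩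
  rw [← hN] at b1 b2 ⊢
  have e : ∀ v : ℝ × RSp d, (faddeevSymbol (rhoVec z x) ((2 * Real.pi) • lineFreq ν B x.1 v))⁻¹ *
      𝓕 f (lineFreq ν B x.1 v) * 𝓕⁻ φ (lineFreq ν B x.1 v) = testLine ν B f φ x.1 v.2 v.1 *
        ((v.1 : ℂ) ^ 2 + 2 * z * v.1 + ((‖v.2‖ ^ 2 - ‖x.1‖ ^ 2 : ℝ) : ℂ))⁻¹ := fun v => by
    have h1 := contourVec_eq_freqVec (ν := ν) (B := B) x.1 v.1 0 v.2
    simp only [Complex.ofReal_zero, zero_mul, add_zero, zero_smul] at h1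
    have h2 := testLine_eq (ν := ν) (B := B) f φ x.1 v.1 0 v.2
    have h3 : ∀ g : RSp (d + 1) → ℂ, expTilt ν 0 g = g := fun g => by funext w; simp [expTilt]
    rw [neg_zero, h3, h3] at h2
    simp only [Complex.ofReal_zero, zero_mul, add_zero] at h2
    have h4 := fullSymbol_contourVec hν hB (z, perpToC x) v.1 1 v.2
    change fullSymbol (rhoVec z x) (contourVec ν B (toC x.1) v.1 1 v.2) = _ at h4
    rw [h1, cdot_perpToC] at h4
    rw [faddeevSymbol_eq, h4, h2, mul_assoc, mul_comm]
    congr 2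
    push_cast
    ring
  rw [hc x.1]
  simp only [e]
  obtain ⟨h, hh⟩ : ∃ h : ℝ × RSp d → ℂ, h = fun v => testLine ν B f φ x.1 v.2 v.1 *
        ((v.1 : ℂ) ^ 2 + 2 * z * v.1 + ((‖v.2‖ ^ 2 - ‖x.1‖ ^ 2 : ℝ) : ℂ))⁻¹ := ⟨_, rfl⟩
  rw [← hh]
  have hmeas : ∀ a : ℝ, |a| ≤ γ / 2 → Measurable fun v : ℝ × RSp d =>
      ‖tiltProduct ν a f φ (lineFreq ν B x.1 v)‖ₑ := fun a ha =>
    ((tiltProduct_bounds hγ hν hf hfc hφ hφc ha).1.continuous.comp (continuous_lineFreq x.1)).enorm.measurable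
  have m1 := hmeas _ habs
  have m2 := hmeas (-(γ / 2)) (by rwa [abs_neg])
  have key : ‖∫ v, h v‖ₑ ≤ 2 * (K * (M * N)) := by
    -- A nonintegrable `h` has Bochner integral 0, so Fubini is needed only in the integrable case.
    by_cases hi : Integrable h
    swap
    · rw [integral_undef hi, enorm_zero]; exact zero_le
    rw [Measure.volume_eq_prod] at hi ⊢
    rw [integral_prod_symm h hi]
    refine (enorm_integral_le_lintegral_enorm _).trans ?_
    calc ∫⁻ y, ‖∫ t, h (t, y)‖ₑ
        ≤ ∫⁻ y, ((∫⁻ t : ℝ, k y * ‖tiltProduct ν (γ / 2) f φ (lineFreq ν B x.1 (t, y))‖ₑ) +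
        ∫⁻ t : ℝ, k y * ‖tiltProduct ν (-(γ / 2)) f φ (lineFreq ν B x.1 (t, y))‖ₑ) := by
          refine lintegral_mono_ae ?_
          filter_upwards [ae_norm_ne d hd ‖x.1‖, hX0, hXk] with y h1 h2 h3
          have hτ : ‖y‖ ^ 2 - ‖x.1‖ ^ 2 ≠ 0 := fun h0 => h1
            ((sq_eq_sq₀ (norm_nonneg _) (norm_nonneg _)).1 (sub_eq_zero.1 h0))
          have h4 := enorm_line_integral_le hγ hν hB hf hfc hφ hφc x y hz hτ (hQ y) (hX y) h2
          have m1' : Measurable fun t : ℝ => ‖tiltProduct ν (γ / 2) f φ (lineFreq ν B x.1 (t, y))‖ₑ :=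
            m1.comp measurable_prodMk_right
          have m2' : Measurable fun t : ℝ => ‖tiltProduct ν (-(γ / 2)) f φ (lineFreq ν B x.1 (t, y))‖ₑ :=
            m2.comp measurable_prodMk_right
          rw [lintegral_const_mul _ m1', lintegral_const_mul _ m2', ← mul_add, hh]
          exact h4.trans (mul_le_mul_left h3 _)
      _ = (∫⁻ v : ℝ × RSp d, k v.2 * ‖tiltProduct ν (γ / 2) f φ (lineFreq ν B x.1 v)‖ₑ) +
          ∫⁻ v : ℝ × RSp d, k v.2 * ‖tiltProduct ν (-(γ / 2)) f φ (lineFreq ν B x.1 v)‖ₑ := by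
          have n1 : Measurable fun v : ℝ × RSp d => k v.2 * ‖tiltProduct ν (γ / 2) f φ (lineFreq ν B x.1 v)‖ₑ :=
            (hkm.comp measurable_snd).mul m1
          have n2 : Measurable fun v : ℝ × RSp d => k v.2 * ‖tiltProduct ν (-(γ / 2)) f φ (lineFreq ν B x.1 v)‖ₑ :=
            (hkm.comp measurable_snd).mul m2
          have n3 : Measurable fun y => ∫⁻ t : ℝ, k y * ‖tiltProduct ν (γ / 2) f φ (lineFreq ν B x.1 (t, y))‖ₑ :=
            n1.lintegral_prod_left'
          rw [lintegral_add_left n3, Measure.volume_eq_prod,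
            lintegral_prod_symm' _ n1, lintegral_prod_symm' _ n2]
      _ ≤ _ := (add_le_add b1 b2).trans (le_of_eq (two_mul _).symm)
  rw [NNReal.smul_def, enorm_smul]
  have hcc : ‖(c : ℝ)‖ₑ = (c : ℝ≥0∞) := by rw [Real.enorm_eq_ofReal (NNReal.coe_nonneg c), ENNReal.ofReal_coe_nnreal]
  rw [hcc]
  refine (mul_le_mul_right key _).trans (le_of_eq ?_)
  push_cast
  ring

theorem norm_sq_rhoVec (hν : ‖ν‖ = 1) (z : ℂ) (x : PerpR ν) : ‖rhoVec z x‖ ^ 2 = ‖z‖ ^ 2 + ‖x.1‖ ^ 2 := by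
  have h1 : ∑ i, ν i * x.1 i = 0 := by
    have := Submodule.mem_orthogonal_singleton_iff_inner_right.1 x.2
    rw [PiLp.inner_apply] at this
    simpa [mul_comm] using this
  have h2 : ∑ i, ν i ^ 2 = 1 := by
    have := EuclideanSpace.real_norm_sq_eq ν
    rw [hν] at this
    linarith
  rw [EuclideanSpace.norm_sq_eq, EuclideanSpace.real_norm_sq_eq x.1]
  have h3 : ∀ i, ‖rhoVec z x i‖ ^ 2 = ‖z‖ ^ 2 * ν i ^ 2 + 2 * z.re * (ν i * x.1 i) + x.1 i ^ 2 := fun i => by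
    have : rhoVec z x i = z * (ν i : ℂ) + (x.1 i : ℂ) := rfl
    rw [this, Complex.sq_norm, Complex.sq_norm, Complex.normSq_apply, Complex.normSq_apply]
    simp
    ring
  simp only [h3, Finset.sum_add_distrib, ← Finset.mul_sum]
  rw [h1, h2]
  ring

theorem isKernelBound_lineKernel (hd : 1 ≤ d) : ∃ M : NNReal, ∀ (R : ℝ), 1 ≤ R → ∀ c : ℝ≥0∞,
    IsKernelBound (fun η : RSp d => c * ENNReal.ofReal (lineKernel (R ^ 2 - ‖η‖ ^ 2)))
      (ENNReal.ofReal (R ^ (-(1 / 2) : ℝ)) * (c * M)) := by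
  obtain ⟨M, hM⟩ := exists_lintegral_sphere_kernel_le d hd
  refine ⟨M, fun R hR c H hH => ?_⟩
  have hm : Measurable fun η : RSp d => ENNReal.ofReal (lineKernel (R ^ 2 - ‖η‖ ^ 2)) * ‖H η‖ₑ :=
    (measurable_lineKernel.comp (by fun_prop)).ennreal_ofReal.mul hH.continuous.enorm.measurable
  simp only [mul_assoc]
  rw [lintegral_const_mul _ hm]
  refine (mul_le_mul_right (hM R hR H hH) _).trans (le_of_eq ?_)
  ring

/-- If `|Im z| ≥ |ρ|/4`, the choice `X = |Im z|` is already of the order of `|ρ|`. Otherwise `‖Q‖² ≥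
|Re Q²| = |R² - ‖y‖²|` with `R² = |ρ|² - 2(Im z)²`; then `R ≥ |ρ|/2`, and the estimate near the
sphere of radius `R` yields `R^(-1/2)`. -/
theorem exists_enorm_pairing_decay {γ : ℝ} (hγ : 0 < γ) (hν : ‖ν‖ = 1) (hB : ∀ y, inner ℝ ν (B y) = 0)
    (hd : 2 ≤ d) : ∃ M : NNReal, ∀ (z : ℂ) (x : PerpR ν), z.im ≠ 0 → 2 ≤ ‖rhoVec z x‖ →
    ∀ {f φ : RSp (d + 1) → ℂ}, ContDiff ℝ ∞ f → HasCompactSupport f →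
    ContDiff ℝ ∞ φ → HasCompactSupport φ →
    ‖∫ ξ, (faddeevSymbol (rhoVec z x) ((2 * Real.pi) • ξ))⁻¹ * 𝓕 f ξ * 𝓕⁻ φ ξ‖ₑ ≤
      ENNReal.ofReal ((‖rhoVec z x‖ / 2) ^ (-(1 / 2) : ℝ)) * (M * (eLpNorm f 2 (expMeasure (normWeight (d + 1) (-γ))) *
        eLpNorm φ 2 (expMeasure (normWeight (d + 1) (-γ))))) := by
  obtain ⟨M, hM⟩ := exists_enorm_pairing_le hγ hν hB hd
  obtain ⟨M', hM'⟩ := isKernelBound_lineKernel (d := d) (by omega)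
  have hδ : 0 < γ / 2 := by positivity
  refine ⟨(Real.toNNReal (2 / (γ / 2)) + Real.toNNReal (γ / 2)⁻¹ * M') * M,
    fun z x hz hρ f φ hf hfc hφ hφc => ?_⟩
  obtain ⟨r, hr⟩ : ∃ r, r = ‖rhoVec z x‖ := ⟨_, rfl⟩
  rw [← hr] at hρ ⊢
  have hsq := norm_sq_rhoVec hν z x
  rw [← hr] at hsq
  obtain ⟨N, hN⟩ : ∃ N, N = eLpNorm f 2 (expMeasure (normWeight (d + 1) (-γ))) *
        eLpNorm φ 2 (expMeasure (normWeight (d + 1) (-γ))) := ⟨_, rfl⟩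
  choose Q hQ using fun y : RSp d => IsAlgClosed.exists_pow_nat_eq (z ^ 2 - ((‖y‖ ^ 2 - ‖x.1‖ ^ 2 : ℝ) : ℂ)) two_pos
  suffices h : ∃ (k : RSp d → ℝ≥0∞) (K : ℝ≥0∞) (X : RSp d → ℝ), Measurable k ∧ IsKernelBound k K ∧
      (∀ y, X y = ‖Q y‖ ∨ X y = |z.im|) ∧ (∀ᵐ y, 0 < X y) ∧ (∀ᵐ y, ENNReal.ofReal ((γ / 2 * X y)⁻¹) ≤ k y) ∧
      K ≤ ENNReal.ofReal ((r / 2) ^ (-(1 / 2) : ℝ)) *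
        (ENNReal.ofReal (2 / (γ / 2)) + ENNReal.ofReal (γ / 2)⁻¹ * M') by
    obtain ⟨k, K, X, h1, h2, h3, h4, h5, h6⟩ := h
    refine (hM h1 h2 x hz hQ h3 h4 h5 hf hfc hφ hφc).trans ((mul_le_mul_left h6 _).trans (le_of_eq ?_))
    push_cast
    simp only [ENNReal.ofReal, mul_assoc]
  by_cases hcase : r / 4 ≤ |z.im|
  · refine ⟨fun _ => ENNReal.ofReal ((γ / 2 * |z.im|)⁻¹), ENNReal.ofReal ((γ / 2 * |z.im|)⁻¹), fun _ => |z.im|,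
      measurable_const, isKernelBound_const (by omega) _, fun _ => Or.inr rfl,
      Filter.Eventually.of_forall fun _ => abs_pos.2 hz, Filter.Eventually.of_forall fun _ => le_rfl, ?_⟩
    rw [mul_add]
    refine le_trans ?_ le_self_add
    rw [← ENNReal.ofReal_mul (by positivity)]
    refine ENNReal.ofReal_le_ofReal ?_
    have h1 : (r / 2) ^ (-1 : ℝ) ≤ (r / 2) ^ (-(1 / 2) : ℝ) :=
      Real.rpow_le_rpow_of_exponent_le (by linarith) (by norm_num)
    rw [Real.rpow_neg_one] at h1
    calc (γ / 2 * |z.im|)⁻¹ ≤ (γ / 2 * (r / 4))⁻¹ := by gcongr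
      _ = (r / 2)⁻¹ * (2 / (γ / 2)) := by field_simp; norm_num
      _ ≤ _ := mul_le_mul_of_nonneg_right h1 (by positivity)
  · push Not at hcase
    have hy2 : z.im ^ 2 ≤ (r / 4) ^ 2 := by
      rw [← sq_abs]
      exact pow_le_pow_left₀ (abs_nonneg _) hcase.le 2
    have hR2 : (r / 2) ^ 2 ≤ r ^ 2 - 2 * z.im ^ 2 := by nlinarith
    obtain ⟨R, hR⟩ : ∃ R, R = √(r ^ 2 - 2 * z.im ^ 2) := ⟨_, rfl⟩
    have hRsq : R ^ 2 = r ^ 2 - 2 * z.im ^ 2 := by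
      rw [hR, Real.sq_sqrt]
      exact (sq_nonneg _).trans hR2
    have hrR : r / 2 ≤ R := by
      rw [hR]
      exact Real.le_sqrt_of_sq_le hR2
    have hlow : ∀ y, |R ^ 2 - ‖y‖ ^ 2| ≤ ‖Q y‖ ^ 2 := fun y => by
      rw [← norm_pow, hQ]
      refine le_trans (le_of_eq ?_) (Complex.abs_re_le_norm _)
      congr 1
      rw [hRsq, hsq, Complex.sq_norm, Complex.normSq_apply, Complex.sub_re, Complex.ofReal_re, sq z, Complex.mul_re]
      ring
    have hpos : ∀ y : RSp d, ‖y‖ ≠ R → 0 < √|R ^ 2 - ‖y‖ ^ 2| := fun y hy => by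
      refine Real.sqrt_pos.2 (abs_pos.2 (sub_ne_zero.2 fun h0 => hy ?_))
      exact ((sq_eq_sq₀ (by linarith : 0 ≤ R) (norm_nonneg y)).1 h0).symm
    have hsqrt : ∀ y, √|R ^ 2 - ‖y‖ ^ 2| ≤ ‖Q y‖ := fun y => Real.sqrt_le_iff.2 ⟨norm_nonneg _, hlow y⟩
    refine ⟨fun η => ENNReal.ofReal (γ / 2)⁻¹ * ENNReal.ofReal (lineKernel (R ^ 2 - ‖η‖ ^ 2)),
      ENNReal.ofReal (R ^ (-(1 / 2) : ℝ)) * (ENNReal.ofReal (γ / 2)⁻¹ * M'), fun y => ‖Q y‖,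
      measurable_const.mul (measurable_lineKernel.comp (by fun_prop)).ennreal_ofReal,
      hM' R (by linarith) _, fun _ => Or.inl rfl, ?_, ?_, ?_⟩
    · filter_upwards [ae_norm_ne d hd R] with y hy
      exact (hpos y hy).trans_le (hsqrt y)
    · filter_upwards [ae_norm_ne d hd R] with y hy
      rw [← ENNReal.ofReal_mul (by positivity), lineKernel_eq, mul_inv]
      refine ENNReal.ofReal_le_ofReal (mul_le_mul_of_nonneg_left (inv_anti₀ (hpos y hy) (hsqrt y)) (by positivity))
    · refine mul_le_mul' (ENNReal.ofReal_le_ofReal ?_) le_add_self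
      exact Real.rpow_le_rpow_of_nonpos (by linarith) hrR (by norm_num)

end

/-! ### Decay of the resolvent in operator norm -/

/-- The dual description of the norm of a weighted space. -/
theorem norm_le_of_expPairing_le {n : ℕ} {W W' : C(RSp n, ℝ)} (h : ∀ w, W' w = -W w) {C : ℝ}
    (hC : 0 ≤ C) (u : ExpL2 W) (hu : ∀ v : ExpL2 W', ‖expPairing W W' u v‖ ≤ C * ‖v‖) : ‖u‖ ≤ C := by
  obtain ⟨U, hU⟩ : ∃ U, U = expToL2 W u := ⟨_, rfl⟩
  have hUc : U =ᵐ[volume] fun w => ((Real.exp (-W w) : ℝ) : ℂ) * u w := by rw [hU]; exact coeFn_expToL2 W u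
  have hnorm : ‖u‖ = ‖U‖ := by rw [hU, LinearIsometry.norm_map]
  have hstar : MemLp (fun w => starRingEnd ℂ (U w)) 2 volume := (Lp.memLp U).star
  -- The extremal test element: it has the same norm as `u`, and its pairing with `u` is `‖u‖²`.
  have hmem : MemLp (fun w => ((Real.exp (W' w) : ℝ) : ℂ) * starRingEnd ℂ (U w)) 2 (expMeasure W') := by
    rw [memLp_expMeasure_iff]
    refine hstar.congr_norm (Continuous.aestronglyMeasurable (by fun_prop) |>.mul
      ((Continuous.aestronglyMeasurable (by fun_prop)).mul hstar.aestronglyMeasurable))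
      (Filter.Eventually.of_forall fun w => ?_)
    rw [← mul_assoc, ← Complex.ofReal_mul, ← Real.exp_add, neg_add_cancel, Real.exp_zero]
    simp
  obtain ⟨v, hv⟩ : ∃ v, v = hmem.toLp _ := ⟨_, rfl⟩
  have hvc : v =ᵐ[volume] fun w => ((Real.exp (W' w) : ℝ) : ℂ) * starRingEnd ℂ (U w) := by
    have := hmem.coeFn_toLp
    rw [Filter.EventuallyEq, ae_expMeasure, ← hv] at this
    exact this
  have hVc : expToL2 W' v =ᵐ[volume] fun w => starRingEnd ℂ (U w) := by
    filter_upwards [coeFn_expToL2 W' v, hvc] with w h1 h2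
    rw [h1, h2, ← mul_assoc, ← Complex.ofReal_mul, ← Real.exp_add, neg_add_cancel, Real.exp_zero]
    simp
  have hvn : ‖v‖ = ‖u‖ := by
    rw [hnorm, ← LinearIsometry.norm_map (expToL2 W') v]
    rw [Lp.norm_def, Lp.norm_def]
    refine congrArg ENNReal.toReal (eLpNorm_congr_norm_ae ?_)
    filter_upwards [hVc] with w hw
    rw [hw, RCLike.norm_conj]
  have hpair : expPairing W W' u v = ((‖u‖ ^ 2 : ℝ) : ℂ) := by
    rw [expPairing_apply h, hnorm]
    have h1 : inner ℂ U U = ((‖U‖ ^ 2 : ℝ) : ℂ) := by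
      rw [inner_self_eq_norm_sq_to_K]
      push_cast
      rfl
    rw [← h1, L2.inner_def]
    refine integral_congr_ae ?_
    filter_upwards [hUc, hvc] with w h2 h3
    rw [h3, RCLike.inner_apply, h w]
    conv_rhs => rw [h2]
    rw [h2]
    ring
  have := hu v
  rw [hpair, hvn, Complex.norm_real, Real.norm_of_nonneg (by positivity), sq] at this
  rcases (norm_nonneg u).eq_or_lt with h0 | h0
  · rw [← h0]
    exact hC
  · exact le_of_mul_le_mul_right this h0


section

variable {d : ℕ} {γ : ℝ} {ν : RSp (d + 1)} {B : RSp d →ₗᵢ[ℝ] RSp (d + 1)}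

theorem norm_bilinear_le_of_dense {E : Type*} [NormedAddCommGroup E] [NormedSpace ℂ E]
    (b : E →L[ℂ] E →L[ℂ] ℂ) {S : Set E} (hS : Dense S) {C : ℝ}
    (h : ∀ f ∈ S, ∀ g ∈ S, ‖b f g‖ ≤ C * ‖f‖ * ‖g‖) (f g : E) : ‖b f g‖ ≤ C * ‖f‖ * ‖g‖ := by
  have hcl : IsClosed {p : E × E | ‖b p.1 p.2‖ ≤ C * ‖p.1‖ * ‖p.2‖} := isClosed_le (by fun_prop) (by fun_prop)
  exact closure_minimal (fun p hp => h p.1 hp.1 p.2 hp.2) hcl ((hS.prod hS) (f, g))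

theorem eLpNorm_eq_ofReal_norm {X : Type*} [MeasurableSpace X] {μ : Measure X} {u : Lp ℂ 2 μ} {v : X → ℂ}
    (h : u =ᵐ[μ] v) : eLpNorm v 2 μ = ENNReal.ofReal ‖u‖ := by
  rw [← eLpNorm_congr_ae h, Lp.norm_def, ENNReal.ofReal_toReal (Lp.eLpNorm_ne_top u)]

/-- On smooth functions of compact support the Faddeev relation expresses the bilinear form of `T`
by the Fourier integral already estimated. Such functions are dense in the dual pair, so the bound
extends to the operator norm. -/
theorem exists_norm_le_of_isFaddeevInverse (hd : 2 ≤ d) (hγ : 0 < γ) (hν : ‖ν‖ = 1)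
    (hB : ∀ y, inner ℝ ν (B y) = 0) : ∃ M : NNReal, ∀ (z : ℂ) (x : PerpR ν), z.im ≠ 0 → 2 ≤ ‖rhoVec z x‖ →
    ∀ T : ExpL2 (normWeight (d + 1) (-γ)) →L[ℂ] ExpL2 (normWeight (d + 1) γ),
    (∀ f : ExpL2 (normWeight (d + 1) (-γ)), IsFaddeevInverse (rhoVec z x) f (T f)) →
    ‖T‖ ≤ M * (‖rhoVec z x‖ / 2) ^ (-(1 / 2) : ℝ) := by
  obtain ⟨M, hM⟩ := exists_enorm_pairing_decay hγ hν hB hd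
  refine ⟨M, fun z x hz hρ T hT => ?_⟩
  have hW : ∀ w, normWeight (d + 1) (-γ) w = -normWeight (d + 1) γ w := fun w => neg_mul _ _
  obtain ⟨C, hC⟩ : ∃ C, C = (M : ℝ) * (‖rhoVec z x‖ / 2) ^ (-(1 / 2) : ℝ) := ⟨_, rfl⟩
  have hC0 : 0 ≤ C := by rw [hC]; positivity
  rw [← hC]
  have : IsFiniteMeasureOnCompacts (expMeasure (normWeight (d + 1) (-γ))) := ⟨fun K hK => by
    have h1 : IntegrableOn (fun w => Real.exp (-2 * normWeight (d + 1) (-γ) w)) K volume :=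
      Continuous.continuousOn (by fun_prop) |>.integrableOn_compact hK
    rw [expMeasure, withDensity_apply _ hK.measurableSet]
    exact (lintegral_ofReal_le_lintegral_enorm _).trans_lt h1.2⟩
  have hS := Lp.dense_hasCompactSupport_contDiff (F := ℂ) (E := RSp (d + 1))
    (μ := expMeasure (normWeight (d + 1) (-γ))) (p := 2) ENNReal.ofNat_ne_top
  have hall := norm_bilinear_le_of_dense ((expPairing (normWeight (d + 1) γ) (normWeight (d + 1) (-γ))).comp T)
    hS (C := C) fun f ⟨f', h1, h2, h3⟩ g ⟨g', h4, h5, h6⟩ => by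
    have h7 := hM z x hz hρ h3 h2 h6 h5
    rw [eLpNorm_eq_ofReal_norm h1, eLpNorm_eq_ofReal_norm h4,
      ← ENNReal.ofReal_coe_nnreal, ← ENNReal.ofReal_mul (norm_nonneg _),
      ← ENNReal.ofReal_mul M.coe_nonneg, ← ENNReal.ofReal_mul (by positivity), ← ofReal_norm,
      ENNReal.ofReal_le_ofReal_iff (by positivity)] at h7
    rw [Filter.EventuallyEq, ae_expMeasure] at h1 h4
    obtain ⟨Φ, hΦ⟩ : ∃ Φ : 𝓢(RSp (d + 1), ℂ), ⇑Φ = g' := ⟨h5.toSchwartzMap h6, rfl⟩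
    have h8 := (((hT f).congr h1 Filter.EventuallyEq.rfl) Φ).2.2
    rw [SchwartzMap.fourierInv_coe, hΦ] at h8
    have h9 : expPairing (normWeight (d + 1) γ) (normWeight (d + 1) (-γ)) (T f) g =
        ∫ ξ, (faddeevSymbol (rhoVec z x) ((2 * Real.pi) • ξ))⁻¹ * 𝓕 f' ξ * 𝓕⁻ g' ξ := by
      rw [expPairing_apply hW]
      refine Eq.trans ?_ h8
      refine integral_congr_ae ?_
      filter_upwards [h4] with w hw
      rw [hw]
    rw [ContinuousLinearMap.comp_apply, h9]
    refine h7.trans (le_of_eq ?_)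
    rw [hC]
    ring
  exact ContinuousLinearMap.opNorm_le_bound _ hC0 fun f =>
    norm_le_of_expPairing_le hW (by positivity) (T f) fun g => hall f g

end

/-! ### The main theorem. -/

theorem proposition2p2 (n : ℕ) (hn : 3 ≤ n) (γ : ℝ) (hγ : 0 < γ) (ν : RSp n) (hν : ‖ν‖ = 1) :
    -- the analytic extension to complex `ρ_⊥`, with values in operators into `e^{γ⟨w⟩} H²`
    (∃ (U : Set (PerpC ν))
      (calG : ℂ → PerpC ν →
        (ExpL2 (bracketWeight n (-γ)) →L[ℂ] ExpSobolev (bracketWeight n γ) 2)),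
      IsOpen U ∧
      (∀ x : PerpR ν, x ≠ 0 → perpToC x ∈ U) ∧
      AnalyticOnNhd ℂ (fun p : ℂ × PerpC ν => calG p.1 p.2) ({z : ℂ | z.im ≠ 0} ×ˢ U) ∧
      (∀ (z : ℂ) (x : PerpR ν), z.im ≠ 0 → x ≠ 0 → ∀ f : ExpL2 (bracketWeight n (-γ)),
        IsFaddeevInverse (rhoVec z x) f (expSobolevFn (calG z (perpToC x) f)))) ∧
    -- the operators `G₀(ρ) : e^{-γ|w|} L² → e^{γ|w|} L²`, `ρ = z ν + ρ_⊥` with `ρ_⊥` real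
    (∃ G : ℂ → PerpR ν → (ExpL2 (normWeight n (-γ)) →L[ℂ] ExpL2 (normWeight n γ)),
      (∀ (z : ℂ) (x : PerpR ν), z.im ≠ 0 → x ≠ 0 → ∀ f : ExpL2 (normWeight n (-γ)),
        IsFaddeevInverse (rhoVec z x) f (G z x f)) ∧
      (∀ x : PerpR ν, x ≠ 0 → AnalyticOnNhd ℂ (fun z => G z x) {z : ℂ | z.im ≠ 0}) ∧
      (∀ z : ℂ, z.im ≠ 0 → AnalyticOnNhd ℝ (fun x => G z x) {x : PerpR ν | x ≠ 0}) ∧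
      (∀ ε > 0, ∃ R : ℝ, ∀ (z : ℂ) (x : PerpR ν), z.im ≠ 0 → x ≠ 0 → R ≤ ‖rhoVec z x‖ →
        ‖G z x‖ ≤ ε)) := by
  obtain ⟨d, rfl⟩ : ∃ d, n = d + 1 := ⟨n - 1, by omega⟩
  have hd : 2 ≤ d := by omega
  obtain ⟨B, hB, -⟩ := exists_perp_isometry hν
  obtain ⟨κ, hκ⟩ := sobolevResolvent_isFaddeevInverse hd hγ hν hB
  obtain ⟨M, hM⟩ := exists_norm_le_of_isFaddeevInverse hd hγ hν hB
  have hG : ∀ (z : ℂ) (x : PerpR ν), z.im ≠ 0 → x ≠ 0 → ∀ f : ExpL2 (normWeight (d + 1) (-γ)),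
      IsFaddeevInverse (rhoVec z x) f (normResolvent hγ κ B z x f) := fun z x hz hx f =>
    normResolvent_isFaddeevInverse (fun g => (hκ z x hz hx g).1) f
  refine ⟨⟨perpDomain γ ν, fun z ρ => sobolevResolvent hγ κ B (z, ρ), isOpen_perpDomain γ ν, fun x hx =>
    perpToC_mem_perpDomain hγ hx, analyticOnNhd_sobolevResolvent hd hγ hν hB κ, fun z x hz hx f => ?_⟩,
    normResolvent hγ κ B, hG, fun x hx => analyticOnNhd_normResolvent_left hd hγ hν hB κ hx,
    fun z hz => analyticOnNhd_normResolvent_right hd hγ hν hB κ hz, fun ε hε => ?_⟩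
  · obtain ⟨h1, h2⟩ := hκ z x hz hx f
    rw [h2]
    exact h1
  · have h1 : Filter.Tendsto (fun r : ℝ => (M : ℝ) * (r / 2) ^ (-(1 / 2) : ℝ)) Filter.atTop (nhds 0) := by
      have h2 := ((tendsto_rpow_neg_atTop (y := 1 / 2) (by norm_num)).comp
        (Filter.tendsto_id.atTop_div_const (two_pos : (0 : ℝ) < 2))).const_mul (M : ℝ)
      rwa [mul_zero] at h2
    obtain ⟨R, hR⟩ := Filter.eventually_atTop.1 (h1.eventually_le_const hε)
    -- The decay estimate is available only for `‖ρ‖ ≥ 2`.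
    refine ⟨max R 2, fun z x hz hx hr => ?_⟩
    exact (hM z x hz ((le_max_right _ _).trans hr) _ (hG z x hz hx)).trans (hR _ ((le_max_left _ _).trans hr))

end
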